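/- Let $\theta(t)=\operatorname{Im}\log\Gamma\left(\frac14+\frac{it}{2}\right)-\frac t2\log\pi$ for real $t$, where $\log\Gamma$ is the analytic branch on $\operatorname{Re} z>0$ that is real on the positive real axis. Let $Z(t)=e^{i\theta(t)}\zeta\left(\frac12+it\right)$ be Hardy's function, where $\zeta$ is the Riemann zeta-function, and for each integer $n\ge -1$ let $g(n)$ be the $n$-th Gram point, i.e. the unique $t>7$ with $\theta(t)=\pi n$. Then, as $N\to\infty$ through the positive integers, $$\sum_{0\le n\le N} Z(g(2n)) = 2N+O\left(N^{1/4}(\log N)^{3/4}\log\log N\right)$$ and $$\sum_{0\le n\le N} Z(g(2n+1)) = -2N+O\left(N^{1/4}(\log N)^{3/4}\log\log N\right).$$ -/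

import Mathlib

open Filter Asymptotics

/-- The logarithm of the Gamma function on the half-plane `0 < re z`: the analytic branch that is
real on the positive real axis. It is continued from the real point `re z` to `z` along the
vertical segment, using that its derivative is the digamma function. -/
noncomputable def logGamma (z : ℂ) : ℂ :=
  (Real.log (Real.Gamma z.re) : ℂ) +
    Complex.I * ∫ u in (0 : ℝ)..z.im, Complex.digamma ((z.re : ℂ) + (u : ℂ) * Complex.I)

/-- `logGamma` is indeed a logarithm of the Gamma function. -/
theorem exp_logGamma {z : ℂ} (hz : 0 < z.re) : Complex.exp (logGamma z) = Complex.Gamma z := by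
  set σ : ℝ := z.re with hσ
  have hre : ∀ u : ℝ, 0 < ((σ : ℂ) + (u : ℂ) * Complex.I).re := fun u => by simpa using hz
  have hne : ∀ u : ℝ, ∀ m : ℕ, ((σ : ℂ) + (u : ℂ) * Complex.I) ≠ -(m : ℂ) := fun u m h => by
    have h1 := hre u
    rw [h] at h1
    simp only [Complex.neg_re, Complex.natCast_re, Left.neg_pos_iff] at h1
    exact absurd h1 (not_lt.mpr (Nat.cast_nonneg m))
  have hline : ∀ u : ℝ, HasDerivAt (fun v : ℝ => (σ : ℂ) + (v : ℂ) * Complex.I) Complex.I u := by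
    intro u
    simpa using ((Complex.ofRealCLM.hasDerivAt (x := u)).mul_const Complex.I).const_add (σ : ℂ)
  have hG : ∀ u : ℝ, HasDerivAt (fun v : ℝ => Complex.Gamma ((σ : ℂ) + (v : ℂ) * Complex.I))
      (deriv Complex.Gamma ((σ : ℂ) + (u : ℂ) * Complex.I) * Complex.I) u := fun u =>
    (Complex.differentiableAt_Gamma _ (hne u)).hasDerivAt.comp u (hline u)
  have hdiff : DifferentiableOn ℂ Complex.Gamma {w : ℂ | 0 < w.re} := fun w hw =>
    (Complex.differentiableAt_Gamma w fun m h => by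
      change 0 < w.re at hw
      rw [h] at hw
      simp only [Complex.neg_re, Complex.natCast_re, Left.neg_pos_iff] at hw
      exact absurd hw (not_lt.mpr (Nat.cast_nonneg m))).differentiableWithinAt
  have hopen : IsOpen {w : ℂ | 0 < w.re} := isOpen_lt continuous_const Complex.continuous_re
  have hcont : Continuous fun u : ℝ => Complex.digamma ((σ : ℂ) + (u : ℂ) * Complex.I) := by
    refine continuous_iff_continuousAt.mpr fun u => ?_
    have h1 : ContinuousAt (deriv Complex.Gamma) ((σ : ℂ) + (u : ℂ) * Complex.I) :=
      ((hdiff.deriv hopen).differentiableAt (hopen.mem_nhds (hre u))).continuousAt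
    have h2 := (Complex.differentiableAt_Gamma _ (hne u)).continuousAt
    have h3 : ContinuousAt Complex.digamma ((σ : ℂ) + (u : ℂ) * Complex.I) :=
      h1.div h2 (Complex.Gamma_ne_zero (hne u))
    exact ContinuousAt.comp (f := fun v : ℝ => (σ : ℂ) + (v : ℂ) * Complex.I) h3
      (hline u).continuousAt
  set L : ℝ → ℂ := fun t => (Real.log (Real.Gamma σ) : ℂ) +
    Complex.I * ∫ u in (0 : ℝ)..t, Complex.digamma ((σ : ℂ) + (u : ℂ) * Complex.I) with hL
  have hLd : ∀ t : ℝ, HasDerivAt L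
      (Complex.I * Complex.digamma ((σ : ℂ) + (t : ℂ) * Complex.I)) t := fun t =>
    ((hcont.integral_hasStrictDerivAt 0 t).hasDerivAt.const_mul Complex.I).const_add _
  have hconst : ∀ t : ℝ, Complex.exp (-L t) * Complex.Gamma ((σ : ℂ) + (t : ℂ) * Complex.I) =
      Complex.exp (-L 0) * Complex.Gamma ((σ : ℂ) + ((0 : ℝ) : ℂ) * Complex.I) := by
    intro t
    refine is_const_of_deriv_eq_zero
      (f := fun t : ℝ => Complex.exp (-L t) * Complex.Gamma ((σ : ℂ) + (t : ℂ) * Complex.I))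
      (fun u => ((hLd u).neg.cexp.mul (hG u)).differentiableAt) (fun u => ?_) t 0
    refine ((hLd u).neg.cexp.mul (hG u)).deriv.trans ?_
    have h0 := Complex.Gamma_ne_zero (hne u)
    rw [Complex.digamma_def, logDeriv_apply]
    generalize Complex.Gamma ((σ : ℂ) + (u : ℂ) * Complex.I) = G at h0 ⊢
    generalize deriv Complex.Gamma ((σ : ℂ) + (u : ℂ) * Complex.I) = G'
    simp only [Pi.neg_apply]
    field_simp
    ring
  have hz' : (σ : ℂ) + (z.im : ℂ) * Complex.I = z := Complex.re_add_im z
  have h := hconst z.im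
  have h0 : Complex.exp (-L 0) * Complex.Gamma ((σ : ℂ) + ((0 : ℝ) : ℂ) * Complex.I) = 1 := by
    have hpos := Real.Gamma_pos_of_pos hz
    have hL0 : L 0 = ((Real.log (Real.Gamma σ) : ℝ) : ℂ) := by simp [hL]
    rw [hL0, Complex.exp_neg, ← Complex.ofReal_exp, Real.exp_log hpos]
    simp only [Complex.ofReal_zero, zero_mul, add_zero, Complex.Gamma_ofReal]
    exact inv_mul_cancel₀ (by exact_mod_cast hpos.ne')
  rw [hz', h0, Complex.exp_neg] at h
  have : logGamma z = L z.im := rfl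
  rw [this]
  exact ((inv_mul_eq_one₀ (Complex.exp_ne_zero _)).mp h)

/-- The Riemann–Siegel theta function `θ(t) = Im log Γ(1/4 + it/2) - (t/2) log π`. -/
noncomputable def rsTheta (t : ℝ) : ℝ :=
  (logGamma (1 / 4 + (t : ℂ) / 2 * Complex.I)).im - t / 2 * Real.log Real.pi

/-- Hardy's function `Z(t) = e^{iθ(t)} ζ(1/2 + it)`, as a complex number (its values are real). -/
noncomputable def hardyZ (t : ℝ) : ℂ :=
  Complex.exp ((rsTheta t : ℂ) * Complex.I) * riemannZeta (1 / 2 + (t : ℂ) * Complex.I)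

/-- The `n`-th Gram point, for `n ≥ -1`: the number `t > 7` with `θ(t) = π n`. -/
noncomputable def gramPoint (n : ℤ) : ℝ :=
  Classical.epsilon fun t : ℝ => 7 < t ∧ rsTheta t = Real.pi * n

/-! Let `w = exp ∘ rsW` be the analytic continuation of `e^{iθ}` off the critical line, so that `w'
= w · rsDeriv`. The Gram points of one parity are the solutions of `w = ε` on that line, with `ε =
1` for even and `ε = -1` for odd indices. Hence `gramKernel ε`, which is `ζ · rsDeriv · w / (w -
ε)`, has a simple pole at each such point `1/2 + iρ`, with residue `ζ(1/2 + iρ) = ε Z(ρ)`. Integrate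
it round the rectangle `1/2 ≤ Re s ≤ 2` between the two neighbouring Gram points of the other
parity. The pole lies on the left side and counts with half its residue. On the rest of that side
the real part of the kernel has no singularity at all: `Re 1/(w - ε) = -ε/2` whenever `|w| = 1`, so
it equals `-(ε/2) Z θ'` (`gramKernel_cell`). The cells telescope through `gramPrimitive`, and `π ∑ ε
Z` becomes the right side, plus `(ε/2) ∫ Z θ'`, plus two horizontal sides.

On `Re s = 2` the factor `|w|` is at least of order `t^{3/4}`, so the kernel is close to `ζ θ'` and
its integral is `θ(T) + O(T^{1/4} log T)`. This is the main term, since `θ(T) = π (2N + O(1))` at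
the last edge. On a horizontal side `w` is `-ε` times a number close to the positive real axis, so
`w / (w - ε)` is bounded by `1` and the convexity bound for `ζ` gives `O(T^{1/4} log T)`.

The analytic core is `∫ Z θ' = O(T^{1/4} log T)` (`exists_norm_integral_hardyZ_mul_rsDeriv_le`).
Replace `θ` by its leading Stirling term `rsPhase` and put `T = 2π x²`. Subtract from `ζ` the
Dirichlet polynomial of length `2x`. The difference is moved to `Re s = 2`, where every remaining
term has `n ≥ 2x` and a phase without stationary point; the horizontal sides are controlled by a
weak approximate functional equation. The polynomial is integrated term by term on the critical
line. After `t = 2π n² τ` each term is an oscillatory integral with phase `π n² (τ log τ - τ + 1)`,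
critical at `τ = 1`, with a sign `(-1)^n`. A critical point inside the range yields `C₀ / n`, and
these contributions form an alternating sum. The endpoint `τ = (x/n)²` yields boundary terms with
phase `x² log n` and a weight of size `√x log x / |x - n|`. For `n` near `x` that phase is linear
modulo `1` and the weight is odd, which leaves a bounded sum `∑ sin(2πβj)/j`. Farther away van der
Corput's test applies. Everything is `O(√x log x)`.

Finally `T log T = O(N)` turns `T^{1/4} log T` into `N^{1/4} (log N)^{3/4}`, so the factor `log log
N` is only slack. -/

/-! ### Exponential sums: Kuzmin–Landau and van der Corput. -/

/-- The additive character `u ↦ e^{2πiu}`. -/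
noncomputable def unitExp (u : ℝ) : ℂ := Complex.exp ((2 * Real.pi * u : ℝ) * Complex.I)

theorem norm_unitExp (u : ℝ) : ‖unitExp u‖ = 1 := Complex.norm_exp_ofReal_mul_I _

theorem unitExp_add (u v : ℝ) : unitExp (u + v) = unitExp u * unitExp v := by
  unfold unitExp
  rw [← Complex.exp_add]
  congr 1
  push_cast
  ring

theorem unitExp_intCast (k : ℤ) : unitExp k = 1 := by
  unfold unitExp
  rw [Complex.exp_eq_one_iff]
  exact ⟨k, by push_cast; ring⟩

theorem unitExp_neg (u : ℝ) : unitExp (-u) = (starRingEnd ℂ) (unitExp u) := by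
  unfold unitExp
  rw [← Complex.exp_conj]
  congr 1
  rw [map_mul, Complex.conj_ofReal, Complex.conj_I]
  push_cast
  ring

theorem sum_mul_by_parts (z w : ℕ → ℂ) {a b : ℕ} (hab : a ≤ b) :
    ∑ n ∈ Finset.Ico a (b + 1), w n * z n =
      w b * ∑ n ∈ Finset.Ico a (b + 1), z n -
        ∑ n ∈ Finset.Ico a b, (w (n + 1) - w n) * ∑ j ∈ Finset.Ico a (n + 1), z j := by
  induction b, hab using Nat.le_induction with
  | base => simp
  | succ b hab ih =>
    rw [Finset.sum_Ico_succ_top (by omega), ih, Finset.sum_Ico_succ_top (f := z) (b := b + 1) (by omega),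
      Finset.sum_Ico_succ_top (f := fun n => (w (n + 1) - w n) * _) hab]
    ring

/-- Partial summation with explicit bounds for the partial sums. -/
theorem norm_sum_mul_le_by_parts (z w : ℕ → ℂ) (P : ℕ → ℝ) {a b : ℕ} (hab : a ≤ b)
    (hP : ∀ m, a ≤ m → m ≤ b → ‖∑ n ∈ Finset.Ico a (m + 1), z n‖ ≤ P m) :
    ‖∑ n ∈ Finset.Ico a (b + 1), w n * z n‖ ≤
      ‖w b‖ * P b + ∑ n ∈ Finset.Ico a b, ‖w (n + 1) - w n‖ * P n := by
  rw [sum_mul_by_parts z w hab]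
  refine (norm_sub_le _ _).trans (add_le_add ?_ ?_)
  · rw [norm_mul]
    exact mul_le_mul_of_nonneg_left (hP b hab le_rfl) (norm_nonneg _)
  · refine (norm_sum_le _ _).trans (Finset.sum_le_sum fun n hn => ?_)
    rw [Finset.mem_Ico] at hn
    rw [norm_mul]
    exact mul_le_mul_of_nonneg_left (hP n hn.1 hn.2.le) (norm_nonneg _)

/-- Because `1 - e(u) = -2i sin(πu) e^{iπu}`, the reciprocal has constant real part and a cotangent
as imaginary part. Its total variation is therefore that of a monotone function as long as `u` moves
monotonically between two integers. -/
theorem inv_one_sub_unitExp {u : ℝ} (h : Real.sin (Real.pi * u) ≠ 0) :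
    1 / (1 - unitExp u) =
      1 / 2 + ((Real.cos (Real.pi * u) / Real.sin (Real.pi * u) / 2 : ℝ) : ℂ) * Complex.I := by
  have h2 : unitExp u = (Complex.cos (Real.pi * u) + Complex.sin (Real.pi * u) * Complex.I) ^ 2 := by
    rw [← Complex.exp_mul_I, ← Complex.exp_nat_mul]
    unfold unitExp
    congr 1
    push_cast
    ring
  have hs : Complex.sin (Real.pi * u) ≠ 0 := by
    have : Complex.sin (Real.pi * u) = ((Real.sin (Real.pi * u) : ℝ) : ℂ) := by push_cast; rfl
    rw [this]
    exact_mod_cast h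
  have hpy := Complex.sin_sq_add_cos_sq (Real.pi * u : ℂ)
  push_cast
  set S := Complex.sin (Real.pi * u)
  set D := Complex.cos (Real.pi * u)
  have h3 : 1 - unitExp u = -2 * Complex.I * S * (D + S * Complex.I) := by
    rw [h2]
    linear_combination (-1) * hpy + (S ^ 2) * Complex.I_sq
  have h4 : (D + S * Complex.I) * (D - S * Complex.I) = 1 := by
    linear_combination hpy - S ^ 2 * Complex.I_sq
  have h5 : D + S * Complex.I ≠ 0 := left_ne_zero_of_mul (a := _) (b := D - S * Complex.I) (by rw [h4]; exact one_ne_zero)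
  have hI := Complex.I_ne_zero
  have h6 : (1 : ℂ) / 2 + D / S / 2 * Complex.I = (S + D * Complex.I) / (2 * S) := by
    field_simp
  rw [h3, h6, div_eq_div_iff (by simp [hs, h5, hI]) (by simp [hs])]
  linear_combination (2 * S + 2 * Complex.I * S ^ 2 * (D + S * Complex.I)) * Complex.I_sq +
    2 * S * Complex.I ^ 2 * h4

theorem two_mul_le_sin_pi_mul {u δ : ℝ} (hδ : 0 < δ) (h1 : δ ≤ u) (h2 : u ≤ 1 - δ) :
    2 * δ ≤ Real.sin (Real.pi * u) := by
  have hpi := Real.pi_pos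
  rcases le_total u (1 / 2) with h | h
  · have := Real.mul_le_sin (x := Real.pi * u) (by nlinarith) (by nlinarith)
    have h3 : 2 / Real.pi * (Real.pi * u) = 2 * u := by field_simp
    linarith
  · have := Real.mul_le_sin (x := Real.pi * (1 - u)) (by nlinarith) (by nlinarith)
    have h3 : 2 / Real.pi * (Real.pi * (1 - u)) = 2 * (1 - u) := by field_simp
    have h4 : Real.sin (Real.pi * (1 - u)) = Real.sin (Real.pi * u) := by
      rw [mul_sub, mul_one, Real.sin_pi_sub]
    linarith

theorem cos_div_sin_sub_cos_div_sin {α β : ℝ} (hα : Real.sin α ≠ 0) (hβ : Real.sin β ≠ 0) :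
    Real.cos α / Real.sin α - Real.cos β / Real.sin β =
      Real.sin (β - α) / (Real.sin α * Real.sin β) := by
  rw [Real.sin_sub]
  field_simp

/-- The Kuzmin–Landau inequality. -/
theorem norm_sum_unitExp_le_of_monotone_diff (f : ℕ → ℝ) {a b : ℕ} {k : ℤ} {δ : ℝ} (hδ : 0 < δ)
    (h1 : ∀ n, a ≤ n → n < b → k + δ ≤ f (n + 1) - f n)
    (h2 : ∀ n, a ≤ n → n < b → f (n + 1) - f n ≤ k + 1 - δ)
    (hm : ∀ n, a ≤ n → n + 1 < b → f (n + 1) - f n ≤ f (n + 2) - f (n + 1)) :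
    ‖∑ n ∈ Finset.Ico a b, unitExp (f n)‖ ≤ 2 / δ := by
  rcases Nat.lt_or_ge a b with hab | hab
  swap
  · rw [Finset.Ico_eq_empty (by omega)]
    simp only [Finset.sum_empty, norm_zero]
    positivity
  obtain ⟨b, rfl⟩ : ∃ c, b = c + 1 := ⟨b - 1, by omega⟩
  have hab' : a ≤ b := by omega
  have hpi := Real.pi_pos
  -- Subtracting the integer `k` leaves the exponential sum unchanged and places the differences in
  -- `[δ, 1 - δ]`.
  set D : ℕ → ℝ := fun n => f (n + 1) - f n - k with hD
  set s : ℕ → ℝ := fun n => Real.sin (Real.pi * D n) with hs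
  set ct : ℕ → ℝ := fun n => Real.cos (Real.pi * D n) / Real.sin (Real.pi * D n) with hct
  have hs2 : ∀ n, a ≤ n → n ≤ b → 2 * δ ≤ s n := fun n hn hn' =>
    two_mul_le_sin_pi_mul hδ (by have := h1 n hn (by omega); simp only [hD]; linarith)
      (by have := h2 n hn (by omega); simp only [hD]; linarith)
  have hspos : ∀ n, a ≤ n → n ≤ b → 0 < s n := fun n hn hn' => by
    have := hs2 n hn hn'; linarith
  have hctb : ∀ n, a ≤ n → n ≤ b → |ct n| ≤ 1 / (2 * δ) := fun n hn hn' => by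
    simp only [hct]
    rw [abs_div, abs_of_pos (hspos n hn hn')]
    exact div_le_div₀ zero_le_one (Real.abs_cos_le_one _) (by positivity) (hs2 n hn hn')
  have hctm : ∀ n, a ≤ n → n < b → ct (n + 1) ≤ ct n := fun n hn hn' => by
    have h3 := cos_div_sin_sub_cos_div_sin (hspos n hn hn'.le).ne' (hspos (n + 1) (by omega) hn').ne'
    have h4 : 0 ≤ Real.sin (Real.pi * D (n + 1) - Real.pi * D n) := by
      have e1 := h1 n hn (by omega)
      have e2 := h2 (n + 1) (by omega) (by omega)
      have e3 := hm n hn (by omega)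
      apply Real.sin_nonneg_of_nonneg_of_le_pi
      · simp only [hD]; rw [show n + 1 + 1 = n + 2 by ring]; nlinarith
      · simp only [hD]; nlinarith
    have h5 : 0 ≤ ct n - ct (n + 1) := by
      simp only [hct]
      rw [h3]
      exact div_nonneg h4 (mul_pos (hspos n hn hn'.le) (hspos (n + 1) (by omega) hn')).le
    linarith
  set c : ℕ → ℂ := fun n => 1 / 2 + ((ct n / 2 : ℝ) : ℂ) * Complex.I with hc
  -- With `c n = 1 / (1 - e(D n))` every term is `c n` times a difference of consecutive terms.
  -- Partial summation then meets telescoping sums of norm at most `2`, and the cost is the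
  -- variation of a decreasing cotangent.
  have hterm : ∀ n, a ≤ n → n ≤ b →
      unitExp (f n) = c n * (unitExp (f n) - unitExp (f (n + 1))) := fun n hn hn' => by
    have e1 := inv_one_sub_unitExp (u := D n) (hspos n hn hn').ne'
    have e2 : unitExp (f (n + 1)) = unitExp (f n) * unitExp (D n) := by
      rw [← unitExp_add, show f (n + 1) = f n + D n + k by simp only [hD]; ring, unitExp_add _ (k : ℝ),
        unitExp_intCast, mul_one]
    have e4 : c n * (1 - unitExp (D n)) = 1 := by
      simp only [hc, hct]
      rw [← e1]
      refine one_div_mul_cancel fun h0 => ?_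
      rw [h0, div_zero] at e1
      have := congrArg Complex.re e1
      simp only [Complex.add_re, Complex.mul_re, Complex.ofReal_re, Complex.ofReal_im,
        Complex.I_re, Complex.I_im, Complex.zero_re, mul_zero, zero_mul, sub_zero, add_zero] at this
      norm_num at this
    rw [e2]
    linear_combination (-unitExp (f n)) * e4
  have htel : ∀ m, a ≤ m → ∑ n ∈ Finset.Ico a (m + 1), (unitExp (f n) - unitExp (f (n + 1))) =
      unitExp (f a) - unitExp (f (m + 1)) := by
    intro m hm
    have := Finset.sum_Ico_sub (fun n => unitExp (f n)) (show a ≤ m + 1 by omega)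
    rw [← neg_inj, neg_sub, ← this, ← Finset.sum_neg_distrib]
    simp
  rw [Finset.sum_congr rfl fun n hn => hterm n (Finset.mem_Ico.mp hn).1 (by
    have := (Finset.mem_Ico.mp hn).2; omega)]
  refine (norm_sum_mul_le_by_parts _ c (fun _ => 2) hab' fun m hm _ => ?_).trans ?_
  · rw [htel m hm]
    refine (norm_sub_le _ _).trans ?_
    rw [norm_unitExp, norm_unitExp]
    norm_num
  · have e1 : ∀ n ∈ Finset.Ico a b, ‖c (n + 1) - c n‖ * 2 = ct n - ct (n + 1) := fun n hn => by
      rw [Finset.mem_Ico] at hn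
      have : c (n + 1) - c n = ((ct (n + 1) / 2 - ct n / 2 : ℝ) : ℂ) * Complex.I := by
        simp only [hc]; push_cast; ring
      rw [this, norm_mul, Complex.norm_I, Complex.norm_real, Real.norm_eq_abs, abs_of_nonpos
        (by have := hctm n hn.1 hn.2; linarith)]
      ring
    rw [Finset.sum_congr rfl e1]
    have e2 : ∑ n ∈ Finset.Ico a b, (ct n - ct (n + 1)) = ct a - ct b := by
      have := Finset.sum_Ico_sub ct hab'
      rw [← neg_inj, neg_sub, ← this, ← Finset.sum_neg_distrib]
      simp
    rw [e2]
    have e3 : ‖c b‖ ≤ 1 / 2 + |ct b| / 2 := by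
      refine (norm_add_le _ _).trans (add_le_add (by norm_num) ?_)
      rw [norm_mul, Complex.norm_I, Complex.norm_real, Real.norm_eq_abs, abs_div]
      norm_num
    have e4 := hctb a le_rfl hab'
    have e5 := hctb b hab' le_rfl
    have e6 := le_abs_self (ct a)
    have e7 := neg_abs_le (ct b)
    -- The interval `[δ, 1 - δ]` contains a difference, so `δ ≤ 1/2`; this absorbs the additive
    -- constant `1` coming from the real part `1/2`.
    have hδ2 : δ ≤ 1 / 2 := by
      have q1 := h1 a le_rfl (by omega)
      have q2 := h2 a le_rfl (by omega)
      linarith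
    have e8 : 1 ≤ 1 / (2 * δ) := by
      rw [le_div_iff₀ (by positivity)]; linarith
    have e9 : 2 / δ = 4 * (1 / (2 * δ)) := by field_simp; norm_num
    rw [e9]
    linarith

/-- The indices at which a monotone function takes values in an order-connected set form an
interval. -/
theorem exists_filter_Ico_eq_Ico {D : ℕ → ℝ} {a b : ℕ}
    (hD : ∀ m n, a ≤ m → m ≤ n → n < b → D m ≤ D n) (s : Set ℝ) (hs : s.OrdConnected)
    [DecidablePred (· ∈ s)] :
    ∃ a' b', (Finset.Ico a b).filter (fun n => D n ∈ s) = Finset.Ico a' b' := by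
  rcases ((Finset.Ico a b).filter (fun n => D n ∈ s)).eq_empty_or_nonempty with h | h
  · exact ⟨0, 0, by rw [h]; simp⟩
  · set S := (Finset.Ico a b).filter (fun n => D n ∈ s) with hS
    refine ⟨S.min' h, S.max' h + 1, ?_⟩
    have hmin := S.min'_mem h
    have hmax := S.max'_mem h
    ext n
    rw [Finset.mem_Ico]
    constructor
    · intro hn
      exact ⟨S.min'_le n hn, Nat.lt_succ_of_le (S.le_max' n hn)⟩
    · rintro ⟨h1, h2⟩
      have h2' : n ≤ S.max' h := Nat.lt_succ_iff.mp h2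
      have key : ∀ m, m ∈ S ↔ (a ≤ m ∧ m < b) ∧ D m ∈ s := fun m => by
        rw [hS, Finset.mem_filter, Finset.mem_Ico]
      rw [key] at hmin hmax ⊢
      refine ⟨⟨hmin.1.1.trans h1, h2'.trans_lt hmax.1.2⟩, hs.out hmin.2 hmax.2 ⟨?_, ?_⟩⟩
      · exact hD _ _ hmin.1.1 h1 (h2'.trans_lt hmax.1.2)
      · exact hD _ _ (hmin.1.1.trans h1) h2' hmax.1.2

theorem add_mul_le_of_le_diff {D : ℕ → ℝ} {a b : ℕ} {l : ℝ}
    (h : ∀ n, a ≤ n → n + 1 < b → l ≤ D (n + 1) - D n) (m n : ℕ) (hm : a ≤ m) (hmn : m ≤ n)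
    (hn : n < b) : D m + l * ((n : ℝ) - m) ≤ D n := by
  induction n, hmn using Nat.le_induction with
  | base => simp
  | succ n hmn ih =>
    have h1 := ih (by omega)
    have h2 := h n (by omega) hn
    push_cast
    linarith

/-- Van der Corput's second derivative test, for a sequence whose second differences lie in
`[l, L]`. -/
theorem norm_sum_unitExp_le_of_second_diff (f : ℕ → ℝ) {a b : ℕ} {l L : ℝ} (hl : 0 < l)
    (hl1 : l ≤ 1) (hL0 : 0 ≤ L) (hab : a ≤ b)
    (h1 : ∀ n, a ≤ n → n + 1 < b → l ≤ (f (n + 2) - f (n + 1)) - (f (n + 1) - f n))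
    (h2 : ∀ n, a ≤ n → n + 1 < b → (f (n + 2) - f (n + 1)) - (f (n + 1) - f n) ≤ L) :
    ‖∑ n ∈ Finset.Ico a b, unitExp (f n)‖ ≤ (L * (b - a) + 2) * (8 / √l) := by
  classical
  rcases hab.eq_or_lt with rfl | hab
  · simp only [Finset.Ico_self, Finset.sum_empty, norm_zero, sub_self, mul_zero, zero_add]
    positivity
  set D : ℕ → ℝ := fun n => f (n + 1) - f n with hD
  have hsl : 0 < √l := Real.sqrt_pos.mpr hl
  have hsl1 : √l ≤ 1 := Real.sqrt_le_one.mpr hl1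
  have hsq : √l * √l = l := Real.mul_self_sqrt hl.le
  have hDl := add_mul_le_of_le_diff (D := D) (a := a) (b := b) (l := l) (fun n hn hn' => h1 n hn hn')
  have hmono : ∀ m n, a ≤ m → m ≤ n → n < b → D m ≤ D n := fun m n hm hmn hn => by
    have h3 := hDl m n hm hmn hn
    have h4 : (0 : ℝ) ≤ n - m := by rw [sub_nonneg]; exact_mod_cast hmn
    nlinarith
  -- The differences `D` grow by at least `l` at each step, so they stay in an interval of length
  -- `√l / 2` for only `O(1/√l)` indices, and the trivial bound suffices there.
  have hshort : ∀ (s : Set ℝ) [DecidablePred (· ∈ s)], s.OrdConnected → (∀ u ∈ s, ∀ v ∈ s, v - u ≤ √l / 2) →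
      ‖∑ n ∈ (Finset.Ico a b).filter (fun n => D n ∈ s), unitExp (f n)‖ ≤ 2 / √l := by
    intro s _ hs hd
    refine (norm_sum_le _ _).trans ?_
    simp only [norm_unitExp, Finset.sum_const, nsmul_eq_mul, mul_one]
    obtain ⟨a', b', hE⟩ := exists_filter_Ico_eq_Ico hmono s hs
    rw [hE, Nat.card_Ico]
    rcases Nat.lt_or_ge a' b' with h | h
    · have m1 : a' ∈ (Finset.Ico a b).filter (fun n => D n ∈ s) := by rw [hE]; simp [h]
      have m2 : b' - 1 ∈ (Finset.Ico a b).filter (fun n => D n ∈ s) := by rw [hE]; simp; omega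
      rw [Finset.mem_filter, Finset.mem_Ico] at m1 m2
      have h3 := hDl a' (b' - 1) m1.1.1 (by omega) m2.1.2
      have h4 := hd _ m1.2 _ m2.2
      have h5 : (b' : ℝ) - 1 - a' ≤ 1 / (2 * √l) := by
        rw [le_div_iff₀ (by positivity)]
        rw [Nat.cast_sub (by omega)] at h3
        push_cast at h3
        have h6 : √l * (√l * (b' - 1 - a')) ≤ √l * (1 / 2) := by nlinarith
        have := le_of_mul_le_mul_left h6 hsl
        linarith
      rw [Nat.cast_sub h.le]
      have h7 : 1 ≤ 1 / √l := by rw [le_div_iff₀ hsl]; linarith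
      have h8 : 1 / (2 * √l) = 1 / √l / 2 := by field_simp
      have h9 : 2 / √l = 2 * (1 / √l) := by field_simp
      rw [h9]
      rw [h8] at h5
      linarith
    · rw [Nat.sub_eq_zero_of_le h]
      simp only [Nat.cast_zero]
      positivity
  -- Differences in `[k, k+1)` are either within `√l / 2` of an end, which is the short case, or at
  -- distance at least `√l / 2` from the integers, where Kuzmin–Landau with `δ = √l / 2` gives
  -- `4/√l`. The cut `√l / 2` balances the two.
  have hblock : ∀ k : ℤ, ‖∑ n ∈ (Finset.Ico a b).filter (fun n => ⌊D n⌋ = k), unitExp (f n)‖ ≤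
      8 / √l := by
    intro k
    have e1 := hshort (Set.Ico (k : ℝ) (k + √l / 2)) Set.ordConnected_Ico
      (fun u hu v hv => by have := hu.1; have := hv.2; linarith)
    have e2 := hshort (Set.Ioo (k + 1 - √l / 2 : ℝ) (k + 1)) Set.ordConnected_Ioo
      (fun u hu v hv => by have := hu.1; have := hv.2; linarith)
    have e3 : ‖∑ n ∈ (Finset.Ico a b).filter
        (fun n => D n ∈ Set.Icc (k + √l / 2 : ℝ) (k + 1 - √l / 2)), unitExp (f n)‖ ≤ 4 / √l := by
      obtain ⟨a', b', hE⟩ := exists_filter_Ico_eq_Ico hmono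
        (Set.Icc (k + √l / 2 : ℝ) (k + 1 - √l / 2)) Set.ordConnected_Icc
      have hmem : ∀ n, a' ≤ n → n < b' → (a ≤ n ∧ n < b) ∧
          D n ∈ Set.Icc (k + √l / 2 : ℝ) (k + 1 - √l / 2) := fun n hn hn' => by
        have : n ∈ Finset.Ico a' b' := Finset.mem_Ico.mpr ⟨hn, hn'⟩
        rwa [← hE, Finset.mem_filter, Finset.mem_Ico] at this
      rw [hE]
      refine (norm_sum_unitExp_le_of_monotone_diff f (k := k) (δ := √l / 2) (by positivity)
        (fun n hn hn' => (hmem n hn hn').2.1) (fun n hn hn' => (hmem n hn hn').2.2)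
        (fun n hn hn' => hmono n (n + 1) (hmem n hn (by omega)).1.1 (by omega)
          (hmem (n + 1) (by omega) hn').1.2)).trans (le_of_eq ?_)
      field_simp
      norm_num
    have hsplit : ∑ n ∈ (Finset.Ico a b).filter (fun n => ⌊D n⌋ = k), unitExp (f n) =
        ∑ n ∈ (Finset.Ico a b).filter (fun n => D n ∈ Set.Ico (k : ℝ) (k + √l / 2)), unitExp (f n) +
        ∑ n ∈ (Finset.Ico a b).filter
          (fun n => D n ∈ Set.Icc (k + √l / 2 : ℝ) (k + 1 - √l / 2)), unitExp (f n) +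
        ∑ n ∈ (Finset.Ico a b).filter
          (fun n => D n ∈ Set.Ioo (k + 1 - √l / 2 : ℝ) (k + 1)), unitExp (f n) := by
      simp only [Finset.sum_filter, ← Finset.sum_add_distrib]
      refine Finset.sum_congr rfl fun n _ => ?_
      simp only [Int.floor_eq_iff, Set.mem_Ico, Set.mem_Icc, Set.mem_Ioo]
      by_cases c1 : (k : ℝ) ≤ D n
      · by_cases c2 : D n < k + 1
        · rcases lt_or_ge (D n) (k + √l / 2) with c3 | c3
          · rw [if_pos ⟨c1, c2⟩, if_pos ⟨c1, c3⟩, if_neg (by rintro ⟨q, -⟩; linarith),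
              if_neg (by rintro ⟨q, -⟩; linarith)]
            simp
          · rcases le_or_gt (D n) (k + 1 - √l / 2) with c4 | c4
            · rw [if_pos ⟨c1, c2⟩, if_neg (by rintro ⟨-, q⟩; linarith), if_pos ⟨c3, c4⟩,
                if_neg (by rintro ⟨q, -⟩; linarith)]
              simp
            · rw [if_pos ⟨c1, c2⟩, if_neg (by rintro ⟨-, q⟩; linarith),
                if_neg (by rintro ⟨-, q⟩; linarith), if_pos ⟨c4, c2⟩]
              simp
        · rw [if_neg (by rintro ⟨-, q⟩; exact c2 q), if_neg (by rintro ⟨-, q⟩; linarith),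
            if_neg (by rintro ⟨-, q⟩; linarith), if_neg (by rintro ⟨-, q⟩; exact c2 q)]
          simp
      · rw [if_neg (by rintro ⟨q, -⟩; exact c1 q), if_neg (by rintro ⟨q, -⟩; exact c1 q),
          if_neg (by rintro ⟨q, -⟩; linarith), if_neg (by rintro ⟨q, -⟩; linarith)]
        simp
    rw [hsplit]
    refine (norm_add₃_le).trans ?_
    have : 8 / √l = 2 / √l + 4 / √l + 2 / √l := by ring
    linarith
  obtain ⟨b, rfl⟩ : ∃ c, b = c + 1 := ⟨b - 1, by omega⟩
  have hab' : a ≤ b := by omega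
  have hmaps : ∀ n ∈ Finset.Ico a (b + 1), ⌊D n⌋ ∈ Finset.Icc ⌊D a⌋ ⌊D b⌋ := fun n hn => by
    rw [Finset.mem_Ico] at hn
    rw [Finset.mem_Icc]
    exact ⟨Int.floor_mono (hmono a n le_rfl hn.1 hn.2),
      Int.floor_mono (hmono n b hn.1 (by omega) (by omega))⟩
  rw [← Finset.sum_fiberwise_of_maps_to hmaps]
  refine (norm_sum_le _ _).trans ((Finset.sum_le_sum fun k _ => hblock k).trans ?_)
  rw [Finset.sum_const, nsmul_eq_mul]
  refine mul_le_mul_of_nonneg_right ?_ (by positivity)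
  -- The upper bound `L` on second differences limits the number of integer parts of `D` to `L (b -
  -- a) + 2`.
  have hL := add_mul_le_of_le_diff (D := fun n => -D n) (a := a) (b := b + 1) (l := -L)
    (fun n hn hn' => by have := h2 n hn hn'; simp only [hD]; linarith) a b le_rfl hab' (by omega)
  rw [Int.card_Icc]
  have h3 : ⌊D a⌋ ≤ ⌊D b⌋ := Int.floor_mono (hmono a b le_rfl hab' (by omega))
  have h4 : (((⌊D b⌋ + 1 - ⌊D a⌋).toNat : ℕ) : ℝ) = ⌊D b⌋ + 1 - ⌊D a⌋ := by
    have : ((⌊D b⌋ + 1 - ⌊D a⌋).toNat : ℤ) = ⌊D b⌋ + 1 - ⌊D a⌋ := Int.toNat_of_nonneg (by omega)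
    exact_mod_cast congrArg (Int.cast : ℤ → ℝ) this
  rw [h4]
  have h5 := Int.floor_le (D b)
  have h6 := Int.lt_floor_add_one (D a)
  push_cast
  linarith

/-! ### Euler–Maclaurin approximation of the zeta function. -/

/-- The difference between a term of the Dirichlet series of `ζ` and the corresponding integral. -/
noncomputable def zetaTermDiff (n : ℕ) (s : ℂ) : ℂ :=
  ((n : ℂ) + 1) ^ (-s) - (((n : ℂ) + 1) ^ (1 - s) - (n : ℂ) ^ (1 - s)) / (1 - s)

/-- The quantity is `∫ ((n+1)^{-s} - u^{-s}) du` over `[n, n+1]`. The mean value inequality is used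
twice: for `u ↦ u^{-s}`, whose derivative is at most `‖s‖ n^{-Re s - 1}`, and then for the primitive
of the integrand. -/
theorem norm_zetaTermDiff_le {n : ℕ} (hn : 0 < n) {s : ℂ} (hs : 0 < s.re) (h1 : s ≠ 1) :
    ‖zetaTermDiff n s‖ ≤ ‖s‖ * (n : ℝ) ^ (-s.re - 1) := by
  have hn' : (0 : ℝ) < n := by exact_mod_cast hn
  have hs0 : s ≠ 0 := fun h => by simp [h] at hs
  have h1s : 1 - s ≠ 0 := sub_ne_zero.mpr (Ne.symm h1)
  have hpos : ∀ v ∈ Set.Icc (n : ℝ) (n + 1), 0 < v := fun v hv => hn'.trans_le hv.1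
  have hA : ∀ u ∈ Set.Icc (n : ℝ) (n + 1),
      ‖((n : ℂ) + 1) ^ (-s) - (u : ℂ) ^ (-s)‖ ≤ ‖s‖ * (n : ℝ) ^ (-s.re - 1) := by
    intro u hu
    have := (convex_Icc (n : ℝ) (n + 1)).norm_image_sub_le_of_norm_hasDerivWithin_le
      (f := fun v : ℝ => (v : ℂ) ^ (-s)) (f' := fun v => -s * (v : ℂ) ^ (-s - 1))
      (C := ‖s‖ * (n : ℝ) ^ (-s.re - 1))
      (fun v hv => (hasDerivAt_ofReal_cpow_const (hpos v hv).ne' (neg_ne_zero.mpr hs0)).hasDerivWithinAt)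
      (fun v hv => by
        rw [norm_mul, norm_neg, Complex.norm_cpow_eq_rpow_re_of_pos (hpos v hv)]
        refine mul_le_mul_of_nonneg_left ?_ (norm_nonneg _)
        simp only [Complex.sub_re, Complex.neg_re, Complex.one_re]
        exact Real.rpow_le_rpow_of_nonpos hn' hv.1 (by linarith))
      hu (Set.right_mem_Icc.mpr (by linarith))
    refine le_trans (le_of_eq ?_) (this.trans ?_)
    · push_cast; rfl
    · rw [Real.norm_eq_abs, abs_of_nonneg (by linarith [hu.2])]
      exact mul_le_of_le_one_right (by positivity) (by linarith [hu.1])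
  have := (convex_Icc (n : ℝ) (n + 1)).norm_image_sub_le_of_norm_hasDerivWithin_le
      (f := fun v : ℝ => ((n : ℂ) + 1) ^ (-s) * v - (v : ℂ) ^ (1 - s) / (1 - s))
      (f' := fun v => ((n : ℂ) + 1) ^ (-s) - (v : ℂ) ^ (-s))
      (C := ‖s‖ * (n : ℝ) ^ (-s.re - 1))
      (fun v hv => by
        have e1 := (Complex.ofRealCLM.hasDerivAt (x := v)).const_mul (((n : ℂ) + 1) ^ (-s))
        have e2 := (hasDerivAt_ofReal_cpow_const (hpos v hv).ne' h1s).div_const (1 - s)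
        have e3 := e1.sub e2
        simp only [Complex.ofRealCLM_apply, Complex.ofReal_one, mul_one] at e3
        rw [mul_div_cancel_left₀ _ h1s, show 1 - s - 1 = -s by ring] at e3
        exact e3.hasDerivWithinAt)
      hA (Set.left_mem_Icc.mpr (by linarith)) (Set.right_mem_Icc.mpr (by linarith))
  simp only [add_sub_cancel_left, norm_one, mul_one] at this
  refine le_trans (le_of_eq ?_) this
  unfold zetaTermDiff
  congr 1
  push_cast
  field_simp
  ring

theorem sum_rpow_neg_three_half_tail {N : ℕ} (hN : 0 < N) (K : ℕ) :
    ∑ k ∈ Finset.range K, ((N + k : ℕ) : ℝ) ^ (-(3 / 2) : ℝ) ≤ 4 / √N - 4 / √((N + K : ℕ) : ℝ) := by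
  induction K with
  | zero => simp
  | succ K ih =>
    rw [Finset.sum_range_succ]
    have h : ∀ m : ℕ, 0 < m → (m : ℝ) ^ (-(3 / 2) : ℝ) ≤ 4 / √(m : ℝ) - 4 / √((m + 1 : ℕ) : ℝ) := by
      intro m hm
      have hm' : (1 : ℝ) ≤ m := by exact_mod_cast hm
      set p := √(m : ℝ) with hp
      set q := √((m + 1 : ℕ) : ℝ) with hq
      have hp2 : p ^ 2 = m := Real.sq_sqrt (by positivity)
      have hq2 : q ^ 2 = m + 1 := by rw [hq, Real.sq_sqrt (by positivity)]; push_cast; rfl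
      have hp0 : 0 < p := Real.sqrt_pos.mpr (by positivity)
      have hq0 : 0 < q := Real.sqrt_pos.mpr (by positivity)
      have e1 : (m : ℝ) ^ (-(3 / 2) : ℝ) = 1 / p ^ 3 := by
        rw [Real.rpow_neg (by positivity), one_div, hp, Real.sqrt_eq_rpow, ← Real.rpow_natCast,
          ← Real.rpow_mul (by positivity)]
        norm_num
      have e2 : 4 / p - 4 / q = 4 / (p * q * (p + q)) := by
        have : q - p = 1 / (p + q) := by
          rw [eq_div_iff (by positivity)]; nlinarith
        rw [div_sub_div _ _ hp0.ne' hq0.ne', div_eq_div_iff (by positivity) (by positivity)]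
        have h3 : (q - p) * (p + q) = 1 := by nlinarith
        linear_combination (4 * p * q) * h3
      rw [e1, e2, div_le_div_iff₀ (by positivity) (by positivity)]
      have hpq : q ≤ 3 / 2 * p := by
        refine (sq_le_sq₀ hq0.le (by positivity)).mp ?_
        nlinarith
      have : q * (p + q) ≤ 3 / 2 * p * (p + 3 / 2 * p) := by gcongr
      nlinarith [mul_le_mul_of_nonneg_left this hp0.le, pow_pos hp0 3]
    have := h (N + K) (by omega)
    rw [show N + (K + 1) = N + K + 1 by ring]
    linarith

theorem zetaTermDiff_sum {s : ℂ} (N K : ℕ) :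
    ∑ k ∈ Finset.range K, zetaTermDiff (N + k) s =
      ∑ n ∈ Finset.Ico (N + 1) (N + 1 + K), (n : ℂ) ^ (-s) -
        (((N + K : ℕ) : ℂ) ^ (1 - s) - (N : ℂ) ^ (1 - s)) / (1 - s) := by
  induction K with
  | zero => simp
  | succ K ih =>
    rw [Finset.sum_range_succ, ih, show N + 1 + (K + 1) = N + 1 + K + 1 by ring,
      Finset.sum_Ico_succ_top (by omega)]
    unfold zetaTermDiff
    rw [show N + 1 + K = N + K + 1 by ring, show N + (K + 1) = N + K + 1 by ring]
    push_cast
    ring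

theorem differentiableOn_zetaTermDiff {n : ℕ} (hn : 0 < n) :
    DifferentiableOn ℂ (zetaTermDiff n) {s : ℂ | 0 < s.im} := by
  intro s hs
  have h1s : 1 - s ≠ 0 := fun h => by
    have := congrArg Complex.im h
    simp only [Complex.sub_im, Complex.one_im, Complex.zero_im] at this
    change 0 < s.im at hs
    linarith
  have e1 : (n : ℂ) ≠ 0 := by exact_mod_cast hn.ne'
  have e2 : (n : ℂ) + 1 ≠ 0 := by exact_mod_cast n.succ_ne_zero
  unfold zetaTermDiff
  refine DifferentiableAt.differentiableWithinAt ?_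
  refine DifferentiableAt.sub (DifferentiableAt.const_cpow (by fun_prop) (Or.inl e2)) ?_
  refine DifferentiableAt.div (DifferentiableAt.sub (DifferentiableAt.const_cpow (by fun_prop) (Or.inl e2))
    (DifferentiableAt.const_cpow (by fun_prop) (Or.inl e1))) (by fun_prop) h1s

theorem summable_zetaTermDiff_bound {N : ℕ} {r : ℝ} (hr : 1 < r) :
    Summable fun k : ℕ => ((N + k : ℕ) : ℝ) ^ (-r) := by
  have := (Real.summable_nat_rpow (p := -r)).mpr (by linarith)
  have := this.comp_injective (add_right_injective N)
  exact this

/-- The first-order Euler–Maclaurin expansion of `ζ` in the quarter plane `0 < re s`, `0 < im s`. -/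
theorem riemannZeta_eq_sum_add_tsum {s : ℂ} (hs : 0 < s.re) (hs' : 0 < s.im) {N : ℕ} (hN : 0 < N) :
    riemannZeta s = ∑ n ∈ Finset.Ico 1 (N + 1), (n : ℂ) ^ (-s) - (N : ℂ) ^ (1 - s) / (1 - s) +
      ∑' k : ℕ, zetaTermDiff (N + k) s := by
  set U : Set ℂ := {s : ℂ | 0 < s.re} ∩ {s : ℂ | 0 < s.im} with hU
  have hUo : IsOpen U := (isOpen_lt continuous_const Complex.continuous_re).inter
    (isOpen_lt continuous_const Complex.continuous_im)
  have hUc : Convex ℝ U := (convex_halfSpace_re_gt 0).inter (convex_halfSpace_im_gt 0)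
  have hne : ∀ s ∈ U, s ≠ 1 := fun s hs h => by
    have := hs.2
    simp [h] at this
  have hd1 : DifferentiableOn ℂ riemannZeta U := fun s hs =>
    (differentiableAt_riemannZeta (hne s hs)).differentiableWithinAt
  have hd2 : DifferentiableOn ℂ (fun s => ∑' k : ℕ, zetaTermDiff (N + k) s) U := by
    intro s hs
    -- Near `s` the real part stays above `Re s / 2` and the norm below `‖s‖ + 1`, which gives one
    -- summable majorant and hence analyticity of the tail.
    set V : Set ℂ := U ∩ {w : ℂ | s.re / 2 < w.re} ∩ Metric.ball 0 (‖s‖ + 1) with hV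
    have hVo : IsOpen V := (hUo.inter (isOpen_lt continuous_const Complex.continuous_re)).inter
      Metric.isOpen_ball
    have hsV : s ∈ V := ⟨⟨hs, by have := hs.1; simp only [Set.mem_ofPred_eq] at *; linarith⟩, by simp⟩
    have := Complex.differentiableOn_tsum_of_summable_norm (F := fun k : ℕ => zetaTermDiff (N + k))
      (u := fun k : ℕ => (‖s‖ + 1) * ((N + k : ℕ) : ℝ) ^ (-(s.re / 2 + 1))) (U := V)
      ((summable_zetaTermDiff_bound (by have := hs.1; simp only [Set.mem_ofPred_eq] at *; linarith)).mul_left _)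
      (fun k => (differentiableOn_zetaTermDiff (by omega)).mono fun w hw => hw.1.1.2) hVo
      (fun k w hw => by
        refine (norm_zetaTermDiff_le (by omega) hw.1.1.1 (hne w hw.1.1)).trans ?_
        have h1 : ‖w‖ ≤ ‖s‖ + 1 := by have := hw.2; simp at this; exact this.le
        have h2 : s.re / 2 < w.re := hw.1.2
        refine mul_le_mul h1 ?_ (by positivity) (by positivity)
        refine Real.rpow_le_rpow_of_exponent_le ?_ (by linarith)
        exact_mod_cast (show 1 ≤ N + k by omega))
    exact (this.differentiableAt (hVo.mem_nhds hsV)).differentiableWithinAt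
  have hd3 : DifferentiableOn ℂ (fun s => ∑ n ∈ Finset.Ico 1 (N + 1), (n : ℂ) ^ (-s) -
      (N : ℂ) ^ (1 - s) / (1 - s) + ∑' k : ℕ, zetaTermDiff (N + k) s) U := by
    refine DifferentiableOn.add (DifferentiableOn.sub (DifferentiableOn.fun_sum fun n hn => ?_) ?_) hd2
    · have : (n : ℂ) ≠ 0 := by
        have := (Finset.mem_Ico.mp hn).1
        exact_mod_cast (by omega : n ≠ 0)
      exact fun s _ => (DifferentiableAt.const_cpow (by fun_prop) (Or.inl this)).differentiableWithinAt
    · intro s hs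
      refine (DifferentiableAt.div (DifferentiableAt.const_cpow (by fun_prop)
        (Or.inl (by exact_mod_cast hN.ne'))) (by fun_prop) ?_).differentiableWithinAt
      exact sub_ne_zero.mpr (hne s hs).symm
  -- For `Re s > 1` the identity is a telescoping sum, because the boundary term `(N+K)^{1-s}` tends
  -- to `0`. The identity theorem then carries it from a neighbourhood of `2 + i` to the quarter
  -- plane.
  have hloc : ∀ s ∈ U, 1 < s.re → riemannZeta s =
      ∑ n ∈ Finset.Ico 1 (N + 1), (n : ℂ) ^ (-s) - (N : ℂ) ^ (1 - s) / (1 - s) +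
        ∑' k : ℕ, zetaTermDiff (N + k) s := by
    intro s hs h1
    have hsum : Summable fun k : ℕ => zetaTermDiff (N + k) s :=
      Summable.of_norm_bounded (g := fun k : ℕ => ‖s‖ * ((N + k : ℕ) : ℝ) ^ (-(s.re + 1)))
        ((summable_zetaTermDiff_bound (by linarith)).mul_left _) (fun k => by
          refine (norm_zetaTermDiff_le (by omega) hs.1 (hne s hs)).trans (le_of_eq ?_)
          rw [neg_add']
          )
    have t1 := hsum.hasSum.tendsto_sum_nat
    have hz : HasSum (fun n : ℕ => 1 / ((n : ℂ) + 1) ^ s) (riemannZeta s) := by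
      rw [zeta_eq_tsum_one_div_nat_add_one_cpow h1]
      refine Summable.hasSum ?_
      have := (Complex.summable_one_div_nat_cpow (p := s)).mpr h1
      have := (summable_nat_add_iff 1).mpr this
      simpa using this
    have t2 := hz.tendsto_sum_nat
    have t3 : Tendsto (fun K : ℕ => ((N + K : ℕ) : ℂ) ^ (1 - s)) atTop (nhds 0) := by
      rw [tendsto_zero_iff_norm_tendsto_zero]
      have e : Tendsto (fun K : ℕ => ((N + K : ℕ) : ℝ) ^ (-(s.re - 1))) atTop (nhds 0) :=
        (tendsto_rpow_neg_atTop (by linarith)).comp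
          (tendsto_natCast_atTop_atTop.comp (tendsto_add_atTop_nat N |>.congr fun K => by ring))
      refine e.congr fun K => ?_
      rw [← Complex.ofReal_natCast, Complex.norm_cpow_eq_rpow_re_of_pos (by exact_mod_cast (by omega))]
      congr 1
      simp
    have t4 : Tendsto (fun K : ℕ => ∑ k ∈ Finset.range K, zetaTermDiff (N + k) s) atTop
        (nhds (riemannZeta s - ∑ n ∈ Finset.Ico 1 (N + 1), (n : ℂ) ^ (-s) -
          (0 - (N : ℂ) ^ (1 - s)) / (1 - s))) := by
      have t5 := ((t2.comp (tendsto_add_atTop_nat N)).sub_const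
        (∑ n ∈ Finset.Ico 1 (N + 1), (n : ℂ) ^ (-s))).sub ((t3.sub_const ((N : ℂ) ^ (1 - s))).div_const (1 - s))
      refine t5.congr fun K => ?_
      rw [zetaTermDiff_sum]
      congr 1
      simp only [Function.comp]
      rw [sub_eq_iff_eq_add, show N + 1 + K = (K + N) + 1 by ring, add_comm (∑ n ∈ Finset.Ico (N + 1) (K + N + 1), _),
        Finset.sum_Ico_consecutive _ (by omega) (by omega), Finset.sum_Ico_eq_sum_range]
      refine Finset.sum_congr (by simp) fun n _ => ?_
      rw [Complex.cpow_neg, one_div]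
      push_cast
      rw [add_comm]
    have := tendsto_nhds_unique t1 t4
    rw [this]
    ring
  have hmem : (2 + Complex.I : ℂ) ∈ U := by constructor <;> simp
  have key := (hd1.analyticOnNhd hUo).eqOn_of_preconnected_of_eventuallyEq (hd3.analyticOnNhd hUo)
    hUc.isPreconnected hmem (by
      have : U ∩ {s : ℂ | 1 < s.re} ∈ nhds (2 + Complex.I : ℂ) :=
        (hUo.inter (isOpen_lt continuous_const Complex.continuous_re)).mem_nhds ⟨hmem, by simp⟩
      filter_upwards [this] with w hw using hloc w hw.1 hw.2)
  exact key ⟨hs, hs'⟩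

/-- For `Re s ≥ 1/2` the factor `N^{1/2 - Re s}` can be taken out of every tail term, so that only
the exponent `-3/2` has to be summed and the constant is uniform in `s`. -/
theorem norm_riemannZeta_sub_sum_le {s : ℂ} (hs : 1 / 2 ≤ s.re) (hs' : 0 < s.im) {N : ℕ} (hN : 0 < N) :
    ‖riemannZeta s - ∑ n ∈ Finset.Ico 1 (N + 1), (n : ℂ) ^ (-s)‖ ≤
      (N : ℝ) ^ (1 - s.re) / s.im + 4 * ‖s‖ * (N : ℝ) ^ (-s.re) := by
  have hN' : (1 : ℝ) ≤ N := by exact_mod_cast hN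
  have hne : s ≠ 1 := fun h => by simp [h] at hs'
  have hterm : ∀ k : ℕ, ‖zetaTermDiff (N + k) s‖ ≤
      ‖s‖ * (N : ℝ) ^ (1 / 2 - s.re) * ((N + k : ℕ) : ℝ) ^ (-(3 / 2) : ℝ) := fun k => by
    refine (norm_zetaTermDiff_le (by omega) (by linarith) hne).trans ?_
    rw [mul_assoc]
    refine mul_le_mul_of_nonneg_left ?_ (norm_nonneg _)
    have hNk : (N : ℝ) ≤ ((N + k : ℕ) : ℝ) := by push_cast; linarith [(Nat.cast_nonneg k : (0 : ℝ) ≤ k)]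
    rw [show -s.re - 1 = (1 / 2 - s.re) + (-(3 / 2) : ℝ) by ring, Real.rpow_add (by linarith)]
    refine mul_le_mul_of_nonneg_right ?_ (by positivity)
    exact Real.rpow_le_rpow_of_nonpos (by linarith) hNk (by linarith)
  have hpart : ∀ K : ℕ, ∑ k ∈ Finset.range K, ‖zetaTermDiff (N + k) s‖ ≤
      ‖s‖ * (N : ℝ) ^ (1 / 2 - s.re) * (4 / √N) := fun K => by
    refine (Finset.sum_le_sum fun k _ => hterm k).trans ?_
    rw [← Finset.mul_sum]
    refine mul_le_mul_of_nonneg_left ?_ (by positivity)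
    refine (sum_rpow_neg_three_half_tail hN K).trans ?_
    have : 0 ≤ 4 / √((N + K : ℕ) : ℝ) := by positivity
    linarith
  have hsumm : Summable fun k => ‖zetaTermDiff (N + k) s‖ :=
    summable_of_sum_range_le (fun _ => norm_nonneg _) hpart
  have htail : ‖∑' k, zetaTermDiff (N + k) s‖ ≤ 4 * ‖s‖ * (N : ℝ) ^ (-s.re) := by
    refine (norm_tsum_le_tsum_norm hsumm).trans ((hsumm.tsum_le_of_sum_range_le hpart).trans (le_of_eq ?_))
    have : (N : ℝ) ^ (-s.re) = (N : ℝ) ^ (1 / 2 - s.re) / √N := by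
      rw [Real.sqrt_eq_rpow, ← Real.rpow_sub (by linarith)]
      congr 1
      ring
    rw [this]
    ring
  rw [riemannZeta_eq_sum_add_tsum (by linarith) hs' hN]
  rw [show ∀ a b c : ℂ, a - b + c - a = -b + c by intros; ring]
  refine (norm_add_le _ _).trans (add_le_add ?_ htail)
  rw [norm_neg, norm_div, ← Complex.ofReal_natCast, Complex.norm_cpow_eq_rpow_re_of_pos (by linarith)]
  simp only [Complex.sub_re, Complex.one_re]
  refine div_le_div_of_nonneg_left (by positivity) hs' ?_
  have := Complex.abs_im_le_norm (1 - s)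
  simp only [Complex.sub_im, Complex.one_im, zero_sub, abs_neg] at this
  exact (le_abs_self _).trans this

theorem re_ofReal_add_ofReal_mul_I (σ t : ℝ) : ((σ : ℂ) + (t : ℂ) * Complex.I).re = σ := by simp

theorem im_ofReal_add_ofReal_mul_I (σ t : ℝ) : ((σ : ℂ) + (t : ℂ) * Complex.I).im = t := by simp

/-! ### Sums with phase `x² log n` and the weak approximate functional equation. -/

/-- Summation of dyadic block estimates. -/
theorem norm_sum_Ico_le_of_dyadic {z : ℕ → ℂ} {F : ℕ → ℝ} {a B : ℕ} {ρ : ℝ} (ha : 1 ≤ a)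
    (hρ : 0 < ρ) (hρ1 : ρ < 1) (hF0 : ∀ m, 0 ≤ F m) (hFm : ∀ m, a ≤ m → F a ≤ F m)
    (hF : ∀ h m, a ≤ h → 3 * h ≤ 2 * m → F h ≤ ρ * F m)
    (hblock : ∀ h m, a ≤ h → h ≤ m → m ≤ 2 * h → m ≤ B → ‖∑ n ∈ Finset.Ico h m, z n‖ ≤ F h)
    (m : ℕ) (hm : a ≤ m) (hmB : m ≤ B) :
    ‖∑ n ∈ Finset.Ico a m, z n‖ ≤ F m / (1 - ρ) := by
  have h1ρ : 0 < 1 - ρ := by linarith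
  induction m using Nat.strong_induction_on with
  | _ m ih =>
    rcases le_or_gt m (2 * a) with h | h
    · refine (hblock a m le_rfl hm h hmB).trans ((hFm m hm).trans ?_)
      rw [le_div_iff₀ h1ρ]
      nlinarith [hF0 m]
    -- Halving is rounded up so that `[k, m)` is still a dyadic block. In exchange only `3k ≤ 2m` is
    -- available, which is why the growth hypothesis on `F` has ratio `2/3` rather than `1/2`.
    · set k := (m + 1) / 2 with hk
      have e1 : a ≤ k := by omega
      have e2 : k < m := by omega
      have e3 : 3 * k ≤ 2 * m := by omega
      rw [← Finset.sum_Ico_consecutive z e1 e2.le]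
      refine (norm_add_le _ _).trans ?_
      have e4 := ih k e2 e1 (by omega)
      have e5 := hblock k m e1 e2.le (by omega) hmB
      have e6 := hF k m e1 e3
      have e7 : F k / (1 - ρ) + F k ≤ F m / (1 - ρ) := by
        rw [div_add' _ _ _ h1ρ.ne', div_le_div_iff_of_pos_right h1ρ]
        nlinarith [mul_le_mul_of_nonneg_right e6 (show 0 ≤ 2 - ρ by linarith),
          mul_nonneg (sq_nonneg (1 - ρ)) (hF0 m)]
      linarith

theorem log_second_diff_bounds {n : ℕ} (hn : 1 ≤ n) :
    1 / ((n : ℝ) + 1) ^ 2 ≤ 2 * Real.log (n + 1) - Real.log n - Real.log (n + 2) ∧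
    2 * Real.log (n + 1) - Real.log n - Real.log (n + 2) ≤ 1 / ((n : ℝ) * (n + 2)) := by
  have hn' : (1 : ℝ) ≤ n := by exact_mod_cast hn
  have e : 2 * Real.log (n + 1) - Real.log n - Real.log (n + 2) =
      Real.log (((n : ℝ) + 1) ^ 2 / (n * (n + 2))) := by
    rw [Real.log_div (by positivity) (by positivity), Real.log_pow,
      Real.log_mul (by positivity) (by positivity)]
    push_cast
    ring
  have e2 : ((n : ℝ) + 1) ^ 2 / (n * (n + 2)) - 1 = 1 / (n * (n + 2)) := by
    field_simp
    ring
  have e3 : 1 - (((n : ℝ) + 1) ^ 2 / (n * (n + 2)))⁻¹ = 1 / ((n : ℝ) + 1) ^ 2 := by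
    rw [inv_div]
    field_simp
    ring
  rw [e, ← e2, ← e3]
  exact ⟨Real.one_sub_inv_le_log_of_pos (by positivity), Real.log_le_sub_one_of_pos (by positivity)⟩

/-- On a dyadic block the second differences of `-x² log n` lie between `x²/(2a)²` and `x²/a²`, so
the second derivative test applies; `x ≤ 2a` keeps the lower bound below `1`. The estimate is used
up to `a` of order `x²`. -/
theorem norm_sum_unitExp_log_block_le {x : ℝ} (hx : 0 < x) {a b : ℕ} (ha : 1 ≤ a) (hab : a ≤ b)
    (hb : b ≤ 2 * a) (hxa : x ≤ 2 * a) :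
    ‖∑ n ∈ Finset.Ico a b, unitExp (-(x ^ 2 * Real.log n))‖ ≤ 16 * x + 32 * a / x := by
  have ha' : (1 : ℝ) ≤ a := by exact_mod_cast ha
  have hsecond : ∀ n : ℕ, (-(x ^ 2 * Real.log ((n + 2 : ℕ) : ℝ)) - -(x ^ 2 * Real.log ((n + 1 : ℕ) : ℝ))) -
      (-(x ^ 2 * Real.log ((n + 1 : ℕ) : ℝ)) - -(x ^ 2 * Real.log (n : ℝ))) =
      x ^ 2 * (2 * Real.log (n + 1) - Real.log n - Real.log (n + 2)) := fun n => by
    push_cast; ring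
  have hl : (0 : ℝ) < x ^ 2 / (2 * a) ^ 2 := by positivity
  have := norm_sum_unitExp_le_of_second_diff (fun n : ℕ => -(x ^ 2 * Real.log n)) (a := a) (b := b)
    (l := x ^ 2 / (2 * a) ^ 2) (L := x ^ 2 / a ^ 2) hl
    (by rw [div_le_one (by positivity)]; exact pow_le_pow_left₀ hx.le hxa 2) (by positivity) hab
    (fun n hn hn' => by
      rw [hsecond]
      refine le_trans ?_ (mul_le_mul_of_nonneg_left (log_second_diff_bounds (by omega)).1 (by positivity))
      rw [div_eq_mul_one_div]
      have : (n : ℝ) + 1 ≤ 2 * a := by exact_mod_cast (by omega : n + 1 ≤ 2 * a)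
      gcongr)
    (fun n hn hn' => by
      rw [hsecond]
      refine le_trans (mul_le_mul_of_nonneg_left (log_second_diff_bounds (by omega)).2 (by positivity)) ?_
      rw [← div_eq_mul_one_div]
      have : (a : ℝ) ≤ n := by exact_mod_cast hn
      have : (a : ℝ) ^ 2 ≤ n * (n + 2) := by nlinarith
      gcongr)
  refine this.trans ?_
  rw [Real.sqrt_div (by positivity), Real.sqrt_sq hx.le, Real.sqrt_sq (by positivity)]
  have hb' : (b : ℝ) - a ≤ a := by
    have : (b : ℝ) ≤ 2 * a := by exact_mod_cast hb
    linarith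
  calc (x ^ 2 / a ^ 2 * (b - a) + 2) * (8 / (x / (2 * a)))
      ≤ (x ^ 2 / a ^ 2 * a + 2) * (8 / (x / (2 * a))) := by gcongr
    _ = 16 * x + 32 * a / x := by field_simp; ring

theorem log_succ_sub_log_bounds {n : ℕ} (hn : 1 ≤ n) :
    1 / ((n : ℝ) + 1) ≤ Real.log (n + 1) - Real.log n ∧
      Real.log (n + 1) - Real.log n ≤ 1 / (n : ℝ) := by
  have hn' : (1 : ℝ) ≤ n := by exact_mod_cast hn
  rw [← Real.log_div (by positivity) (by positivity)]
  have e2 : ((n : ℝ) + 1) / n - 1 = 1 / n := by field_simp; ring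
  have e3 : 1 - (((n : ℝ) + 1) / n)⁻¹ = 1 / ((n : ℝ) + 1) := by
    rw [inv_div]; field_simp; ring
  rw [← e2, ← e3]
  exact ⟨Real.one_sub_inv_le_log_of_pos (by positivity), Real.log_le_sub_one_of_pos (by positivity)⟩

/-- Once `a ≥ 2x²` the first differences lie in `[-1/2, -x²/(2a)]` and increase, so Kuzmin–Landau
with `k = -1` applies to the whole block directly. -/
theorem norm_sum_unitExp_log_block_le' {x : ℝ} (hx : 1 ≤ x) {a b : ℕ} (hxa : 2 * x ^ 2 ≤ a)
    (hb : b ≤ 2 * a) :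
    ‖∑ n ∈ Finset.Ico a b, unitExp (-(x ^ 2 * Real.log n))‖ ≤ 4 * a / x ^ 2 := by
  have ha' : (1 : ℝ) ≤ a := by nlinarith
  have ha : 1 ≤ a := by exact_mod_cast ha'
  have hx0 : 0 < x := by linarith
  have := norm_sum_unitExp_le_of_monotone_diff (fun n : ℕ => -(x ^ 2 * Real.log n)) (a := a) (b := b)
    (k := -1) (δ := x ^ 2 / (2 * a)) (by positivity)
    (fun n hn hn' => by
      have h1 := (log_succ_sub_log_bounds (show 1 ≤ n by omega)).2
      have h2 : (a : ℝ) ≤ n := by exact_mod_cast hn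
      have h3 : x ^ 2 * (Real.log (n + 1) - Real.log n) ≤ x ^ 2 * (1 / n) := by gcongr
      have h4 : x ^ 2 * (1 / (n : ℝ)) ≤ x ^ 2 / a := by
        rw [← div_eq_mul_one_div]; gcongr
      have h5 : x ^ 2 / a ≤ 1 / 2 := by
        rw [div_le_iff₀ (by positivity)]; linarith
      have h6 : x ^ 2 / (2 * a) = x ^ 2 / a / 2 := by field_simp
      push_cast
      linarith)
    (fun n hn hn' => by
      have h1 := (log_succ_sub_log_bounds (show 1 ≤ n by omega)).1
      have h2 : (n : ℝ) + 1 ≤ 2 * a := by exact_mod_cast (by omega : n + 1 ≤ 2 * a)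
      have h3 : x ^ 2 * (1 / (n + 1)) ≤ x ^ 2 * (Real.log (n + 1) - Real.log n) := by gcongr
      have h4 : x ^ 2 / (2 * a) ≤ x ^ 2 * (1 / ((n : ℝ) + 1)) := by
        rw [← div_eq_mul_one_div]; gcongr
      push_cast
      linarith)
    (fun n hn hn' => by
      have h1 := (log_second_diff_bounds (show 1 ≤ n by omega)).1
      have h2 : 0 ≤ x ^ 2 * (2 * Real.log (n + 1) - Real.log n - Real.log (n + 2)) :=
        mul_nonneg (by positivity) (le_trans (by positivity) h1)
      push_cast
      linarith)
  refine this.trans (le_of_eq ?_)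
  field_simp
  ring

/-- For `x ≤ h ≤ 8x³` the two block bounds, of order `x + h/x` and `h/x²`, are both dominated by the
single power `x^{3/4} h^{1/4}`. A pure power of `h` is what dyadic summation needs. -/
theorem norm_sum_unitExp_log_le {x : ℝ} (hx : 1 ≤ x) {a m : ℕ} (hxa : x ≤ a) (ham : a ≤ m)
    (hm : (m : ℝ) ≤ 8 * x ^ 3) :
    ‖∑ n ∈ Finset.Ico a m, unitExp (-(x ^ 2 * Real.log n))‖ ≤
      1000 * x ^ (3 / 4 : ℝ) * (m : ℝ) ^ (1 / 4 : ℝ) := by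
  have hx0 : 0 < x := by linarith
  have ha' : (1 : ℝ) ≤ a := by linarith
  have ha : 1 ≤ a := by exact_mod_cast ha'
  set B := ⌊8 * x ^ 3⌋₊ with hB
  have hmB : m ≤ B := Nat.le_floor hm
  have hBle : (B : ℝ) ≤ 8 * x ^ 3 := Nat.floor_le (by positivity)
  set y := x ^ (1 / 4 : ℝ) with hy
  have hy1 : 1 ≤ y := Real.one_le_rpow hx (by norm_num)
  have hy4 : y ^ 4 = x := by
    rw [hy, ← Real.rpow_natCast, ← Real.rpow_mul hx0.le]; norm_num
  have hy3 : x ^ (3 / 4 : ℝ) = y ^ 3 := by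
    rw [hy, ← Real.rpow_natCast, ← Real.rpow_mul hx0.le]; norm_num
  have hr : ∀ n : ℕ, ((n : ℝ) ^ (1 / 4 : ℝ)) ^ 4 = n := fun n => by
    rw [← Real.rpow_natCast, ← Real.rpow_mul (by positivity)]; norm_num
  -- The ratio `91/100` exceeds `(2/3)^{1/4}`.
  have := norm_sum_Ico_le_of_dyadic (z := fun n : ℕ => unitExp (-(x ^ 2 * Real.log n)))
    (F := fun n : ℕ => 90 * x ^ (3 / 4 : ℝ) * (n : ℝ) ^ (1 / 4 : ℝ)) (a := a) (B := B) (ρ := 91 / 100)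
    ha (by norm_num) (by norm_num) (fun m => by positivity)
    (fun m hm => by
      have : (a : ℝ) ≤ m := by exact_mod_cast hm
      gcongr)
    (fun h m hh hm => by
      have h1 : (h : ℝ) ≤ 2 / 3 * m := by
        have : (3 * h : ℝ) ≤ 2 * m := by exact_mod_cast hm
        linarith
      have h2 : (h : ℝ) ^ (1 / 4 : ℝ) ≤ 91 / 100 * (m : ℝ) ^ (1 / 4 : ℝ) := by
        refine (pow_le_pow_iff_left₀ (by positivity) (by positivity) (four_ne_zero)).mp ?_
        rw [mul_pow, hr, hr]
        nlinarith [(Nat.cast_nonneg m : (0 : ℝ) ≤ m)]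
      have : 0 ≤ 90 * x ^ (3 / 4 : ℝ) := by positivity
      nlinarith)
    (fun h m hh hhm hm hmB => by
      have hha : (a : ℝ) ≤ h := by exact_mod_cast hh
      set q := (h : ℝ) ^ (1 / 4 : ℝ) with hq
      have hq4 : q ^ 4 = h := hr h
      have hyq : y ≤ q := Real.rpow_le_rpow hx0.le (hxa.trans hha) (by norm_num)
      have hh1 : (h : ℝ) ≤ 8 * x ^ 3 := by
        have : (h : ℝ) ≤ B := by exact_mod_cast hhm.trans hmB
        linarith
      rw [hy3]
      rcases lt_or_ge (h : ℝ) (2 * x ^ 2) with hc | hc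
      · refine (norm_sum_unitExp_log_block_le hx0 (by omega) hhm hm (by linarith)).trans ?_
        have e1 : q ≤ 2 * y ^ 2 := by
          refine (pow_le_pow_iff_left₀ (by positivity) (by positivity) (four_ne_zero)).mp ?_
          rw [hq4, mul_pow, ← pow_mul, mul_comm 2 4, pow_mul, hy4]
          nlinarith [sq_nonneg x]
        have e1' : q ^ 3 ≤ 2 * y ^ 6 := by
          refine (pow_le_pow_iff_left₀ (by positivity) (by positivity) (four_ne_zero)).mp ?_
          have : (q ^ 3) ^ 4 = (h : ℝ) ^ 3 := by rw [← hq4]; ring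
          rw [this]
          have : (2 * y ^ 6) ^ 4 = 16 * x ^ 6 := by rw [← hy4]; ring
          rw [this]
          calc (h : ℝ) ^ 3 ≤ (2 * x ^ 2) ^ 3 := by gcongr
            _ = 8 * x ^ 6 := by ring
            _ ≤ 16 * x ^ 6 := by nlinarith [pow_pos hx0 6]
        have e2 : 32 * (h : ℝ) / x ≤ 64 * (y ^ 3 * q) := by
          rw [div_le_iff₀ hx0, ← hq4, ← hy4]
          have : q ^ 3 ≤ 2 * y ^ 7 := e1'.trans (by gcongr; norm_num)
          nlinarith [mul_le_mul_of_nonneg_right this (show 0 ≤ q by positivity)]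
        have e3 : x ≤ y ^ 3 * q := by
          nth_rewrite 1 [← hy4]
          have : y ^ 3 * y ≤ y ^ 3 * q := by gcongr
          nlinarith
        have : 0 ≤ y ^ 3 * q := by positivity
        linarith
      · refine (norm_sum_unitExp_log_block_le' hx hc hm).trans ?_
        have e1' : q ^ 3 ≤ 8 * y ^ 9 := by
          refine (pow_le_pow_iff_left₀ (by positivity) (by positivity) (four_ne_zero)).mp ?_
          have : (q ^ 3) ^ 4 = (h : ℝ) ^ 3 := by rw [← hq4]; ring
          rw [this]
          have : (8 * y ^ 9) ^ 4 = 8 ^ 4 * x ^ 9 := by rw [← hy4]; ring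
          rw [this]
          calc (h : ℝ) ^ 3 ≤ (8 * x ^ 3) ^ 3 := by gcongr
            _ = 8 ^ 3 * x ^ 9 := by ring
            _ ≤ 8 ^ 4 * x ^ 9 := by nlinarith [pow_pos hx0 9]
        rw [div_le_iff₀ (by positivity), ← hq4, ← hy4]
        have : q ^ 3 ≤ 8 * y ^ 11 := e1'.trans (by gcongr; norm_num)
        nlinarith [mul_le_mul_of_nonneg_right this (show 0 ≤ q by positivity)]) m ham hmB
  refine this.trans ?_
  have h0 : 0 ≤ x ^ (3 / 4 : ℝ) * (m : ℝ) ^ (1 / 4 : ℝ) := by positivity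
  have : (1 - 91 / 100 : ℝ) = 9 / 100 := by norm_num
  rw [this, div_le_iff₀ (by norm_num)]
  linarith

theorem rpow_neg_diff_bound {σ : ℝ} (hσ : 0 < σ) {n : ℕ} (hn : 1 ≤ n) :
    |((n + 1 : ℕ) : ℝ) ^ (-σ) - (n : ℝ) ^ (-σ)| ≤ σ * (n : ℝ) ^ (-σ - 1) := by
  have hn' : (0 : ℝ) < n := by exact_mod_cast hn
  have := (convex_Icc (n : ℝ) (n + 1)).norm_image_sub_le_of_norm_hasDerivWithin_le
    (f := fun v : ℝ => v ^ (-σ)) (f' := fun v => -σ * v ^ (-σ - 1)) (C := σ * (n : ℝ) ^ (-σ - 1))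
    (fun v hv => (Real.hasDerivAt_rpow_const (Or.inl (hn'.trans_le hv.1).ne')).hasDerivWithinAt)
    (fun v hv => by
      have hv0 := hn'.trans_le hv.1
      rw [norm_mul, norm_neg, Real.norm_eq_abs, abs_of_pos hσ, Real.norm_eq_abs,
        abs_of_pos (Real.rpow_pos_of_pos hv0 _)]
      exact mul_le_mul_of_nonneg_left (Real.rpow_le_rpow_of_nonpos hn' hv.1 (by linarith)) hσ.le)
    (Set.left_mem_Icc.mpr (by linarith)) (Set.right_mem_Icc.mpr (by linarith))
  simpa using this

theorem sum_rpow_neg_five_quarter_le {a : ℕ} (ha : 1 ≤ a) (b : ℕ) :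
    ∑ n ∈ Finset.Ico a b, (n : ℝ) ^ (-(5 / 4) : ℝ) ≤ 16 * (a : ℝ) ^ (-(1 / 4) : ℝ) := by
  have key : ∀ n : ℕ, 1 ≤ n → (n : ℝ) ^ (-(5 / 4) : ℝ) ≤
      16 * ((n : ℝ) ^ (-(1 / 4) : ℝ) - ((n + 1 : ℕ) : ℝ) ^ (-(1 / 4) : ℝ)) := by
    intro n hn
    have hn' : (1 : ℝ) ≤ n := by exact_mod_cast hn
    obtain ⟨c, hc, hc'⟩ := exists_hasDerivAt_eq_slope (fun v : ℝ => v ^ (-(1 / 4) : ℝ))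
      (fun v => -(1 / 4) * v ^ (-(1 / 4) - 1 : ℝ)) (show (n : ℝ) < n + 1 by linarith)
      (fun v hv => (Real.continuousAt_rpow_const _ _ (Or.inl (by have := hv.1; linarith))).continuousWithinAt)
      (fun v hv => Real.hasDerivAt_rpow_const (Or.inl (by have := hv.1; linarith)))
    rw [add_sub_cancel_left, div_one] at hc'
    push_cast
    have h1 : (2 * (n : ℝ)) ^ (-(5 / 4) : ℝ) ≤ c ^ (-(1 / 4) - 1 : ℝ) := by
      rw [show (-(1 / 4) - 1 : ℝ) = -(5 / 4) by norm_num]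
      exact Real.rpow_le_rpow_of_nonpos (by linarith [hc.1]) (by linarith [hc.2]) (by norm_num)
    rw [Real.mul_rpow (by norm_num) (by positivity)] at h1
    have h2 : (1 / 4 : ℝ) ≤ 2 ^ (-(5 / 4) : ℝ) := by
      have : (2 : ℝ) ^ (-2 : ℝ) ≤ 2 ^ (-(5 / 4) : ℝ) :=
        Real.rpow_le_rpow_of_exponent_le (by norm_num) (by norm_num)
      rw [Real.rpow_neg (by norm_num)] at this
      norm_num at this ⊢
      exact this
    have h3 : 0 ≤ (n : ℝ) ^ (-(5 / 4) : ℝ) := by positivity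
    nlinarith
  rcases le_or_gt a b with h | h
  · refine (Finset.sum_le_sum fun n hn => key n (ha.trans (Finset.mem_Ico.mp hn).1)).trans ?_
    rw [← Finset.mul_sum]
    refine mul_le_mul_of_nonneg_left ?_ (by norm_num)
    have := Finset.sum_Ico_sub (fun n : ℕ => (n : ℝ) ^ (-(1 / 4) : ℝ)) h
    have e : ∑ n ∈ Finset.Ico a b, ((n : ℝ) ^ (-(1 / 4) : ℝ) - ((n + 1 : ℕ) : ℝ) ^ (-(1 / 4) : ℝ)) =
        -∑ n ∈ Finset.Ico a b, (((n + 1 : ℕ) : ℝ) ^ (-(1 / 4) : ℝ) - (n : ℝ) ^ (-(1 / 4) : ℝ)) := by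
      rw [← Finset.sum_neg_distrib]; simp
    rw [e, this]
    have : 0 ≤ (b : ℝ) ^ (-(1 / 4) : ℝ) := by positivity
    linarith
  · rw [Finset.Ico_eq_empty (by omega), Finset.sum_empty]
    positivity

theorem natCast_cpow_neg_eq {n : ℕ} (hn : 1 ≤ n) (σ x : ℝ) :
    (n : ℂ) ^ (-((σ : ℂ) + ((2 * Real.pi * x ^ 2 : ℝ) : ℂ) * Complex.I)) =
      (((n : ℝ) ^ (-σ) : ℝ) : ℂ) * unitExp (-(x ^ 2 * Real.log n)) := by
  have hn' : (0 : ℝ) < n := by exact_mod_cast hn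
  have hn0 : (n : ℂ) ≠ 0 := by exact_mod_cast hn'.ne'
  rw [neg_add, Complex.cpow_add _ _ hn0, ← Complex.ofReal_natCast, ← Complex.ofReal_neg,
    ← Complex.ofReal_cpow hn'.le]
  congr 1
  rw [Complex.cpow_def_of_ne_zero (by exact_mod_cast hn'.ne'), ← Complex.ofReal_log hn'.le]
  unfold unitExp
  congr 1
  push_cast
  ring

/-- Tails of the zeta series between `x ≤ a` and `8 x³`. -/
theorem norm_sum_rpow_mul_unitExp_log_le {x σ : ℝ} (hx : 1 ≤ x) (hσ : 1 / 2 ≤ σ) (hσ2 : σ ≤ 2)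
    {a b : ℕ} (hxa : x ≤ a) (hab : a ≤ b) (hb : ((b + 1 : ℕ) : ℝ) ≤ 8 * x ^ 3) :
    ‖∑ n ∈ Finset.Ico a (b + 1), (((n : ℝ) ^ (-σ) : ℝ) : ℂ) * unitExp (-(x ^ 2 * Real.log n))‖ ≤
      100000 * x ^ (1 - σ) := by
  have hx0 : 0 < x := by linarith
  have ha' : (1 : ℝ) ≤ a := by linarith
  have ha : 1 ≤ a := by exact_mod_cast ha'
  have hP : ∀ m, a ≤ m → m ≤ b →
      ‖∑ n ∈ Finset.Ico a (m + 1), unitExp (-(x ^ 2 * Real.log n))‖ ≤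
        2000 * x ^ (3 / 4 : ℝ) * (m : ℝ) ^ (1 / 4 : ℝ) := fun m hm hmb => by
    have hm1 : (1 : ℝ) ≤ m := by exact_mod_cast ha.trans hm
    refine (norm_sum_unitExp_log_le hx hxa (by omega) (le_trans ?_ hb)).trans ?_
    · exact_mod_cast (by omega : m + 1 ≤ b + 1)
    · have h1 : ((m + 1 : ℕ) : ℝ) ^ (1 / 4 : ℝ) ≤ 2 * (m : ℝ) ^ (1 / 4 : ℝ) := by
        calc ((m + 1 : ℕ) : ℝ) ^ (1 / 4 : ℝ) ≤ (16 * (m : ℝ)) ^ (1 / 4 : ℝ) := by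
              apply Real.rpow_le_rpow (by positivity) _ (by norm_num)
              push_cast; linarith
          _ = 2 * (m : ℝ) ^ (1 / 4 : ℝ) := by
              rw [Real.mul_rpow (by norm_num) (by positivity)]
              congr 1
              rw [show (16 : ℝ) = 2 ^ (4 : ℝ) by norm_num, ← Real.rpow_mul (by norm_num)]
              norm_num
      have : 0 ≤ x ^ (3 / 4 : ℝ) := by positivity
      nlinarith
  refine (norm_sum_mul_le_by_parts _ (fun n : ℕ => (((n : ℝ) ^ (-σ) : ℝ) : ℂ)) _ hab hP).trans ?_
  have hX : x ^ (3 / 4 : ℝ) * x ^ (1 / 4 - σ) = x ^ (1 - σ) := by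
    rw [← Real.rpow_add hx0]; congr 1; ring
  have hmono : ∀ m : ℕ, a ≤ m → (m : ℝ) ^ (1 / 4 - σ) ≤ x ^ (1 / 4 - σ) := fun m hm =>
    Real.rpow_le_rpow_of_nonpos hx0 (hxa.trans (by exact_mod_cast hm)) (by linarith)
  have hx34 : 0 ≤ x ^ (3 / 4 : ℝ) := by positivity
  have hfirst : ‖(((b : ℝ) ^ (-σ) : ℝ) : ℂ)‖ * (2000 * x ^ (3 / 4 : ℝ) * (b : ℝ) ^ (1 / 4 : ℝ)) ≤
      2000 * x ^ (1 - σ) := by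
    have hb1 : (0 : ℝ) < b := by exact_mod_cast (by omega : 0 < b)
    rw [Complex.norm_real, Real.norm_eq_abs, abs_of_nonneg (by positivity)]
    have : (b : ℝ) ^ (-σ) * (b : ℝ) ^ (1 / 4 : ℝ) = (b : ℝ) ^ (1 / 4 - σ) := by
      rw [← Real.rpow_add hb1]; congr 1; ring
    calc _ = 2000 * x ^ (3 / 4 : ℝ) * ((b : ℝ) ^ (-σ) * (b : ℝ) ^ (1 / 4 : ℝ)) := by ring
      _ ≤ 2000 * x ^ (3 / 4 : ℝ) * x ^ (1 / 4 - σ) := by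
        rw [this]; exact mul_le_mul_of_nonneg_left (hmono b hab) (by positivity)
      _ = _ := by rw [mul_assoc, hX]
  -- The variation of `n^{-σ}` times the majorant `n^{1/4}` is `n^{1/2-σ} n^{-5/4}`. The first
  -- factor is at most `x^{1/2-σ}`, and the second sums to `O(x^{-1/4})`.
  have hsecond : ∑ n ∈ Finset.Ico a b, ‖((((n + 1 : ℕ) : ℝ) ^ (-σ) : ℝ) : ℂ) - (((n : ℝ) ^ (-σ) : ℝ) : ℂ)‖ *
      (2000 * x ^ (3 / 4 : ℝ) * (n : ℝ) ^ (1 / 4 : ℝ)) ≤ 64000 * x ^ (1 - σ) := by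
    have hterm : ∀ n ∈ Finset.Ico a b, ‖((((n + 1 : ℕ) : ℝ) ^ (-σ) : ℝ) : ℂ) - (((n : ℝ) ^ (-σ) : ℝ) : ℂ)‖ *
        (2000 * x ^ (3 / 4 : ℝ) * (n : ℝ) ^ (1 / 4 : ℝ)) ≤
        4000 * x ^ (3 / 4 : ℝ) * x ^ (1 / 2 - σ) * (n : ℝ) ^ (-(5 / 4) : ℝ) := fun n hn => by
      have hn1 := (Finset.mem_Ico.mp hn).1
      have hn0 : (0 : ℝ) < n := by exact_mod_cast ha.trans hn1
      have e1 : ‖((((n + 1 : ℕ) : ℝ) ^ (-σ) : ℝ) : ℂ) - (((n : ℝ) ^ (-σ) : ℝ) : ℂ)‖ ≤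
          2 * (n : ℝ) ^ (-σ - 1) := by
        rw [← Complex.ofReal_sub, Complex.norm_real, Real.norm_eq_abs]
        refine (rpow_neg_diff_bound (by linarith) (by omega)).trans ?_
        exact mul_le_mul_of_nonneg_right hσ2 (by positivity)
      have e2 : (n : ℝ) ^ (-σ - 1) * (n : ℝ) ^ (1 / 4 : ℝ) = (n : ℝ) ^ (1 / 2 - σ) * (n : ℝ) ^ (-(5 / 4) : ℝ) := by
        rw [← Real.rpow_add hn0, ← Real.rpow_add hn0]; congr 1; ring
      have e3 : (n : ℝ) ^ (1 / 2 - σ) ≤ x ^ (1 / 2 - σ) :=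
        Real.rpow_le_rpow_of_nonpos hx0 (hxa.trans (by exact_mod_cast hn1)) (by linarith)
      calc _ ≤ 2 * (n : ℝ) ^ (-σ - 1) * (2000 * x ^ (3 / 4 : ℝ) * (n : ℝ) ^ (1 / 4 : ℝ)) := by gcongr
        _ = 4000 * x ^ (3 / 4 : ℝ) * ((n : ℝ) ^ (-σ - 1) * (n : ℝ) ^ (1 / 4 : ℝ)) := by ring
        _ = 4000 * x ^ (3 / 4 : ℝ) * (n : ℝ) ^ (1 / 2 - σ) * (n : ℝ) ^ (-(5 / 4) : ℝ) := by rw [e2]; ring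
        _ ≤ _ := by gcongr
    refine (Finset.sum_le_sum hterm).trans ?_
    rw [← Finset.mul_sum]
    have e4 := sum_rpow_neg_five_quarter_le ha b
    have e5 : (a : ℝ) ^ (-(1 / 4) : ℝ) ≤ x ^ (-(1 / 4) : ℝ) :=
      Real.rpow_le_rpow_of_nonpos hx0 hxa (by norm_num)
    have e6 : x ^ (3 / 4 : ℝ) * x ^ (1 / 2 - σ) * x ^ (-(1 / 4) : ℝ) = x ^ (1 - σ) := by
      rw [← Real.rpow_add hx0, ← Real.rpow_add hx0]; congr 1; ring
    calc _ ≤ 4000 * x ^ (3 / 4 : ℝ) * x ^ (1 / 2 - σ) * (16 * x ^ (-(1 / 4) : ℝ)) := by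
          refine mul_le_mul_of_nonneg_left (e4.trans ?_) (by positivity)
          exact mul_le_mul_of_nonneg_left e5 (by norm_num)
      _ = 64000 * (x ^ (3 / 4 : ℝ) * x ^ (1 / 2 - σ) * x ^ (-(1 / 4) : ℝ)) := by ring
      _ = _ := by rw [e6]
  have : 0 ≤ x ^ (1 - σ) := by positivity
  linarith

/-- A weak approximate functional equation: `ζ(σ + 2πix²)` is a partial sum of length `≍ x` up to
`O(x^{1-σ})`. -/
theorem norm_riemannZeta_sub_sum_Ico_le {x σ : ℝ} (hx : 4 ≤ x) (hσ : 1 / 2 ≤ σ) (hσ2 : σ ≤ 2)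
    {a : ℕ} (hxa : x ≤ a) (hax : a ≤ 4 * x) :
    ‖riemannZeta ((σ : ℂ) + ((2 * Real.pi * x ^ 2 : ℝ) : ℂ) * Complex.I) -
      ∑ n ∈ Finset.Ico 1 a, (n : ℂ) ^ (-((σ : ℂ) + ((2 * Real.pi * x ^ 2 : ℝ) : ℂ) * Complex.I))‖ ≤
      200000 * x ^ (1 - σ) := by
  have hx0 : 0 < x := by linarith
  have hpi := Real.pi_pos
  have hpi3 := Real.pi_gt_three
  have hpi4 := Real.pi_lt_four
  have ha' : (1 : ℝ) ≤ a := by linarith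
  have ha : 1 ≤ a := by exact_mod_cast ha'
  set s : ℂ := (σ : ℂ) + ((2 * Real.pi * x ^ 2 : ℝ) : ℂ) * Complex.I with hs
  have hre : s.re = σ := re_ofReal_add_ofReal_mul_I _ _
  have him : s.im = 2 * Real.pi * x ^ 2 := im_ofReal_add_ofReal_mul_I _ _
  -- At length `x³` the Euler–Maclaurin error `‖s‖ N^{-σ}` has size `x^{2-3σ}`, which is at most
  -- `x^{1-σ}` exactly because `σ ≥ 1/2`.
  set N := ⌊x ^ 3⌋₊ with hN
  have hN1 : (N : ℝ) ≤ x ^ 3 := Nat.floor_le (by positivity)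
  have hN2 : x ^ 3 < N + 1 := Nat.lt_floor_add_one _
  have hx3 : 16 * x ≤ x ^ 3 := by nlinarith [mul_nonneg hx0.le (show 0 ≤ x - 4 by linarith)]
  have haN' : (a : ℝ) ≤ N := by linarith
  have haN : a ≤ N := by exact_mod_cast haN'
  have hNpos : 0 < N := by omega
  have hNhalf : x ^ 3 / 2 ≤ N := by linarith
  have him0 : 0 < s.im := by rw [him]; positivity
  have h1 := norm_riemannZeta_sub_sum_le (s := s) (by rw [hre]; exact hσ) him0 hNpos
  rw [hre, him] at h1
  have h2 := norm_sum_rpow_mul_unitExp_log_le (x := x) (σ := σ) (by linarith) hσ hσ2 hxa haN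
    (by push_cast; nlinarith [pow_pos hx0 3])
  have hsum : ∑ n ∈ Finset.Ico a (N + 1), (((n : ℝ) ^ (-σ) : ℝ) : ℂ) * unitExp (-(x ^ 2 * Real.log n)) =
      ∑ n ∈ Finset.Ico a (N + 1), (n : ℂ) ^ (-s) := Finset.sum_congr rfl fun n hn => by
    rw [hs, natCast_cpow_neg_eq (ha.trans (Finset.mem_Ico.mp hn).1)]
  rw [hsum] at h2
  have hsplit := Finset.sum_Ico_consecutive (fun n : ℕ => (n : ℂ) ^ (-s)) ha (show a ≤ N + 1 by omega)
  have hsn : ‖s‖ ≤ 10 * x ^ 2 := by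
    refine (Complex.norm_le_abs_re_add_abs_im s).trans ?_
    rw [hre, him, abs_of_pos (by linarith), abs_of_pos (by positivity)]
    nlinarith [sq_nonneg x]
  have hpow1 : (N : ℝ) ^ (-σ) ≤ 4 * x ^ (-(3 * σ)) := by
    calc (N : ℝ) ^ (-σ) ≤ (x ^ 3 / 2) ^ (-σ) :=
          Real.rpow_le_rpow_of_nonpos (by positivity) hNhalf (by linarith)
      _ = x ^ (-(3 * σ)) * 2 ^ σ := by
          rw [Real.div_rpow (by positivity) (by norm_num), ← Real.rpow_natCast x 3, ← Real.rpow_mul hx0.le,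
            Real.rpow_neg (by norm_num : (0 : ℝ) ≤ 2), div_inv_eq_mul]
          congr 2
          push_cast; ring
      _ ≤ x ^ (-(3 * σ)) * 4 := by
          refine mul_le_mul_of_nonneg_left ?_ (by positivity)
          calc (2 : ℝ) ^ σ ≤ 2 ^ (2 : ℝ) := Real.rpow_le_rpow_of_exponent_le (by norm_num) hσ2
            _ = 4 := by norm_num
      _ = _ := by ring
  have hx23 : x ^ 2 * x ^ (-(3 * σ)) ≤ x ^ (1 - σ) := by
    rw [← Real.rpow_natCast x 2, ← Real.rpow_add hx0]
    refine Real.rpow_le_rpow_of_exponent_le (by linarith) ?_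
    push_cast; linarith
  have hE : 4 * ‖s‖ * (N : ℝ) ^ (-σ) ≤ 160 * x ^ (1 - σ) := by
    calc 4 * ‖s‖ * (N : ℝ) ^ (-σ) ≤ 4 * (10 * x ^ 2) * (4 * x ^ (-(3 * σ))) := by gcongr
      _ = 160 * (x ^ 2 * x ^ (-(3 * σ))) := by ring
      _ ≤ _ := by gcongr
  have hpow2 : (N : ℝ) ^ (1 - σ) / (2 * Real.pi * x ^ 2) ≤ 4 * x ^ (1 - σ) := by
    rw [div_le_iff₀ (by positivity)]
    have e1 : (N : ℝ) ^ (1 - σ) ≤ 4 * x ^ 3 * x ^ (-(3 * σ)) := by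
      have e0 : (N : ℝ) ^ (1 - σ) = N * (N : ℝ) ^ (-σ) := by
        rw [sub_eq_add_neg, Real.rpow_add (by exact_mod_cast hNpos), Real.rpow_one]
      rw [e0]
      calc (N : ℝ) * (N : ℝ) ^ (-σ) ≤ x ^ 3 * (4 * x ^ (-(3 * σ))) := by gcongr
        _ = _ := by ring
    have e2 : x ^ 3 * x ^ (-(3 * σ)) ≤ x ^ (1 - σ) * x ^ 2 := by
      rw [← Real.rpow_natCast x 2, ← Real.rpow_natCast x 3, ← Real.rpow_add hx0, ← Real.rpow_add hx0]
      refine Real.rpow_le_rpow_of_exponent_le (by linarith) ?_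
      push_cast; linarith
    have e3 : 0 ≤ x ^ (1 - σ) * x ^ 2 := by positivity
    nlinarith
  have hx1σ : 0 ≤ x ^ (1 - σ) := by positivity
  calc _ = ‖(riemannZeta s - ∑ n ∈ Finset.Ico 1 (N + 1), (n : ℂ) ^ (-s)) +
        ∑ n ∈ Finset.Ico a (N + 1), (n : ℂ) ^ (-s)‖ := by rw [← hsplit]; congr 1; ring
    _ ≤ _ := norm_add_le _ _
    _ ≤ _ := by linarith

theorem sum_rpow_neg_half_le (m : ℕ) :
    ∑ n ∈ Finset.Ico 1 (m + 1), (n : ℝ) ^ (-(1 / 2) : ℝ) ≤ 2 * √(m : ℝ) := by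
  induction m with
  | zero => simp
  | succ m ih =>
    rw [Finset.sum_Ico_succ_top (by omega)]
    have h : ((m + 1 : ℕ) : ℝ) ^ (-(1 / 2) : ℝ) = 1 / √((m + 1 : ℕ) : ℝ) := by
      rw [Real.rpow_neg (by positivity), Real.sqrt_eq_rpow, ← one_div]
    rw [h]
    set p := √(m : ℝ)
    set q := √((m + 1 : ℕ) : ℝ)
    have hp2 : p ^ 2 = m := Real.sq_sqrt (by positivity)
    have hq2 : q ^ 2 = m + 1 := by rw [Real.sq_sqrt (by positivity)]; push_cast; rfl
    have hp0 : 0 ≤ p := Real.sqrt_nonneg _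
    have hq0 : 0 < q := Real.sqrt_pos.mpr (by positivity)
    have : 1 / q ≤ 2 * (q - p) := by
      rw [div_le_iff₀ hq0]
      nlinarith [sq_nonneg (q - p)]
    linarith

theorem norm_sum_cpow_neg_le {s : ℂ} (hs : 1 / 2 ≤ s.re) (m : ℕ) :
    ‖∑ n ∈ Finset.Ico 1 (m + 1), (n : ℂ) ^ (-s)‖ ≤ 2 * √(m : ℝ) := by
  refine (norm_sum_le _ _).trans ((Finset.sum_le_sum fun n hn => ?_).trans (sum_rpow_neg_half_le m))
  have hn1 : 1 ≤ n := (Finset.mem_Ico.mp hn).1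
  rw [← Complex.ofReal_natCast, Complex.norm_cpow_eq_rpow_re_of_pos (by exact_mod_cast hn1)]
  exact Real.rpow_le_rpow_of_exponent_le (by exact_mod_cast hn1) (by simp only [Complex.neg_re]; linarith)

/-- The convexity bound `ζ(σ + it) ≪ t^{1/4}` for `1/2 ≤ σ ≤ 2`, with `t = 2πx²`. -/
theorem norm_riemannZeta_le_sqrt {x σ : ℝ} (hx : 4 ≤ x) (hσ : 1 / 2 ≤ σ) (hσ2 : σ ≤ 2) :
    ‖riemannZeta ((σ : ℂ) + ((2 * Real.pi * x ^ 2 : ℝ) : ℂ) * Complex.I)‖ ≤ 200004 * √x := by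
  have hx0 : 0 < x := by linarith
  set a := ⌈x⌉₊ with ha
  have h1 : x ≤ a := Nat.le_ceil x
  have h2 : (a : ℝ) < x + 1 := Nat.ceil_lt_add_one hx0.le
  have h3 := norm_riemannZeta_sub_sum_Ico_le hx hσ hσ2 h1 (by linarith)
  have ha1 : 1 ≤ a := by
    have : (1 : ℝ) ≤ a := by linarith
    exact_mod_cast this
  obtain ⟨m, hm⟩ : ∃ m, a = m + 1 := ⟨a - 1, by omega⟩
  rw [hm] at h3
  set s : ℂ := (σ : ℂ) + ((2 * Real.pi * x ^ 2 : ℝ) : ℂ) * Complex.I with hs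
  have hre : s.re = σ := re_ofReal_add_ofReal_mul_I _ _
  have h4 := norm_sum_cpow_neg_le (s := s) (by rw [hre]; exact hσ) m
  have h5 : √(m : ℝ) ≤ √x := Real.sqrt_le_sqrt (by
    have : (a : ℝ) = m + 1 := by exact_mod_cast hm
    linarith)
  have h6 : x ^ (1 - σ) ≤ √x := by
    rw [Real.sqrt_eq_rpow]
    exact Real.rpow_le_rpow_of_exponent_le (by linarith) (by linarith)
  have h7 := norm_le_norm_sub_add (riemannZeta s) (∑ n ∈ Finset.Ico 1 (m + 1), (n : ℂ) ^ (-s))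
  linarith [Real.sqrt_nonneg x]

/-! ### Oscillatory integrals away from the critical point. -/

/-- Integration by parts against `e^{iφ}` for a weight whose derivative has constant sign. -/
theorem norm_integral_exp_mul_le_of_monotone {φ φ' g g' : ℝ → ℝ} {a b : ℝ} (hab : a ≤ b)
    (hφ : ∀ u ∈ Set.Icc a b, HasDerivAt φ (φ' u) u) (hg : ∀ u ∈ Set.Icc a b, HasDerivAt g (g' u) u)
    (hφc : ContinuousOn φ' (Set.Icc a b)) (hgc : ContinuousOn g' (Set.Icc a b))
    (hsign : (∀ u ∈ Set.Icc a b, 0 ≤ g' u) ∨ (∀ u ∈ Set.Icc a b, g' u ≤ 0)) :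
    ‖∫ u in a..b, Complex.exp ((φ u : ℂ) * Complex.I) * ((φ' u * g u : ℝ) : ℂ)‖ ≤
      2 * (|g a| + |g b|) := by
  have hI : Set.uIcc a b = Set.Icc a b := Set.uIcc_of_le hab
  set E : ℝ → ℂ := fun u => Complex.exp ((φ u : ℂ) * Complex.I) with hE
  have hEd : ∀ u ∈ Set.Icc a b, HasDerivAt E (E u * ((φ' u : ℂ) * Complex.I)) u := fun u hu =>
    (((hφ u hu).ofReal_comp).mul_const Complex.I).cexp
  have hEc : ContinuousOn E (Set.Icc a b) := fun u hu => (hEd u hu).continuousAt.continuousWithinAt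
  have hE1 : ∀ u, ‖E u‖ = 1 := fun u => Complex.norm_exp_ofReal_mul_I _
  have hgd : ∀ u ∈ Set.Icc a b, HasDerivAt (fun u => (g u : ℂ)) (g' u : ℂ) u := fun u hu =>
    (hg u hu).ofReal_comp
  have hgc' : ContinuousOn (fun u => (g' u : ℂ)) (Set.Icc a b) :=
    Complex.continuous_ofReal.comp_continuousOn hgc
  have hparts := intervalIntegral.integral_mul_deriv_eq_deriv_mul (a := a) (b := b)
    (u := fun u => (g u : ℂ)) (v := E) (u' := fun u => (g' u : ℂ))
    (v' := fun u => E u * ((φ' u : ℂ) * Complex.I))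
    (by rw [hI]; exact hgd) (by rw [hI]; exact hEd)
    (ContinuousOn.intervalIntegrable (by rw [hI]; exact hgc'))
    (ContinuousOn.intervalIntegrable (by
      rw [hI]
      exact hEc.mul ((Complex.continuous_ofReal.comp_continuousOn hφc).mul continuousOn_const)))
  have hL : ∫ u in a..b, (g u : ℂ) * (E u * ((φ' u : ℂ) * Complex.I)) =
      Complex.I * ∫ u in a..b, E u * ((φ' u * g u : ℝ) : ℂ) := by
    rw [← intervalIntegral.integral_const_mul]
    congr 1
    ext u
    push_cast
    ring
  -- Constant sign makes the integral of `|g'|` equal to `|g b - g a|`.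
  have hvar : ‖∫ u in a..b, (g' u : ℂ) * E u‖ ≤ |g a| + |g b| := by
    have hint : IntervalIntegrable g' MeasureTheory.volume a b :=
      ContinuousOn.intervalIntegrable (by rw [hI]; exact hgc)
    have h1 : ‖∫ u in a..b, (g' u : ℂ) * E u‖ ≤ ∫ u in a..b, |g' u| := by
      refine (intervalIntegral.norm_integral_le_integral_norm hab).trans (le_of_eq ?_)
      congr 1
      ext u
      rw [norm_mul, hE1, mul_one, Complex.norm_real, Real.norm_eq_abs]
    have hftc : ∫ u in a..b, g' u = g b - g a :=
      intervalIntegral.integral_eq_sub_of_hasDerivAt (by rw [hI]; exact hg) hint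
    refine h1.trans ?_
    rcases hsign with h | h
    · have : ∫ u in a..b, |g' u| = ∫ u in a..b, g' u :=
        intervalIntegral.integral_congr (by rw [hI]; exact fun u hu => abs_of_nonneg (h u hu))
      rw [this, hftc]
      have := neg_abs_le (g a); have := le_abs_self (g b)
      linarith
    · have : ∫ u in a..b, |g' u| = ∫ u in a..b, -g' u :=
        intervalIntegral.integral_congr (by rw [hI]; exact fun u hu => abs_of_nonpos (h u hu))
      rw [this, intervalIntegral.integral_neg, hftc]
      have := neg_abs_le (g b); have := le_abs_self (g a)
      linarith
  have : ‖∫ u in a..b, E u * ((φ' u * g u : ℝ) : ℂ)‖ =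
      ‖Complex.I * ∫ u in a..b, E u * ((φ' u * g u : ℝ) : ℂ)‖ := by
    rw [norm_mul, Complex.norm_I, one_mul]
  rw [this, ← hL, hparts]
  refine (norm_sub_le _ _).trans ?_
  have h2 : ‖(g b : ℂ) * E b - (g a : ℂ) * E a‖ ≤ |g a| + |g b| := by
    refine (norm_sub_le _ _).trans ?_
    rw [norm_mul, norm_mul, hE1, hE1, mul_one, mul_one, Complex.norm_real, Complex.norm_real,
      Real.norm_eq_abs, Real.norm_eq_abs, add_comm]
  linarith

/-- The normalized phase `τ log τ - τ + 1`, with its critical point at `τ = 1`. -/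
noncomputable def phaseFn (τ : ℝ) : ℝ := τ * Real.log τ - τ + 1

theorem hasDerivAt_phaseFn {τ : ℝ} (hτ : τ ≠ 0) : HasDerivAt phaseFn (Real.log τ) τ := by
  have := (((hasDerivAt_id τ).mul (Real.hasDerivAt_log hτ)).sub (hasDerivAt_id τ)).add_const (1 : ℝ)
  refine this.congr_deriv ?_
  simp only [id]
  field_simp
  ring

theorem continuous_phaseFn : Continuous phaseFn := by
  unfold phaseFn
  exact (Real.continuous_mul_log.sub continuous_id).add continuous_const

/-- In the application `l = π n²` and `τ = t / (2π n²)`. -/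
noncomputable def oscKernel (l τ : ℝ) : ℂ := Complex.exp ((l * phaseFn τ : ℝ) * Complex.I)

theorem norm_oscKernel (l τ : ℝ) : ‖oscKernel l τ‖ = 1 := Complex.norm_exp_ofReal_mul_I _

theorem continuous_oscKernel (l : ℝ) : Continuous (oscKernel l) := by
  unfold oscKernel
  have := continuous_phaseFn
  fun_prop

theorem log_ne_zero_of_notMem {a b τ : ℝ} (ha : 0 < a) (h : b < 1 ∨ 1 < a) (hτ : τ ∈ Set.Icc a b) :
    Real.log τ ≠ 0 := by
  have h0 : 0 < τ := ha.trans_le hτ.1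
  refine Real.log_ne_zero_of_pos_of_ne_one h0 ?_
  rcases h with h | h
  · exact (hτ.2.trans_lt h).ne
  · exact (h.trans_le hτ.1).ne'

/-- First derivative test: the phase has derivative `l log τ`, which does not vanish away from `τ =
1`, and `1 / log τ` is monotone there. -/
theorem norm_integral_oscKernel_le {l a b : ℝ} (hl : 0 < l) (ha : 0 < a) (hab : a ≤ b)
    (h : b < 1 ∨ 1 < a) :
    ‖∫ τ in a..b, oscKernel l τ‖ ≤ 2 / l * (1 / |Real.log a| + 1 / |Real.log b|) := by
  have hlog := fun τ (hτ : τ ∈ Set.Icc a b) => log_ne_zero_of_notMem ha h hτ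
  have hne : ∀ τ ∈ Set.Icc a b, τ ≠ 0 := fun τ hτ => (ha.trans_le hτ.1).ne'
  have hcl : ContinuousOn Real.log (Set.Icc a b) := Real.continuousOn_log.mono hne
  have := norm_integral_exp_mul_le_of_monotone (φ := fun τ => l * phaseFn τ)
    (φ' := fun τ => l * Real.log τ) (g := fun τ => (Real.log τ)⁻¹ / l)
    (g' := fun τ => -τ⁻¹ / Real.log τ ^ 2 / l) hab
    (fun τ hτ => (hasDerivAt_phaseFn (hne τ hτ)).const_mul l)
    (fun τ hτ => ((Real.hasDerivAt_log (hne τ hτ)).inv (hlog τ hτ)).div_const l)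
    (continuousOn_const.mul hcl)
    (((continuousOn_inv₀.mono hne).neg.div (hcl.pow 2) (fun τ hτ => pow_ne_zero 2 (hlog τ hτ))).div_const l)
    (Or.inr fun τ hτ => by
      have : 0 < τ := ha.trans_le hτ.1
      rw [neg_div, neg_div]
      exact neg_nonpos.mpr (by positivity))
  have e : ∫ τ in a..b, oscKernel l τ = ∫ τ in a..b, Complex.exp (((l * phaseFn τ : ℝ) : ℂ) * Complex.I) *
      ((l * Real.log τ * ((Real.log τ)⁻¹ / l) : ℝ) : ℂ) := by
    refine intervalIntegral.integral_congr fun τ hτ => ?_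
    rw [Set.uIcc_of_le hab] at hτ
    have : l * Real.log τ * ((Real.log τ)⁻¹ / l) = 1 := by
      have := hlog τ hτ
      field_simp
    simp only [this, Complex.ofReal_one, mul_one]
    rfl
  rw [e]
  refine this.trans (le_of_eq ?_)
  rw [abs_div, abs_div, abs_inv, abs_inv, abs_of_pos hl]
  field_simp

/-- The boundary expansion of the oscillatory integral away from its critical point. -/
theorem norm_integral_oscKernel_sub_boundary_le {l a b : ℝ} (hl : 0 < l) (ha : 1 / 4 ≤ a) (hab : a ≤ b)
    (h : b < 1 ∨ 1 < a) :
    ‖(∫ τ in a..b, oscKernel l τ) - (oscKernel l b / (Complex.I * l * Real.log b) -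
      oscKernel l a / (Complex.I * l * Real.log a))‖ ≤
      2 / l ^ 2 * (1 / (a * |Real.log a| ^ 3) + 1 / (b * |Real.log b| ^ 3)) := by
  have ha0 : 0 < a := by linarith
  have hI : Set.uIcc a b = Set.Icc a b := Set.uIcc_of_le hab
  have hlog := fun τ (hτ : τ ∈ Set.Icc a b) => log_ne_zero_of_notMem ha0 h hτ
  have hne : ∀ τ ∈ Set.Icc a b, τ ≠ 0 := fun τ hτ => (ha0.trans_le hτ.1).ne'
  have hcl : ContinuousOn Real.log (Set.Icc a b) := Real.continuousOn_log.mono hne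
  have hlogC : ∀ τ ∈ Set.Icc a b, ((Real.log τ : ℝ) : ℂ) ≠ 0 := fun τ hτ => by exact_mod_cast hlog τ hτ
  have hlC : (l : ℂ) ≠ 0 := by exact_mod_cast hl.ne'
  -- One integration by parts: the boundary function has derivative equal to the kernel minus a
  -- remainder with weight `τ⁻¹ / log² τ`. The remainder is again handled by the first derivative
  -- test, with `g = 1 / (l τ log³ τ)`.
  have hder : ∀ τ ∈ Set.Icc a b, HasDerivAt (fun τ => oscKernel l τ / (Complex.I * l * Real.log τ))
      (oscKernel l τ - oscKernel l τ * ((τ⁻¹ / Real.log τ ^ 2 : ℝ) : ℂ) / (Complex.I * l)) τ := by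
    intro τ hτ
    have e1 : HasDerivAt (oscKernel l) (oscKernel l τ * ((l * Real.log τ : ℝ) * Complex.I)) τ :=
      ((((hasDerivAt_phaseFn (hne τ hτ)).const_mul l).ofReal_comp).mul_const Complex.I).cexp
    have e2 : HasDerivAt (fun τ : ℝ => Complex.I * l * (Real.log τ : ℂ)) (Complex.I * l * ((τ⁻¹ : ℝ) : ℂ)) τ :=
      ((Real.hasDerivAt_log (hne τ hτ)).ofReal_comp).const_mul _
    have e3 := e1.div e2 (mul_ne_zero (mul_ne_zero Complex.I_ne_zero hlC) (hlogC τ hτ))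
    refine e3.congr_deriv ?_
    have h1 := hlogC τ hτ
    have h2 : (τ : ℂ) ≠ 0 := by exact_mod_cast hne τ hτ
    have h3 := Complex.I_ne_zero
    push_cast
    field_simp
  have hcont2 : ContinuousOn (fun τ => oscKernel l τ * ((τ⁻¹ / Real.log τ ^ 2 : ℝ) : ℂ)) (Set.Icc a b) :=
    (continuous_oscKernel l).continuousOn.mul (Complex.continuous_ofReal.comp_continuousOn
      ((continuousOn_inv₀.mono hne).div (hcl.pow 2) (fun τ hτ => pow_ne_zero 2 (hlog τ hτ))))
  have hftc := intervalIntegral.integral_eq_sub_of_hasDerivAt (a := a) (b := b)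
    (by rw [hI]; exact hder) (ContinuousOn.intervalIntegrable (by
      rw [hI]
      exact (continuous_oscKernel l).continuousOn.sub (hcont2.div_const _)))
  rw [intervalIntegral.integral_sub ((continuous_oscKernel l).intervalIntegrable _ _)
    (ContinuousOn.intervalIntegrable (by rw [hI]; exact hcont2.div_const _)),
    intervalIntegral.integral_div] at hftc
  have hdiff : (∫ τ in a..b, oscKernel l τ) - (oscKernel l b / (Complex.I * l * Real.log b) -
      oscKernel l a / (Complex.I * l * Real.log a)) =
      (∫ τ in a..b, oscKernel l τ * ((τ⁻¹ / Real.log τ ^ 2 : ℝ) : ℂ)) / (Complex.I * l) := by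
    rw [← hftc]; ring
  -- The function `1 / (τ log³ τ)` is decreasing as long as `log τ + 3 ≥ 0`; the assumption `1/4 ≤
  -- a` secures this.
  have hlogge : ∀ τ ∈ Set.Icc a b, -2 < Real.log τ := fun τ hτ => by
    have h0 : 0 < τ := ha0.trans_le hτ.1
    have h1 : (1 / 4 : ℝ) ≤ τ := ha.trans hτ.1
    have h2 := Real.log_le_log (by norm_num) h1
    have h3 : Real.log (1 / 4) = -(2 * Real.log 2) := by
      rw [one_div, Real.log_inv, show (4 : ℝ) = 2 ^ 2 by norm_num, Real.log_pow]; norm_num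
    have h4 := Real.log_two_lt_d9
    linarith
  have hmain := norm_integral_exp_mul_le_of_monotone (φ := fun τ => l * phaseFn τ)
    (φ' := fun τ => l * Real.log τ) (g := fun τ => (τ * Real.log τ ^ 3)⁻¹ / l)
    (g' := fun τ => -(Real.log τ ^ 2 * (Real.log τ + 3)) / (τ * Real.log τ ^ 3) ^ 2 / l) hab
    (fun τ hτ => (hasDerivAt_phaseFn (hne τ hτ)).const_mul l)
    (fun τ hτ => by
      have h1 := (hasDerivAt_id τ).mul ((Real.hasDerivAt_log (hne τ hτ)).pow 3)
      have h2 := h1.inv (mul_ne_zero (hne τ hτ) (pow_ne_zero 3 (hlog τ hτ)))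
      have h3 := h2.div_const l
      refine h3.congr_deriv ?_
      have := hne τ hτ
      simp only [id, Pi.mul_apply, Pi.pow_apply]
      congr 3
      field_simp
      norm_num
      ring)
    (continuousOn_const.mul hcl)
    ((((hcl.pow 2).mul (hcl.add continuousOn_const)).neg.div ((continuousOn_id.mul (hcl.pow 3)).pow 2)
      (fun τ hτ => pow_ne_zero 2 (mul_ne_zero (hne τ hτ) (pow_ne_zero 3 (hlog τ hτ))))).div_const l)
    (Or.inr fun τ hτ => by
      have h1 : 0 ≤ Real.log τ + 3 := by linarith [hlogge τ hτ]
      rw [neg_div, neg_div]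
      exact neg_nonpos.mpr (by positivity))
  have e : ∫ τ in a..b, oscKernel l τ * ((τ⁻¹ / Real.log τ ^ 2 : ℝ) : ℂ) =
      ∫ τ in a..b, Complex.exp (((l * phaseFn τ : ℝ) : ℂ) * Complex.I) *
        ((l * Real.log τ * ((τ * Real.log τ ^ 3)⁻¹ / l) : ℝ) : ℂ) := by
    refine intervalIntegral.integral_congr fun τ hτ => ?_
    rw [hI] at hτ
    have : l * Real.log τ * ((τ * Real.log τ ^ 3)⁻¹ / l) = τ⁻¹ / Real.log τ ^ 2 := by
      have := hlog τ hτ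
      have := hne τ hτ
      field_simp
    simp only [this]
    rfl
  rw [hdiff, e, norm_div, norm_mul, Complex.norm_I, one_mul, Complex.norm_real, Real.norm_eq_abs,
    abs_of_pos hl, div_le_iff₀ hl]
  refine hmain.trans (le_of_eq ?_)
  have hb0 : 0 < b := ha0.trans_le hab
  simp only [abs_div, abs_inv, abs_mul, abs_pow, abs_of_pos hl, abs_of_pos ha0, abs_of_pos hb0]
  field_simp

theorem norm_integral_oscKernel_le_length (l a b : ℝ) : ‖∫ τ in a..b, oscKernel l τ‖ ≤ |b - a| := by
  have := intervalIntegral.norm_integral_le_of_norm_le_const (a := a) (b := b) (C := 1)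
    (f := oscKernel l) (fun τ _ => (norm_oscKernel l τ).le)
  simpa using this

theorem log_four_gt_one : 1 < Real.log 4 := by
  have : Real.log 4 = 2 * Real.log 2 := by
    rw [show (4 : ℝ) = 2 ^ 2 by norm_num, Real.log_pow]; norm_num
  linarith [Real.log_two_gt_d9]

/-- Cut at `1/l`: the trivial bound on `[0, 1/l]` and the first derivative test on `[1/l, 1/4]`,
where `|log τ| ≥ log 4 > 1`. For `l ≤ 4` the length of the interval is already small enough. -/
theorem norm_integral_oscKernel_zero_quarter_le {l : ℝ} (hl : 1 ≤ l) :
    ‖∫ τ in (0 : ℝ)..(1 / 4), oscKernel l τ‖ ≤ 5 / l := by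
  have hl0 : 0 < l := by linarith
  have h4 := log_four_gt_one
  have hq : |Real.log (1 / 4)| = Real.log 4 := by
    rw [one_div, Real.log_inv, abs_neg, abs_of_pos (by linarith)]
  have hc := fun a b => (continuous_oscKernel l).intervalIntegrable (μ := MeasureTheory.volume) a b
  rcases le_or_gt l 4 with h | h
  · refine (norm_integral_oscKernel_le_length _ _ _).trans ?_
    rw [sub_zero, abs_of_pos (by norm_num), le_div_iff₀ hl0]
    linarith
  · have hlq : 1 / l ≤ 1 / 4 := one_div_le_one_div_of_le (by norm_num) h.le
    have h1 := norm_integral_oscKernel_le (l := l) hl0 (a := 1 / l) (b := 1 / 4) (by positivity) hlq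
      (Or.inl (by norm_num))
    have h2 := norm_integral_oscKernel_le_length l 0 (1 / l)
    rw [← intervalIntegral.integral_add_adjacent_intervals (hc 0 (1 / l)) (hc (1 / l) (1 / 4))]
    refine (norm_add_le _ _).trans ?_
    have h3 : 1 / |Real.log (1 / l)| ≤ 1 := by
      rw [one_div l, Real.log_inv, abs_neg]
      have : Real.log 4 ≤ Real.log l := Real.log_le_log (by norm_num) h.le
      rw [abs_of_pos (by linarith), div_le_one (by linarith)]
      linarith
    have h5 : 1 / |Real.log (1 / 4)| ≤ 1 := by
      rw [hq, div_le_one (by linarith)]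
      exact h4.le
    rw [sub_zero, abs_of_pos (by positivity)] at h2
    have h6 : 2 / l * (1 / |Real.log (1 / l)| + 1 / |Real.log (1 / 4)|) ≤ 2 / l * (1 + 1) := by gcongr
    have h7 : 5 / l = 1 / l + 2 / l * (1 + 1) := by field_simp; norm_num
    rw [h7]
    linarith

theorem abs_log_ge_one_sub {τ : ℝ} (h0 : 0 < τ) (h1 : τ < 1) : 1 - τ ≤ |Real.log τ| := by
  rw [abs_of_neg (Real.log_neg h0 h1)]
  linarith [Real.log_le_sub_one_of_pos h0]

theorem abs_log_ge_sub_one_div {τ : ℝ} (h1 : 1 < τ) (h4 : τ ≤ 4) : (τ - 1) / 4 ≤ |Real.log τ| := by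
  rw [abs_of_pos (Real.log_pos h1)]
  have h2 := Real.one_sub_inv_le_log_of_pos (show 0 < τ by linarith)
  have h3 : (τ - 1) / 4 ≤ 1 - τ⁻¹ := by
    have : 1 - τ⁻¹ = (τ - 1) / τ := by field_simp
    rw [this]
    exact div_le_div_of_nonneg_left (by linarith) (by linarith) h4
  linarith

theorem norm_oscKernel_div_le {l τ : ℝ} (hl : 0 < l) (h : 1 ≤ |Real.log τ|) :
    ‖oscKernel l τ / (Complex.I * l * Real.log τ)‖ ≤ 1 / l := by
  rw [norm_div, norm_oscKernel, norm_mul, norm_mul, Complex.norm_I, one_mul, Complex.norm_real,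
    Complex.norm_real, Real.norm_eq_abs, Real.norm_eq_abs, abs_of_pos hl]
  exact one_div_le_one_div_of_le hl (by nlinarith)

theorem intervalIntegrable_oscKernel (l a b : ℝ) :
    IntervalIntegrable (oscKernel l) MeasureTheory.volume a b :=
  (continuous_oscKernel l).intervalIntegrable _ _

theorem abs_log_quarter : |Real.log (1 / 4)| = Real.log 4 := by
  rw [one_div, Real.log_inv, abs_neg, abs_of_pos (by linarith [log_four_gt_one])]

/-- The oscillatory integral up to a point before the critical point. -/
theorem norm_integral_oscKernel_sub_le_of_lt_one {l X : ℝ} (hl : 1 ≤ l) (hX : 1 / 4 ≤ X) (hX1 : X < 1) :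
    ‖(∫ τ in (0 : ℝ)..X, oscKernel l τ) - oscKernel l X / (Complex.I * l * Real.log X)‖ ≤
      20 * (1 / l + 1 / (l ^ 2 * (1 - X) ^ 3)) := by
  have hl0 : 0 < l := by linarith
  have h4 := log_four_gt_one
  have hX1' : 0 < 1 - X := by linarith
  have e1 := norm_integral_oscKernel_zero_quarter_le hl
  have e2 := norm_integral_oscKernel_sub_boundary_le hl0 (le_refl (1 / 4)) hX (Or.inl hX1)
  have e3 : ‖oscKernel l (1 / 4) / (Complex.I * l * Real.log (1 / 4))‖ ≤ 1 / l :=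
    norm_oscKernel_div_le hl0 (by rw [abs_log_quarter]; exact h4.le)
  rw [abs_log_quarter] at e2
  rw [← intervalIntegral.integral_add_adjacent_intervals (intervalIntegrable_oscKernel l 0 (1 / 4))
    (intervalIntegrable_oscKernel l (1 / 4) X)]
  have e4 : 1 / (1 / 4 * Real.log 4 ^ 3) ≤ 4 := by
    rw [div_le_iff₀ (by positivity)]
    have : 1 ≤ Real.log 4 ^ 3 := one_le_pow₀ h4.le
    linarith
  have e5 : 1 / (X * |Real.log X| ^ 3) ≤ 4 / (1 - X) ^ 3 := by
    have h5 := abs_log_ge_one_sub (by linarith) hX1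
    rw [div_le_div_iff₀ (by have : 0 < |Real.log X| := by linarith
                            positivity) (by positivity)]
    have h6 : (1 - X) ^ 3 ≤ |Real.log X| ^ 3 := pow_le_pow_left₀ hX1'.le h5 3
    have : 1 / 4 * |Real.log X| ^ 3 ≤ X * |Real.log X| ^ 3 := by gcongr
    linarith
  have e6 : 2 / l ^ 2 * (1 / (1 / 4 * Real.log 4 ^ 3) + 1 / (X * |Real.log X| ^ 3)) ≤
      8 * (1 / l) + 8 * (1 / (l ^ 2 * (1 - X) ^ 3)) := by
    calc _ ≤ 2 / l ^ 2 * (4 + 4 / (1 - X) ^ 3) := by gcongr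
      _ = 8 * (1 / l ^ 2) + 8 * (1 / (l ^ 2 * (1 - X) ^ 3)) := by field_simp; ring
      _ ≤ _ := by
        have : 1 / l ^ 2 ≤ 1 / l := one_div_le_one_div_of_le hl0 (by nlinarith)
        linarith
  have e7 : 0 ≤ 1 / (l ^ 2 * (1 - X) ^ 3) := by positivity
  have e8 : 5 / l = 5 * (1 / l) := by ring
  set A := ∫ τ in (0 : ℝ)..(1 / 4), oscKernel l τ
  set B := ∫ τ in (1 / 4 : ℝ)..X, oscKernel l τ
  set P := oscKernel l (1 / 4) / (Complex.I * l * Real.log (1 / 4))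
  set Q := oscKernel l X / (Complex.I * l * Real.log X)
  calc ‖A + B - Q‖ = ‖A + (B - (Q - P)) - P‖ := by congr 1; ring
    _ ≤ ‖A‖ + ‖B - (Q - P)‖ + ‖P‖ := (norm_sub_le _ _).trans (by gcongr; exact norm_add_le _ _)
    _ ≤ _ := by
      have : 0 ≤ 1 / l := by positivity
      linarith

/-- The oscillatory integral beyond the critical point. -/
theorem norm_integral_oscKernel_sub_le_of_one_lt {l X : ℝ} (hl : 1 ≤ l) (hX : 1 < X) (hX4 : X ≤ 4) :
    ‖(∫ τ in (0 : ℝ)..X, oscKernel l τ) - (∫ τ in (0 : ℝ)..4, oscKernel l τ) -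
      oscKernel l X / (Complex.I * l * Real.log X)‖ ≤
      200 * (1 / l + 1 / (l ^ 2 * (X - 1) ^ 3)) := by
  have hl0 : 0 < l := by linarith
  have h4 := log_four_gt_one
  have hX1' : 0 < X - 1 := by linarith
  have h4' : |Real.log 4| = Real.log 4 := abs_of_pos (by linarith)
  have e2 := norm_integral_oscKernel_sub_boundary_le hl0 (show 1 / 4 ≤ X by linarith) hX4 (Or.inr hX)
  have e3 : ‖oscKernel l 4 / (Complex.I * l * Real.log 4)‖ ≤ 1 / l :=
    norm_oscKernel_div_le hl0 (by rw [h4']; exact h4.le)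
  rw [h4'] at e2
  rw [← intervalIntegral.integral_add_adjacent_intervals (intervalIntegrable_oscKernel l 0 X)
    (intervalIntegrable_oscKernel l X 4)]
  have e4 : 1 / (4 * Real.log 4 ^ 3) ≤ 4 := by
    rw [div_le_iff₀ (by positivity)]
    have : 1 ≤ Real.log 4 ^ 3 := one_le_pow₀ h4.le
    linarith
  have e5 : 1 / (X * |Real.log X| ^ 3) ≤ 64 / (X - 1) ^ 3 := by
    have h5 := abs_log_ge_sub_one_div hX hX4
    rw [div_le_div_iff₀ (by have : 0 < |Real.log X| := by linarith
                            positivity) (by positivity)]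
    have h6 : ((X - 1) / 4) ^ 3 ≤ |Real.log X| ^ 3 := pow_le_pow_left₀ (by positivity) h5 3
    have : 1 * |Real.log X| ^ 3 ≤ X * |Real.log X| ^ 3 := by gcongr
    have h7 : ((X - 1) / 4) ^ 3 = (X - 1) ^ 3 / 64 := by ring
    linarith
  have e6 : 2 / l ^ 2 * (1 / (X * |Real.log X| ^ 3) + 1 / (4 * Real.log 4 ^ 3)) ≤
      8 * (1 / l) + 128 * (1 / (l ^ 2 * (X - 1) ^ 3)) := by
    calc _ ≤ 2 / l ^ 2 * (64 / (X - 1) ^ 3 + 4) := by gcongr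
      _ = 8 * (1 / l ^ 2) + 128 * (1 / (l ^ 2 * (X - 1) ^ 3)) := by field_simp; ring
      _ ≤ _ := by
        have : 1 / l ^ 2 ≤ 1 / l := one_div_le_one_div_of_le hl0 (by nlinarith)
        linarith
  have e7 : 0 ≤ 1 / (l ^ 2 * (X - 1) ^ 3) := by positivity
  set A := ∫ τ in (0 : ℝ)..X, oscKernel l τ
  set B := ∫ τ in X..4, oscKernel l τ
  set P := oscKernel l 4 / (Complex.I * l * Real.log 4)
  set Q := oscKernel l X / (Complex.I * l * Real.log X)
  calc ‖A - (A + B) - Q‖ = ‖-(B - (P - Q)) - P‖ := by congr 1; ring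
    _ ≤ ‖-(B - (P - Q))‖ + ‖P‖ := norm_sub_le _ _
    _ = ‖B - (P - Q)‖ + ‖P‖ := by rw [norm_neg]
    _ ≤ _ := by
      have : 0 ≤ 1 / l := by positivity
      linarith

theorem norm_integral_oscKernel_sub_le_of_four_le {l X : ℝ} (hl : 1 ≤ l) (hX4 : 4 ≤ X) :
    ‖(∫ τ in (0 : ℝ)..X, oscKernel l τ) - (∫ τ in (0 : ℝ)..4, oscKernel l τ)‖ ≤ 4 / l := by
  have hl0 : 0 < l := by linarith
  have h4 := log_four_gt_one
  have hlX : Real.log 4 ≤ Real.log X := Real.log_le_log (by norm_num) hX4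
  rw [← intervalIntegral.integral_add_adjacent_intervals (intervalIntegrable_oscKernel l 0 4)
    (intervalIntegrable_oscKernel l 4 X), add_sub_cancel_left]
  refine (norm_integral_oscKernel_le hl0 (by norm_num) hX4 (Or.inr (by norm_num))).trans ?_
  rw [abs_of_pos (by linarith), abs_of_pos (by linarith)]
  have e1 : 1 / Real.log 4 ≤ 1 := by rw [div_le_one (by linarith)]; linarith
  have e2 : 1 / Real.log X ≤ 1 := by rw [div_le_one (by linarith)]; linarith
  calc 2 / l * (1 / Real.log 4 + 1 / Real.log X) ≤ 2 / l * (1 + 1) := by gcongr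
    _ = 4 / l := by ring

/-- With `δ = K/√l`, the part within `δ` of the critical point is bounded by its length, and up to
`1 - δ` the first derivative test costs `O(1/l + 1/(lδ)) = O(δ)`. If `δ ≥ 3/4`, the length alone
suffices. -/
theorem norm_integral_oscKernel_le_of_near {l X K : ℝ} (hl : 1 ≤ l) (hK : 1 ≤ K) (hX0 : 0 ≤ X)
    (hX : |X - 1| ≤ K / √l) : ‖∫ τ in (0 : ℝ)..X, oscKernel l τ‖ ≤ 20 * K / √l := by
  have hl0 : 0 < l := by linarith
  have hsl : 1 ≤ √l := Real.one_le_sqrt.mpr hl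
  have hss : √l * √l = l := Real.mul_self_sqrt hl0.le
  set δ := K / √l with hδ
  have hδ0 : 0 < δ := by positivity
  have hKδ : 20 * K / √l = 20 * δ := by rw [hδ]; ring
  rw [hKδ]
  have hX' := abs_le.mp hX
  rcases le_or_gt (3 / 4) δ with h | h
  · refine (norm_integral_oscKernel_le_length _ _ _).trans ?_
    rw [sub_zero, abs_of_nonneg hX0]
    linarith
  · have e1 := norm_integral_oscKernel_zero_quarter_le hl
    have e2 := norm_integral_oscKernel_le hl0 (by norm_num : (0 : ℝ) < 1 / 4) (show 1 / 4 ≤ 1 - δ by linarith)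
      (Or.inl (by linarith))
    have e3 := norm_integral_oscKernel_le_length l (1 - δ) X
    rw [← intervalIntegral.integral_add_adjacent_intervals (intervalIntegrable_oscKernel l 0 (1 - δ))
      (intervalIntegrable_oscKernel l (1 - δ) X),
      ← intervalIntegral.integral_add_adjacent_intervals (intervalIntegrable_oscKernel l 0 (1 / 4))
      (intervalIntegrable_oscKernel l (1 / 4) (1 - δ))]
    have e4 : |X - (1 - δ)| ≤ 2 * δ := by rw [abs_le]; constructor <;> linarith
    have e5 : 1 / |Real.log (1 - δ)| ≤ 1 / δ := by
      have := abs_log_ge_one_sub (τ := 1 - δ) (by linarith) (by linarith)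
      exact one_div_le_one_div_of_le hδ0 (by linarith)
    have e6 : 1 / |Real.log (1 / 4)| ≤ 1 := by
      rw [abs_log_quarter, div_le_one (by linarith [log_four_gt_one])]
      exact log_four_gt_one.le
    have e7 : 1 / l ≤ δ := by
      rw [hδ, div_le_div_iff₀ hl0 (by positivity)]
      nlinarith
    have e8 : 1 / l * (1 / δ) ≤ δ := by
      have : 1 / l * (1 / δ) = √l / (l * K) := by rw [hδ]; field_simp
      rw [this, hδ, div_le_div_iff₀ (by positivity) (by positivity), hss]
      have : 1 ≤ K * K := by nlinarith
      nlinarith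
    have e9 : 2 / l * (1 / |Real.log (1 / 4)| + 1 / |Real.log (1 - δ)|) ≤ 2 * (1 / l) + 2 * (1 / l * (1 / δ)) := by
      calc _ ≤ 2 / l * (1 + 1 / δ) := by gcongr
        _ = _ := by ring
    have e10 : 5 / l = 5 * (1 / l) := by ring
    refine (norm_add_le _ _).trans ((add_le_add_left (norm_add_le _ _) _).trans ?_)
    linarith

/-! ### Smooth normal form of the phase at its critical point. -/

/-- `z log z - z + 1`, the complex version of `phaseFn`. -/
noncomputable def phaseFnC (z : ℂ) : ℂ := z * Complex.log z - z + 1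

/-- This is `phaseFnC z / (z - 1)²` with its removable singularity filled in, since `phaseFnC` and
its derivative vanish at `1`. Working over `ℂ` gives its smoothness on the real half-line for free.
-/
noncomputable def phaseQuot (z : ℂ) : ℂ := dslope (dslope phaseFnC 1) 1 z

/-- The prime denotes the divided difference of `phaseQuot` at `1`, not its derivative. -/
noncomputable def phaseQuot' (z : ℂ) : ℂ := dslope phaseQuot 1 z

theorem isOpen_re_pos : IsOpen {z : ℂ | 0 < z.re} := isOpen_lt continuous_const Complex.continuous_re

theorem re_pos_mem_nhds_one : {z : ℂ | 0 < z.re} ∈ nhds (1 : ℂ) := isOpen_re_pos.mem_nhds (by simp)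

theorem hasDerivAt_phaseFnC {z : ℂ} (hz : 0 < z.re) : HasDerivAt phaseFnC (Complex.log z) z := by
  have hz' : z ∈ Complex.slitPlane := Or.inl hz
  have := (((hasDerivAt_id z).mul (Complex.hasDerivAt_log hz')).sub (hasDerivAt_id z)).add_const (1 : ℂ)
  refine this.congr_deriv ?_
  have : z ≠ 0 := Complex.slitPlane_ne_zero hz'
  simp only [id]
  field_simp
  ring

theorem differentiableOn_phaseQuot : DifferentiableOn ℂ phaseQuot {z : ℂ | 0 < z.re} := by
  refine (Complex.differentiableOn_dslope re_pos_mem_nhds_one).mpr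
    ((Complex.differentiableOn_dslope re_pos_mem_nhds_one).mpr fun z hz => ?_)
  exact (hasDerivAt_phaseFnC hz).differentiableAt.differentiableWithinAt

theorem differentiableOn_phaseQuot' : DifferentiableOn ℂ phaseQuot' {z : ℂ | 0 < z.re} :=
  (Complex.differentiableOn_dslope re_pos_mem_nhds_one).mpr differentiableOn_phaseQuot

theorem phaseFnC_eq (z : ℂ) : phaseFnC z = (z - 1) ^ 2 * phaseQuot z := by
  have h0 : phaseFnC 1 = 0 := by simp [phaseFnC]
  have h1 : dslope phaseFnC 1 1 = 0 := by
    rw [dslope_same, (hasDerivAt_phaseFnC (by simp)).deriv, Complex.log_one]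
  have e1 := sub_smul_dslope phaseFnC 1 z
  have e2 := sub_smul_dslope (dslope phaseFnC 1) 1 z
  rw [h0, sub_zero, smul_eq_mul] at e1
  rw [h1, sub_zero, smul_eq_mul] at e2
  rw [← e1, ← e2]
  unfold phaseQuot
  ring

/-- Differentiate `phaseFnC z = (z - 1)² phaseQuot z`; the derivative of `phaseFnC` is `log`. -/
theorem log_eq_phaseQuot {z : ℂ} (hz : 0 < z.re) :
    Complex.log z = (z - 1) * (2 * phaseQuot z + (z - 1) * deriv phaseQuot z) := by
  have hd : HasDerivAt phaseQuot (deriv phaseQuot z) z :=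
    (differentiableOn_phaseQuot.differentiableAt (isOpen_re_pos.mem_nhds hz)).hasDerivAt
  have h1 := (((hasDerivAt_id z).sub_const (1 : ℂ)).pow 2).mul hd
  have h2 := hasDerivAt_phaseFnC hz
  have h3 : phaseFnC = (fun z => id z - 1) ^ 2 * phaseQuot := by
    ext w
    simp [phaseFnC_eq]
  rw [h3] at h2
  rw [h2.unique h1]
  simp
  ring

/-- As `z → 1` the factorization of the logarithm gives `log z / (z - 1) → 2 phaseQuot 1`, while the
limit is the derivative of `log` at `1`. -/
theorem phaseQuot_one : phaseQuot 1 = 1 / 2 := by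
  have h1 : Tendsto (fun z : ℂ => 2 * phaseQuot z + (z - 1) * deriv phaseQuot z) (nhdsWithin 1 {1}ᶜ)
      (nhds (2 * phaseQuot 1 + (1 - 1) * deriv phaseQuot 1)) := by
    have hc : ContinuousAt phaseQuot 1 :=
      (differentiableOn_phaseQuot.differentiableAt re_pos_mem_nhds_one).continuousAt
    have hc' : ContinuousAt (deriv phaseQuot) 1 :=
      ((differentiableOn_phaseQuot.deriv isOpen_re_pos).differentiableAt re_pos_mem_nhds_one).continuousAt
    have : ContinuousAt (fun z : ℂ => 2 * phaseQuot z + (z - 1) * deriv phaseQuot z) 1 := by fun_prop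
    exact this.tendsto.mono_left nhdsWithin_le_nhds
  have h2 : Tendsto (slope Complex.log 1) (nhdsWithin 1 {1}ᶜ) (nhds 1) := by
    have := (Complex.hasDerivAt_log (z := 1) (by simp))
    rw [inv_one, hasDerivAt_iff_tendsto_slope] at this
    exact this
  have h3 : (fun z : ℂ => 2 * phaseQuot z + (z - 1) * deriv phaseQuot z) =ᶠ[nhdsWithin 1 {1}ᶜ]
      slope Complex.log 1 := by
    filter_upwards [mem_nhdsWithin_of_mem_nhds re_pos_mem_nhds_one, self_mem_nhdsWithin] with z hz hz1
    rw [slope_def_field, Complex.log_one, sub_zero, log_eq_phaseQuot hz,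
      mul_div_cancel_left₀ _ (sub_ne_zero.mpr hz1)]
  have := tendsto_nhds_unique (h1.congr' h3) h2
  rw [sub_self, zero_mul, add_zero] at this
  linear_combination this / 2

theorem phaseFn_pos {τ : ℝ} (h0 : 0 < τ) (h1 : τ ≠ 1) : 0 < phaseFn τ := by
  have h := Real.log_lt_sub_one_of_pos (inv_pos.mpr h0) (by simpa using h1)
  rw [Real.log_inv] at h
  have h2 : τ * τ⁻¹ = 1 := mul_inv_cancel₀ h0.ne'
  unfold phaseFn
  nlinarith

theorem phaseFnC_ofReal {τ : ℝ} (h0 : 0 ≤ τ) : phaseFnC τ = (phaseFn τ : ℂ) := by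
  unfold phaseFnC phaseFn
  push_cast
  rw [Complex.ofReal_log h0]

/-- Real smooth versions of the quotients. -/
noncomputable def phaseK (τ : ℝ) : ℝ := (phaseQuot τ).re

noncomputable def phaseK3 (τ : ℝ) : ℝ := (phaseQuot' τ).re

theorem contDiffOn_re_comp_ofReal {f : ℂ → ℂ} (hf : DifferentiableOn ℂ f {z : ℂ | 0 < z.re}) :
    ContDiffOn ℝ 2 (fun τ : ℝ => (f τ).re) (Set.Ioi 0) := by
  have h1 : ContDiffOn ℝ 2 f {z : ℂ | 0 < z.re} := (hf.contDiffOn isOpen_re_pos).restrict_scalars ℝ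
  have h2 : ContDiffOn ℝ 2 (fun τ : ℝ => f τ) (Set.Ioi 0) :=
    h1.comp Complex.ofRealCLM.contDiff.contDiffOn (fun τ hτ => by simpa using hτ)
  exact Complex.reCLM.contDiff.comp_contDiffOn h2

theorem contDiffOn_phaseK : ContDiffOn ℝ 2 phaseK (Set.Ioi 0) :=
  contDiffOn_re_comp_ofReal differentiableOn_phaseQuot

theorem contDiffOn_phaseK3 : ContDiffOn ℝ 2 phaseK3 (Set.Ioi 0) :=
  contDiffOn_re_comp_ofReal differentiableOn_phaseQuot'

theorem phaseFn_eq_phaseK {τ : ℝ} (h0 : 0 < τ) : phaseFn τ = (τ - 1) ^ 2 * phaseK τ := by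
  have := congrArg Complex.re (phaseFnC_eq τ)
  rw [phaseFnC_ofReal h0.le, Complex.ofReal_re,
    show ((τ : ℂ) - 1) ^ 2 = (((τ - 1) ^ 2 : ℝ) : ℂ) by push_cast; ring, Complex.re_ofReal_mul] at this
  exact this

theorem phaseK_one : phaseK 1 = 1 / 2 := by
  unfold phaseK
  rw [Complex.ofReal_one, phaseQuot_one]
  norm_num

theorem phaseK_pos {τ : ℝ} (h0 : 0 < τ) : 0 < phaseK τ := by
  rcases eq_or_ne τ 1 with rfl | h1
  · rw [phaseK_one]; norm_num
  · have h2 := phaseFn_pos h0 h1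
    rw [phaseFn_eq_phaseK h0] at h2
    exact (mul_pos_iff_of_pos_left (by have := sub_ne_zero.mpr h1; positivity)).mp h2

theorem phaseK_eq (τ : ℝ) : phaseK τ = 1 / 2 + (τ - 1) * phaseK3 τ := by
  have e := sub_smul_dslope phaseQuot 1 (τ : ℂ)
  rw [phaseQuot_one, smul_eq_mul] at e
  have := congrArg Complex.re e
  rw [show ((τ : ℂ) - 1) = ((τ - 1 : ℝ) : ℂ) by push_cast; ring, Complex.re_ofReal_mul, Complex.sub_re] at this
  have h2 : ((1 : ℂ) / 2).re = 1 / 2 := by norm_num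
  rw [h2] at this
  unfold phaseK phaseK3 phaseQuot'
  linarith

theorem hasDerivAt_phaseK {τ : ℝ} (h0 : 0 < τ) : HasDerivAt phaseK (deriv phaseK τ) τ :=
  ((contDiffOn_phaseK.differentiableOn (by norm_num)).differentiableAt (Ioi_mem_nhds h0)).hasDerivAt

theorem log_eq_phaseK {τ : ℝ} (h0 : 0 < τ) :
    Real.log τ = (τ - 1) * (2 * phaseK τ + (τ - 1) * deriv phaseK τ) := by
  have h1 := (((hasDerivAt_id τ).sub_const (1 : ℝ)).pow 2).mul (hasDerivAt_phaseK h0)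
  have h2 := hasDerivAt_phaseFn h0.ne'
  have h3 : phaseFn =ᶠ[nhds τ] (fun z => id z - 1) ^ 2 * phaseK := by
    filter_upwards [Ioi_mem_nhds h0] with w hw
    simpa using phaseFn_eq_phaseK hw
  rw [(h2.congr_of_eventuallyEq h3.symm).unique h1]
  simp
  ring

/-- The expression is `log τ / (τ - 1)`, continued by the value `1` at `τ = 1`, and is positive by
the sign of the logarithm. It is the denominator of `phaseQ`. -/
theorem phaseL_pos {τ : ℝ} (h0 : 0 < τ) : 0 < 2 * phaseK τ + (τ - 1) * deriv phaseK τ := by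
  rcases lt_trichotomy τ 1 with h | rfl | h
  · have h1 := Real.log_neg h0 h
    rw [log_eq_phaseK h0] at h1
    by_contra hc
    have := mul_nonneg_of_nonpos_of_nonpos (show τ - 1 ≤ 0 by linarith) (not_lt.mp hc)
    linarith
  · rw [phaseK_one]; norm_num
  · have h1 := Real.log_pos h
    rw [log_eq_phaseK h0] at h1
    exact (mul_pos_iff_of_pos_left (by linarith)).mp h1

/-- The square root `v` of the phase that is smooth through the critical point. -/
noncomputable def phaseV (τ : ℝ) : ℝ := (τ - 1) * √(phaseK τ)

noncomputable def phaseV' (τ : ℝ) : ℝ := √(phaseK τ) + (τ - 1) * (deriv phaseK τ / (2 * √(phaseK τ)))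

theorem hasDerivAt_phaseV {τ : ℝ} (h0 : 0 < τ) : HasDerivAt phaseV (phaseV' τ) τ := by
  have h1 := ((hasDerivAt_id τ).sub_const (1 : ℝ)).mul ((hasDerivAt_phaseK h0).sqrt (phaseK_pos h0).ne')
  refine h1.congr_deriv ?_
  simp only [id, one_mul]
  rfl

theorem phaseV_sq {τ : ℝ} (h0 : 0 < τ) : phaseV τ ^ 2 = phaseFn τ := by
  unfold phaseV
  rw [mul_pow, Real.sq_sqrt (phaseK_pos h0).le, phaseFn_eq_phaseK h0]

/-- The smooth quotient `(1 - √2 v') / log`. -/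
noncomputable def phaseQ (τ : ℝ) : ℝ :=
  (-(2 * phaseK3 τ) / (1 + √2 * √(phaseK τ)) - √2 * deriv phaseK τ / (2 * √(phaseK τ))) /
    (2 * phaseK τ + (τ - 1) * deriv phaseK τ)

/-- Both `1 - √2 v'` and `log` vanish at `τ = 1`, so their quotient is smooth. The constant
amplitude thus splits into `√2 v'`, which becomes an exact Fresnel integral, and a multiple of `log
τ`, which can be integrated by parts against the kernel. -/
theorem one_sub_phaseV' {τ : ℝ} (h0 : 0 < τ) : 1 - √2 * phaseV' τ = Real.log τ * phaseQ τ := by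
  have hL := (phaseL_pos h0).ne'
  have hk := phaseK_pos h0
  have hs : 0 < √(phaseK τ) := Real.sqrt_pos.mpr hk
  have hs2 : √(phaseK τ) ^ 2 = phaseK τ := Real.sq_sqrt hk.le
  have h2 : √2 ^ 2 = (2 : ℝ) := Real.sq_sqrt (by norm_num)
  have h20 : 0 < √2 := by positivity
  have hk3 := phaseK_eq τ
  rw [log_eq_phaseK h0]
  unfold phaseQ phaseV'
  rw [mul_assoc, mul_div_cancel₀ _ hL]
  -- Rationalize the difference; `phaseK τ - 1/2 = (τ - 1) phaseK3 τ` supplies the factor `τ - 1`.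
  have e1 : 1 - √2 * √(phaseK τ) = (τ - 1) * (-(2 * phaseK3 τ) / (1 + √2 * √(phaseK τ))) := by
    rw [← mul_div_assoc, eq_div_iff (by positivity)]
    have : (1 - √2 * √(phaseK τ)) * (1 + √2 * √(phaseK τ)) = 1 - √2 ^ 2 * √(phaseK τ) ^ 2 := by ring
    rw [this, h2, hs2, hk3]
    ring
  rw [mul_add, mul_sub, ← e1]
  ring

theorem contDiffOn_phaseQ : ContDiffOn ℝ 1 phaseQ (Set.Ioi 0) := by
  have hk := contDiffOn_phaseK.of_le (show (1 : WithTop ℕ∞) ≤ 2 by norm_num)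
  have hk3 := contDiffOn_phaseK3.of_le (show (1 : WithTop ℕ∞) ≤ 2 by norm_num)
  have hd : ContDiffOn ℝ 1 (deriv phaseK) (Set.Ioi 0) :=
    contDiffOn_phaseK.deriv_of_isOpen isOpen_Ioi (by norm_num)
  have hs : ContDiffOn ℝ 1 (fun τ => √(phaseK τ)) (Set.Ioi 0) := hk.sqrt fun τ hτ => (phaseK_pos hτ).ne'
  have hsp : ∀ τ ∈ Set.Ioi (0 : ℝ), 0 < √(phaseK τ) := fun τ hτ => Real.sqrt_pos.mpr (phaseK_pos hτ)
  unfold phaseQ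
  refine ContDiffOn.div (ContDiffOn.sub (ContDiffOn.div (contDiffOn_const.mul hk3).neg
    (contDiffOn_const.add (contDiffOn_const.mul hs)) fun τ hτ => ?_)
    (ContDiffOn.div (contDiffOn_const.mul hd) (contDiffOn_const.mul hs) fun τ hτ => ?_))
    ((contDiffOn_const.mul hk).add ((contDiffOn_id.sub contDiffOn_const).mul hd)) fun τ hτ => (phaseL_pos hτ).ne'
  · have := hsp τ hτ; positivity
  · have := hsp τ hτ; positivity

/-! ### The Fresnel integral and stationary phase. -/

/-- Convergence of the Fresnel integral, with a rate. -/
theorem exists_fresnel : ∃ F : ℂ, ∀ A B : ℝ, 0 < A → 0 < B →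
    ‖(∫ u in (-A)..B, Complex.exp ((u ^ 2 : ℝ) * Complex.I)) - F‖ ≤ 4 * (1 / A + 1 / B) := by
  set E : ℝ → ℂ := fun u => Complex.exp ((u ^ 2 : ℝ) * Complex.I) with hE
  have hEc : Continuous E := by fun_prop
  have hint : ∀ a b, IntervalIntegrable E MeasureTheory.volume a b := fun a b => hEc.intervalIntegrable a b
  -- First derivative test for the phase `u²`: tails beyond `a` are at most `2/a`, whatever the
  -- upper end. This gives convergence and the rate together.
  have key : ∀ a b : ℝ, 0 < a → a ≤ b → ‖∫ u in a..b, E u‖ ≤ 2 / a := by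
    intro a b ha hab
    have hne : ∀ u ∈ Set.Icc a b, u ≠ 0 := fun u hu => (ha.trans_le hu.1).ne'
    have := norm_integral_exp_mul_le_of_monotone (φ := fun u => u ^ 2) (φ' := fun u => 2 * u)
      (g := fun u => u⁻¹ / 2) (g' := fun u => -(u ^ 2)⁻¹ / 2) hab
      (fun u _ => by simpa using (hasDerivAt_pow 2 u))
      (fun u hu => (hasDerivAt_inv (hne u hu)).div_const 2)
      (by fun_prop)
      (((continuousOn_id.pow 2).inv₀ fun u hu => pow_ne_zero 2 (hne u hu)).neg.div_const 2)
      (Or.inr fun u _ => by rw [neg_div]; exact neg_nonpos.mpr (by positivity))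
    have e : ∫ u in a..b, E u = ∫ u in a..b, Complex.exp (((u ^ 2 : ℝ) : ℂ) * Complex.I) *
        ((2 * u * (u⁻¹ / 2) : ℝ) : ℂ) := by
      refine intervalIntegral.integral_congr fun u hu => ?_
      rw [Set.uIcc_of_le hab] at hu
      have : 2 * u * (u⁻¹ / 2) = 1 := by have := hne u hu; field_simp
      simp only [this, Complex.ofReal_one, mul_one, hE]
    rw [e]
    refine this.trans ?_
    have hb : 0 < b := ha.trans_le hab
    rw [abs_of_pos (by positivity), abs_of_pos (by positivity)]
    have : b⁻¹ ≤ a⁻¹ := inv_anti₀ ha hab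
    rw [div_eq_mul_inv 2 a]
    linarith
  set G : ℝ → ℂ := fun y => ∫ u in (0 : ℝ)..y, E u with hG
  have hGd : ∀ a b, 0 < a → a ≤ b → ‖G b - G a‖ ≤ 2 / a := fun a b ha hab => by
    have : G b - G a = ∫ u in a..b, E u := intervalIntegral.integral_interval_sub_left (hint _ _) (hint _ _)
    rw [this]
    exact key a b ha hab
  have hcauchy : CauchySeq fun n : ℕ => G (n + 1) := by
    refine cauchySeq_of_le_tendsto_0 (fun n : ℕ => 4 / ((n : ℝ) + 1)) (fun m n N hm hn => ?_) ?_
    · have h0 : (0 : ℝ) < (N : ℝ) + 1 := by positivity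
      have h1 := hGd (N + 1) (m + 1) h0 (by exact_mod_cast Nat.succ_le_succ hm)
      have h2 := hGd (N + 1) (n + 1) h0 (by exact_mod_cast Nat.succ_le_succ hn)
      rw [dist_eq_norm]
      calc ‖G (m + 1) - G (n + 1)‖ = ‖(G (m + 1) - G (N + 1)) - (G (n + 1) - G (N + 1))‖ := by congr 1; ring
        _ ≤ _ := norm_sub_le _ _
        _ ≤ 2 / ((N : ℝ) + 1) + 2 / ((N : ℝ) + 1) := add_le_add h1 h2
        _ = _ := by ring
    · have := tendsto_one_div_add_atTop_nhds_zero_nat (𝕜 := ℝ)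
      have := this.const_mul 4
      simpa [div_eq_mul_inv] using this
  obtain ⟨F, hF⟩ := cauchySeq_tendsto_of_complete hcauchy
  have hlim : ∀ a, 0 < a → ‖G a - F‖ ≤ 2 / a := by
    intro a ha
    have h1 : Tendsto (fun n : ℕ => ‖G a - G (n + 1)‖) atTop (nhds ‖G a - F‖) :=
      (hF.const_sub (G a)).norm
    refine le_of_tendsto h1 ?_
    filter_upwards [eventually_ge_atTop ⌈a⌉₊] with n hn
    rw [norm_sub_rev]
    refine hGd a _ ha ?_
    have : a ≤ n := (Nat.le_ceil a).trans (by exact_mod_cast hn)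
    linarith
  -- The integrand is even, so the limit over the whole line is twice the limit over the half-line.
  refine ⟨2 * F, fun A B hA hB => ?_⟩
  have hneg : ∫ u in (-A)..0, E u = G A := by
    have := intervalIntegral.integral_comp_neg (a := 0) (b := A) E
    rw [neg_zero] at this
    rw [← this]
    refine intervalIntegral.integral_congr fun u _ => ?_
    simp [hE]
  have hsplit : ∫ u in (-A)..B, E u = G A + G B := by
    rw [← intervalIntegral.integral_add_adjacent_intervals (hint (-A) 0) (hint 0 B), hneg]
  rw [hsplit]
  have h1 := hlim A hA
  have h2 := hlim B hB
  calc ‖G A + G B - 2 * F‖ = ‖(G A - F) + (G B - F)‖ := by congr 1; ring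
    _ ≤ ‖G A - F‖ + ‖G B - F‖ := norm_add_le _ _
    _ ≤ 2 / A + 2 / B := add_le_add h1 h2
    _ ≤ _ := by
      have e1 : 2 / A = 2 * (1 / A) := by ring
      have e2 : 2 / B = 2 * (1 / B) := by ring
      have : 0 < 1 / A := by positivity
      have : 0 < 1 / B := by positivity
      linarith

/-- Stationary phase for the full oscillatory integral. -/
theorem exists_integral_oscKernel_zero_four : ∃ (C : ℝ) (C₀ : ℂ), ∀ l : ℝ, 1 ≤ l →
    ‖(∫ τ in (0 : ℝ)..4, oscKernel l τ) - C₀ / √l‖ ≤ C / l := by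
  obtain ⟨F, hF⟩ := exists_fresnel
  have hsub : Set.Icc (1 / 4 : ℝ) 4 ⊆ Set.Ioi 0 := fun τ hτ => lt_of_lt_of_le (by norm_num) hτ.1
  have hI : Set.uIcc (1 / 4 : ℝ) 4 = Set.Icc (1 / 4) 4 := Set.uIcc_of_le (by norm_num)
  have hQd : ∀ τ ∈ Set.Icc (1 / 4 : ℝ) 4, HasDerivAt phaseQ (deriv phaseQ τ) τ := fun τ hτ =>
    ((contDiffOn_phaseQ.differentiableOn (by norm_num)).differentiableAt (Ioi_mem_nhds (hsub hτ))).hasDerivAt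
  have hQc : ContinuousOn (deriv phaseQ) (Set.Icc (1 / 4 : ℝ) 4) :=
    (contDiffOn_phaseQ.continuousOn_deriv_of_isOpen isOpen_Ioi (by norm_num)).mono hsub
  have hVc : ContinuousOn phaseV' (Set.Icc (1 / 4 : ℝ) 4) := by
    have hk := contDiffOn_phaseK.continuousOn.mono hsub
    have hd := (contDiffOn_phaseK.continuousOn_deriv_of_isOpen isOpen_Ioi (by norm_num)).mono hsub
    have hs : ContinuousOn (fun τ => √(phaseK τ)) (Set.Icc (1 / 4 : ℝ) 4) := hk.sqrt
    unfold phaseV'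
    refine hs.add ((continuousOn_id.sub continuousOn_const).mul (hd.div (continuousOn_const.mul hs) fun τ hτ => ?_))
    have := Real.sqrt_pos.mpr (phaseK_pos (hsub hτ))
    positivity
  obtain ⟨M, hM⟩ := (isCompact_Icc (a := (1 / 4 : ℝ)) (b := 4)).exists_bound_of_continuousOn hQc
  have hM0 : 0 ≤ M := (norm_nonneg _).trans (hM 1 (by norm_num))
  set A := -phaseV (1 / 4) with hA
  set B := phaseV 4 with hB
  have hA0 : 0 < A := by
    have := Real.sqrt_pos.mpr (phaseK_pos (show (0 : ℝ) < 1 / 4 by norm_num))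
    rw [hA]; unfold phaseV; nlinarith
  have hB0 : 0 < B := by
    have := Real.sqrt_pos.mpr (phaseK_pos (show (0 : ℝ) < 4 by norm_num))
    rw [hB]; unfold phaseV; nlinarith
  refine ⟨5 + √2 * (4 * (1 / A + 1 / B)) + (|phaseQ (1 / 4)| + |phaseQ 4| + 4 * M), √2 * F, fun l hl => ?_⟩
  have hl0 : 0 < l := by linarith
  have hsl : 0 < √l := Real.sqrt_pos.mpr hl0
  have hss : √l * √l = l := Real.mul_self_sqrt hl0.le
  have e1 := norm_integral_oscKernel_zero_quarter_le hl
  have hosc : ∀ τ ∈ Set.Icc (1 / 4 : ℝ) 4, HasDerivAt (oscKernel l)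
      (oscKernel l τ * ((l * Real.log τ : ℝ) * Complex.I)) τ := fun τ hτ =>
    ((((hasDerivAt_phaseFn (hsub hτ).ne').const_mul l).ofReal_comp).mul_const Complex.I).cexp
  have hcl : ContinuousOn Real.log (Set.Icc (1 / 4 : ℝ) 4) :=
    Real.continuousOn_log.mono fun τ hτ => (hsub hτ).ne'
  have hoc := (continuous_oscKernel l).continuousOn (s := Set.Icc (1 / 4 : ℝ) 4)
  have hVC : ContinuousOn (fun τ => ((phaseV' τ : ℝ) : ℂ)) (Set.Icc (1 / 4 : ℝ) 4) :=
    Complex.continuous_ofReal.comp_continuousOn hVc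
  have hQC : ContinuousOn (fun τ => ((phaseQ τ : ℝ) : ℂ)) (Set.Icc (1 / 4 : ℝ) 4) :=
    Complex.continuous_ofReal.comp_continuousOn fun τ hτ => (hQd τ hτ).continuousAt.continuousWithinAt
  have hQC' : ContinuousOn (fun τ => ((deriv phaseQ τ : ℝ) : ℂ)) (Set.Icc (1 / 4 : ℝ) 4) :=
    Complex.continuous_ofReal.comp_continuousOn hQc
  have hlC : ContinuousOn (fun τ => ((l * Real.log τ : ℝ) : ℂ) * Complex.I) (Set.Icc (1 / 4 : ℝ) 4) :=
    (Complex.continuous_ofReal.comp_continuousOn (continuousOn_const.mul hcl)).mul continuousOn_const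
  -- The amplitude `1` is written as `√2 v' + log τ · phaseQ τ`. Only the first part sees the
  -- critical point; the second is a derivative up to the factor `1/(il)` and contributes `O(1/l)`.
  have hsplit : ∫ τ in (1 / 4 : ℝ)..4, oscKernel l τ =
      (√2 : ℂ) * (∫ τ in (1 / 4 : ℝ)..4, oscKernel l τ * (phaseV' τ : ℂ)) +
        ∫ τ in (1 / 4 : ℝ)..4, oscKernel l τ * ((Real.log τ * phaseQ τ : ℝ) : ℂ) := by
    rw [← intervalIntegral.integral_const_mul, ← intervalIntegral.integral_add
      (ContinuousOn.intervalIntegrable (by rw [hI]; exact continuousOn_const.mul (hoc.mul hVC)))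
      (ContinuousOn.intervalIntegrable (by
        rw [hI]
        refine hoc.mul ?_
        have := (Complex.continuous_ofReal.comp_continuousOn hcl).mul hQC
        refine this.congr fun τ _ => ?_
        simp))]
    refine intervalIntegral.integral_congr fun τ hτ => ?_
    rw [hI] at hτ
    rw [← one_sub_phaseV' (hsub hτ)]
    push_cast
    ring
  have hsecond : ‖∫ τ in (1 / 4 : ℝ)..4, oscKernel l τ * ((Real.log τ * phaseQ τ : ℝ) : ℂ)‖ ≤
      (|phaseQ (1 / 4)| + |phaseQ 4| + 4 * M) / l := by
    have hparts := intervalIntegral.integral_mul_deriv_eq_deriv_mul (a := (1 / 4 : ℝ)) (b := 4)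
      (u := fun τ => ((phaseQ τ : ℝ) : ℂ)) (v := oscKernel l) (u' := fun τ => ((deriv phaseQ τ : ℝ) : ℂ))
      (v' := fun τ => oscKernel l τ * ((l * Real.log τ : ℝ) * Complex.I))
      (by rw [hI]; exact fun τ hτ => (hQd τ hτ).ofReal_comp) (by rw [hI]; exact hosc)
      (ContinuousOn.intervalIntegrable (by rw [hI]; exact hQC'))
      (ContinuousOn.intervalIntegrable (by rw [hI]; exact hoc.mul hlC))
    have hL : ∫ τ in (1 / 4 : ℝ)..4, ((phaseQ τ : ℝ) : ℂ) * (oscKernel l τ * ((l * Real.log τ : ℝ) * Complex.I)) =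
        (Complex.I * l) * ∫ τ in (1 / 4 : ℝ)..4, oscKernel l τ * ((Real.log τ * phaseQ τ : ℝ) : ℂ) := by
      rw [← intervalIntegral.integral_const_mul]
      congr 1
      ext τ
      push_cast
      ring
    rw [hL] at hparts
    have hn : ‖(Complex.I * l) * ∫ τ in (1 / 4 : ℝ)..4, oscKernel l τ * ((Real.log τ * phaseQ τ : ℝ) : ℂ)‖ ≤
        |phaseQ (1 / 4)| + |phaseQ 4| + 4 * M := by
      rw [hparts]
      refine (norm_sub_le _ _).trans (add_le_add ((norm_sub_le _ _).trans (le_of_eq ?_)) ?_)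
      · rw [norm_mul, norm_mul, norm_oscKernel, norm_oscKernel, Complex.norm_real, Complex.norm_real,
          Real.norm_eq_abs, Real.norm_eq_abs]
        ring
      · refine (intervalIntegral.norm_integral_le_of_norm_le_const (C := M) fun τ hτ => ?_).trans ?_
        · rw [Set.uIoc_of_le (by norm_num)] at hτ
          rw [norm_mul, norm_oscKernel, mul_one, Complex.norm_real]
          exact hM τ ⟨hτ.1.le, hτ.2⟩
        · rw [abs_of_pos (by norm_num)]
          linarith
    rw [norm_mul, norm_mul, Complex.norm_I, one_mul, Complex.norm_real, Real.norm_eq_abs, abs_of_pos hl0] at hn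
    rw [le_div_iff₀ hl0]
    linarith
  -- Substitute `u = √l v(τ)`, which turns `l phaseFn τ` into `u²`.
  have hfirst : ∫ τ in (1 / 4 : ℝ)..4, oscKernel l τ * (phaseV' τ : ℂ) =
      (√l : ℂ)⁻¹ * ∫ u in (-(√l * A))..(√l * B), Complex.exp ((u ^ 2 : ℝ) * Complex.I) := by
    have h1 := intervalIntegral.integral_deriv_smul_comp' (a := (1 / 4 : ℝ)) (b := 4)
      (f := fun τ => √l * phaseV τ) (f' := fun τ => √l * phaseV' τ)
      (g := fun u : ℝ => Complex.exp ((u ^ 2 : ℝ) * Complex.I))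
      (by rw [hI]; exact fun τ hτ => (hasDerivAt_phaseV (hsub hτ)).const_mul _)
      (by rw [hI]; exact continuousOn_const.mul hVc) (by fun_prop)
    have h2 : √l * phaseV (1 / 4) = -(√l * A) := by rw [hA]; ring
    rw [h2] at h1
    rw [← h1, ← intervalIntegral.integral_const_mul]
    refine intervalIntegral.integral_congr fun τ hτ => ?_
    rw [hI] at hτ
    have h3 : (√l * phaseV τ) ^ 2 = l * phaseFn τ := by
      rw [mul_pow, phaseV_sq (hsub hτ), sq, hss]
    have h4 : (√l : ℂ) ≠ 0 := by exact_mod_cast hsl.ne'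
    simp only [Function.comp, Complex.real_smul, oscKernel]
    rw [h3]
    push_cast
    field_simp
  have hthird := hF (√l * A) (√l * B) (by positivity) (by positivity)
  rw [← intervalIntegral.integral_add_adjacent_intervals (intervalIntegrable_oscKernel l 0 (1 / 4))
    (intervalIntegrable_oscKernel l (1 / 4) 4), hsplit, hfirst]
  set I0 := ∫ τ in (0 : ℝ)..(1 / 4), oscKernel l τ
  set I1 := ∫ u in (-(√l * A))..(√l * B), Complex.exp ((u ^ 2 : ℝ) * Complex.I)
  set I2 := ∫ τ in (1 / 4 : ℝ)..4, oscKernel l τ * ((Real.log τ * phaseQ τ : ℝ) : ℂ)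
  have hslC : (√l : ℂ) ≠ 0 := by exact_mod_cast hsl.ne'
  calc ‖I0 + ((√2 : ℂ) * ((√l : ℂ)⁻¹ * I1) + I2) - √2 * F / √l‖
      = ‖I0 + ((√2 / √l : ℝ) : ℂ) * (I1 - F) + I2‖ := by
        congr 1; push_cast; field_simp; ring
    _ ≤ ‖I0‖ + ‖((√2 / √l : ℝ) : ℂ) * (I1 - F)‖ + ‖I2‖ := norm_add₃_le
    _ ≤ 5 / l + √2 / √l * (4 * (1 / (√l * A) + 1 / (√l * B))) +
        (|phaseQ (1 / 4)| + |phaseQ 4| + 4 * M) / l := by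
        rw [norm_mul, Complex.norm_real, Real.norm_eq_abs, abs_of_pos (by positivity)]
        gcongr
    _ = _ := by
        have : √2 / √l * (4 * (1 / (√l * A) + 1 / (√l * B))) = √2 * (4 * (1 / A + 1 / B)) / (√l * √l) := by
          field_simp
        rw [this, hss]
        ring

/-! ### The phase `x² log n` near `n = x`. -/

theorem norm_sum_unitExp_mul_le {β : ℝ} {k : ℤ} {α : ℝ} (hα : 0 < α) (h1 : k + α ≤ β) (h2 : β ≤ k + 1 - α)
    (a b : ℕ) : ‖∑ j ∈ Finset.Ico a b, unitExp (β * j)‖ ≤ 2 / α := by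
  refine norm_sum_unitExp_le_of_monotone_diff (fun j : ℕ => β * j) (k := k) hα ?_ ?_ ?_
  · intro n _ _; push_cast; linarith
  · intro n _ _; push_cast; linarith
  · intro n _ _; push_cast; linarith

/-- The partial sums of `∑ sin(2πβj)/j` are uniformly bounded. -/
theorem abs_sum_sin_div_le (β : ℝ) (L : ℕ) :
    |∑ j ∈ Finset.Ico 1 (L + 1), Real.sin (2 * Real.pi * (β * j)) / j| ≤ 9 := by
  have hpi := Real.pi_pos
  have hpi4 := Real.pi_lt_d2
  set k := round β with hk
  set b := β - k with hb
  have hbhalf : |b| ≤ 1 / 2 := abs_sub_round β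
  have hsin : ∀ j : ℕ, Real.sin (2 * Real.pi * (β * j)) = Real.sin (2 * Real.pi * (b * j)) := fun j => by
    have : 2 * Real.pi * (β * j) = 2 * Real.pi * (b * j) + ((k * j : ℤ) : ℝ) * (2 * Real.pi) := by
      rw [hb]; push_cast; ring
    rw [this, Real.sin_add_int_mul_two_pi]
  rcases eq_or_ne b 0 with h0 | h0
  · rw [Finset.sum_eq_zero]
    · simp
    · intro j _; rw [hsin, h0]; simp
  set α := |b| with hα
  have hα0 : 0 < α := abs_pos.mpr h0
  -- Cut at `1/α`, where `α` is the distance from `β` to the nearest integer. Below the cut `|sin| ≤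
  -- 2παj` bounds the sum by `2π`. Above it the partial sums of `e(βj)` are at most `2/α`, and
  -- partial summation against `1/j` gives at most `2`.
  set J := ⌊1 / α⌋₊ with hJ
  have hJ1 : (J : ℝ) ≤ 1 / α := Nat.floor_le (by positivity)
  have hJ2 : 1 / α < J + 1 := Nat.lt_floor_add_one _
  have hJα : α * J ≤ 1 := by rw [le_div_iff₀ hα0] at hJ1; linarith
  have hsmall : ∀ N : ℕ, N ≤ J → |∑ j ∈ Finset.Ico 1 (N + 1), Real.sin (2 * Real.pi * (β * j)) / j| ≤ 2 * Real.pi := by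
    intro N hN
    refine (Finset.abs_sum_le_sum_abs _ _).trans ?_
    have : ∀ j ∈ Finset.Ico 1 (N + 1), |Real.sin (2 * Real.pi * (β * j)) / j| ≤ 2 * Real.pi * α := fun j hj => by
      have hj0 : (0 : ℝ) < j := by exact_mod_cast (Finset.mem_Ico.mp hj).1
      rw [hsin, abs_div, abs_of_pos hj0, div_le_iff₀ hj0]
      refine Real.abs_sin_le_abs.trans (le_of_eq ?_)
      rw [abs_mul (2 * Real.pi), abs_of_pos (by positivity : 0 < 2 * Real.pi), abs_mul b, abs_of_pos hj0]
      ring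
    refine (Finset.sum_le_sum this).trans ?_
    rw [Finset.sum_const, Nat.card_Ico, nsmul_eq_mul, Nat.add_sub_cancel]
    have : (N : ℝ) * α ≤ 1 := by
      have : (N : ℝ) ≤ J := by exact_mod_cast hN
      nlinarith
    nlinarith
  rcases le_or_gt L J with hLJ | hLJ
  · exact (hsmall L hLJ).trans (by linarith)
  rw [← Finset.sum_Ico_consecutive _ (show 1 ≤ J + 1 by omega) (show J + 1 ≤ L + 1 by omega)]
  have htail : |∑ j ∈ Finset.Ico (J + 1) (L + 1), Real.sin (2 * Real.pi * (β * j)) / j| ≤ 2 := by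
    have hpart : ∀ N, J + 1 ≤ N → N ≤ L → ‖∑ j ∈ Finset.Ico (J + 1) (N + 1), unitExp (β * j)‖ ≤ 2 / α := by
      intro N _ _
      rcases lt_or_gt_of_ne h0 with hneg | hpos
      · have hαe : α = -b := abs_of_neg hneg
        exact norm_sum_unitExp_mul_le (k := k - 1) hα0 (by push_cast; linarith) (by push_cast; linarith) _ _
      · have hαe : α = b := abs_of_pos hpos
        exact norm_sum_unitExp_mul_le (k := k) hα0 (by linarith) (by linarith) _ _
    have habel := norm_sum_mul_le_by_parts (fun j : ℕ => unitExp (β * j)) (fun j : ℕ => (((1 / j : ℝ)) : ℂ))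
      (fun _ => 2 / α) (show J + 1 ≤ L by omega) hpart
    have him : ∑ j ∈ Finset.Ico (J + 1) (L + 1), Real.sin (2 * Real.pi * (β * j)) / j =
        (∑ j ∈ Finset.Ico (J + 1) (L + 1), (((1 / j : ℝ)) : ℂ) * unitExp (β * j)).im := by
      rw [Complex.im_sum]
      refine Finset.sum_congr rfl fun j _ => ?_
      rw [Complex.im_ofReal_mul]
      unfold unitExp
      rw [Complex.exp_ofReal_mul_I_im]
      ring
    rw [him]
    refine (Complex.abs_im_le_norm _).trans (habel.trans ?_)
    have hL0 : (0 : ℝ) < L := by exact_mod_cast (by omega : 0 < L)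
    have hdiff : ∀ n ∈ Finset.Ico (J + 1) L, ‖((1 / ((n + 1 : ℕ) : ℝ) : ℝ) : ℂ) - ((1 / (n : ℝ) : ℝ) : ℂ)‖ * (2 / α) =
        -((1 / ((n + 1 : ℕ) : ℝ) - 1 / (n : ℝ)) * (2 / α)) := fun n hn => by
      have hn0 : (0 : ℝ) < n := by
        have := (Finset.mem_Ico.mp hn).1
        exact_mod_cast (by omega : 0 < n)
      rw [← Complex.ofReal_sub, Complex.norm_real, Real.norm_eq_abs, abs_of_nonpos]
      · ring
      · rw [sub_nonpos]
        exact one_div_le_one_div_of_le hn0 (by push_cast; linarith)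
    rw [Finset.sum_congr rfl hdiff, Finset.sum_neg_distrib, ← Finset.sum_mul,
      Finset.sum_Ico_sub (fun n : ℕ => 1 / (n : ℝ)) (show J + 1 ≤ L by omega), Complex.norm_real, Real.norm_eq_abs,
      abs_of_pos (by positivity)]
    have : 1 / ((J + 1 : ℕ) : ℝ) * (2 / α) ≤ 2 := by
      push_cast
      rw [div_mul_div_comm, one_mul, div_le_iff₀ (by positivity)]
      rw [div_lt_iff₀ hα0] at hJ2
      linarith
    linarith
  refine (abs_add_le _ _).trans ?_
  have := hsmall J le_rfl
  linarith

theorem norm_unitExp_sub_le (u v : ℝ) : ‖unitExp u - unitExp v‖ ≤ 2 * Real.pi * |u - v| := by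
  have h1 : unitExp u - unitExp v = unitExp v * (Complex.exp (Complex.I * (2 * Real.pi * (u - v) : ℝ)) - 1) := by
    have : unitExp u = unitExp v * unitExp (u - v) := by rw [← unitExp_add]; congr 1; ring
    rw [this]
    have : unitExp (u - v) = Complex.exp (Complex.I * (2 * Real.pi * (u - v) : ℝ)) := by
      unfold unitExp; rw [mul_comm]
    rw [this]; ring
  rw [h1, norm_mul, norm_unitExp, one_mul]
  refine (Real.norm_exp_I_mul_ofReal_sub_one_le).trans (le_of_eq ?_)
  rw [Real.norm_eq_abs, abs_mul, abs_of_pos (by positivity)]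

theorem abs_log_one_add_sub_le {y : ℝ} (hy : |y| ≤ 1 / 2) : |Real.log (1 + y) - (y - y ^ 2 / 2)| ≤ 2 * |y| ^ 3 := by
  have h := Real.abs_log_sub_add_sum_range_le (x := -y) (by rw [abs_neg]; linarith) 2
  rw [sub_neg_eq_add, abs_neg] at h
  simp only [Finset.sum_range_succ, Finset.sum_range_zero] at h
  norm_num at h
  have h2 : |y| ^ 3 / (1 - |y|) ≤ 2 * |y| ^ 3 := by
    rw [div_le_iff₀ (by linarith)]
    have : 0 ≤ |y| ^ 3 := by positivity
    nlinarith
  refine le_trans (le_of_eq ?_) (h.trans h2)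
  congr 1
  ring

/-- The integer `h (h - 1)` is even. Hence a quadratic phase `h²/2` is the linear phase `h/2` modulo
`1`, so such quadratic terms may be added or removed freely. -/
theorem unitExp_half_sq_sub (h : ℤ) : unitExp ((h : ℝ) ^ 2 / 2 - h / 2) = 1 := by
  obtain ⟨q, hq⟩ := Int.even_mul_pred_self h
  have : (h : ℝ) ^ 2 / 2 - h / 2 = (q : ℤ) := by
    have : (h : ℝ) * (h - 1) = q + q := by exact_mod_cast hq
    linarith
  rw [this, unitExp_intCast]

/-- Near `x` the phase `x² log n` is quadratic, hence linear modulo `1`. -/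
theorem norm_unitExp_log_sub_linear_le {x : ℝ} (hx : 0 < x) (m : ℤ) (hm : |x - m| ≤ 1 / 2) (h : ℤ)
    (hh : h ≠ 0) (hhx : |(h : ℝ)| ≤ x / 4) :
    ‖unitExp (-(x ^ 2 * Real.log ((m + h : ℤ) : ℝ))) -
      unitExp (-(x ^ 2 * Real.log x) - x * (m - x) + (m - x) ^ 2 / 2) * unitExp ((1 / 2 - 2 * x) * h)‖ ≤
      60 * |(h : ℝ)| ^ 3 / x := by
  have hpi := Real.pi_pos
  have hpi4 := Real.pi_lt_d2
  have hh1 : 1 ≤ |(h : ℝ)| := by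
    have : (1 : ℤ) ≤ |h| := Int.one_le_abs hh
    exact_mod_cast this
  set d : ℝ := (m + h : ℤ) - x with hd
  have hdle : |d| ≤ 3 / 2 * |(h : ℝ)| := by
    have : d = h + -(x - m) := by rw [hd]; push_cast; ring
    rw [this]
    refine (abs_add_le _ _).trans ?_
    rw [abs_neg]
    linarith
  have hy : |d / x| ≤ 1 / 2 := by
    rw [abs_div, abs_of_pos hx, div_le_iff₀ hx]
    linarith
  have hlog := abs_log_one_add_sub_le hy
  have hpos : 0 < 1 + d / x := by have := (abs_le.mp hy).1; linarith
  have e1 : Real.log ((m + h : ℤ) : ℝ) = Real.log x + Real.log (1 + d / x) := by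
    rw [← Real.log_mul hx.ne' hpos.ne']
    congr 1
    rw [hd]; field_simp; ring
  have hphase : unitExp (-(x ^ 2 * Real.log x) - x * (m - x) + (m - x) ^ 2 / 2) * unitExp ((1 / 2 - 2 * x) * h) =
      unitExp (-(x ^ 2 * Real.log x) - x * d + d ^ 2 / 2) := by
    -- Expanding the square at `d = m - x + h` produces `h²/2`, equal to `h/2` modulo `1`, the
    -- integer `mh`, and the linear term `-2xh`. This is the origin of the frequency `1/2 - 2x`.
    have e2 : -(x ^ 2 * Real.log x) - x * d + d ^ 2 / 2 =
        (-(x ^ 2 * Real.log x) - x * (m - x) + (m - x) ^ 2 / 2) + (1 / 2 - 2 * x) * h +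
          ((h : ℝ) ^ 2 / 2 - h / 2) + ((m * h : ℤ) : ℝ) := by
      rw [hd]; push_cast; ring
    rw [e2, unitExp_add _ ((m * h : ℤ) : ℝ), unitExp_intCast, unitExp_add _ ((h : ℝ) ^ 2 / 2 - h / 2),
      unitExp_half_sq_sub, unitExp_add _ ((1 / 2 - 2 * x) * h), mul_one, mul_one]
  rw [hphase]
  refine (norm_unitExp_sub_le _ _).trans ?_
  have e3 : -(x ^ 2 * Real.log ((m + h : ℤ) : ℝ)) - (-(x ^ 2 * Real.log x) - x * d + d ^ 2 / 2) =
      -(x ^ 2 * (Real.log (1 + d / x) - (d / x - (d / x) ^ 2 / 2))) := by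
    rw [e1]; field_simp; ring
  rw [e3, abs_neg, abs_mul, abs_of_pos (by positivity)]
  have e4 : |d| ^ 3 ≤ (3 / 2 * |(h : ℝ)|) ^ 3 := pow_le_pow_left₀ (abs_nonneg _) hdle 3
  calc 2 * Real.pi * (x ^ 2 * |Real.log (1 + d / x) - (d / x - (d / x) ^ 2 / 2)|)
      ≤ 2 * Real.pi * (x ^ 2 * (2 * |d / x| ^ 3)) := by gcongr
    _ = 4 * Real.pi * |d| ^ 3 / x := by rw [abs_div, abs_of_pos hx]; field_simp; ring
    _ ≤ 4 * Real.pi * (3 / 2 * |(h : ℝ)|) ^ 3 / x := by gcongr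
    _ ≤ 60 * |(h : ℝ)| ^ 3 / x := by
      refine div_le_div_of_nonneg_right ?_ hx.le
      rw [mul_pow]
      have : 0 ≤ |(h : ℝ)| ^ 3 := by positivity
      nlinarith

/-! ### Weights of the boundary terms and the central range. -/

/-- The function `u ↦ log u / √u`. -/
noncomputable def logDivSqrt (u : ℝ) : ℝ := Real.log u / Real.sqrt u

/-- The weight of the boundary terms. -/
noncomputable def edgeWeight (x u : ℝ) : ℝ := logDivSqrt u / (Real.log x - Real.log u)

theorem one_le_log_of_four_le {x : ℝ} (hx : 4 ≤ x) : 1 ≤ Real.log x := by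
  rw [Real.le_log_iff_exp_le (by linarith)]
  have := Real.exp_one_lt_d9
  linarith

theorem inv_sqrt_le_of_half_le {x u : ℝ} (hx : 0 < x) (hu : x / 2 ≤ u) : 1 / Real.sqrt u ≤ 3 / 2 / Real.sqrt x := by
  have hs := Real.sqrt_pos.mpr hx
  rw [div_le_div_iff₀ (Real.sqrt_pos.mpr (by linarith)) hs]
  have : Real.sqrt x ≤ Real.sqrt ((3 / 2) ^ 2 * u) := Real.sqrt_le_sqrt (by linarith)
  rw [Real.sqrt_mul (by norm_num), Real.sqrt_sq (by norm_num)] at this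
  linarith

theorem abs_log_sub_log_le {x u v : ℝ} (hx : 0 < x) (hu : x / 2 ≤ u) (hv : x / 2 ≤ v) :
    |Real.log u - Real.log v| ≤ 2 * |u - v| / x := by
  have key : ∀ {a b : ℝ}, x / 2 ≤ b → b ≤ a → Real.log a - Real.log b ≤ 2 * (a - b) / x := by
    intro a b hb hab
    have hb0 : 0 < b := by linarith
    rw [← Real.log_div (by linarith) hb0.ne']
    refine (Real.log_le_sub_one_of_pos (div_pos (by linarith) hb0)).trans ?_
    rw [div_sub_one hb0.ne', div_le_div_iff₀ hb0 hx]
    nlinarith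
  rcases le_total v u with h | h
  · rw [abs_of_nonneg (sub_nonneg.mpr (Real.log_le_log (by linarith) h)), abs_of_nonneg (by linarith)]
    exact key hv h
  · rw [abs_sub_comm, abs_sub_comm u v, abs_of_nonneg (sub_nonneg.mpr (Real.log_le_log (by linarith) h)),
      abs_of_nonneg (by linarith)]
    exact key hu h

theorem le_abs_log_sub_log {x u : ℝ} (hx : 0 < x) (hu0 : 0 < u) (hu : u ≤ 3 * x) :
    |x - u| / (3 * x) ≤ |Real.log x - Real.log u| := by
  rcases le_total u x with h | h
  · rw [abs_of_nonneg (sub_nonneg.mpr h), abs_of_nonneg (sub_nonneg.mpr (Real.log_le_log hu0 h)),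
      ← Real.log_div hx.ne' hu0.ne']
    refine le_trans ?_ (Real.one_sub_inv_le_log_of_pos (div_pos hx hu0))
    rw [inv_div, one_sub_div hx.ne', div_le_div_iff₀ (by positivity) hx]
    nlinarith
  · rw [abs_sub_comm, abs_sub_comm (Real.log x), abs_of_nonneg (sub_nonneg.mpr h),
      abs_of_nonneg (sub_nonneg.mpr (Real.log_le_log hx h)), ← Real.log_div hu0.ne' hx.ne']
    refine le_trans ?_ (Real.one_sub_inv_le_log_of_pos (div_pos hu0 hx))
    rw [inv_div, one_sub_div hu0.ne', div_le_div_iff₀ (by positivity) hu0]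
    nlinarith

theorem abs_logDivSqrt_le {x u : ℝ} (hx : 4 ≤ x) (hu : x / 2 ≤ u) (hu2 : u ≤ 3 * x) :
    |logDivSqrt u| ≤ 3 * Real.log x / Real.sqrt x := by
  have hs := Real.sqrt_pos.mpr (show 0 < x by linarith)
  have hlogu : 0 ≤ Real.log u := Real.log_nonneg (by linarith)
  have hlog : Real.log u ≤ 2 * Real.log x := by
    have : Real.log u ≤ Real.log (x ^ 2) := Real.log_le_log (by linarith) (by nlinarith)
    rw [Real.log_pow] at this
    exact_mod_cast this
  unfold logDivSqrt
  rw [abs_of_nonneg (div_nonneg hlogu (Real.sqrt_nonneg _)), div_eq_mul_one_div]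
  have := inv_sqrt_le_of_half_le (by linarith) hu
  have h3 := one_le_log_of_four_le hx
  calc Real.log u * (1 / Real.sqrt u) ≤ 2 * Real.log x * (3 / 2 / Real.sqrt x) := by gcongr
    _ = _ := by ring

theorem abs_logDivSqrt_sub_le {x u v : ℝ} (hx : 4 ≤ x) (hu : x / 2 ≤ u) (hv : x / 2 ≤ v)
    (hv2 : v ≤ 3 * x) :
    |logDivSqrt u - logDivSqrt v| ≤ 7 * Real.log x * |u - v| / (x * Real.sqrt x) := by
  have hx0 : 0 < x := by linarith
  have hs := Real.sqrt_pos.mpr hx0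
  have hss := Real.mul_self_sqrt hx0.le
  have hl1 := one_le_log_of_four_le hx
  have hu0 : 0 < u := by linarith
  have hv0 : 0 < v := by linarith
  have hsu := Real.sqrt_pos.mpr hu0
  have hsv := Real.sqrt_pos.mpr hv0
  have hlogv : 0 ≤ Real.log v := Real.log_nonneg (by linarith)
  have hlog : Real.log v ≤ 2 * Real.log x := by
    have : Real.log v ≤ Real.log (x ^ 2) := Real.log_le_log (by linarith) (by nlinarith)
    rw [Real.log_pow] at this
    exact_mod_cast this
  have iu := inv_sqrt_le_of_half_le hx0 hu
  have iv := inv_sqrt_le_of_half_le hx0 hv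
  have e : logDivSqrt u - logDivSqrt v = (Real.log u - Real.log v) * (1 / Real.sqrt u) +
      Real.log v * ((v - u) * (1 / Real.sqrt u) * (1 / Real.sqrt v) * (1 / (Real.sqrt u + Real.sqrt v))) := by
    unfold logDivSqrt
    have : v - u = (Real.sqrt v - Real.sqrt u) * (Real.sqrt u + Real.sqrt v) := by
      have h1 := Real.mul_self_sqrt hu0.le
      have h2 := Real.mul_self_sqrt hv0.le
      nlinarith
    rw [this]
    field_simp
    ring
  have isum : 1 / (Real.sqrt u + Real.sqrt v) ≤ 3 / 4 / Real.sqrt x := by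
    rw [div_le_div_iff₀ hsu hs] at iu
    rw [div_le_div_iff₀ hsv hs] at iv
    rw [div_le_div_iff₀ (by positivity) hs]
    linarith
  rw [e]
  refine (abs_add_le _ _).trans ?_
  have b1 : |(Real.log u - Real.log v) * (1 / Real.sqrt u)| ≤ 2 * |u - v| / x * (3 / 2 / Real.sqrt x) := by
    rw [abs_mul, abs_of_pos (show 0 < 1 / Real.sqrt u by positivity)]
    exact mul_le_mul (abs_log_sub_log_le hx0 hu hv) iu (by positivity) (by positivity)
  have b2 : |Real.log v * ((v - u) * (1 / Real.sqrt u) * (1 / Real.sqrt v) * (1 / (Real.sqrt u + Real.sqrt v)))| ≤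
      2 * Real.log x * (|u - v| * (3 / 2 / Real.sqrt x) * (3 / 2 / Real.sqrt x) * (3 / 4 / Real.sqrt x)) := by
    rw [abs_mul, abs_mul, abs_mul, abs_mul, abs_of_nonneg hlogv, abs_of_pos (show 0 < 1 / Real.sqrt u by positivity),
      abs_of_pos (show 0 < 1 / Real.sqrt v by positivity),
      abs_of_pos (show 0 < 1 / (Real.sqrt u + Real.sqrt v) by positivity), abs_sub_comm v u]
    gcongr
  have hp : 0 ≤ |u - v| / (x * Real.sqrt x) := by positivity
  have c1 : 2 * |u - v| / x * (3 / 2 / Real.sqrt x) = 3 * (|u - v| / (x * Real.sqrt x)) := by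
    field_simp
  have c2 : 2 * Real.log x * (|u - v| * (3 / 2 / Real.sqrt x) * (3 / 2 / Real.sqrt x) * (3 / 4 / Real.sqrt x)) =
      27 / 8 * Real.log x * (|u - v| / (x * Real.sqrt x)) := by
    rw [← hss]
    have : Real.sqrt (Real.sqrt x * Real.sqrt x) = Real.sqrt x := by rw [hss]
    rw [this]
    field_simp
    ring
  have c3 : 7 * Real.log x * |u - v| / (x * Real.sqrt x) = 7 * Real.log x * (|u - v| / (x * Real.sqrt x)) := by ring
  rw [c3]
  rw [c1] at b1
  rw [c2] at b2
  nlinarith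

theorem abs_edgeWeight_le {x u : ℝ} (hx : 4 ≤ x) (hu : x / 2 ≤ u) (hu2 : u ≤ 3 * x) (hne : u ≠ x) :
    |edgeWeight x u| ≤ 9 * (Real.sqrt x * Real.log x) / |x - u| := by
  have hx0 : 0 < x := by linarith
  have hs := Real.sqrt_pos.mpr hx0
  have hss := Real.mul_self_sqrt hx0.le
  have hl1 := one_le_log_of_four_le hx
  have hd : 0 < |x - u| := abs_pos.mpr (sub_ne_zero.mpr hne.symm)
  have h1 := le_abs_log_sub_log hx0 (by linarith) hu2
  unfold edgeWeight
  rw [abs_div]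
  calc |logDivSqrt u| / |Real.log x - Real.log u| ≤ (3 * Real.log x / Real.sqrt x) / (|x - u| / (3 * x)) :=
        div_le_div₀ (by positivity) (abs_logDivSqrt_le hx hu hu2) (by positivity) h1
    _ = 9 * (x / Real.sqrt x * Real.log x) / |x - u| := by field_simp; ring
    _ = _ := by rw [Real.div_sqrt]

theorem abs_edgeWeight_sub_le {x u v : ℝ} (hx : 4 ≤ x) (hu : x / 2 ≤ u) (hu2 : u ≤ 3 * x) (hv : x / 2 ≤ v)
    (hv2 : v ≤ 3 * x) (hune : u ≠ x) (hvne : v ≠ x) (huv : |u - v| = 1) :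
    |edgeWeight x u - edgeWeight x v| ≤ 96 * (Real.sqrt x * Real.log x) / (|x - u| * |x - v|) := by
  have hx0 : 0 < x := by linarith
  have hs := Real.sqrt_pos.mpr hx0
  have hss := Real.mul_self_sqrt hx0.le
  have hl1 := one_le_log_of_four_le hx
  have hdu : 0 < |x - u| := abs_pos.mpr (sub_ne_zero.mpr hune.symm)
  have hdv : 0 < |x - v| := abs_pos.mpr (sub_ne_zero.mpr hvne.symm)
  have lu := le_abs_log_sub_log hx0 (by linarith) hu2
  have lv := le_abs_log_sub_log hx0 (by linarith) hv2
  have lu0 : 0 < |Real.log x - Real.log u| := lt_of_lt_of_le (by positivity) lu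
  have lv0 : 0 < |Real.log x - Real.log v| := lt_of_lt_of_le (by positivity) lv
  have e : edgeWeight x u - edgeWeight x v = (logDivSqrt u - logDivSqrt v) / (Real.log x - Real.log v) +
      logDivSqrt u * (Real.log u - Real.log v) / ((Real.log x - Real.log u) * (Real.log x - Real.log v)) := by
    have := abs_pos.mp lu0
    have := abs_pos.mp lv0
    unfold edgeWeight
    field_simp
    ring
  rw [e]
  refine (abs_add_le _ _).trans ?_
  have b1 : |(logDivSqrt u - logDivSqrt v) / (Real.log x - Real.log v)| ≤
      (7 * Real.log x * 1 / (x * Real.sqrt x)) / (|x - v| / (3 * x)) := by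
    rw [abs_div]
    have := abs_logDivSqrt_sub_le hx hu hv hv2
    rw [huv] at this
    exact div_le_div₀ (by positivity) this (by positivity) lv
  have b2 : |logDivSqrt u * (Real.log u - Real.log v) / ((Real.log x - Real.log u) * (Real.log x - Real.log v))| ≤
      (3 * Real.log x / Real.sqrt x) * (2 * 1 / x) / ((|x - u| / (3 * x)) * (|x - v| / (3 * x))) := by
    rw [abs_div, abs_mul, abs_mul]
    have h2 := abs_log_sub_log_le hx0 hu hv
    rw [huv] at h2
    have h1 := abs_logDivSqrt_le hx hu hu2
    exact div_le_div₀ (by positivity) (mul_le_mul h1 h2 (abs_nonneg _) (by positivity)) (by positivity)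
      (mul_le_mul lu lv (by positivity) (by positivity))
  have hdu2 : |x - u| ≤ 2 * x := by rw [abs_le]; constructor <;> linarith
  have c1 : (7 * Real.log x * 1 / (x * Real.sqrt x)) / (|x - v| / (3 * x)) ≤
      42 * (Real.sqrt x * Real.log x) / (|x - u| * |x - v|) := by
    have : (7 * Real.log x * 1 / (x * Real.sqrt x)) / (|x - v| / (3 * x)) =
        21 * Real.log x / (Real.sqrt x * |x - v|) := by field_simp; ring
    rw [this, div_le_div_iff₀ (by positivity) (by positivity)]
    have : 42 * (Real.sqrt x * Real.log x) * (Real.sqrt x * |x - v|) = 21 * Real.log x * (2 * x * |x - v|) := by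
      linear_combination (42 * Real.log x * |x - v|) * hss
    rw [this]
    gcongr
  have c2 : (3 * Real.log x / Real.sqrt x) * (2 * 1 / x) / ((|x - u| / (3 * x)) * (|x - v| / (3 * x))) =
      54 * (Real.sqrt x * Real.log x) / (|x - u| * |x - v|) := by
    have : (3 * Real.log x / Real.sqrt x) * (2 * 1 / x) / ((|x - u| / (3 * x)) * (|x - v| / (3 * x))) =
      54 * (x / Real.sqrt x * Real.log x) / (|x - u| * |x - v|) := by field_simp; ring
    rw [this, Real.div_sqrt]
  rw [c2] at b2
  calc _ ≤ 42 * (Real.sqrt x * Real.log x) / (|x - u| * |x - v|) +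
      54 * (Real.sqrt x * Real.log x) / (|x - u| * |x - v|) := add_le_add (b1.trans c1) b2
    _ = _ := by ring

/-- To first order `log x - log u` is `(x - u)/x`, so the weight is `-√x log x / (u - x)`. The term
`25/x` collects the second-order errors of the logarithm and of `logDivSqrt`; the term `1/h²` is the
price of writing `h` for `u - x`, from which it differs by at most `1/2`. -/
theorem abs_edgeWeight_add_div_le {x u h : ℝ} (hx : 4 ≤ x) (hu : |u - x| ≤ x / 2) (hh : 1 ≤ |h|)
    (huh : |u - x - h| ≤ 1 / 2) :
    |edgeWeight x u + Real.sqrt x * Real.log x / h| ≤ Real.sqrt x * Real.log x * (25 / x + 1 / h ^ 2) := by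
  have hx0 : 0 < x := by linarith
  have hs := Real.sqrt_pos.mpr hx0
  have hss := Real.mul_self_sqrt hx0.le
  have hl1 := one_le_log_of_four_le hx
  have hu1 : x / 2 ≤ u := by linarith [(abs_le.mp hu).1]
  have hu2 : u ≤ 3 * x := by linarith [(abs_le.mp hu).2]
  have hdh : |h| / 2 ≤ |u - x| := by
    have : |h| ≤ |u - x| + |u - x - h| := by
      have := abs_sub (u - x) (u - x - h)
      simpa using this
    linarith
  have hd : 0 < |u - x| := by linarith
  have hne : u - x ≠ 0 := abs_pos.mp hd
  have hh0 : h ≠ 0 := abs_pos.mp (by linarith)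
  have hxu : |x - u| = |u - x| := abs_sub_comm _ _
  have lu := le_abs_log_sub_log hx0 (by linarith) hu2
  rw [hxu] at lu
  have lu0 : 0 < |Real.log x - Real.log u| := lt_of_lt_of_le (by positivity) lu
  have lne := abs_pos.mp lu0
  have e : edgeWeight x u + Real.sqrt x * Real.log x / h =
      logDivSqrt u * ((u - x) + x * (Real.log x - Real.log u)) / ((Real.log x - Real.log u) * (u - x)) +
      (-(x * (logDivSqrt u - logDivSqrt x) / (u - x)) + Real.sqrt x * Real.log x * (u - x - h) / ((u - x) * h)) := by
    have : x * logDivSqrt x = Real.sqrt x * Real.log x := by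
      unfold logDivSqrt
      rw [mul_div_assoc', mul_comm x, mul_div_assoc, Real.div_sqrt, mul_comm]
    rw [mul_sub x (logDivSqrt u), this]
    unfold edgeWeight
    field_simp
    ring
  have hlog2 : |(u - x) + x * (Real.log x - Real.log u)| ≤ 2 * (u - x) ^ 2 / x := by
    set y := (u - x) / x with hy
    have hy' : |y| ≤ 1 / 2 := by
      rw [hy, abs_div, abs_of_pos hx0, div_le_iff₀ hx0]; linarith
    have hl : Real.log u = Real.log x + Real.log (1 + y) := by
      rw [← Real.log_mul hx0.ne' (by linarith [(abs_le.mp hy').1])]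
      congr 1
      rw [hy]; field_simp; ring
    have h3 := Real.abs_log_sub_add_sum_range_le (x := -y) (by rw [abs_neg]; linarith) 1
    rw [sub_neg_eq_add, abs_neg] at h3
    simp only [Finset.sum_range_succ, Finset.sum_range_zero] at h3
    norm_num at h3
    have e2 : (u - x) + x * (Real.log x - Real.log u) = -(x * (-y + Real.log (1 + y))) := by
      rw [hl, hy]; field_simp; ring
    have e3 : 2 * (u - x) ^ 2 / x = x * (2 * y ^ 2) := by rw [hy]; field_simp
    rw [e2, e3, abs_neg, abs_mul, abs_of_pos hx0]
    refine mul_le_mul_of_nonneg_left (h3.trans ?_) hx0.le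
    rw [div_le_iff₀ (by linarith)]
    nlinarith [sq_nonneg y]
  have t1 : |logDivSqrt u * ((u - x) + x * (Real.log x - Real.log u)) / ((Real.log x - Real.log u) * (u - x))| ≤
      18 * (Real.sqrt x * Real.log x) / x := by
    rw [abs_div, abs_mul, abs_mul]
    calc _ ≤ (3 * Real.log x / Real.sqrt x) * (2 * (u - x) ^ 2 / x) / ((|u - x| / (3 * x)) * |u - x|) :=
          div_le_div₀ (by positivity) (mul_le_mul (abs_logDivSqrt_le hx hu1 hu2) hlog2 (abs_nonneg _) (by positivity))
            (by positivity) (by gcongr)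
      _ = 18 * (x / Real.sqrt x * Real.log x) / x := by
          rw [← sq_abs (u - x)]; field_simp; ring
      _ = _ := by rw [Real.div_sqrt]
  have t2 : |-(x * (logDivSqrt u - logDivSqrt x) / (u - x))| ≤ 7 * (Real.sqrt x * Real.log x) / x := by
    rw [abs_neg, abs_div, abs_mul, abs_of_pos hx0]
    calc _ ≤ x * (7 * Real.log x * |u - x| / (x * Real.sqrt x)) / |u - x| := by
          gcongr; exact abs_logDivSqrt_sub_le hx hu1 (by linarith) (by linarith)
      _ = 7 * (x / Real.sqrt x * Real.log x) / x := by field_simp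
      _ = _ := by rw [Real.div_sqrt]
  have t3 : |Real.sqrt x * Real.log x * (u - x - h) / ((u - x) * h)| ≤ Real.sqrt x * Real.log x * (1 / h ^ 2) := by
    rw [abs_div, abs_mul, abs_mul, abs_mul, abs_of_pos hs, abs_of_pos (show 0 < Real.log x by linarith)]
    calc _ ≤ Real.sqrt x * Real.log x * (1 / 2) / (|h| / 2 * |h|) := by gcongr
      _ = _ := by rw [← sq_abs h]; field_simp
  rw [e]
  refine (abs_add_le _ _).trans ((add_le_add t1 ((abs_add_le _ _).trans (add_le_add t2 t3))).trans (le_of_eq ?_))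
  ring

theorem unitExp_sub_unitExp_neg (u : ℝ) : unitExp u - unitExp (-u) = 2 * Complex.I * (Real.sin (2 * Real.pi * u) : ℝ) := by
  rw [unitExp_neg, Complex.sub_conj]
  unfold unitExp
  rw [Complex.exp_ofReal_mul_I_im]
  push_cast
  ring

theorem sum_inv_sq_le (L : ℕ) : ∑ j ∈ Finset.Ico 1 (L + 1), 1 / (j : ℝ) ^ 2 ≤ 2 := by
  rcases Nat.eq_zero_or_pos L with rfl | hL
  · simp
  suffices ∑ j ∈ Finset.Ico 1 (L + 1), 1 / (j : ℝ) ^ 2 ≤ 2 - 1 / (L : ℝ) by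
    have : 0 ≤ 1 / (L : ℝ) := by positivity
    linarith
  induction L, hL using Nat.le_induction with
  | base => norm_num
  | succ L hL ih =>
    rw [Finset.sum_Ico_succ_top (by omega)]
    have hL0 : (0 : ℝ) < L := by exact_mod_cast hL
    have h : 1 / ((L + 1 : ℕ) : ℝ) ^ 2 ≤ 1 / (L : ℝ) - 1 / ((L + 1 : ℕ) : ℝ) := by
      push_cast
      rw [div_sub_div _ _ (by positivity) (by positivity), div_le_div_iff₀ (by positivity) (by positivity)]
      nlinarith
    linarith

/-- The indices `m ± j` are paired. The weights are odd to leading order and the phases are linear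
in `j` modulo `1`, so a pair collapses to a constant times `sin(2πβj)/j`, whose partial sums are
bounded uniformly in `β`. The phase error `j³/x` against the weight `1/j` adds up to `O(L³/x)`,
which explains the condition on `L`. -/
theorem norm_sum_edgeWeight_near_le {x : ℝ} (hx : 8 ≤ x) (m : ℕ) (hm : |x - m| ≤ 1 / 2) (L : ℕ)
    (hL : (L : ℝ) ^ 3 ≤ x) :
    ‖∑ j ∈ Finset.Ico 1 (L + 1), ((edgeWeight x (m + j : ℝ) : ℂ) * unitExp (-(x ^ 2 * Real.log (m + j : ℝ))) +
      (edgeWeight x (m - j : ℝ) : ℂ) * unitExp (-(x ^ 2 * Real.log (m - j : ℝ))))‖ ≤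
      192 * (Real.sqrt x * Real.log x) := by
  have hx0 : 0 < x := by linarith
  have hl1 := one_le_log_of_four_le (show 4 ≤ x by linarith)
  set A := Real.sqrt x * Real.log x with hA
  have hA0 : 0 ≤ A := by positivity
  have hLx : (L : ℝ) ≤ x / 4 := by
    by_contra hcon
    push Not at hcon
    have : (x / 4) ^ 3 < (L : ℝ) ^ 3 := pow_lt_pow_left₀ hcon (by positivity) (by norm_num)
    nlinarith [sq_nonneg (x - 8)]
  set c := unitExp (-(x ^ 2 * Real.log x) - x * (m - x) + (m - x) ^ 2 / 2) with hc
  set β : ℝ := 1 / 2 - 2 * x with hβ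
  have hterm : ∀ j ∈ Finset.Ico 1 (L + 1), ‖((edgeWeight x (m + j : ℝ) : ℂ) * unitExp (-(x ^ 2 * Real.log (m + j : ℝ))) +
      (edgeWeight x (m - j : ℝ) : ℂ) * unitExp (-(x ^ 2 * Real.log (m - j : ℝ)))) +
      A * c * (2 * Complex.I) * ((Real.sin (2 * Real.pi * (β * j)) / j : ℝ) : ℂ)‖ ≤
      A * (50 / x + 2 * (1 / (j : ℝ) ^ 2) + 120 * (L : ℝ) ^ 2 / x) := by
    intro j hj
    rw [Finset.mem_Ico] at hj
    have hj1 : (1 : ℝ) ≤ j := by exact_mod_cast hj.1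
    have hj0 : (0 : ℝ) < j := by linarith
    have hjL : (j : ℝ) ≤ L := by exact_mod_cast (by omega : j ≤ L)
    have hm1 := abs_le.mp hm
    have w1 := abs_edgeWeight_add_div_le (x := x) (u := m + j) (h := j) (by linarith)
      (by rw [abs_le]; constructor <;> linarith) (by rwa [abs_of_pos hj0])
      (by rw [show (m : ℝ) + j - x - j = -(x - m) by ring, abs_neg]; exact hm)
    have w2 := abs_edgeWeight_add_div_le (x := x) (u := m - j) (h := -j) (by linarith)
      (by rw [abs_le]; constructor <;> linarith) (by rwa [abs_neg, abs_of_pos hj0])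
      (by rw [show (m : ℝ) - j - x - -j = -(x - m) by ring, abs_neg]; exact hm)
    have u1 := norm_unitExp_log_sub_linear_le hx0 (m : ℤ) (by exact_mod_cast hm) (j : ℤ) (by omega)
      (by push_cast; rw [abs_of_pos hj0]; linarith)
    have u2 := norm_unitExp_log_sub_linear_le hx0 (m : ℤ) (by exact_mod_cast hm) (-(j : ℤ)) (by omega)
      (by push_cast; rw [abs_neg, abs_of_pos hj0]; linarith)
    push_cast at u1 u2
    rw [← sub_eq_add_neg (m : ℝ), abs_neg] at u2
    rw [abs_of_pos hj0] at u1 u2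
    rw [← hc, ← hβ] at u1 u2
    rw [← hA] at w1 w2
    rw [neg_sq] at w2
    set U1 := unitExp (-(x ^ 2 * Real.log (m + j : ℝ))) with hU1
    set U2 := unitExp (-(x ^ 2 * Real.log (m - j : ℝ))) with hU2
    -- Four errors per pair: two from replacing the weights by `∓A/j`, two from replacing the phases
    -- by their linear models.
    have e : ((edgeWeight x (m + j : ℝ) : ℂ) * U1 + (edgeWeight x (m - j : ℝ) : ℂ) * U2) +
      A * c * (2 * Complex.I) * ((Real.sin (2 * Real.pi * (β * j)) / j : ℝ) : ℂ) =
      ((edgeWeight x (m + j : ℝ) + A / j : ℝ) : ℂ) * U1 + ((edgeWeight x (m - j : ℝ) + A / -j : ℝ) : ℂ) * U2 +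
      (((-(A / j) : ℝ) : ℂ) * (U1 - c * unitExp (β * j)) + ((A / j : ℝ) : ℂ) * (U2 - c * unitExp (β * -j))) := by
      have hs := unitExp_sub_unitExp_neg (β * j)
      rw [mul_neg]
      have hjc : (j : ℂ) ≠ 0 := by exact_mod_cast hj0.ne'
      have : (2 * Complex.I) * ((Real.sin (2 * Real.pi * (β * j)) / j : ℝ) : ℂ) =
          (unitExp (β * j) - unitExp (-(β * j))) / j := by
        rw [hs]; push_cast; ring
      rw [mul_assoc (A * c : ℂ), this]
      push_cast
      rw [div_neg]
      field_simp
      ring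
    rw [e]
    have nU1 : ‖U1‖ = 1 := norm_unitExp _
    have nU2 : ‖U2‖ = 1 := norm_unitExp _
    have b1 : ‖((edgeWeight x (m + j : ℝ) + A / j : ℝ) : ℂ) * U1‖ ≤ A * (25 / x + 1 / (j : ℝ) ^ 2) := by
      rw [norm_mul, nU1, mul_one, Complex.norm_real]; exact w1
    have b2 : ‖((edgeWeight x (m - j : ℝ) + A / -j : ℝ) : ℂ) * U2‖ ≤ A * (25 / x + 1 / (j : ℝ) ^ 2) := by
      rw [norm_mul, nU2, mul_one, Complex.norm_real]; exact w2
    have hAj : A / j * (60 * (j : ℝ) ^ 3 / x) ≤ A * (60 * (L : ℝ) ^ 2 / x) := by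
      have : A / j * (60 * (j : ℝ) ^ 3 / x) = A * (60 * (j : ℝ) ^ 2 / x) := by field_simp
      rw [this]; gcongr
    have b3 : ‖((-(A / j) : ℝ) : ℂ) * (U1 - c * unitExp (β * j))‖ ≤ A * (60 * (L : ℝ) ^ 2 / x) := by
      rw [norm_mul, Complex.norm_real, norm_neg, Real.norm_eq_abs, abs_of_nonneg (by positivity)]
      exact (mul_le_mul_of_nonneg_left u1 (by positivity)).trans hAj
    have b4 : ‖((A / j : ℝ) : ℂ) * (U2 - c * unitExp (β * -j))‖ ≤ A * (60 * (L : ℝ) ^ 2 / x) := by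
      rw [norm_mul, Complex.norm_real, Real.norm_eq_abs, abs_of_nonneg (by positivity)]
      exact (mul_le_mul_of_nonneg_left u2 (by positivity)).trans hAj
    refine (norm_add_le _ _).trans ((add_le_add ((norm_add_le _ _).trans (add_le_add b1 b2))
      ((norm_add_le _ _).trans (add_le_add b3 b4))).trans (le_of_eq ?_))
    ring
  have hsin := abs_sum_sin_div_le β L
  have hsum := (norm_sum_le _ _).trans (Finset.sum_le_sum hterm)
  rw [Finset.sum_add_distrib, ← Finset.mul_sum, ← Complex.ofReal_sum] at hsum
  have hS : ‖(A : ℂ) * c * (2 * Complex.I) *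
      ((∑ j ∈ Finset.Ico 1 (L + 1), Real.sin (2 * Real.pi * (β * j)) / j : ℝ) : ℂ)‖ ≤ 18 * A := by
    rw [norm_mul, norm_mul, norm_mul, norm_mul, Complex.norm_I, Complex.norm_real, Complex.norm_real, hc, norm_unitExp,
      Real.norm_eq_abs, Real.norm_eq_abs, abs_of_nonneg hA0, Complex.norm_two]
    nlinarith
  have hR : ∑ j ∈ Finset.Ico 1 (L + 1), A * (50 / x + 2 * (1 / (j : ℝ) ^ 2) + 120 * (L : ℝ) ^ 2 / x) ≤ 174 * A := by
    rw [← Finset.mul_sum, Finset.sum_add_distrib, Finset.sum_add_distrib, ← Finset.mul_sum]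
    simp only [Finset.sum_const, Nat.card_Ico, Nat.add_sub_cancel, nsmul_eq_mul]
    have h1 := sum_inv_sq_le L
    have h2 : (L : ℝ) * (50 / x) ≤ 50 := by
      rw [mul_div_assoc', div_le_iff₀ hx0]; nlinarith
    have h3 : (L : ℝ) * (120 * (L : ℝ) ^ 2 / x) ≤ 120 := by
      rw [mul_div_assoc', div_le_iff₀ hx0]; nlinarith
    nlinarith
  have := norm_sub_le_norm_add (∑ j ∈ Finset.Ico 1 (L + 1), ((edgeWeight x (m + j : ℝ) : ℂ) * unitExp (-(x ^ 2 * Real.log (m + j : ℝ))) +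
      (edgeWeight x (m - j : ℝ) : ℂ) * unitExp (-(x ^ 2 * Real.log (m - j : ℝ))))) ((A : ℂ) * c * (2 * Complex.I) *
      ((∑ j ∈ Finset.Ico 1 (L + 1), Real.sin (2 * Real.pi * (β * j)) / j : ℝ) : ℂ))
  linarith

/-! ### Boundary terms away from the critical index. -/

set_option maxHeartbeats 1000000 in
-- After dyadic summation the partial sums are `O(√h (h/q³ + q))`. Against weights with differences
-- `A/h²` this leaves `q⁻³ ∑ h^{-1/2}` and `q ∑ h^{-3/2}`. The first is bounded because `h ≤ 2q⁶`,
-- the second because `h ≥ q²`.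
theorem norm_sum_mul_far_le {q A : ℝ} (hq : 1 ≤ q) (hA : 0 ≤ A) (u w : ℕ → ℂ) {a b : ℕ} (ha : q ^ 2 ≤ a)
    (hab : a ≤ b) (hb : (b : ℝ) ≤ 2 * q ^ 6)
    (hblock : ∀ H m, a ≤ H → H ≤ m → m ≤ 2 * H → m ≤ b + 1 →
      ‖∑ n ∈ Finset.Ico H m, u n‖ ≤ Real.sqrt H * (1008 * H / q ^ 3 + 36 * q))
    (hw : ∀ h, a ≤ h → h ≤ b → ‖w h‖ ≤ A / h) (hdw : ∀ h, a ≤ h → h < b → ‖w (h + 1) - w h‖ ≤ A / (h : ℝ) ^ 2) :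
    ‖∑ h ∈ Finset.Ico a (b + 1), w h * u h‖ ≤ 110000 * A := by
  have hq0 : 0 < q := by linarith
  have ha1 : 1 ≤ a := by
    have : (0 : ℝ) < a := lt_of_lt_of_le (by positivity) ha
    exact_mod_cast this
  set F : ℕ → ℝ := fun h => Real.sqrt h * (1008 * h / q ^ 3 + 36 * q) with hF
  have hFmono : ∀ h m : ℕ, h ≤ m → F h ≤ F m := by
    intro h m hm
    have : (h : ℝ) ≤ m := by exact_mod_cast hm
    simp only [hF]
    gcongr
  have hP : ∀ m, a ≤ m → m ≤ b + 1 → ‖∑ n ∈ Finset.Ico a m, u n‖ ≤ F m / (1 - 0.82) := by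
    intro m h1 h2
    refine norm_sum_Ico_le_of_dyadic (B := ((b + 1 : ℕ) : ℕ)) ha1 (by norm_num) (by norm_num)
      (fun m => by positivity) (fun m hm => hFmono a m hm) ?_ ?_ m h1 (by exact_mod_cast h2)
    -- The ratio `0.82` exceeds `√(2/3)`, the decay of the factor `√h`; the other factor of `F` is
    -- increasing.
    · intro h m _ hm
      have hmr : 3 * (h : ℝ) ≤ 2 * m := by exact_mod_cast hm
      have hm0 : (0 : ℝ) ≤ h := Nat.cast_nonneg _
      have hs : Real.sqrt h ≤ 0.82 * Real.sqrt m := by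
        rw [Real.sqrt_le_left (by positivity), mul_pow, Real.sq_sqrt (by linarith)]
        linarith
      have : F h ≤ (0.82 * Real.sqrt m) * (1008 * m / q ^ 3 + 36 * q) := by
        simp only [hF]
        gcongr
        linarith
      simp only [hF] at this ⊢
      linarith
    · intro h m h1 h2 h3 h4
      exact hblock h m h1 h2 h3 (by exact_mod_cast h4)
  have hP2 : ∀ m, a ≤ m → m ≤ b → ‖∑ n ∈ Finset.Ico a (m + 1), u n‖ ≤ 17 * F m := by
    intro m h1 h2
    refine (hP (m + 1) (by omega) (by omega)).trans ?_
    have hm1 : (1 : ℝ) ≤ m := by exact_mod_cast ha1.trans h1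
    have hs : Real.sqrt ((m + 1 : ℕ) : ℝ) ≤ 1.5 * Real.sqrt m := by
      rw [Real.sqrt_le_left (by positivity), mul_pow, Real.sq_sqrt (by linarith)]
      push_cast
      linarith
    have : F (m + 1) ≤ (1.5 * Real.sqrt m) * (1008 * (2 * m) / q ^ 3 + 72 * q) := by
      simp only [hF]
      gcongr
      · push_cast; linarith
      · norm_num
    have e : (1.5 * Real.sqrt m) * (1008 * (2 * m) / q ^ 3 + 72 * q) = 3 * F m := by
      simp only [hF]; ring
    rw [div_le_iff₀ (by norm_num)]
    have : 0 ≤ F m := by positivity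
    linarith
  have habel := norm_sum_mul_le_by_parts u w (fun m => 17 * F m) hab hP2
  refine habel.trans ?_
  have hbpos : (0 : ℝ) < b := by exact_mod_cast (by omega : 0 < b)
  have hsq : ∀ h : ℕ, a ≤ h → q ≤ Real.sqrt h := by
    intro h hh
    apply Real.le_sqrt_of_sq_le
    have : (a : ℝ) ≤ h := by exact_mod_cast hh
    linarith
  have hsb : Real.sqrt b ≤ 3 / 2 * q ^ 3 := by
    rw [Real.sqrt_le_left (by positivity)]
    nlinarith [pow_pos hq0 6]
  have t1 : ‖w b‖ * (17 * F b) ≤ 26316 * A := by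
    have hb' := hsq b hab
    have hb0 : 0 < Real.sqrt b := by linarith
    have hbb := Real.mul_self_sqrt hbpos.le
    calc ‖w b‖ * (17 * F b) ≤ A / b * (17 * F b) := by gcongr; exact hw b hab le_rfl
      _ = 17 * A * (1008 * (Real.sqrt b / q ^ 3) + 36 * (q / Real.sqrt b)) := by
        simp only [hF]
        have : A / b = A / (Real.sqrt b * Real.sqrt b) := by rw [hbb]
        rw [this]
        have e2 : (b : ℝ) = Real.sqrt b * Real.sqrt b := hbb.symm
        generalize Real.sqrt b = s at *
        rw [e2]
        field_simp
      _ ≤ 17 * A * (1008 * (3 / 2) + 36 * 1) := by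
        have r1 : Real.sqrt b / q ^ 3 ≤ 3 / 2 := by rw [div_le_iff₀ (by positivity)]; linarith
        have r2 : q / Real.sqrt b ≤ 1 := by rw [div_le_one hb0]; exact hb'
        refine mul_le_mul_of_nonneg_left ?_ (by positivity)
        linarith
      _ = 26316 * A := by ring
  have t2 : ∑ n ∈ Finset.Ico a b, ‖w (n + 1) - w n‖ * (17 * F n) ≤ 79560 * A := by
    have hterm : ∀ n ∈ Finset.Ico a b, ‖w (n + 1) - w n‖ * (17 * F n) ≤
        17 * A * (1008 / q ^ 3 * (3 * (Real.sqrt (n + 1 : ℕ) - Real.sqrt n)) +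
          36 * q * (-4 * (1 / Real.sqrt (n + 1 : ℕ) - 1 / Real.sqrt n))) := by
      intro n hn
      rw [Finset.mem_Ico] at hn
      have hn1 : (1 : ℝ) ≤ n := by exact_mod_cast ha1.trans hn.1
      have hs0 : 0 < Real.sqrt n := Real.sqrt_pos.mpr (by linarith)
      have hss := Real.mul_self_sqrt (show (0 : ℝ) ≤ n by linarith)
      set s := Real.sqrt n with hs
      set r := Real.sqrt (n + 1 : ℕ) with hr
      have hrr : r * r = n + 1 := by rw [hr, Real.mul_self_sqrt (by positivity)]; push_cast; ring
      have hr0 : 0 ≤ r := Real.sqrt_nonneg _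
      have hrs : r ≤ 3 / 2 * s := by nlinarith
      have hsr : s < r := by nlinarith
      have g1 : 1 / s ≤ 3 * (r - s) := by
        rw [div_le_iff₀ hs0]
        have : (r - s) * (r + s) = 1 := by nlinarith
        nlinarith
      have g2 : 1 / (s * s * s) ≤ -4 * (1 / r - 1 / s) := by
        have hr1 : 0 < r := hs0.trans hsr
        have : -4 * (1 / r - 1 / s) = 4 * (r - s) / (r * s) := by
          field_simp; ring
        rw [this, div_le_div_iff₀ (by positivity) (by positivity)]
        have h5 : (r - s) * (r + s) = 1 := by nlinarith
        have h6 : 1 ≤ (r - s) * (5 / 2 * s) := by nlinarith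
        have h7 : r * s ≤ 3 / 2 * (s * s) := by nlinarith
        have h8 : 0 < s * s := mul_pos hs0 hs0
        have h9 : s * s ≤ (r - s) * (5 / 2 * s) * (s * s) := le_mul_of_one_le_left h8.le h6
        linarith
      calc ‖w (n + 1) - w n‖ * (17 * F n) ≤ A / (n : ℝ) ^ 2 * (17 * F n) := by gcongr; exact hdw n hn.1 hn.2
        _ = 17 * A * (1008 / q ^ 3 * (1 / s) + 36 * q * (1 / (s * s * s))) := by
          simp only [hF, ← hs]
          rw [← hss]
          clear_value s
          field_simp
        _ ≤ _ := by
          refine mul_le_mul_of_nonneg_left (add_le_add ?_ ?_) (by positivity)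
          · exact mul_le_mul_of_nonneg_left g1 (by positivity)
          · exact mul_le_mul_of_nonneg_left g2 (by positivity)
    refine (Finset.sum_le_sum hterm).trans ?_
    rw [← Finset.mul_sum, Finset.sum_add_distrib, ← Finset.mul_sum, ← Finset.mul_sum, ← Finset.mul_sum, ← Finset.mul_sum,
      Finset.sum_Ico_sub (fun n : ℕ => Real.sqrt n) hab, Finset.sum_Ico_sub (fun n : ℕ => 1 / Real.sqrt n) hab]
    have hsa := hsq a le_rfl
    have h1 : 1008 / q ^ 3 * (3 * (Real.sqrt b - Real.sqrt a)) ≤ 1008 * 4.5 := by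
      rw [div_mul_eq_mul_div, div_le_iff₀ (by positivity)]
      nlinarith [Real.sqrt_nonneg (a : ℝ)]
    have h2 : 36 * q * (-4 * (1 / Real.sqrt b - 1 / Real.sqrt a)) ≤ 36 * 4 := by
      have : 0 ≤ 1 / Real.sqrt b := by positivity
      have : q * (1 / Real.sqrt a) ≤ 1 := by rw [mul_one_div, div_le_one (by linarith)]; exact hsa
      nlinarith
    calc _ ≤ 17 * A * (1008 * 4.5 + 36 * 4) := mul_le_mul_of_nonneg_left (add_le_add h1 h2) (by positivity)
      _ = 79560 * A := by ring
  linarith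

/-- This is van der Corput's test for second differences of order `H/q⁶`. That is their size for `x²
log n` at distance `H` from `x = q⁶`, once the quadratic part at `x` has been removed. -/
theorem norm_sum_unitExp_block_le {q : ℝ} (hq : 1 ≤ q) {H m : ℕ} (hH : q ^ 2 ≤ H) (hHm : H ≤ m) (hm2 : m ≤ 2 * H)
    (hHq : (H : ℝ) ≤ 5 * q ^ 6) (f : ℕ → ℝ)
    (h1 : ∀ n, H ≤ n → n + 1 < m → (H : ℝ) / (5 * q ^ 6) ≤ (f (n + 2) - f (n + 1)) - (f (n + 1) - f n))
    (h2 : ∀ n, H ≤ n → n + 1 < m → (f (n + 2) - f (n + 1)) - (f (n + 1) - f n) ≤ 56 * H / q ^ 6) :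
    ‖∑ n ∈ Finset.Ico H m, unitExp (f n)‖ ≤ Real.sqrt H * (1008 * H / q ^ 3 + 36 * q) := by
  have hq0 : 0 < q := by linarith
  have hH0 : (0 : ℝ) < H := lt_of_lt_of_le (by positivity) hH
  refine (norm_sum_unitExp_le_of_second_diff f (l := H / (5 * q ^ 6)) (L := 56 * H / q ^ 6) (by positivity)
    (by rw [div_le_one (by positivity)]; exact hHq) (by positivity) hHm h1 h2).trans ?_
  have hs0 : 0 < Real.sqrt H := Real.sqrt_pos.mpr hH0
  have hss := Real.mul_self_sqrt hH0.le
  -- The number `2.24` exceeds `√5`.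
  have hsq : Real.sqrt (H / (5 * q ^ 6)) ≥ Real.sqrt H / (2.24 * q ^ 3) := by
    apply Real.le_sqrt_of_sq_le
    rw [div_pow, Real.sq_sqrt hH0.le, mul_pow, div_le_div_iff₀ (by positivity) (by positivity)]
    have : (q ^ 3) ^ 2 = q ^ 6 := by ring
    rw [this]
    nlinarith [mul_pos hH0 (pow_pos hq0 6)]
  have h8 : 8 / Real.sqrt (H / (5 * q ^ 6)) ≤ 18 * q ^ 3 / Real.sqrt H := by
    have hp : 0 < Real.sqrt H / (2.24 * q ^ 3) := by positivity
    calc 8 / Real.sqrt (H / (5 * q ^ 6)) ≤ 8 / (Real.sqrt H / (2.24 * q ^ 3)) := by gcongr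
      _ = 17.92 * q ^ 3 / Real.sqrt H := by field_simp; norm_num
      _ ≤ _ := by gcongr; norm_num
  have hmH : (m : ℝ) - H ≤ H := by
    have : (m : ℝ) ≤ 2 * H := by exact_mod_cast hm2
    linarith
  have hmH0 : (0 : ℝ) ≤ m - H := by
    have : (H : ℝ) ≤ m := by exact_mod_cast hHm
    linarith
  calc (56 * H / q ^ 6 * (m - H) + 2) * (8 / Real.sqrt (H / (5 * q ^ 6)))
      ≤ (56 * H / q ^ 6 * H + 2) * (18 * q ^ 3 / Real.sqrt H) := by gcongr
    _ = 1008 * (H * (H / Real.sqrt H)) / q ^ 3 + 36 * (q ^ 3 / Real.sqrt H) := by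
      field_simp
      ring
    _ ≤ 1008 * (H * Real.sqrt H) / q ^ 3 + 36 * (q * Real.sqrt H) := by
      rw [Real.div_sqrt]
      have : q ^ 3 / Real.sqrt H ≤ q * Real.sqrt H := by
        rw [div_le_iff₀ hs0, mul_assoc, hss]
        nlinarith
      linarith
    _ = _ := by ring

/-- Blocks to the right of the stationary point. -/
theorem norm_sum_unitExp_log_add_le {x q : ℝ} (hq : 1 ≤ q) (hx : x = q ^ 6) {m₀ : ℕ} (hm : |x - m₀| ≤ 1 / 2) {H m : ℕ}
    (hH : q ^ 2 ≤ H) (hHm : H ≤ m) (hm2 : m ≤ 2 * H) (hmx : (m₀ : ℝ) + m ≤ 5 / 2 * x) :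
    ‖∑ n ∈ Finset.Ico H m, unitExp (-(x ^ 2 * Real.log (m₀ + n : ℝ)))‖ ≤
      Real.sqrt H * (1008 * H / q ^ 3 + 36 * q) := by
  have hq0 : 0 < q := by linarith
  have hx0 : 0 < x := by rw [hx]; positivity
  have hH1 : (1 : ℝ) ≤ H := le_trans (by nlinarith) hH
  have hm1 := abs_le.mp hm
  have hHmr : (H : ℝ) ≤ m := by exact_mod_cast hHm
  have hm2r : (m : ℝ) ≤ 2 * H := by exact_mod_cast hm2
  have hm00 : (0 : ℝ) ≤ m₀ := Nat.cast_nonneg _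
  -- Adding the integer `k(k-1)/2` with `k = m₀ + n` does not change the exponential but moves the
  -- second difference of `x² log k` away from `-1`, its approximate value at `k = x`. Conjugation
  -- makes the resulting second differences positive to the right of `x`.
  set f : ℕ → ℝ := fun n => x ^ 2 * Real.log (m₀ + n : ℝ) + (((m₀ + n : ℕ) : ℤ) : ℝ) ^ 2 / 2 - (((m₀ + n : ℕ) : ℤ) : ℝ) / 2 with hf
  have hconj : ∀ n : ℕ, unitExp (-(x ^ 2 * Real.log (m₀ + n : ℝ))) = (starRingEnd ℂ) (unitExp (f n)) := by
    intro n
    rw [unitExp_neg]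
    simp only [hf]
    rw [add_sub_assoc, unitExp_add, unitExp_half_sq_sub, mul_one]
  simp only [hconj]
  rw [← map_sum, Complex.norm_conj]
  have hdiff : ∀ n : ℕ, (f (n + 2) - f (n + 1)) - (f (n + 1) - f n) =
      1 - x ^ 2 * (2 * Real.log (((m₀ + n : ℕ) : ℝ) + 1) - Real.log ((m₀ + n : ℕ) : ℝ) - Real.log (((m₀ + n : ℕ) : ℝ) + 2)) := by
    intro n
    simp only [hf]
    push_cast
    rw [show (m₀ : ℝ) + (n + 2) = m₀ + n + 2 by ring, show (m₀ : ℝ) + (n + 1) = m₀ + n + 1 by ring]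
    ring
  refine norm_sum_unitExp_block_le hq hH hHm hm2 (by rw [← hx]; linarith) f ?_ ?_
  · intro n hn hnm
    have hnr : (H : ℝ) ≤ n := by exact_mod_cast hn
    have hnm : (n : ℝ) + 2 ≤ m := by exact_mod_cast (by omega : n + 2 ≤ m)
    rw [hdiff]
    have hb := (log_second_diff_bounds (n := m₀ + n) (by have : (1 : ℝ) ≤ n := by linarith
                                                         have : 1 ≤ n := by exact_mod_cast this
                                                         omega)).2
    set N : ℝ := ((m₀ + n : ℕ) : ℝ) with hN
    have hNe : N = m₀ + n := by rw [hN]; push_cast; ring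
    have hNx : x ≤ N := by linarith
    refine le_trans ?_ (sub_le_sub_left (mul_le_mul_of_nonneg_left hb (by positivity)) 1)
    rw [← hx]
    have hNx2 : (n : ℝ) / 2 * N ≤ N * (N + 2) - x ^ 2 := by nlinarith
    have : 1 - x ^ 2 * (1 / (N * (N + 2))) = (N * (N + 2) - x ^ 2) / (N * (N + 2)) := by
      have : 0 < N := by linarith
      field_simp
    rw [this]
    calc (H : ℝ) / (5 * x) ≤ n / (2 * (N + 2)) := by
          apply div_le_div₀ <;> linarith
      _ = (n / 2 * N) / (N * (N + 2)) := by
          have : 0 < N := by linarith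
          field_simp
      _ ≤ _ := by
          have : 0 < N := by linarith
          gcongr
  · intro n hn hnm
    have hnr : (H : ℝ) ≤ n := by exact_mod_cast hn
    have hnm : (n : ℝ) + 2 ≤ m := by exact_mod_cast (by omega : n + 2 ≤ m)
    rw [hdiff]
    have hb := (log_second_diff_bounds (n := m₀ + n) (by have : (1 : ℝ) ≤ n := by linarith
                                                         have : 1 ≤ n := by exact_mod_cast this
                                                         omega)).1
    set N : ℝ := ((m₀ + n : ℕ) : ℝ) with hN
    have hNe : N = m₀ + n := by rw [hN]; push_cast; ring
    have hNx : x ≤ N := by linarith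
    refine le_trans (sub_le_sub_left (mul_le_mul_of_nonneg_left hb (by positivity)) 1) ?_
    rw [← hx]
    have hN0 : 0 < N := by linarith
    have : 1 - x ^ 2 * (1 / (N + 1) ^ 2) = ((N + 1 - x) * (N + 1 + x)) / (N + 1) ^ 2 := by
      field_simp
      ring
    rw [this, div_le_div_iff₀ (by positivity) hx0]
    have e1 : N + 1 - x ≤ 4 * H := by linarith
    calc (N + 1 - x) * (N + 1 + x) * x ≤ (4 * H) * (2 * (N + 1)) * (N + 1) := by
          have : 0 ≤ N + 1 - x := by linarith
          gcongr <;> linarith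
      _ ≤ 56 * H * (N + 1) ^ 2 := by nlinarith [mul_pos (show (0:ℝ) < H by linarith) (pow_pos (show 0 < N + 1 by linarith) 2)]

/-- Blocks to the left of the stationary point. -/
theorem norm_sum_unitExp_log_sub_le {x q : ℝ} (hx16 : 16 ≤ x) (hq : 1 ≤ q) (hx : x = q ^ 6) {m₀ : ℕ} (hm : |x - m₀| ≤ 1 / 2)
    {H m : ℕ} (hH : q ^ 2 ≤ H) (hHm : H ≤ m) (hm2 : m ≤ 2 * H) (hmx : x / 2 - 2 ≤ (m₀ : ℝ) - m) :
    ‖∑ n ∈ Finset.Ico H m, unitExp (-(x ^ 2 * Real.log (m₀ - n : ℝ)))‖ ≤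
      Real.sqrt H * (1008 * H / q ^ 3 + 36 * q) := by
  have hq0 : 0 < q := by linarith
  have hx0 : 0 < x := by rw [hx]; positivity
  have hH1 : (1 : ℝ) ≤ H := le_trans (by nlinarith) hH
  have hm1 := abs_le.mp hm
  have hHmr : (H : ℝ) ≤ m := by exact_mod_cast hHm
  have hm2r : (m : ℝ) ≤ 2 * H := by exact_mod_cast hm2
  have hm00 : (0 : ℝ) ≤ m₀ := Nat.cast_nonneg _
  -- To the left of `x` the opposite sign occurs, so the integer is subtracted and no conjugation is
  -- needed.
  set f : ℕ → ℝ := fun n => -(x ^ 2 * Real.log (m₀ - n : ℝ)) + -((((m₀ : ℤ) - n : ℤ) : ℝ) ^ 2 / 2 - (((m₀ : ℤ) - n : ℤ) : ℝ) / 2) with hf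
  have hconj : ∀ n : ℕ, unitExp (-(x ^ 2 * Real.log (m₀ - n : ℝ))) = unitExp (f n) := by
    intro n
    simp only [hf]
    rw [unitExp_add, unitExp_neg (_ - _), unitExp_half_sq_sub, map_one, mul_one]
  simp only [hconj]
  -- Here `N = m₀ - n - 2`, so that the three arguments of the logarithm are `N`, `N + 1`, `N + 2`.
  have hdiff : ∀ n N : ℕ, m₀ = n + 2 + N → (f (n + 2) - f (n + 1)) - (f (n + 1) - f n) =
      x ^ 2 * (2 * Real.log ((N : ℝ) + 1) - Real.log (N : ℝ) - Real.log ((N : ℝ) + 2)) - 1 := by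
    intro n N hN
    simp only [hf]
    push_cast
    have hN' : (m₀ : ℝ) = n + 2 + N := by exact_mod_cast hN
    rw [show (m₀ : ℝ) - (n + 2) = N by linarith, show (m₀ : ℝ) - (n + 1) = N + 1 by linarith,
      show (m₀ : ℝ) - n = N + 2 by linarith]
    ring
  refine norm_sum_unitExp_block_le hq hH hHm hm2 (by rw [← hx]; linarith) f ?_ ?_
  · intro n hn hnm
    have hnr : (H : ℝ) ≤ n := by exact_mod_cast hn
    have hnm' : (n : ℝ) + 2 ≤ m := by exact_mod_cast (by omega : n + 2 ≤ m)
    have hmm : m ≤ m₀ := by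
      have : (m : ℝ) ≤ m₀ := by linarith
      exact_mod_cast this
    obtain ⟨N, hN⟩ := Nat.exists_eq_add_of_le (show n + 2 ≤ m₀ by omega)
    have hN' : (m₀ : ℝ) = n + 2 + N := by exact_mod_cast hN
    rw [hdiff n N hN]
    have hNx : x / 2 - 2 ≤ N := by linarith
    have hb := (log_second_diff_bounds (n := N) (by have : (1 : ℝ) ≤ N := by linarith
                                                    exact_mod_cast this)).1
    refine le_trans ?_ (sub_le_sub_right (mul_le_mul_of_nonneg_left hb (by positivity)) 1)
    rw [← hx]
    have hN0 : (0 : ℝ) < N := by linarith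
    have e0 : x ^ 2 * (1 / ((N : ℝ) + 1) ^ 2) - 1 = ((x - (N + 1)) * (x + (N + 1))) / ((N : ℝ) + 1) ^ 2 := by
      field_simp
      ring
    rw [e0, div_le_div_iff₀ (by positivity) (by positivity)]
    have e1 : (H : ℝ) ≤ x - (N + 1) := by linarith
    calc (H : ℝ) * ((N : ℝ) + 1) ^ 2 = H * (((N : ℝ) + 1) * (N + 1)) := by ring
      _ ≤ (x - (N + 1)) * ((x + (N + 1)) * (5 * x)) := by gcongr <;> linarith
      _ = _ := by ring
  · intro n hn hnm
    have hnr : (H : ℝ) ≤ n := by exact_mod_cast hn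
    have hnm' : (n : ℝ) + 2 ≤ m := by exact_mod_cast (by omega : n + 2 ≤ m)
    have hmm : m ≤ m₀ := by
      have : (m : ℝ) ≤ m₀ := by linarith
      exact_mod_cast this
    obtain ⟨N, hN⟩ := Nat.exists_eq_add_of_le (show n + 2 ≤ m₀ by omega)
    have hN' : (m₀ : ℝ) = n + 2 + N := by exact_mod_cast hN
    rw [hdiff n N hN]
    have hNx : x / 2 - 2 ≤ N := by linarith
    have hb := (log_second_diff_bounds (n := N) (by have : (1 : ℝ) ≤ N := by linarith
                                                    exact_mod_cast this)).2
    refine le_trans (sub_le_sub_right (mul_le_mul_of_nonneg_left hb (by positivity)) 1) ?_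
    rw [← hx]
    have hN0 : (0 : ℝ) < N := by linarith
    have e0 : x ^ 2 * (1 / ((N : ℝ) * (N + 2))) - 1 = (x ^ 2 - N * (N + 2)) / ((N : ℝ) * (N + 2)) := by
      field_simp
    have e1 : x - (N : ℝ) ≤ 3 * H := by linarith
    have e3 : (N : ℝ) ≤ x := by linarith
    have e2 : x ^ 2 - (N : ℝ) * (N + 2) ≤ (3 * H) * (2 * x) := by
      have : (x - N) * (x + N) ≤ (3 * H) * (2 * x) := mul_le_mul e1 (by linarith) (by linarith) (by linarith)
      nlinarith
    have e4 : 3 / 16 * x ^ 2 ≤ (N : ℝ) * (N + 2) := by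
      calc 3 / 16 * x ^ 2 = (3 / 8 * x) * (x / 2) := by ring
        _ ≤ _ := by gcongr <;> linarith
    rw [e0]
    calc _ ≤ (3 * H) * (2 * x) / (3 / 16 * x ^ 2) := by gcongr
      _ = 32 * H / x := by field_simp; norm_num
      _ ≤ _ := by gcongr; norm_num

/-- The sum of the boundary terms over `n ≠ m₀`. -/
theorem norm_sum_edgeWeight_le {x : ℝ} (hx : 64 ≤ x) {m₀ n₀ Y : ℕ} (hm : |x - m₀| ≤ 1 / 2)
    (hn₀ : x / 2 ≤ n₀) (hn₀' : (n₀ : ℝ) ≤ x / 2 + 1) (hY : (Y : ℝ) ≤ 2 * x) (hY' : 2 * x - 1 ≤ Y) :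
    ‖∑ n ∈ Finset.Ico n₀ m₀, (edgeWeight x n : ℂ) * unitExp (-(x ^ 2 * Real.log n)) +
      ∑ n ∈ Finset.Ico (m₀ + 1) (Y + 1), (edgeWeight x n : ℂ) * unitExp (-(x ^ 2 * Real.log n))‖ ≤
      100000000 * (Real.sqrt x * Real.log x) := by
  have hx0 : 0 < x := by linarith
  set q : ℝ := x ^ (1 / 6 : ℝ) with hqdef
  have hxq : x = q ^ 6 := by
    rw [hqdef, ← Real.rpow_natCast, ← Real.rpow_mul hx0.le]; norm_num
  have hq2 : 2 ≤ q := by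
    by_contra hcon
    push Not at hcon
    have hq0 : 0 ≤ q := by positivity
    have : q ^ 6 < 2 ^ 6 := pow_lt_pow_left₀ hcon hq0 (by norm_num)
    norm_num at this
    linarith
  have hl1 := one_le_log_of_four_le (show 4 ≤ x by linarith)
  set A := Real.sqrt x * Real.log x with hA
  have hA0 : 0 ≤ A := by positivity
  have hm1 := abs_le.mp hm
  -- The central range ends at `q² = x^{1/3}`: this is both the largest `L` with `L³ ≤ x` and the
  -- start of the range covered by `norm_sum_mul_far_le`.
  set L := ⌊q ^ 2⌋₊ with hL
  have hL1 : (L : ℝ) ≤ q ^ 2 := Nat.floor_le (by positivity)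
  have hL2 : q ^ 2 ≤ ((L + 1 : ℕ) : ℝ) := by push_cast; exact (Nat.lt_floor_add_one _).le
  have hLx : q ^ 2 ≤ x / 16 := by
    rw [hxq]
    have : 2 ^ 4 ≤ q ^ 4 := pow_le_pow_left₀ (by norm_num) hq2 4
    have : q ^ 2 * 2 ^ 4 ≤ q ^ 2 * q ^ 4 := by gcongr
    nlinarith
  have hnear := norm_sum_edgeWeight_near_le (show 8 ≤ x by linarith) m₀ hm L (by
    rw [hxq]
    calc (L : ℝ) ^ 3 ≤ (q ^ 2) ^ 3 := by gcongr
      _ = q ^ 6 := by ring)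
  rw [← hA] at hnear
  set φ : ℝ → ℂ := fun u => (edgeWeight x u : ℂ) * unitExp (-(x ^ 2 * Real.log u)) with hφ
  have hm0n : n₀ + L + 2 ≤ m₀ := by
    have : ((n₀ + L + 2 : ℕ) : ℝ) ≤ m₀ := by push_cast; linarith
    exact_mod_cast this
  have hmY : m₀ + L + 2 ≤ Y := by
    have : ((m₀ + L + 2 : ℕ) : ℝ) ≤ Y := by push_cast; linarith
    exact_mod_cast this
  obtain ⟨b₁, hb₁⟩ := Nat.exists_eq_add_of_le (show n₀ ≤ m₀ by omega)
  obtain ⟨b₂, hb₂⟩ := Nat.exists_eq_add_of_le (show m₀ ≤ Y by omega)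
  have hb₁r : (m₀ : ℝ) = n₀ + b₁ := by exact_mod_cast hb₁
  have hb₂r : (Y : ℝ) = m₀ + b₂ := by exact_mod_cast hb₂
  have hleft : ∑ n ∈ Finset.Ico n₀ m₀, φ n = ∑ j ∈ Finset.Ico 1 (b₁ + 1), φ (m₀ - j) := by
    have h := Finset.sum_Ico_reflect (fun n : ℕ => φ n) 1 (m := b₁ + 1) (n := m₀) (by omega)
    rw [show m₀ + 1 - (b₁ + 1) = n₀ by omega, show m₀ + 1 - 1 = m₀ by omega] at h
    rw [← h]
    refine Finset.sum_congr rfl fun j hj => ?_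
    rw [Finset.mem_Ico] at hj
    rw [Nat.cast_sub (by omega)]
  have hright : ∑ n ∈ Finset.Ico (m₀ + 1) (Y + 1), φ n = ∑ j ∈ Finset.Ico 1 (b₂ + 1), φ (m₀ + j) := by
    have h := Finset.sum_Ico_add' (fun n : ℕ => φ n) 1 (b₂ + 1) m₀
    rw [show 1 + m₀ = m₀ + 1 by omega, show b₂ + 1 + m₀ = Y + 1 by omega] at h
    rw [← h]
    refine Finset.sum_congr rfl fun j hj => ?_
    rw [Nat.cast_add, add_comm]
  have hposj : ∀ j : ℕ, L + 1 ≤ j → (0 : ℝ) < j ∧ (1 : ℝ) ≤ j := fun j hj => by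
    have : (1 : ℝ) ≤ j := by exact_mod_cast (by omega : 1 ≤ j)
    exact ⟨by linarith, this⟩
  have hfl : ‖∑ j ∈ Finset.Ico (L + 1) (b₁ + 1), φ (m₀ - j)‖ ≤ 110000 * (400 * A) := by
    refine norm_sum_mul_far_le (q := q) (by linarith) (by positivity) (fun j : ℕ => unitExp (-(x ^ 2 * Real.log (m₀ - j : ℝ))))
      (fun j : ℕ => (edgeWeight x (m₀ - j : ℝ) : ℂ)) hL2 (by omega) (by rw [← hxq]; linarith) ?_ ?_ ?_
    · intro H m h1 h2 h3 h4
      have h1r : ((L + 1 : ℕ) : ℝ) ≤ H := by exact_mod_cast h1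
      have h4r : (m : ℝ) ≤ b₁ + 1 := by exact_mod_cast h4
      exact norm_sum_unitExp_log_sub_le (by linarith) (by linarith) hxq hm (by linarith) h2 h3 (by linarith)
    · intro h h1 h2
      obtain ⟨hp, hp1⟩ := hposj h h1
      have h2r : (h : ℝ) ≤ b₁ := by exact_mod_cast h2
      rw [Complex.norm_real]
      have hd : (h : ℝ) / 2 ≤ |x - (m₀ - h)| := le_trans (by linarith) (le_abs_self _)
      refine (abs_edgeWeight_le (by linarith) (by linarith) (by linarith) (by linarith)).trans ?_
      rw [← hA]
      calc _ ≤ 9 * A / ((h : ℝ) / 2) := by gcongr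
        _ = 18 * A / h := by ring
        _ ≤ _ := by gcongr; norm_num
    · intro h h1 h2
      obtain ⟨hp, hp1⟩ := hposj h h1
      have h2r : (h : ℝ) + 1 ≤ b₁ := by exact_mod_cast h2
      rw [← Complex.ofReal_sub, Complex.norm_real]
      push_cast
      have hd : (h : ℝ) / 2 ≤ |x - (m₀ - h)| := le_trans (by linarith) (le_abs_self _)
      have hd' : (h : ℝ) / 2 ≤ |x - (m₀ - (h + 1))| := le_trans (by linarith) (le_abs_self _)
      refine (abs_edgeWeight_sub_le (by linarith) (by linarith) (by linarith) (by linarith) (by linarith)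
        (by linarith) (by linarith) (by rw [abs_eq (by norm_num)]; right; ring)).trans ?_
      rw [← hA]
      calc _ ≤ 96 * A / ((h : ℝ) / 2 * (h / 2)) := by gcongr
        _ = 384 * A / (h : ℝ) ^ 2 := by field_simp; ring
        _ ≤ _ := by gcongr; norm_num
  have hfr : ‖∑ j ∈ Finset.Ico (L + 1) (b₂ + 1), φ (m₀ + j)‖ ≤ 110000 * (400 * A) := by
    refine norm_sum_mul_far_le (q := q) (by linarith) (by positivity) (fun j : ℕ => unitExp (-(x ^ 2 * Real.log (m₀ + j : ℝ))))
      (fun j : ℕ => (edgeWeight x (m₀ + j : ℝ) : ℂ)) hL2 (by omega) (by rw [← hxq]; linarith) ?_ ?_ ?_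
    · intro H m h1 h2 h3 h4
      have h1r : ((L + 1 : ℕ) : ℝ) ≤ H := by exact_mod_cast h1
      have h4r : (m : ℝ) ≤ b₂ + 1 := by exact_mod_cast h4
      exact norm_sum_unitExp_log_add_le (by linarith) hxq hm (by linarith) h2 h3 (by linarith)
    · intro h h1 h2
      obtain ⟨hp, hp1⟩ := hposj h h1
      have h2r : (h : ℝ) ≤ b₂ := by exact_mod_cast h2
      rw [Complex.norm_real]
      have hd : (h : ℝ) / 2 ≤ |x - (m₀ + h)| := le_trans (by linarith) (neg_le_abs _)
      refine (abs_edgeWeight_le (by linarith) (by linarith) (by linarith) (by linarith)).trans ?_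
      rw [← hA]
      calc _ ≤ 9 * A / ((h : ℝ) / 2) := by gcongr
        _ = 18 * A / h := by ring
        _ ≤ _ := by gcongr; norm_num
    · intro h h1 h2
      obtain ⟨hp, hp1⟩ := hposj h h1
      have h2r : (h : ℝ) + 1 ≤ b₂ := by exact_mod_cast h2
      rw [← Complex.ofReal_sub, Complex.norm_real]
      push_cast
      have hd : (h : ℝ) / 2 ≤ |x - (m₀ + h)| := le_trans (by linarith) (neg_le_abs _)
      have hd' : (h : ℝ) / 2 ≤ |x - (m₀ + (h + 1))| := le_trans (by linarith) (neg_le_abs _)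
      refine (abs_edgeWeight_sub_le (by linarith) (by linarith) (by linarith) (by linarith) (by linarith)
        (by linarith) (by linarith) (by rw [abs_eq (by norm_num)]; left; ring)).trans ?_
      rw [← hA]
      calc _ ≤ 96 * A / ((h : ℝ) / 2 * (h / 2)) := by gcongr
        _ = 384 * A / (h : ℝ) ^ 2 := by field_simp; ring
        _ ≤ _ := by gcongr; norm_num
  rw [hleft, hright, ← Finset.sum_Ico_consecutive _ (show 1 ≤ L + 1 by omega) (show L + 1 ≤ b₁ + 1 by omega),
    ← Finset.sum_Ico_consecutive (fun j : ℕ => φ (m₀ + j)) (show 1 ≤ L + 1 by omega) (show L + 1 ≤ b₂ + 1 by omega)]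
  have e : (∑ j ∈ Finset.Ico 1 (L + 1), φ (m₀ - j) + ∑ j ∈ Finset.Ico (L + 1) (b₁ + 1), φ (m₀ - j)) +
      (∑ j ∈ Finset.Ico 1 (L + 1), φ (m₀ + j) + ∑ j ∈ Finset.Ico (L + 1) (b₂ + 1), φ (m₀ + j)) =
      ∑ j ∈ Finset.Ico 1 (L + 1), (φ (m₀ + j) + φ (m₀ - j)) +
      (∑ j ∈ Finset.Ico (L + 1) (b₁ + 1), φ (m₀ - j) + ∑ j ∈ Finset.Ico (L + 1) (b₂ + 1), φ (m₀ + j)) := by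
    rw [Finset.sum_add_distrib]; ring
  rw [e]
  refine (norm_add_le _ _).trans ((add_le_add hnear ((norm_add_le _ _).trans (add_le_add hfl hfr))).trans ?_)
  linarith

/-! ### The sum of the oscillatory integrals. -/

theorem unitExp_natCast_half (n : ℕ) : unitExp ((n : ℝ) / 2) = (-1) ^ n := by
  unfold unitExp
  rw [← Complex.exp_pi_mul_I, ← Complex.exp_nat_mul]
  congr 1
  push_cast
  ring

/-- At `τ = (x/n)²` the phase `π n² phaseFn τ` is `2π (x² log x - x²/2 - x² log n + n²/2)`, and
`n²/2` equals `n/2` modulo `1`, which cancels the sign. -/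
theorem neg_one_pow_mul_oscKernel {x : ℝ} (hx : 0 < x) {n : ℕ} (hn : 1 ≤ n) :
    (-1) ^ n * oscKernel (Real.pi * (n : ℝ) ^ 2) ((x / n) ^ 2) =
      unitExp (x ^ 2 * Real.log x - x ^ 2 / 2) * unitExp (-(x ^ 2 * Real.log n)) := by
  have hn0 : (0 : ℝ) < n := by exact_mod_cast hn
  have e : oscKernel (Real.pi * (n : ℝ) ^ 2) ((x / n) ^ 2) =
      unitExp (x ^ 2 * Real.log x - x ^ 2 / 2 + -(x ^ 2 * Real.log n) + ((n : ℝ) ^ 2 / 2 - n / 2) + n / 2) := by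
    unfold oscKernel unitExp phaseFn
    congr 3
    rw [Real.log_pow, Real.log_div hx.ne' hn0.ne']
    push_cast
    field_simp
    ring
  have h1 := unitExp_half_sq_sub (n : ℤ)
  push_cast at h1
  rw [e, unitExp_add _ ((n : ℝ) / 2), unitExp_add _ ((n : ℝ) ^ 2 / 2 - n / 2), unitExp_add _ (-(x ^ 2 * Real.log n)),
    h1, unitExp_natCast_half, mul_one]
  have h2 : ((-1 : ℂ)) ^ n * (-1) ^ n = 1 := by rw [← mul_pow]; simp
  linear_combination (unitExp (x ^ 2 * Real.log x - x ^ 2 / 2) * unitExp (-(x ^ 2 * Real.log n))) * h2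

theorem norm_sum_neg_one_pow_mul_le (w : ℕ → ℝ) (M : ℕ) (hw1 : 0 ≤ w 1)
    (hw : ∀ n, 1 ≤ n → n < M → w n ≤ w (n + 1)) (hM : 1 ≤ M) :
    ‖∑ n ∈ Finset.Ico 1 (M + 1), (w n : ℂ) * (-1) ^ n‖ ≤ 2 * w M := by
  have hP : ∀ m, 1 ≤ m → m ≤ M → ‖∑ n ∈ Finset.Ico 1 (m + 1), (-1 : ℂ) ^ n‖ ≤ 1 := by
    intro m hm _
    have : ∑ n ∈ Finset.Ico 1 (m + 1), (-1 : ℂ) ^ n = 0 ∨ ∑ n ∈ Finset.Ico 1 (m + 1), (-1 : ℂ) ^ n = -1 := by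
      have key : ∀ m : ℕ, ∑ n ∈ Finset.Ico 1 (m + 1), (-1 : ℂ) ^ n = ((-1) ^ m - 1) / 2 := by
        intro m
        induction m with
        | zero => simp
        | succ m ih => rw [Finset.sum_Ico_succ_top (by omega), ih]; ring
      rw [key]
      rcases neg_one_pow_eq_or ℂ m with h | h <;> rw [h] <;> norm_num
    rcases this with h | h <;> rw [h] <;> norm_num
  have h := norm_sum_mul_le_by_parts (fun n => (-1 : ℂ) ^ n) (fun n => (w n : ℂ)) (fun _ => 1) hM hP
  refine h.trans ?_
  have hmono : ∀ n, 1 ≤ n → n ≤ M → 0 ≤ w n := by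
    intro n hn
    induction n, hn using Nat.le_induction with
    | base => intro _; exact hw1
    | succ n hn ih => intro h; exact (ih (by omega)).trans (hw n hn (by omega))
  have : ∀ n ∈ Finset.Ico 1 M, ‖((w (n + 1) : ℝ) : ℂ) - (w n : ℂ)‖ * 1 = w (n + 1) - w n := fun n hn => by
    rw [Finset.mem_Ico] at hn
    rw [← Complex.ofReal_sub, Complex.norm_real, Real.norm_eq_abs, mul_one,
      abs_of_nonneg (by linarith [hw n hn.1 hn.2])]
  rw [Finset.sum_congr rfl this, Finset.sum_Ico_sub w hM, Complex.norm_real, Real.norm_eq_abs,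
    abs_of_nonneg (hmono M hM le_rfl)]
  linarith

theorem sum_inv_abs_sub_cube_le {x : ℝ} {m₀ : ℕ} (hm : |x - m₀| ≤ 1 / 2) {n₀ Y : ℕ} (h1 : n₀ ≤ m₀) (h2 : m₀ ≤ Y) :
    ∑ n ∈ Finset.Ico n₀ m₀, 1 / |x - n| ^ 3 ≤ 16 ∧ ∑ n ∈ Finset.Ico (m₀ + 1) (Y + 1), 1 / |x - n| ^ 3 ≤ 16 := by
  have hm1 := abs_le.mp hm
  have key : ∀ (j : ℕ) (d : ℝ), 1 ≤ j → (j : ℝ) / 2 ≤ d → 1 / d ^ 3 ≤ 8 * (1 / (j : ℝ) ^ 2) := by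
    intro j d hj hd
    have hj1 : (1 : ℝ) ≤ j := by exact_mod_cast hj
    calc 1 / d ^ 3 ≤ 1 / ((j : ℝ) / 2) ^ 3 := by gcongr
      _ = 8 * (1 / (j : ℝ) ^ 2) / j := by field_simp; norm_num
      _ ≤ _ := div_le_self (by positivity) hj1
  constructor
  · have h := Finset.sum_Ico_reflect (fun n : ℕ => 1 / |x - n| ^ 3) 1 (m := m₀ - n₀ + 1) (n := m₀) (by omega)
    rw [show m₀ + 1 - (m₀ - n₀ + 1) = n₀ by omega, show m₀ + 1 - 1 = m₀ by omega] at h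
    rw [← h]
    refine (Finset.sum_le_sum fun j hj => ?_).trans
      ((Finset.mul_sum _ _ _).symm.le.trans (by linarith [sum_inv_sq_le (m₀ - n₀)] :
        8 * ∑ j ∈ Finset.Ico 1 (m₀ - n₀ + 1), 1 / (j : ℝ) ^ 2 ≤ 16))
    rw [Finset.mem_Ico] at hj
    have hj1 : (1 : ℝ) ≤ j := by exact_mod_cast hj.1
    refine key j _ hj.1 ?_
    rw [Nat.cast_sub (by omega)]
    exact le_trans (by linarith) (le_abs_self _)
  · have h := Finset.sum_Ico_add' (fun n : ℕ => 1 / |x - n| ^ 3) 1 (Y - m₀ + 1) m₀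
    rw [show 1 + m₀ = m₀ + 1 by omega, show Y - m₀ + 1 + m₀ = Y + 1 by omega] at h
    rw [← h]
    refine (Finset.sum_le_sum fun j hj => ?_).trans
      ((Finset.mul_sum _ _ _).symm.le.trans (by linarith [sum_inv_sq_le (Y - m₀)] :
        8 * ∑ j ∈ Finset.Ico 1 (Y - m₀ + 1), 1 / (j : ℝ) ^ 2 ≤ 16))
    rw [Finset.mem_Ico] at hj
    have hj1 : (1 : ℝ) ≤ j := by exact_mod_cast hj.1
    refine key j _ hj.1 ?_
    push_cast
    exact le_trans (by linarith) (neg_le_abs _)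

/-- The integral of `oscKernel` attached to `n`. -/
noncomputable def oscIntegral (x : ℝ) (n : ℕ) : ℂ :=
  ∫ τ in (0 : ℝ)..(x / n) ^ 2, oscKernel (Real.pi * (n : ℝ) ^ 2) τ

/-- The distance of `(x/n)²` from the critical point is at least `|x - n| / n`; this expresses the
error of the boundary expansion with `l = π n²` in terms of `|x - n|`. -/
theorem one_div_sq_mul_cube_le {x : ℝ} (hx : 0 < x) {n : ℕ} (hn : 1 ≤ n) (hne : (n : ℝ) ≠ x) :
    1 / ((Real.pi * (n : ℝ) ^ 2) ^ 2 * |(x / n) ^ 2 - 1| ^ 3) ≤ 1 / (n * |x - n| ^ 3) := by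
  have hn0 : (0 : ℝ) < n := by exact_mod_cast hn
  have hd : 0 < |x - n| := abs_pos.mpr (sub_ne_zero.mpr hne.symm)
  have h1 : |x - n| / n ≤ |(x / n) ^ 2 - 1| := by
    have : (x / n) ^ 2 - 1 = (x - n) / n * ((x + n) / n) := by field_simp; ring
    rw [this, abs_mul, abs_div, abs_of_pos hn0, abs_of_pos (show 0 < (x + n) / n by positivity)]
    refine le_mul_of_one_le_right (by positivity) ?_
    rw [le_div_iff₀ hn0]; linarith
  have hpi : 1 ≤ Real.pi ^ 2 := by nlinarith [Real.pi_gt_three]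
  apply one_div_le_one_div_of_le (by positivity)
  calc (n : ℝ) * |x - n| ^ 3 = 1 * (n : ℝ) ^ 4 * (|x - n| / n) ^ 3 := by field_simp
    _ ≤ Real.pi ^ 2 * (n : ℝ) ^ 4 * |(x / n) ^ 2 - 1| ^ 3 := by gcongr
    _ = _ := by ring

/-- The boundary contribution to `oscIntegral`. -/
noncomputable def oscEdge (x : ℝ) (n : ℕ) : ℂ :=
  oscKernel (Real.pi * (n : ℝ) ^ 2) ((x / n) ^ 2) /
    (Complex.I * (Real.pi * (n : ℝ) ^ 2 : ℝ) * Real.log ((x / n) ^ 2))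

theorem one_le_pi_mul_sq {n : ℕ} (hn : 1 ≤ n) : (n : ℝ) ^ 2 ≤ Real.pi * (n : ℝ) ^ 2 ∧ 1 ≤ Real.pi * (n : ℝ) ^ 2 := by
  have hn0 : (1 : ℝ) ≤ n := by exact_mod_cast hn
  constructor <;> nlinarith [Real.pi_gt_three]

/-- The cases record where the upper limit `(x/n)²` lies: beyond `4`, where the full stationary
phase value is attained; between the critical point and `4`, where a boundary term is added; before
the critical point, where only the boundary term remains; and at the critical point, where the size
`1/√l` is all that is used. The value has the form `C₀ / n` because `√l = √π n`. -/
theorem exists_oscIntegral_bounds : ∃ (K : ℝ) (C₀ : ℂ), 0 ≤ K ∧ ∀ (x : ℝ) (n : ℕ), 64 ≤ x → 1 ≤ n →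
    ((n : ℝ) < x / 2 → ‖oscIntegral x n - C₀ / n‖ ≤ K * (1 / (n : ℝ) ^ 2)) ∧
    (x / 2 ≤ n → n < x → ‖oscIntegral x n - C₀ / n - oscEdge x n‖ ≤ K * (1 / (n : ℝ) ^ 2 + 1 / (n * |x - n| ^ 3))) ∧
    (x < n → (n : ℝ) ≤ 2 * x → ‖oscIntegral x n - oscEdge x n‖ ≤ K * (1 / (n : ℝ) ^ 2 + 1 / (n * |x - n| ^ 3))) ∧
    (|x - n| ≤ 1 / 2 → ‖oscIntegral x n‖ ≤ K * (1 / n)) := by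
  obtain ⟨C, c, hC⟩ := exists_integral_oscKernel_zero_four
  have hC0 : 0 ≤ C := by
    have := (norm_nonneg _).trans (hC 1 le_rfl)
    simpa using this
  refine ⟨C + 200, c / Real.sqrt Real.pi, by linarith, fun x n hx hn => ?_⟩
  have hn1 : (1 : ℝ) ≤ n := by exact_mod_cast hn
  have hn0 : (0 : ℝ) < n := by linarith
  have hx0 : 0 < x := by linarith
  obtain ⟨hl2, hl1⟩ := one_le_pi_mul_sq hn
  set l := Real.pi * (n : ℝ) ^ 2 with hl
  have hsl : Real.sqrt l = Real.sqrt Real.pi * n := by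
    rw [hl, Real.sqrt_mul Real.pi_pos.le, Real.sqrt_sq hn0.le]
  have hil : 1 / l ≤ 1 / (n : ℝ) ^ 2 := one_div_le_one_div_of_le (by positivity) hl2
  have hc : ‖(∫ τ in (0 : ℝ)..4, oscKernel l τ) - c / Real.sqrt Real.pi / n‖ ≤ C * (1 / (n : ℝ) ^ 2) := by
    have := hC l hl1
    rw [hsl] at this
    push_cast at this
    rw [div_div]
    refine this.trans ?_
    rw [div_eq_mul_one_div]
    gcongr
  have hXn : ∀ y : ℝ, 0 < y → (y * n ≤ x → y ^ 2 ≤ (x / n) ^ 2) := by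
    intro y hy h
    have : y ≤ x / n := by rw [le_div_iff₀ hn0]; exact h
    gcongr
  have hinv : 0 ≤ 1 / (n : ℝ) ^ 2 := by positivity
  have hcube := fun h => one_div_sq_mul_cube_le hx0 hn h
  rw [← hl] at hcube
  refine ⟨fun h => ?_, fun h1 h2 => ?_, fun h1 h2 => ?_, fun h => ?_⟩
  · have h4 := norm_integral_oscKernel_sub_le_of_four_le hl1 (X := (x / n) ^ 2) (by
      have := hXn 2 (by norm_num) (by linarith); linarith)
    have e : oscIntegral x n - c / Real.sqrt Real.pi / n = (oscIntegral x n - ∫ τ in (0 : ℝ)..4, oscKernel l τ) +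
      ((∫ τ in (0 : ℝ)..4, oscKernel l τ) - c / Real.sqrt Real.pi / n) := by ring
    rw [e]
    refine (norm_add_le _ _).trans ((add_le_add h4 hc).trans ?_)
    rw [div_eq_mul_one_div 4 l]
    linarith
  · have hX1 : 1 < (x / n) ^ 2 := by
      have : 1 < x / n := by rw [lt_div_iff₀ hn0]; linarith
      nlinarith
    have hX4 : (x / n) ^ 2 ≤ 4 := by
      have h3 : x / n ≤ 2 := by rw [div_le_iff₀ hn0]; linarith
      have : 0 ≤ x / n := by positivity
      nlinarith
    have h4 := norm_integral_oscKernel_sub_le_of_one_lt hl1 hX1 hX4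
    have hcu := hcube h2.ne
    rw [abs_of_pos (by linarith : 0 < (x / n) ^ 2 - 1)] at hcu
    have e : oscIntegral x n - c / Real.sqrt Real.pi / n - oscEdge x n =
      (oscIntegral x n - (∫ τ in (0 : ℝ)..4, oscKernel l τ) - oscEdge x n) +
      ((∫ τ in (0 : ℝ)..4, oscKernel l τ) - c / Real.sqrt Real.pi / n) := by ring
    rw [e]
    refine (norm_add_le _ _).trans ((add_le_add h4 hc).trans ?_)
    have : 0 ≤ 1 / (n * |x - n| ^ 3) := by positivity
    nlinarith
  · have hX1 : (x / n) ^ 2 < 1 := by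
      have : x / n < 1 := by rw [div_lt_iff₀ hn0]; linarith
      have : 0 ≤ x / n := by positivity
      nlinarith
    have hX4 : 1 / 4 ≤ (x / n) ^ 2 := by
      have := hXn (1 / 2) (by norm_num) (by linarith); linarith
    have h4 := norm_integral_oscKernel_sub_le_of_lt_one hl1 hX4 hX1
    have hcu := hcube h1.ne'
    rw [abs_of_neg (by linarith : (x / n) ^ 2 - 1 < 0), neg_sub] at hcu
    refine h4.trans ?_
    have : 0 ≤ 1 / (n * |x - n| ^ 3) := by positivity
    nlinarith
  · have hd := abs_le.mp h
    have hsp : Real.sqrt Real.pi ≤ 2 := by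
      rw [Real.sqrt_le_left (by norm_num)]; linarith [Real.pi_le_four]
    have hsp1 : 1 ≤ Real.sqrt Real.pi := Real.one_le_sqrt.mpr (by linarith [Real.pi_gt_three])
    have hX : |(x / n) ^ 2 - 1| ≤ 3 / Real.sqrt l := by
      have e : (x / n) ^ 2 - 1 = (x - n) * (x + n) / (n : ℝ) ^ 2 := by field_simp; ring
      rw [e, abs_div, abs_mul, abs_of_pos (show 0 < x + n by linarith), abs_of_pos (show 0 < (n : ℝ) ^ 2 by positivity), hsl]
      calc |x - n| * (x + n) / (n : ℝ) ^ 2 ≤ 1 / 2 * (3 * (n : ℝ)) / (n : ℝ) ^ 2 := by gcongr; linarith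
        _ = 3 / (2 * (n : ℝ)) := by field_simp
        _ ≤ _ := by gcongr
    refine (norm_integral_oscKernel_le_of_near hl1 (by norm_num : (1 : ℝ) ≤ 3) (by positivity) hX).trans ?_
    rw [hsl]
    calc 20 * 3 / (Real.sqrt Real.pi * n) ≤ 20 * 3 / (1 * n) := by gcongr
      _ = 60 * (1 / n) := by ring
      _ ≤ _ := by gcongr; linarith

/-- The endpoint logarithm is `2 (log x - log n)`, and the factor `n²` of `l` combines with the
outer weight to `log n / √n`. What is left in front depends on `x` alone and has norm `1/(2π)`. -/
theorem weight_mul_oscEdge {x : ℝ} (hx : 0 < x) {n : ℕ} (hn : 1 ≤ n) :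
    ((n * Real.sqrt n * Real.log n : ℝ) : ℂ) * ((-1) ^ n * oscEdge x n) =
      unitExp (x ^ 2 * Real.log x - x ^ 2 / 2) / (2 * Real.pi * Complex.I) *
        ((edgeWeight x n : ℂ) * unitExp (-(x ^ 2 * Real.log n))) := by
  have hn0 : (0 : ℝ) < n := by exact_mod_cast hn
  have h := neg_one_pow_mul_oscKernel hx hn
  unfold oscEdge
  rw [← mul_div_assoc ((-1 : ℂ) ^ n), h, Real.log_pow, Real.log_div hx.ne' hn0.ne']
  unfold edgeWeight logDivSqrt
  have hs := Real.mul_self_sqrt hn0.le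
  have hs0 := Real.sqrt_pos.mpr hn0
  have e : n * Real.sqrt n * Real.log n = (n : ℝ) ^ 2 * (Real.log n / Real.sqrt n) := by
    rw [eq_comm, mul_div_assoc', div_eq_iff hs0.ne']
    linear_combination -(n * Real.log n) * hs
  rw [e]
  generalize Real.log n / Real.sqrt n = w
  generalize Real.log (n : ℝ) = ln
  push_cast
  rcases eq_or_ne ((Real.log x : ℂ) - ln) 0 with h0 | h0
  · rw [h0]; simp
  have hnc : (n : ℂ) ≠ 0 := by exact_mod_cast hn0.ne'
  have hpi : (Real.pi : ℂ) ≠ 0 := by exact_mod_cast Real.pi_ne_zero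
  field_simp

/-- The stationary contributions sum to `C₀ ∑ (-1)^n √n log n` over `n < m₀`, an alternating sum
bounded by its last term. The boundary contributions are `norm_sum_edgeWeight_le`. The errors are `∑
log n / √n` and a convergent sum of `|x - n|^{-3}`. -/
theorem exists_norm_sum_oscIntegral_le : ∃ C : ℝ, 0 ≤ C ∧ ∀ x : ℝ, 64 ≤ x →
    ‖∑ n ∈ Finset.Ico 1 (⌊2 * x⌋₊ + 1), ((n * Real.sqrt n * Real.log n : ℝ) : ℂ) * ((-1) ^ n * oscIntegral x n)‖ ≤
      C * (Real.sqrt x * Real.log x) := by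
  obtain ⟨K, C₀, hK, hb⟩ := exists_oscIntegral_bounds
  refine ⟨1000 * K + 10 * ‖C₀‖ + 100000000, by positivity, fun x hx => ?_⟩
  have hx0 : 0 < x := by linarith
  set Y := ⌊2 * x⌋₊ with hYdef
  have hY : (Y : ℝ) ≤ 2 * x := Nat.floor_le (by linarith)
  have hY' : 2 * x - 1 ≤ Y := by linarith [Nat.lt_floor_add_one (2 * x)]
  set n₀ := ⌈x / 2⌉₊ with hn₀def
  have hn₀ : x / 2 ≤ n₀ := Nat.le_ceil _
  have hn₀' : (n₀ : ℝ) ≤ x / 2 + 1 := (Nat.ceil_lt_add_one (by linarith)).le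
  -- The integer nearest to `x`; its term is set aside because the boundary expansion degenerates at
  -- the critical point.
  set m₀ := ⌊x + 1 / 2⌋₊ with hm₀def
  have hm : |x - m₀| ≤ 1 / 2 := by
    have h1 : (m₀ : ℝ) ≤ x + 1 / 2 := Nat.floor_le (by linarith)
    have h2 := Nat.lt_floor_add_one (x + 1 / 2)
    rw [abs_le]; constructor <;> linarith
  have hm1 := abs_le.mp hm
  have hl1 := one_le_log_of_four_le (show 4 ≤ x by linarith)
  set A := Real.sqrt x * Real.log x with hA
  have hA0 : 0 ≤ A := by positivity
  have hlogn : ∀ n : ℕ, 1 ≤ n → n ≤ Y → 0 ≤ Real.log n ∧ Real.log n ≤ 2 * Real.log x := by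
    intro n h1 h2
    have h1r : (1 : ℝ) ≤ n := by exact_mod_cast h1
    have h2r : (n : ℝ) ≤ Y := by exact_mod_cast h2
    refine ⟨Real.log_nonneg h1r, ?_⟩
    have : Real.log n ≤ Real.log (x ^ 2) := Real.log_le_log (by linarith) (by nlinarith)
    rw [Real.log_pow] at this
    exact_mod_cast this
  have hsqn : ∀ n : ℕ, n ≤ Y → Real.sqrt n ≤ 2 * Real.sqrt x := by
    intro n h2
    have h2r : (n : ℝ) ≤ Y := by exact_mod_cast h2
    rw [Real.sqrt_le_left (by positivity), mul_pow, Real.sq_sqrt hx0.le]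
    linarith
  have hn1 : 1 ≤ n₀ := by
    have : (0 : ℝ) < n₀ := by linarith
    exact_mod_cast this
  have hnm : n₀ ≤ m₀ := by
    have : (n₀ : ℝ) ≤ m₀ := by linarith
    exact_mod_cast this
  have hmY : m₀ + 1 ≤ Y := by
    have : ((m₀ + 1 : ℕ) : ℝ) ≤ Y := by push_cast; linarith
    exact_mod_cast this
  set W : ℕ → ℂ := fun n => ((n * Real.sqrt n * Real.log n : ℝ) : ℂ) * (-1) ^ n with hW
  have hWn : ∀ n : ℕ, 1 ≤ n → n ≤ Y → ‖W n‖ = n * Real.sqrt n * Real.log n := by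
    intro n h1 h2
    have := (hlogn n h1 h2).1
    rw [hW]
    simp only [norm_mul, norm_pow, norm_neg, norm_one, one_pow, mul_one, Complex.norm_real, Real.norm_eq_abs]
    rw [abs_of_nonneg (Real.sqrt_nonneg _), abs_of_nonneg this]
    simp
  set E : ℕ → ℝ := fun n => K * (2 * Real.log x) * (1 / Real.sqrt n) with hE
  set E' : ℕ → ℝ := fun n => K * (4 * A) * (1 / |x - n| ^ 3) with hE'
  have hWE : ∀ n : ℕ, 1 ≤ n → n ≤ Y → ‖W n‖ * (K * (1 / (n : ℝ) ^ 2)) ≤ E n := by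
    intro n h1 h2
    have hn0 : (0 : ℝ) < n := by exact_mod_cast h1
    obtain ⟨l0, l2⟩ := hlogn n h1 h2
    rw [hWn n h1 h2]
    have hs := Real.mul_self_sqrt hn0.le
    have hs0 := Real.sqrt_pos.mpr hn0
    have : n * Real.sqrt n * Real.log n * (K * (1 / (n : ℝ) ^ 2)) = K * Real.log n * (1 / Real.sqrt n) := by
      generalize Real.sqrt n = s at *
      rw [← hs]
      field_simp
    rw [this]
    simp only [hE]
    gcongr
  have hWE' : ∀ n : ℕ, 1 ≤ n → n ≤ Y → ‖W n‖ * (K * (1 / (n * |x - n| ^ 3))) ≤ E' n := by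
    intro n h1 h2
    have hn0 : (0 : ℝ) < n := by exact_mod_cast h1
    obtain ⟨l0, l2⟩ := hlogn n h1 h2
    have hs2 := hsqn n h2
    rw [hWn n h1 h2]
    have : n * Real.sqrt n * Real.log n * (K * (1 / (n * |x - n| ^ 3))) = K * (Real.sqrt n * Real.log n) * (1 / |x - n| ^ 3) := by
      rcases eq_or_ne |x - n| 0 with h0 | h0
      · rw [h0]; simp
      field_simp
    rw [this]
    simp only [hE', hA]
    have : Real.sqrt n * Real.log n ≤ 4 * (Real.sqrt x * Real.log x) := by
      calc Real.sqrt n * Real.log n ≤ (2 * Real.sqrt x) * (2 * Real.log x) := by gcongr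
        _ = _ := by ring
    gcongr
  set D : ℕ → ℂ := fun n => W n * (C₀ / n) with hD
  set Bd : ℕ → ℂ := fun n => W n * oscEdge x n with hBd
  set T : ℕ → ℂ := fun n => W n * oscIntegral x n with hT
  have hTeq : ∑ n ∈ Finset.Ico 1 (Y + 1), ((n * Real.sqrt n * Real.log n : ℝ) : ℂ) * ((-1) ^ n * oscIntegral x n) =
      ∑ n ∈ Finset.Ico 1 (Y + 1), T n := Finset.sum_congr rfl fun n _ => by simp only [hT, hW]; ring
  have p1 : ∀ n ∈ Finset.Ico 1 n₀, ‖T n - D n‖ ≤ E n := by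
    intro n hn
    rw [Finset.mem_Ico] at hn
    have hlt : (n : ℝ) < x / 2 := by
      by_contra hcon
      push Not at hcon
      have := Nat.ceil_le.mpr hcon
      omega
    have := (hb x n hx hn.1).1 hlt
    simp only [hT, hD]
    rw [← mul_sub, norm_mul]
    exact (mul_le_mul_of_nonneg_left this (norm_nonneg _)).trans (hWE n hn.1 (by omega))
  have p2 : ∀ n ∈ Finset.Ico n₀ m₀, ‖T n - D n - Bd n‖ ≤ E n + E' n := by
    intro n hn
    rw [Finset.mem_Ico] at hn
    have g1 : x / 2 ≤ n := hn₀.trans (by exact_mod_cast hn.1)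
    have g2 : (n : ℝ) + 1 ≤ m₀ := by exact_mod_cast hn.2
    have := (hb x n hx (by omega)).2.1 g1 (by linarith)
    simp only [hT, hD, hBd]
    rw [← mul_sub, ← mul_sub, norm_mul]
    refine (mul_le_mul_of_nonneg_left this (norm_nonneg _)).trans ?_
    rw [mul_add K, mul_add]
    exact add_le_add (hWE n (by omega) (by omega)) (hWE' n (by omega) (by omega))
  have p3 : ∀ n ∈ Finset.Ico (m₀ + 1) (Y + 1), ‖T n - Bd n‖ ≤ E n + E' n := by
    intro n hn
    rw [Finset.mem_Ico] at hn
    have g1 : (m₀ : ℝ) + 1 ≤ n := by exact_mod_cast hn.1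
    have g2 : (n : ℝ) ≤ Y := by exact_mod_cast (by omega : n ≤ Y)
    have := (hb x n hx (by omega)).2.2.1 (by linarith) (by linarith)
    simp only [hT, hBd]
    rw [← mul_sub, norm_mul]
    refine (mul_le_mul_of_nonneg_left this (norm_nonneg _)).trans ?_
    rw [mul_add K, mul_add]
    exact add_le_add (hWE n (by omega) (by omega)) (hWE' n (by omega) (by omega))
  have p4 : ‖T m₀‖ ≤ 4 * K * A := by
    have := (hb x m₀ hx (by omega)).2.2.2 hm
    simp only [hT]
    rw [norm_mul, hWn m₀ (by omega) (by omega)]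
    obtain ⟨l0, l2⟩ := hlogn m₀ (by omega) (by omega)
    have hs2 := hsqn m₀ (by omega)
    have hm0 : (0 : ℝ) < m₀ := by linarith
    calc _ ≤ m₀ * Real.sqrt m₀ * Real.log m₀ * (K * (1 / m₀)) := by gcongr
      _ = K * (Real.sqrt m₀ * Real.log m₀) := by field_simp
      _ ≤ K * ((2 * Real.sqrt x) * (2 * Real.log x)) := by gcongr
      _ = _ := by rw [hA]; ring
  have hEnn : ∀ n, 0 ≤ E n := fun n => by positivity
  have sE : ∑ n ∈ Finset.Ico 1 (Y + 1), E n ≤ 8 * K * A := by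
    simp only [hE]
    rw [← Finset.mul_sum]
    have h1 := sum_rpow_neg_half_le Y
    have h2 : ∑ n ∈ Finset.Ico 1 (Y + 1), 1 / Real.sqrt n ≤ 2 * Real.sqrt Y := by
      refine le_trans (le_of_eq (Finset.sum_congr rfl fun n _ => ?_)) h1
      rw [Real.rpow_neg (Nat.cast_nonneg _), ← Real.sqrt_eq_rpow, one_div]
    calc _ ≤ K * (2 * Real.log x) * (2 * (2 * Real.sqrt x)) := by
          gcongr
          exact h2.trans (mul_le_mul_of_nonneg_left (hsqn Y le_rfl) (by norm_num))
      _ = _ := by rw [hA]; ring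
  obtain ⟨c1, c2⟩ := sum_inv_abs_sub_cube_le hm hnm (show m₀ ≤ Y by omega)
  have sE1 : ∑ n ∈ Finset.Ico n₀ m₀, E' n ≤ 64 * K * A := by
    simp only [hE']
    rw [← Finset.mul_sum]
    calc _ ≤ K * (4 * A) * 16 := by gcongr
      _ = _ := by ring
  have sE2 : ∑ n ∈ Finset.Ico (m₀ + 1) (Y + 1), E' n ≤ 64 * K * A := by
    simp only [hE']
    rw [← Finset.mul_sum]
    calc _ ≤ K * (4 * A) * 16 := by gcongr
      _ = _ := by ring
  have sD : ‖∑ n ∈ Finset.Ico 1 m₀, D n‖ ≤ 8 * ‖C₀‖ * A := by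
    have e : ∀ n ∈ Finset.Ico 1 m₀, D n = C₀ * (((Real.sqrt n * Real.log n : ℝ) : ℂ) * (-1) ^ n) := by
      intro n hn
      rw [Finset.mem_Ico] at hn
      have hnc : (n : ℂ) ≠ 0 := by exact_mod_cast (by omega : n ≠ 0)
      simp only [hD, hW]
      push_cast
      field_simp
    rw [Finset.sum_congr rfl e, ← Finset.mul_sum, norm_mul]
    have hmm : m₀ = (m₀ - 1) + 1 := by omega
    have h := norm_sum_neg_one_pow_mul_le (fun n : ℕ => Real.sqrt n * Real.log n) (m₀ - 1) (by simp) (by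
      intro n h1 _
      have h1r : (1 : ℝ) ≤ n := by exact_mod_cast h1
      have := Real.log_nonneg h1r
      push_cast
      gcongr <;> linarith) (by
        have : 2 ≤ n₀ := by
          have : ((2 : ℕ) : ℝ) ≤ n₀ := by push_cast; linarith
          exact_mod_cast this
        omega)
    rw [← hmm] at h
    have l2 := hlogn (m₀ - 1) (by
        have : 2 ≤ n₀ := by
          have : ((2 : ℕ) : ℝ) ≤ n₀ := by push_cast; linarith
          exact_mod_cast this
        omega) (by omega)
    have hs2 := hsqn (m₀ - 1) (by omega)
    calc _ ≤ ‖C₀‖ * (2 * ((2 * Real.sqrt x) * (2 * Real.log x))) := by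
          gcongr
          refine h.trans ?_
          have := l2.1
          have := l2.2
          gcongr
      _ = _ := by rw [hA]; ring
  have sB : ‖∑ n ∈ Finset.Ico n₀ m₀, Bd n + ∑ n ∈ Finset.Ico (m₀ + 1) (Y + 1), Bd n‖ ≤ 100000000 * A := by
    have e : ∀ n : ℕ, 1 ≤ n → Bd n = unitExp (x ^ 2 * Real.log x - x ^ 2 / 2) / (2 * Real.pi * Complex.I) *
        ((edgeWeight x n : ℂ) * unitExp (-(x ^ 2 * Real.log n))) := by
      intro n hn
      rw [← weight_mul_oscEdge hx0 hn]
      simp only [hBd, hW]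
      ring
    rw [Finset.sum_congr rfl fun n hn => e n (by rw [Finset.mem_Ico] at hn; omega),
      Finset.sum_congr rfl fun n (hn : n ∈ Finset.Ico (m₀ + 1) (Y + 1)) => e n (by rw [Finset.mem_Ico] at hn; omega),
      ← Finset.mul_sum, ← Finset.mul_sum, ← mul_add, norm_mul, norm_div, norm_unitExp]
    have h := norm_sum_edgeWeight_le hx hm hn₀ hn₀' hY hY'
    have hc : 1 / ‖(2 * Real.pi * Complex.I : ℂ)‖ ≤ 1 := by
      rw [norm_mul, norm_mul, Complex.norm_I, Complex.norm_real, Complex.norm_two, Real.norm_eq_abs,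
        abs_of_pos Real.pi_pos]
      rw [div_le_one (by positivity)]
      linarith [Real.pi_gt_three]
    calc _ ≤ 1 * (100000000 * (Real.sqrt x * Real.log x)) := by gcongr
      _ = _ := by rw [one_mul]
  -- `D` is the stationary value, present for `n < m₀`; `Bd` is the boundary value, present on `[n₀,
  -- Y]` except at `m₀`.
  have split : ∑ n ∈ Finset.Ico 1 (Y + 1), T n =
      ∑ n ∈ Finset.Ico 1 n₀, (T n - D n) + ∑ n ∈ Finset.Ico n₀ m₀, (T n - D n - Bd n) +
      ∑ n ∈ Finset.Ico (m₀ + 1) (Y + 1), (T n - Bd n) + T m₀ + ∑ n ∈ Finset.Ico 1 m₀, D n +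
      (∑ n ∈ Finset.Ico n₀ m₀, Bd n + ∑ n ∈ Finset.Ico (m₀ + 1) (Y + 1), Bd n) := by
    rw [← Finset.sum_Ico_consecutive T (show 1 ≤ m₀ by omega) (show m₀ ≤ Y + 1 by omega),
      ← Finset.sum_Ico_consecutive T hn1 hnm, ← Finset.sum_Ico_consecutive D hn1 hnm,
      Finset.sum_eq_sum_Ico_succ_bot (show m₀ < Y + 1 by omega)]
    simp only [Finset.sum_sub_distrib]
    ring
  have s1 := (norm_sum_le _ _).trans (Finset.sum_le_sum p1)
  have s2 := (norm_sum_le _ _).trans (Finset.sum_le_sum p2)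
  have s3 := (norm_sum_le _ _).trans (Finset.sum_le_sum p3)
  rw [Finset.sum_add_distrib] at s2 s3
  have i1 : ∑ n ∈ Finset.Ico 1 n₀, E n ≤ ∑ n ∈ Finset.Ico 1 (Y + 1), E n :=
    Finset.sum_le_sum_of_subset_of_nonneg (Finset.Ico_subset_Ico le_rfl (by omega)) fun n _ _ => hEnn n
  have i2 : ∑ n ∈ Finset.Ico n₀ m₀, E n ≤ ∑ n ∈ Finset.Ico 1 (Y + 1), E n :=
    Finset.sum_le_sum_of_subset_of_nonneg (Finset.Ico_subset_Ico (by omega) (by omega)) fun n _ _ => hEnn n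
  have i3 : ∑ n ∈ Finset.Ico (m₀ + 1) (Y + 1), E n ≤ ∑ n ∈ Finset.Ico 1 (Y + 1), E n :=
    Finset.sum_le_sum_of_subset_of_nonneg (Finset.Ico_subset_Ico (by omega) (by omega)) fun n _ _ => hEnn n
  rw [hTeq, split]
  refine (norm_add_le _ _).trans ?_
  refine (add_le_add ((norm_add_le _ _).trans (add_le_add ((norm_add_le _ _).trans (add_le_add
    ((norm_add_le _ _).trans (add_le_add ((norm_add_le _ _).trans (add_le_add s1 s2)) s3)) p4)) sD)) sB).trans ?_
  have : 0 ≤ K * A := by positivity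
  have : 0 ≤ ‖C₀‖ * A := by positivity
  nlinarith

/-! ### The main phase in the upper half plane. -/

/-- The main term of the Riemann–Siegel theta function. -/
noncomputable def rsPhase (t : ℝ) : ℝ := t / 2 * (Real.log (t / (2 * Real.pi)) - 1)

/-- The logarithm occurring in the derivative of the analytic continuation of `rsPhase`. -/
noncomputable def rsLog (s : ℂ) : ℂ := Complex.log (-Complex.I * (s - 1 / 2) / (2 * Real.pi))

/-- The analytic continuation of `i * rsPhase` to the upper half plane. -/
noncomputable def rsOmega (s : ℂ) : ℂ := (s - 1 / 2) / 2 * (rsLog s - 1)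

theorem re_rotate (s : ℂ) : (-Complex.I * (s - 1 / 2) / (2 * Real.pi)).re = s.im / (2 * Real.pi) := by
  rw [show -Complex.I * (s - 1 / 2) / (2 * Real.pi) = (-Complex.I * (s - 1 / 2)) / ((2 * Real.pi : ℝ) : ℂ) by push_cast; ring,
    Complex.div_ofReal_re]
  simp

theorem im_rotate (s : ℂ) : (-Complex.I * (s - 1 / 2) / (2 * Real.pi)).im = -(s.re - 1 / 2) / (2 * Real.pi) := by
  rw [show -Complex.I * (s - 1 / 2) / (2 * Real.pi) = (-Complex.I * (s - 1 / 2)) / ((2 * Real.pi : ℝ) : ℂ) by push_cast; ring,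
    Complex.div_ofReal_im]
  simp

theorem norm_rotate (s : ℂ) : ‖-Complex.I * (s - 1 / 2) / (2 * Real.pi)‖ = ‖s - 1 / 2‖ / (2 * Real.pi) := by
  rw [norm_div, norm_mul, norm_neg, Complex.norm_I, one_mul, norm_mul, Complex.norm_two, Complex.norm_real,
    Real.norm_eq_abs, abs_of_pos Real.pi_pos]

theorem rotate_mem_slitPlane {s : ℂ} (hs : 0 < s.im) : -Complex.I * (s - 1 / 2) / (2 * Real.pi) ∈ Complex.slitPlane := by
  left
  rw [re_rotate]
  positivity

theorem rsLog_half (t : ℝ) (ht : 0 < t) : rsLog (1 / 2 + (t : ℂ) * Complex.I) = (Real.log (t / (2 * Real.pi)) : ℝ) := by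
  unfold rsLog
  rw [Complex.ofReal_log (by positivity)]
  congr 1
  push_cast
  linear_combination (-(t : ℂ) / (2 * Real.pi)) * Complex.I_mul_I

theorem rsOmega_half (t : ℝ) (ht : 0 < t) : rsOmega (1 / 2 + (t : ℂ) * Complex.I) = (rsPhase t : ℝ) * Complex.I := by
  unfold rsOmega rsPhase
  rw [rsLog_half t ht]
  push_cast
  ring

theorem hasDerivAt_rsLog {s : ℂ} (hs : 0 < s.im) : HasDerivAt rsLog (1 / (s - 1 / 2)) s := by
  have h1 : HasDerivAt (fun s : ℂ => -Complex.I * (s - 1 / 2) / (2 * Real.pi)) (-Complex.I * 1 / (2 * Real.pi)) s :=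
    (((hasDerivAt_id s).sub_const _).const_mul _).div_const _
  have h2 := h1.clog (rotate_mem_slitPlane hs)
  refine h2.congr_deriv ?_
  have hne : s - 1 / 2 ≠ 0 := by
    intro h
    have := congrArg Complex.im h
    simp at this
    linarith
  have hpi : (Real.pi : ℂ) ≠ 0 := by exact_mod_cast Real.pi_ne_zero
  field_simp [Complex.I_ne_zero]

theorem hasDerivAt_rsOmega {s : ℂ} (hs : 0 < s.im) : HasDerivAt rsOmega (rsLog s / 2) s := by
  have h1 : HasDerivAt (fun s : ℂ => (s - 1 / 2) / 2) (1 / 2) s := ((hasDerivAt_id s).sub_const _).div_const _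
  refine (h1.mul ((hasDerivAt_rsLog hs).sub_const 1)).congr_deriv ?_
  have hne : s - 1 / 2 ≠ 0 := by
    intro h
    have := congrArg Complex.im h
    simp at this
    linarith
  rw [mul_one_div, div_right_comm, div_self hne]
  ring

theorem re_rsLog (s : ℂ) : (rsLog s).re = Real.log (‖s - 1 / 2‖ / (2 * Real.pi)) := by
  unfold rsLog
  rw [Complex.log_re, norm_rotate]

theorem abs_im_rsLog_le {s : ℂ} (hs : 0 < s.im) : |(rsLog s).im| ≤ Real.pi / 2 := by
  unfold rsLog
  rw [Complex.log_im, Complex.abs_arg_le_pi_div_two_iff, re_rotate]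
  positivity

theorem norm_rsLog_le {s : ℂ} (hs : 0 < s.im) : ‖rsLog s‖ ≤ |Real.log (‖s - 1 / 2‖ / (2 * Real.pi))| + 2 := by
  refine (Complex.norm_le_abs_re_add_abs_im _).trans ?_
  rw [re_rsLog]
  have := abs_im_rsLog_le hs
  linarith [Real.pi_le_four]

/-- Only a negative argument matters. There the rotated point satisfies `tan(-arg) = (Re s - 1/2) /
Im s`, and an acute angle is below its tangent. The bound cancels the `-1` in `rsOmega` exactly when
real parts are taken. -/
theorem neg_im_mul_im_rsLog_le {s : ℂ} (hs : 0 < s.im) (hre : 1 / 2 ≤ s.re) :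
    -(s.im * (rsLog s).im) ≤ s.re - 1 / 2 := by
  unfold rsLog
  rw [Complex.log_im]
  set z := -Complex.I * (s - 1 / 2) / (2 * Real.pi) with hz
  have hzre : 0 < z.re := by rw [hz, re_rotate]; have := Real.pi_pos; positivity
  rcases le_or_gt 0 z.arg with h | h
  · have := mul_nonneg hs.le h
    linarith
  have hlt : |z.arg| < Real.pi / 2 := Complex.abs_arg_lt_pi_div_two_iff.mpr (Or.inl hzre)
  have h1 := Real.lt_tan (x := -z.arg) (by linarith) (by linarith [(abs_lt.mp hlt).1])
  rw [Real.tan_neg, Complex.tan_arg, hz, re_rotate, im_rotate] at h1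
  have h2 : -(-(s.re - 1 / 2) / (2 * Real.pi) / (s.im / (2 * Real.pi))) = (s.re - 1 / 2) / s.im := by
    have := Real.pi_pos
    field_simp
  rw [h2, ← hz, lt_div_iff₀ hs] at h1
  linarith

theorem re_rsOmega_le {s : ℂ} (hs : 0 < s.im) (hre : 1 / 2 ≤ s.re) :
    (rsOmega s).re ≤ (s.re - 1 / 2) / 2 * Real.log (‖s - 1 / 2‖ / (2 * Real.pi)) := by
  have h := neg_im_mul_im_rsLog_le hs hre
  have e : (rsOmega s).re = (s.re - 1 / 2) / 2 * ((rsLog s).re - 1) - s.im / 2 * (rsLog s).im := by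
    unfold rsOmega
    rw [show (s - 1 / 2) / 2 * (rsLog s - 1) = ((s - 1 / 2) * (rsLog s - 1)) / ((2 : ℝ) : ℂ) by push_cast; ring,
      Complex.div_ofReal_re, Complex.mul_re]
    simp
    ring
  rw [e, re_rsLog]
  linarith

theorem norm_exp_rsOmega_le {s : ℂ} (hs : 0 < s.im) (hre : 1 / 2 ≤ s.re) :
    ‖Complex.exp (rsOmega s)‖ ≤ (‖s - 1 / 2‖ / (2 * Real.pi)) ^ ((s.re - 1 / 2) / 2) := by
  have hpos : 0 < ‖s - 1 / 2‖ := by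
    have h1 := Complex.abs_im_le_norm (s - 1 / 2)
    have : (s - 1 / 2).im = s.im := by simp
    rw [this, abs_of_pos hs] at h1
    linarith
  have := Real.pi_pos
  rw [Complex.norm_exp, Real.rpow_def_of_pos (by positivity), mul_comm (Real.log _)]
  exact Real.exp_le_exp.mpr (re_rsOmega_le hs hre)

theorem continuousOn_rsOmega_line {σ a b : ℝ} (ha : 0 < a) :
    ContinuousOn (fun t : ℝ => Complex.exp (rsOmega (σ + (t : ℂ) * Complex.I))) (Set.Icc a b) := by
  intro t ht
  have : 0 < ((σ : ℂ) + (t : ℂ) * Complex.I).im := by simp; linarith [ht.1]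
  exact (((hasDerivAt_rsOmega this).continuousAt.cexp).comp (f := fun t : ℝ => (σ : ℂ) + (t : ℂ) * Complex.I)
    (by fun_prop)).continuousWithinAt

theorem continuousOn_rsLog_line {σ a b : ℝ} (ha : 0 < a) :
    ContinuousOn (fun t : ℝ => rsLog (σ + (t : ℂ) * Complex.I)) (Set.Icc a b) := by
  intro t ht
  have : 0 < ((σ : ℂ) + (t : ℂ) * Complex.I).im := by simp; linarith [ht.1]
  exact (((hasDerivAt_rsLog this).continuousAt).comp (f := fun t : ℝ => (σ : ℂ) + (t : ℂ) * Complex.I)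
    (by fun_prop)).continuousWithinAt

theorem hasDerivAt_vertical (σ t : ℝ) : HasDerivAt (fun t : ℝ => (σ : ℂ) + (t : ℂ) * Complex.I) Complex.I t := by
  simpa using ((Complex.ofRealCLM.hasDerivAt (x := t)).mul_const Complex.I).const_add (σ : ℂ)

theorem vertical_norm_bounds {t : ℝ} (ht : 0 ≤ t) :
    (t + 2) / 4 ≤ ‖((2 : ℝ) : ℂ) + (t : ℂ) * Complex.I - 1 / 2‖ ∧ 3 / 2 ≤ ‖((2 : ℝ) : ℂ) + (t : ℂ) * Complex.I - 1 / 2‖ ∧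
      ‖((2 : ℝ) : ℂ) + (t : ℂ) * Complex.I - 1 / 2‖ ≤ t + 2 := by
  have e : ((2 : ℝ) : ℂ) + (t : ℂ) * Complex.I - 1 / 2 = ((3 / 2 : ℝ) : ℂ) + (t : ℂ) * Complex.I := by push_cast; ring
  rw [e]
  have h1 := Complex.abs_re_le_norm (((3 / 2 : ℝ) : ℂ) + (t : ℂ) * Complex.I)
  have h2 := Complex.abs_im_le_norm (((3 / 2 : ℝ) : ℂ) + (t : ℂ) * Complex.I)
  rw [re_ofReal_add_ofReal_mul_I, abs_of_pos (by norm_num)] at h1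
  rw [im_ofReal_add_ofReal_mul_I, abs_of_nonneg ht] at h2
  refine ⟨by linarith, h1, ?_⟩
  refine (norm_add_le _ _).trans ?_
  rw [norm_mul, Complex.norm_I, Complex.norm_real, Complex.norm_real, Real.norm_eq_abs, Real.norm_eq_abs,
    abs_of_nonneg ht, abs_of_pos (by norm_num)]
  linarith

set_option maxHeartbeats 1000000 in
-- The exponent `rsOmega - s log n` has derivative `i p` along the line with `p = rsLog/2 - log n`.
-- For `n ≥ 2x` and heights up to `2πx²` the real part of `p` stays below `-(log n - log x)/2`, so
-- there is no stationary point. One integration by parts leaves the size of the exponential, at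
-- most `(t + 2)^{3/4} n^{-2}`, which at the top is of order `x^{3/2} n^{-2}`.
theorem norm_integral_vertical_le {x T₀ : ℝ} (hx : 64 ≤ x) (hT₀ : 0 < T₀) (hT : T₀ ≤ 2 * Real.pi * x ^ 2) {n : ℕ}
    (hn : 2 * x ≤ n) :
    ‖∫ t in T₀..(2 * Real.pi * x ^ 2), (n : ℂ) ^ (-(((2 : ℝ) : ℂ) + (t : ℂ) * Complex.I)) *
      (Complex.exp (rsOmega (((2 : ℝ) : ℂ) + (t : ℂ) * Complex.I)) * (rsLog (((2 : ℝ) : ℂ) + (t : ℂ) * Complex.I) / 2))‖ ≤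
      300 * (x * Real.sqrt x * Real.log x) / (n : ℝ) ^ 2 := by
  have hx0 : 0 < x := by linarith
  have hpi := Real.pi_gt_three
  have hpi4 := Real.pi_lt_d2
  have hn0 : (0 : ℝ) < n := by linarith
  have hnne : (n : ℂ) ≠ 0 := by exact_mod_cast hn0.ne'
  set T := 2 * Real.pi * x ^ 2 with hTdef
  set γ : ℝ → ℂ := fun t => ((2 : ℝ) : ℂ) + (t : ℂ) * Complex.I with hγ
  set ln : ℝ := Real.log n with hln
  have hlnC : Complex.log n = (ln : ℂ) := by rw [hln, Complex.ofReal_log hn0.le]; simp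
  have hlx := one_le_log_of_four_le (show 4 ≤ x by linarith)
  have hln2 : Real.log x + 69 / 100 ≤ ln := by
    have : Real.log (2 * x) ≤ ln := Real.log_le_log (by linarith) hn
    rw [Real.log_mul (by norm_num) hx0.ne'] at this
    linarith [Real.log_two_gt_d9]
  have him : ∀ t, (γ t).im = t := fun t => im_ofReal_add_ofReal_mul_I _ _
  have hre : ∀ t, (γ t).re = 2 := fun t => re_ofReal_add_ofReal_mul_I _ _
  have hlogub : ∀ t, 0 ≤ t → t ≤ T → Real.log (‖γ t - 1 / 2‖ / (2 * Real.pi)) ≤ 2 * Real.log x + 1 / 1000 := by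
    intro t h0 h1
    obtain ⟨b1, b2, b3⟩ := vertical_norm_bounds h0
    have : ‖γ t - 1 / 2‖ / (2 * Real.pi) ≤ x ^ 2 * (1 + 1 / 1000) := by
      rw [div_le_iff₀ (by positivity)]
      nlinarith
    refine (Real.log_le_log (by positivity) this).trans ?_
    rw [Real.log_mul (by positivity) (by norm_num), Real.log_pow]
    have := Real.log_le_sub_one_of_pos (show (0 : ℝ) < 1 + 1 / 1000 by norm_num)
    push_cast
    linarith
  have hloglb : ∀ t, 0 ≤ t → -2 ≤ Real.log (‖γ t - 1 / 2‖ / (2 * Real.pi)) := by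
    intro t h0
    obtain ⟨b1, b2, b3⟩ := vertical_norm_bounds h0
    have h1 : (1 : ℝ) / 5 ≤ ‖γ t - 1 / 2‖ / (2 * Real.pi) := by
      rw [le_div_iff₀ (by positivity)]
      linarith
    have h2 := Real.log_le_log (by norm_num) h1
    have h3 : Real.log (1 / 5) ≥ -2 := by
      rw [one_div, Real.log_inv]
      have : Real.log 5 ≤ 2 := by
        rw [Real.log_le_iff_le_exp (by norm_num), show (2 : ℝ) = 1 + 1 by norm_num, Real.exp_add]
        nlinarith [Real.exp_one_gt_d9]
      linarith
    linarith
  set p : ℝ → ℂ := fun t => rsLog (γ t) / 2 - ln with hp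
  set q : ℝ → ℂ := fun t => rsLog (γ t) / 2 with hq
  set E : ℝ → ℂ := fun t => rsOmega (γ t) - γ t * ln with hE
  have hplb : ∀ t, 0 < t → t ≤ T → (ln - Real.log x) / 2 ≤ ‖p t‖ := by
    intro t h0 h1
    have h2 := Complex.abs_re_le_norm (p t)
    have h3 : (p t).re = Real.log (‖γ t - 1 / 2‖ / (2 * Real.pi)) / 2 - ln := by
      simp only [hp]
      rw [Complex.sub_re, Complex.ofReal_re, show rsLog (γ t) / 2 = rsLog (γ t) / ((2 : ℝ) : ℂ) by push_cast; ring,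
        Complex.div_ofReal_re, re_rsLog]
    rw [h3] at h2
    have := hlogub t h0.le h1
    have := neg_le_abs (Real.log (‖γ t - 1 / 2‖ / (2 * Real.pi)) / 2 - ln)
    linarith
  have hp0 : ∀ t, 0 < t → t ≤ T → 0 < ‖p t‖ := fun t h0 h1 => by have := hplb t h0 h1; linarith
  have hpne : ∀ t, 0 < t → t ≤ T → p t ≠ 0 := fun t h0 h1 => norm_pos_iff.mp (hp0 t h0 h1)
  have hqub : ∀ t, 0 < t → t ≤ T → ‖q t‖ ≤ 3 * Real.log x + 1 := by
    intro t h0 h1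
    simp only [hq]
    rw [norm_div, Complex.norm_two]
    have h2 := norm_rsLog_le (s := γ t) (by rw [him]; exact h0)
    have h3 : |Real.log (‖γ t - 1 / 2‖ / (2 * Real.pi))| ≤ 2 * Real.log x + 2 := by
      rw [abs_le]; constructor <;> linarith [hlogub t h0.le h1, hloglb t h0.le]
    linarith
  have hqd : ∀ t, 0 < t → HasDerivAt q (1 / (γ t - 1 / 2) * Complex.I / 2) t := by
    intro t h0
    exact ((hasDerivAt_rsLog (by rw [him]; exact h0)).comp t (hasDerivAt_vertical 2 t)).div_const 2
  have hpd : ∀ t, 0 < t → HasDerivAt p (1 / (γ t - 1 / 2) * Complex.I / 2) t := fun t h0 => (hqd t h0).sub_const _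
  have hEd : ∀ t, 0 < t → HasDerivAt E (Complex.I * p t) t := by
    intro t h0
    have h1 := ((hasDerivAt_rsOmega (s := γ t) (by rw [him]; exact h0)).comp t (hasDerivAt_vertical 2 t)).sub
      ((hasDerivAt_vertical 2 t).mul_const (ln : ℂ))
    refine h1.congr_deriv ?_
    simp only [hp]; ring
  set G : ℝ → ℂ := fun t => q t / (Complex.I * p t) with hG
  -- Since `q = p + log n` and `q' = p'`, the derivative of `q / (i p)` reduces to `-p' log n / (i
  -- p²)`.
  set G' : ℝ → ℂ := fun t => (1 / (γ t - 1 / 2) * Complex.I / 2) * (-(ln : ℂ)) / (Complex.I * p t ^ 2) with hG'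
  have hGd : ∀ t, 0 < t → t ≤ T → HasDerivAt G (G' t) t := by
    intro t h0 h1
    have h2 := (hqd t h0).div ((hpd t h0).const_mul Complex.I) (mul_ne_zero Complex.I_ne_zero (hpne t h0 h1))
    refine h2.congr_deriv ?_
    simp only [hG']
    have h3 := hpne t h0 h1
    have h4 : q t = p t + ln := by simp only [hp, hq]; ring
    rw [h4]
    generalize p t = P at *
    generalize 1 / (γ t - 1 / 2) * Complex.I / 2 = D
    field_simp [Complex.I_ne_zero]
    ring
  have hexp : ∀ t, 0 < t → ‖Complex.exp (E t)‖ ≤ (t + 2) ^ (3 / 4 : ℝ) / (n : ℝ) ^ 2 := by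
    intro t h0
    simp only [hE]
    rw [Complex.exp_sub, norm_div]
    have h1 := norm_exp_rsOmega_le (s := γ t) (by rw [him]; exact h0) (by rw [hre]; norm_num)
    rw [hre] at h1
    obtain ⟨b1, b2, b3⟩ := vertical_norm_bounds h0.le
    have h2 : ‖Complex.exp (γ t * ln)‖ = (n : ℝ) ^ 2 := by
      rw [Complex.norm_exp, Complex.re_mul_ofReal, hre, mul_comm, hln, ← Real.rpow_def_of_pos hn0]
      norm_num
    rw [h2]
    gcongr
    refine h1.trans ?_
    rw [show ((2 : ℝ) - 1 / 2) / 2 = 3 / 4 by norm_num]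
    apply Real.rpow_le_rpow (by positivity) _ (by norm_num)
    exact (div_le_self (norm_nonneg _) (by linarith)).trans b3
  have hint : ∀ t ∈ Set.uIcc T₀ T, (n : ℂ) ^ (-(γ t)) * (Complex.exp (rsOmega (γ t)) * (rsLog (γ t) / 2)) =
      G t * (Complex.exp (E t) * (Complex.I * p t)) := by
    intro t ht
    rw [Set.uIcc_of_le hT] at ht
    have h3 := hpne t (hT₀.trans_le ht.1) ht.2
    simp only [hG, hE]
    rw [Complex.cpow_def_of_ne_zero hnne, hlnC, sub_eq_add_neg, Complex.exp_add]
    have : Complex.exp (-(γ t * ln)) = Complex.exp (ln * -γ t) := by congr 1; ring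
    rw [this]
    have h4 : q t = rsLog (γ t) / 2 := rfl
    rw [← h4]
    field_simp [Complex.I_ne_zero]
  rw [intervalIntegral.integral_congr hint]
  have hcq : ContinuousOn q (Set.uIcc T₀ T) := by
    rw [Set.uIcc_of_le hT]
    exact (continuousOn_rsLog_line hT₀).div_const 2
  have hcp : ContinuousOn p (Set.uIcc T₀ T) := hcq.sub continuousOn_const
  have hcE : ContinuousOn (fun t => Complex.exp (E t)) (Set.uIcc T₀ T) := by
    rw [Set.uIcc_of_le hT]
    exact fun t ht => (hEd t (hT₀.trans_le ht.1)).cexp.continuousAt.continuousWithinAt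
  have hcG' : ContinuousOn G' (Set.uIcc T₀ T) := by
    rw [Set.uIcc_of_le hT] at *
    simp only [hG']
    refine ContinuousOn.div (ContinuousOn.mul (ContinuousOn.div_const (ContinuousOn.mul (ContinuousOn.div
      continuousOn_const ?_ ?_) continuousOn_const) _) continuousOn_const) (continuousOn_const.mul (hcp.pow 2)) ?_
    · exact Continuous.continuousOn (by simp only [hγ]; fun_prop)
    · intro t ht h
      have := (vertical_norm_bounds (hT₀.trans_le ht.1).le).2.1
      simp only [hγ] at h
      rw [h] at this
      norm_num at this
    · intro t ht
      exact mul_ne_zero Complex.I_ne_zero (pow_ne_zero 2 (hpne t (hT₀.trans_le ht.1) ht.2))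
  have hparts := intervalIntegral.integral_mul_deriv_eq_deriv_mul (a := T₀) (b := T) (u := G) (v := fun t => Complex.exp (E t))
    (u' := G') (v' := fun t => Complex.exp (E t) * (Complex.I * p t))
    (fun t ht => by rw [Set.uIcc_of_le hT] at ht; exact hGd t (hT₀.trans_le ht.1) ht.2)
    (fun t ht => by rw [Set.uIcc_of_le hT] at ht; exact (hEd t (hT₀.trans_le ht.1)).cexp)
    hcG'.intervalIntegrable (hcE.mul (continuousOn_const.mul hcp)).intervalIntegrable
  rw [hparts]
  have hnp : (0 : ℝ) < (n : ℝ) ^ 2 := by positivity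
  set M := (T + 2) ^ (3 / 4 : ℝ) with hM
  have hGub : ∀ t, 0 < t → t ≤ T → ‖G t‖ ≤ 12 * Real.log x := by
    intro t h0 h1
    simp only [hG]
    rw [norm_div, norm_mul, Complex.norm_I, one_mul, div_le_iff₀ (hp0 t h0 h1)]
    have := hplb t h0 h1
    have := hqub t h0 h1
    nlinarith
  have hbd : ∀ t, 0 < t → t ≤ T → ‖G t * Complex.exp (E t)‖ ≤ 12 * Real.log x * (M / (n : ℝ) ^ 2) := by
    intro t h0 h1
    rw [norm_mul]
    have h2 := hexp t h0
    have h3 : (t + 2) ^ (3 / 4 : ℝ) ≤ M := Real.rpow_le_rpow (by linarith) (by linarith) (by norm_num)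
    have h4 := hGub t h0 h1
    calc _ ≤ 12 * Real.log x * ((t + 2) ^ (3 / 4 : ℝ) / (n : ℝ) ^ 2) := by gcongr
      _ ≤ _ := by gcongr
  have hG'ub : ∀ t, 0 < t → t ≤ T → ‖G' t * Complex.exp (E t)‖ ≤ (30 * Real.log x / (n : ℝ) ^ 2) * (t + 2) ^ (-1 / 4 : ℝ) := by
    intro t h0 h1
    obtain ⟨b1, b2, b3⟩ := vertical_norm_bounds h0.le
    have hpl := hplb t h0 h1
    -- With `d = log n - log x ≥ 0.69` and `‖p‖ ≥ d/2`, the quotient is at most `4 (d + log x)/d²`;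
    -- the decimals `1.5` and `2.11` bound `1/0.69` and `1/0.69²`.
    have h5 : ln / ‖p t‖ ^ 2 ≤ 15 * Real.log x := by
      rw [div_le_iff₀ (by have := hp0 t h0 h1; positivity)]
      set d := ln - Real.log x with hd
      have hd1 : 69 / 100 ≤ d := by linarith
      have h6 : (d / 2) ^ 2 ≤ ‖p t‖ ^ 2 := by gcongr
      have h7 : ln = d + Real.log x := by rw [hd]; ring
      have h8 : d ≤ d ^ 2 * 1.5 := by nlinarith
      have h9 : 1 ≤ d ^ 2 * 2.11 := by nlinarith
      have h10 : Real.log x ≤ d ^ 2 * 2.11 * Real.log x := le_mul_of_one_le_left (by linarith) h9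
      have h11 : d ≤ d ^ 2 * 1.5 * Real.log x := h8.trans (le_mul_of_one_le_right (by positivity) hlx)
      have h12 : 15 * Real.log x * (d / 2) ^ 2 ≤ 15 * Real.log x * ‖p t‖ ^ 2 := by gcongr
      have h13 : 0 ≤ d ^ 2 * Real.log x := by positivity
      nlinarith
    have h2 := hexp t h0
    rw [norm_mul]
    have h6 : ‖G' t‖ ≤ 2 / (t + 2) * (15 * Real.log x) := by
      have e : ‖G' t‖ = 1 / ‖γ t - 1 / 2‖ / 2 * (ln / ‖p t‖ ^ 2) := by
        simp only [hG']
        rw [norm_div, norm_mul, norm_div, norm_mul, norm_div, norm_mul, norm_pow, norm_neg, Complex.norm_I,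
          Complex.norm_real, Complex.norm_two, norm_one, Real.norm_eq_abs, abs_of_nonneg (by linarith : 0 ≤ ln)]
        ring
      rw [e]
      have : 1 / ‖γ t - 1 / 2‖ / 2 ≤ 2 / (t + 2) := by
        rw [div_div, div_le_div_iff₀ (by linarith) (by linarith)]
        simp only [hγ]
        linarith
      have hl0 : 0 ≤ ln := by linarith
      gcongr
    have h7 : (t + 2) ^ (3 / 4 : ℝ) / (t + 2) = (t + 2) ^ (-1 / 4 : ℝ) := by
      rw [← Real.rpow_sub_one (by linarith)]
      norm_num
    calc _ ≤ 2 / (t + 2) * (15 * Real.log x) * ((t + 2) ^ (3 / 4 : ℝ) / (n : ℝ) ^ 2) := by gcongr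
      _ = (30 * Real.log x / (n : ℝ) ^ 2) * ((t + 2) ^ (3 / 4 : ℝ) / (t + 2)) := by ring
      _ = _ := by rw [h7]
  have hI : ‖∫ t in T₀..T, G' t * Complex.exp (E t)‖ ≤ 40 * Real.log x * (M / (n : ℝ) ^ 2) := by
    have hcont : ContinuousOn (fun t : ℝ => (30 * Real.log x / (n : ℝ) ^ 2) * (t + 2) ^ (-1 / 4 : ℝ)) (Set.uIcc T₀ T) := by
      rw [Set.uIcc_of_le hT]
      refine continuousOn_const.mul (ContinuousOn.rpow_const (by fun_prop) fun t ht => Or.inl ?_)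
      have := ht.1
      linarith
    have h1 := intervalIntegral.norm_integral_le_of_norm_le (μ := MeasureTheory.volume) hT (f := fun t => G' t * Complex.exp (E t))
      (g := fun t => (30 * Real.log x / (n : ℝ) ^ 2) * (t + 2) ^ (-1 / 4 : ℝ))
      (Filter.Eventually.of_forall fun t ht => hG'ub t (hT₀.trans ht.1) ht.2) hcont.intervalIntegrable
    refine h1.trans ?_
    have h2 := intervalIntegral.integral_eq_sub_of_hasDerivAt (a := T₀) (b := T)
      (f := fun t : ℝ => (40 * Real.log x / (n : ℝ) ^ 2) * (t + 2) ^ (3 / 4 : ℝ))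
      (f' := fun t => (30 * Real.log x / (n : ℝ) ^ 2) * (t + 2) ^ (-1 / 4 : ℝ)) (fun t ht => by
        rw [Set.uIcc_of_le hT] at ht
        have h3 := (((hasDerivAt_id t).add_const (2 : ℝ)).rpow_const (p := 3 / 4)
          (Or.inl (by simp only [id]; linarith [ht.1]))).const_mul (40 * Real.log x / (n : ℝ) ^ 2)
        refine h3.congr_deriv ?_
        simp only [id]
        norm_num
        ring) hcont.intervalIntegrable
    rw [h2]
    have : 0 ≤ (40 * Real.log x / (n : ℝ) ^ 2) * (T₀ + 2) ^ (3 / 4 : ℝ) := by positivity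
    have e : 40 * Real.log x * (M / (n : ℝ) ^ 2) = 40 * Real.log x / (n : ℝ) ^ 2 * M := by ring
    rw [e]
    linarith
  have hMx : M ≤ 4.5 * (x * Real.sqrt x) := by
    have h1 : T + 2 ≤ (27 / 10 * x) ^ 2 := by nlinarith
    have h2 : M ≤ ((27 / 10 * x) ^ 2) ^ (3 / 4 : ℝ) := Real.rpow_le_rpow (by positivity) h1 (by norm_num)
    refine h2.trans ?_
    rw [← Real.rpow_natCast, ← Real.rpow_mul (by positivity), Real.mul_rpow (by norm_num) hx0.le]
    have h3 : x ^ (((2 : ℕ) : ℝ) * (3 / 4)) = x * Real.sqrt x := by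
      rw [show ((2 : ℕ) : ℝ) * (3 / 4) = 1 + 1 / 2 by norm_num, Real.rpow_add hx0, Real.rpow_one, Real.sqrt_eq_rpow]
    rw [h3]
    have h4 : (27 / 10 : ℝ) ^ (((2 : ℕ) : ℝ) * (3 / 4)) ≤ 4.5 := by
      have h5 : ((27 / 10 : ℝ) ^ (((2 : ℕ) : ℝ) * (3 / 4))) ^ 2 = (27 / 10) ^ 3 := by
        rw [← Real.rpow_natCast, ← Real.rpow_mul (by norm_num), ← Real.rpow_natCast]
        norm_num
      have h6 : 0 ≤ (27 / 10 : ℝ) ^ (((2 : ℕ) : ℝ) * (3 / 4)) := by positivity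
      nlinarith
    gcongr
  refine (norm_sub_le _ _).trans ((add_le_add ((norm_sub_le _ _).trans
    (add_le_add (hbd T (hT₀.trans_le hT) le_rfl) (hbd T₀ hT₀ hT))) hI).trans ?_)
  have : 12 * Real.log x * (M / (n : ℝ) ^ 2) + 12 * Real.log x * (M / (n : ℝ) ^ 2) + 40 * Real.log x * (M / (n : ℝ) ^ 2) =
      64 * M * Real.log x / (n : ℝ) ^ 2 := by ring
  rw [this]
  refine div_le_div_of_nonneg_right ?_ hnp.le
  have := mul_le_mul_of_nonneg_right hMx (show 0 ≤ Real.log x by linarith)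
  have h0 : 0 ≤ x * Real.sqrt x * Real.log x := by positivity
  linarith

/-! ### Zeta minus its Dirichlet polynomial on three sides of a rectangle. -/

/-- The Dirichlet polynomial approximating the zeta function. -/
noncomputable def zetaPoly (Y : ℕ) (s : ℂ) : ℂ := ∑ n ∈ Finset.Ico 1 (Y + 1), (n : ℂ) ^ (-s)

theorem differentiable_zetaPoly (Y : ℕ) : Differentiable ℂ (zetaPoly Y) := by
  unfold zetaPoly
  refine Differentiable.fun_sum fun n hn => ?_
  have : (n : ℂ) ≠ 0 := by
    rw [Finset.mem_Ico] at hn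
    exact_mod_cast (by omega : n ≠ 0)
  exact fun s => ((differentiableAt_id.neg).const_cpow (Or.inl this))

theorem hasSum_zeta_sub_zetaPoly (Y : ℕ) {s : ℂ} (hs : 1 < s.re) :
    HasSum (fun k : ℕ => ((k + (Y + 1) : ℕ) : ℂ) ^ (-s)) (riemannZeta s - zetaPoly Y s) := by
  have h0 : s ≠ 0 := by rintro rfl; norm_num at hs
  have h1 : HasSum (fun n : ℕ => (n : ℂ) ^ (-s)) (riemannZeta s) := by
    rw [zeta_eq_tsum_one_div_nat_cpow hs]
    have h2 : (fun n : ℕ => (n : ℂ) ^ (-s)) = fun n : ℕ => 1 / (n : ℂ) ^ s := by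
      ext n; rw [Complex.cpow_neg, one_div]
    rw [h2]
    exact (Complex.summable_one_div_nat_cpow.mpr hs).hasSum
  have h3 : zetaPoly Y s = ∑ n ∈ Finset.range (Y + 1), (n : ℂ) ^ (-s) := by
    unfold zetaPoly
    rw [Finset.range_eq_Ico, Finset.sum_eq_sum_Ico_succ_bot (show 0 < Y + 1 by omega) fun n : ℕ => (n : ℂ) ^ (-s)]
    simp [h0]
  rw [h3]
  exact (hasSum_nat_add_iff' (Y + 1)).mpr h1

/-- The weight `e^Ω Ω'`. -/
noncomputable def rsWeight (s : ℂ) : ℂ := Complex.exp (rsOmega s) * (rsLog s / 2)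

theorem differentiableAt_rsWeight {s : ℂ} (hs : 0 < s.im) : DifferentiableAt ℂ rsWeight s :=
  ((hasDerivAt_rsOmega hs).differentiableAt.cexp).mul ((hasDerivAt_rsLog hs).differentiableAt.div_const 2)

theorem continuousOn_rsWeight_line {σ a b : ℝ} (ha : 0 < a) :
    ContinuousOn (fun t : ℝ => rsWeight (σ + (t : ℂ) * Complex.I)) (Set.Icc a b) :=
  (continuousOn_rsOmega_line ha).mul ((continuousOn_rsLog_line ha).div_const 2)

theorem norm_natCast_cpow_neg {n : ℕ} (hn : 1 ≤ n) (s : ℂ) : ‖(n : ℂ) ^ (-s)‖ = (n : ℝ) ^ (-s.re) := by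
  rw [Complex.norm_natCast_cpow_of_pos (by omega), Complex.neg_re]

/-- On `Re s = 2` the remaining series converges absolutely and is integrated term by term. Every
term has `n ≥ 2x`, so each costs `O(x^{3/2} log x / n²)`, and the tail of `∑ n^{-2}` gains a factor
`1/x`. -/
theorem norm_integral_two_le {x T₀ : ℝ} (hx : 64 ≤ x) (hT₀ : 0 < T₀) (hT : T₀ ≤ 2 * Real.pi * x ^ 2) :
    ‖∫ t in T₀..(2 * Real.pi * x ^ 2), (riemannZeta (((2 : ℝ) : ℂ) + (t : ℂ) * Complex.I) -
      zetaPoly ⌊2 * x⌋₊ (((2 : ℝ) : ℂ) + (t : ℂ) * Complex.I)) * rsWeight (((2 : ℝ) : ℂ) + (t : ℂ) * Complex.I)‖ ≤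
      600 * (Real.sqrt x * Real.log x) := by
  have hx0 : 0 < x := by linarith
  set Y := ⌊2 * x⌋₊ with hY
  have hYx : x ≤ Y := by linarith [Nat.lt_floor_add_one (2 * x)]
  have hYx2 : 2 * x ≤ Y + 1 := (Nat.lt_floor_add_one (2 * x)).le
  have hlx := one_le_log_of_four_le (show 4 ≤ x by linarith)
  set T := 2 * Real.pi * x ^ 2 with hTdef
  set γ : ℝ → ℂ := fun t => ((2 : ℝ) : ℂ) + (t : ℂ) * Complex.I with hγ
  have hre : ∀ t, (γ t).re = 2 := fun t => re_ofReal_add_ofReal_mul_I _ _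
  set c : ℕ → ℝ := fun k => 1 / ((k + (Y + 1) : ℕ) : ℝ) ^ 2 with hc
  have hw : ContinuousOn (fun t => rsWeight (γ t)) (Set.uIcc T₀ T) := by
    rw [Set.uIcc_of_le hT]; exact continuousOn_rsWeight_line hT₀
  have hkc : ∀ k : ℕ, Continuous fun t => ((k + (Y + 1) : ℕ) : ℂ) ^ (-(γ t)) := by
    intro k
    have : ((k + (Y + 1) : ℕ) : ℂ) ≠ 0 := by exact_mod_cast (by omega : k + (Y + 1) ≠ 0)
    refine Continuous.const_cpow ?_ (Or.inl this)
    simp only [hγ]; fun_prop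
  have hcs : Summable c := by
    have h := (Real.summable_one_div_nat_pow (p := 2)).mpr (by norm_num)
    exact (summable_nat_add_iff (f := fun n : ℕ => 1 / (n : ℝ) ^ 2) (Y + 1)).mpr h
  have hnk : ∀ (k : ℕ) t, ‖((k + (Y + 1) : ℕ) : ℂ) ^ (-(γ t))‖ = c k := by
    intro k t
    rw [norm_natCast_cpow_neg (by omega), hre, Real.rpow_neg (by positivity)]
    simp only [hc, one_div]
    norm_num
  set F : ℕ → ℝ → ℂ := fun k t => ((k + (Y + 1) : ℕ) : ℂ) ^ (-(γ t)) * rsWeight (γ t) with hF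
  have m1 : ∀ k, MeasureTheory.AEStronglyMeasurable (F k) (MeasureTheory.volume.restrict (Set.uIoc T₀ T)) := by
    intro k
    have : ContinuousOn (F k) (Set.uIoc T₀ T) := ((hkc k).continuousOn.mul hw).mono Set.uIoc_subset_uIcc
    exact this.aestronglyMeasurable measurableSet_uIoc
  have m2 : ∀ k t, ‖F k t‖ ≤ c k * ‖rsWeight (γ t)‖ := fun k t => by rw [hF, norm_mul, hnk]
  have m3 : IntervalIntegrable (fun t => ∑' k, c k * ‖rsWeight (γ t)‖) MeasureTheory.volume T₀ T := by
    simp only [tsum_mul_right]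
    exact (continuousOn_const.mul hw.norm).intervalIntegrable
  have m4 : ∀ t, HasSum (fun k => F k t) ((riemannZeta (γ t) - zetaPoly Y (γ t)) * rsWeight (γ t)) := fun t =>
    (hasSum_zeta_sub_zetaPoly Y (by rw [hre]; norm_num)).mul_right _
  -- The bound for finite partial sums, uniform in their length, passes to the limit.
  have hsum := intervalIntegral.hasSum_integral_of_dominated_convergence (μ := MeasureTheory.volume) (a := T₀) (b := T)
    (fun (k : ℕ) t => c k * ‖rsWeight (γ t)‖) m1 (fun k => Filter.Eventually.of_forall fun t _ => m2 k t)
    (Filter.Eventually.of_forall fun t _ => hcs.mul_right _) m3 (Filter.Eventually.of_forall fun t _ => m4 t)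
  refine le_of_tendsto hsum.tendsto_sum_nat.norm (Filter.Eventually.of_forall fun N => ?_)
  set A := x * Real.sqrt x * Real.log x with hA
  have hA0 : 0 ≤ A := by positivity
  have hY0 : (0 : ℝ) < Y := by linarith
  have hterm : ∀ k ∈ Finset.range N, ‖∫ t in T₀..T, ((k + (Y + 1) : ℕ) : ℂ) ^ (-(γ t)) * rsWeight (γ t)‖ ≤
      300 * A * (1 / ((k + Y : ℕ) : ℝ) - 1 / ((k + 1 + Y : ℕ) : ℝ)) := by
    intro k _
    refine (norm_integral_vertical_le hx hT₀ hT (n := k + (Y + 1)) (by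
      push_cast; linarith [(Nat.cast_nonneg k : (0 : ℝ) ≤ k)])).trans ?_
    rw [← hA, div_eq_mul_one_div]
    refine mul_le_mul_of_nonneg_left ?_ (by positivity)
    push_cast
    have hk : (0 : ℝ) < k + Y := by positivity
    rw [show (k : ℝ) + (Y + 1) = k + Y + 1 by ring, show (k : ℝ) + 1 + Y = k + Y + 1 by ring,
      div_sub_div _ _ (by positivity) (by positivity), div_le_div_iff₀ (by positivity) (by positivity)]
    nlinarith
  refine (norm_sum_le _ _).trans ((Finset.sum_le_sum hterm).trans ?_)
  rw [← Finset.mul_sum, Finset.sum_range_sub' (fun k : ℕ => 1 / ((k + Y : ℕ) : ℝ))]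
  have h1 : 1 / ((0 + Y : ℕ) : ℝ) - 1 / ((N + Y : ℕ) : ℝ) ≤ 1 / x := by
    have : 0 ≤ 1 / ((N + Y : ℕ) : ℝ) := by positivity
    have : 1 / ((0 + Y : ℕ) : ℝ) ≤ 1 / x := by
      rw [zero_add]
      exact one_div_le_one_div_of_le hx0 hYx
    linarith
  calc 300 * A * (1 / ((0 + Y : ℕ) : ℝ) - 1 / ((N + Y : ℕ) : ℝ)) ≤ 300 * A * (1 / x) := by gcongr
    _ = 300 * (Real.sqrt x * Real.log x) := by rw [hA]; field_simp
    _ ≤ _ := by gcongr; norm_num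

/-- The approximation error `x^{1-σ}` and the weight `x^{σ-1/2} log x` multiply to `√x log x` for
every `σ`. -/
theorem norm_integral_top_le {x : ℝ} (hx : 64 ≤ x) :
    ‖∫ σ in (1 / 2 : ℝ)..2, (riemannZeta ((σ : ℂ) + ((2 * Real.pi * x ^ 2 : ℝ) : ℂ) * Complex.I) -
      zetaPoly ⌊2 * x⌋₊ ((σ : ℂ) + ((2 * Real.pi * x ^ 2 : ℝ) : ℂ) * Complex.I)) *
        rsWeight ((σ : ℂ) + ((2 * Real.pi * x ^ 2 : ℝ) : ℂ) * Complex.I)‖ ≤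
      1800000 * (Real.sqrt x * Real.log x) := by
  have hx0 : 0 < x := by linarith
  have hpi := Real.pi_gt_three
  have hlx := one_le_log_of_four_le (show 4 ≤ x by linarith)
  set Y := ⌊2 * x⌋₊ with hY
  have hYx : 2 * x ≤ Y + 1 := (Nat.lt_floor_add_one (2 * x)).le
  have hYx2 : (Y : ℝ) ≤ 2 * x := Nat.floor_le (by linarith)
  set T := 2 * Real.pi * x ^ 2 with hT
  have hT0 : 0 < T := by positivity
  have key : ∀ σ ∈ Set.uIoc (1 / 2 : ℝ) 2, ‖(riemannZeta ((σ : ℂ) + (T : ℂ) * Complex.I) -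
      zetaPoly Y ((σ : ℂ) + (T : ℂ) * Complex.I)) * rsWeight ((σ : ℂ) + (T : ℂ) * Complex.I)‖ ≤
      1200000 * (Real.sqrt x * Real.log x) := by
    intro σ hσ
    rw [Set.uIoc_of_le (by norm_num)] at hσ
    obtain ⟨h1, h2⟩ := hσ
    have hz := norm_riemannZeta_sub_sum_Ico_le (x := x) (σ := σ) (by linarith) h1.le h2 (a := Y + 1)
      (by push_cast; linarith) (by push_cast; linarith)
    rw [← hT] at hz
    set s : ℂ := (σ : ℂ) + (T : ℂ) * Complex.I with hs
    have him : s.im = T := im_ofReal_add_ofReal_mul_I _ _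
    have hre : s.re = σ := re_ofReal_add_ofReal_mul_I _ _
    have hb1 : T ≤ ‖s - 1 / 2‖ := by
      have := Complex.abs_im_le_norm (s - 1 / 2)
      rwa [show (s - 1 / 2).im = T by simp [him], abs_of_pos hT0] at this
    have hb2 : ‖s - 1 / 2‖ ≤ T + 2 := by
      have e : s - 1 / 2 = ((σ - 1 / 2 : ℝ) : ℂ) + (T : ℂ) * Complex.I := by rw [hs]; push_cast; ring
      rw [e]
      refine (norm_add_le _ _).trans ?_
      rw [norm_mul, Complex.norm_I, Complex.norm_real, Complex.norm_real, Real.norm_eq_abs, Real.norm_eq_abs,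
        abs_of_pos hT0, abs_of_pos (by linarith)]
      linarith
    have hq1 : x ^ 2 ≤ ‖s - 1 / 2‖ / (2 * Real.pi) := by
      rw [le_div_iff₀ (by positivity)]; rw [hT] at hb1; linarith
    have hq2 : ‖s - 1 / 2‖ / (2 * Real.pi) ≤ 2 * x ^ 2 := by
      rw [div_le_iff₀ (by positivity)]; rw [hT] at hb2; nlinarith
    have hexp : ‖Complex.exp (rsOmega s)‖ ≤ 2 * x ^ (σ - 1 / 2) := by
      refine (norm_exp_rsOmega_le (by rw [him]; exact hT0) (by rw [hre]; exact h1.le)).trans ?_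
      rw [hre]
      calc _ ≤ (2 * x ^ 2) ^ ((σ - 1 / 2) / 2) := by
            apply Real.rpow_le_rpow (by positivity) hq2; linarith
        _ = 2 ^ ((σ - 1 / 2) / 2) * x ^ (σ - 1 / 2) := by
            rw [Real.mul_rpow (by norm_num) (by positivity), ← Real.rpow_natCast, ← Real.rpow_mul hx0.le]
            congr 2
            push_cast
            ring
        _ ≤ 2 ^ (1 : ℝ) * x ^ (σ - 1 / 2) := by
            gcongr
            · norm_num
            · linarith
        _ = _ := by rw [Real.rpow_one]
    have hlog : ‖rsLog s / 2‖ ≤ 3 * Real.log x := by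
      rw [norm_div, Complex.norm_two]
      have h3 := norm_rsLog_le (s := s) (by rw [him]; exact hT0)
      have h4 : 0 ≤ Real.log (‖s - 1 / 2‖ / (2 * Real.pi)) := Real.log_nonneg (by nlinarith)
      have h5 : Real.log (‖s - 1 / 2‖ / (2 * Real.pi)) ≤ Real.log 2 + 2 * Real.log x := by
        refine (Real.log_le_log (by nlinarith) hq2).trans ?_
        rw [Real.log_mul (by norm_num) (by positivity), Real.log_pow]
        norm_num
      rw [abs_of_nonneg h4] at h3
      linarith [Real.log_two_lt_d9]
    have hpow : x ^ (1 - σ) * x ^ (σ - 1 / 2) = Real.sqrt x := by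
      rw [← Real.rpow_add hx0, Real.sqrt_eq_rpow]; congr 1; ring
    unfold rsWeight
    rw [norm_mul, norm_mul]
    calc _ ≤ (200000 * x ^ (1 - σ)) * ((2 * x ^ (σ - 1 / 2)) * (3 * Real.log x)) := by
          gcongr; exact hz
      _ = 1200000 * ((x ^ (1 - σ) * x ^ (σ - 1 / 2)) * Real.log x) := by ring
      _ = _ := by rw [hpow]
  refine (intervalIntegral.norm_integral_le_of_norm_le_const key).trans ?_
  rw [show |(2 : ℝ) - 1 / 2| = 3 / 2 by norm_num]
  linarith

/-- At a fixed height zeta and the weight are bounded by compactness, and only the polynomial grows,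
like `√x`. -/
theorem exists_norm_integral_bottom_le {T₀ : ℝ} (hT₀ : 0 < T₀) : ∃ C : ℝ, 0 ≤ C ∧ ∀ x : ℝ, 64 ≤ x →
    ‖∫ σ in (1 / 2 : ℝ)..2, (riemannZeta ((σ : ℂ) + (T₀ : ℂ) * Complex.I) -
      zetaPoly ⌊2 * x⌋₊ ((σ : ℂ) + (T₀ : ℂ) * Complex.I)) * rsWeight ((σ : ℂ) + (T₀ : ℂ) * Complex.I)‖ ≤
      C * (Real.sqrt x * Real.log x) := by
  set h : ℝ → ℂ := fun σ => (σ : ℂ) + (T₀ : ℂ) * Complex.I with hh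
  have him : ∀ σ, (h σ).im = T₀ := fun σ => im_ofReal_add_ofReal_mul_I _ _
  have hre : ∀ σ, (h σ).re = σ := fun σ => re_ofReal_add_ofReal_mul_I _ _
  have hhc : Continuous h := by simp only [hh]; fun_prop
  have hz : ContinuousOn (fun σ => riemannZeta (h σ)) (Set.Icc (1 / 2) 2) := fun σ _ =>
    (ContinuousAt.comp (f := h) (g := riemannZeta) (differentiableAt_riemannZeta (by
      intro h1
      have := congrArg Complex.im h1
      rw [him] at this
      simp at this
      linarith)).continuousAt hhc.continuousAt).continuousWithinAt
  have hw : ContinuousOn (fun σ => rsWeight (h σ)) (Set.Icc (1 / 2) 2) := fun σ _ =>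
    (ContinuousAt.comp (f := h) (g := rsWeight) (differentiableAt_rsWeight (by rw [him]; exact hT₀)).continuousAt
      hhc.continuousAt).continuousWithinAt
  obtain ⟨B₁, hB₁⟩ := isCompact_Icc.exists_bound_of_continuousOn hz
  obtain ⟨B₂, hB₂⟩ := isCompact_Icc.exists_bound_of_continuousOn hw
  have hB₁0 : 0 ≤ B₁ := (norm_nonneg _).trans (hB₁ 1 (by norm_num))
  have hB₂0 : 0 ≤ B₂ := (norm_nonneg _).trans (hB₂ 1 (by norm_num))
  refine ⟨(B₁ + 4) * B₂ * 2, by positivity, fun x hx => ?_⟩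
  have hx0 : 0 < x := by linarith
  have hlx := one_le_log_of_four_le (show 4 ≤ x by linarith)
  have hsx : 1 ≤ Real.sqrt x := Real.one_le_sqrt.mpr (by linarith)
  set Y := ⌊2 * x⌋₊ with hY
  have hYx2 : (Y : ℝ) ≤ 2 * x := Nat.floor_le (by linarith)
  have hA : Real.sqrt x ≤ Real.sqrt x * Real.log x := le_mul_of_one_le_right (by positivity) hlx
  have key : ∀ σ ∈ Set.uIoc (1 / 2 : ℝ) 2, ‖(riemannZeta (h σ) - zetaPoly Y (h σ)) * rsWeight (h σ)‖ ≤
      (B₁ + 4) * B₂ * (Real.sqrt x * Real.log x) := by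
    intro σ hσ
    rw [Set.uIoc_of_le (by norm_num)] at hσ
    have h1 := hB₁ σ ⟨hσ.1.le, hσ.2⟩
    have h2 := hB₂ σ ⟨hσ.1.le, hσ.2⟩
    have h3 : ‖zetaPoly Y (h σ)‖ ≤ 4 * Real.sqrt x := by
      unfold zetaPoly
      refine (norm_sum_le _ _).trans ?_
      have : ∀ n ∈ Finset.Ico 1 (Y + 1), ‖(n : ℂ) ^ (-(h σ))‖ ≤ (n : ℝ) ^ (-(1 / 2) : ℝ) := by
        intro n hn
        rw [Finset.mem_Ico] at hn
        rw [norm_natCast_cpow_neg hn.1, hre]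
        exact Real.rpow_le_rpow_of_exponent_le (by exact_mod_cast hn.1) (by linarith [hσ.1])
      refine (Finset.sum_le_sum this).trans ((sum_rpow_neg_half_le Y).trans ?_)
      have : Real.sqrt Y ≤ 2 * Real.sqrt x := by
        rw [Real.sqrt_le_left (by positivity), mul_pow, Real.sq_sqrt hx0.le]
        linarith
      linarith
    rw [norm_mul]
    have h4 : ‖riemannZeta (h σ) - zetaPoly Y (h σ)‖ ≤ (B₁ + 4) * Real.sqrt x := by
      refine (norm_sub_le _ _).trans ?_
      nlinarith
    calc _ ≤ (B₁ + 4) * Real.sqrt x * B₂ := by gcongr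
      _ = (B₁ + 4) * B₂ * Real.sqrt x := by ring
      _ ≤ _ := by gcongr
  refine (intervalIntegral.norm_integral_le_of_norm_le_const key).trans ?_
  rw [show |(2 : ℝ) - 1 / 2| = 3 / 2 by norm_num]
  have : 0 ≤ (B₁ + 4) * B₂ * (Real.sqrt x * Real.log x) := by positivity
  linarith

/-! ### The Dirichlet polynomial on the critical line. -/

theorem hasDerivAt_rsPhase {t : ℝ} (ht : 0 < t) : HasDerivAt rsPhase (Real.log (t / (2 * Real.pi)) / 2) t := by
  have hpi := Real.pi_pos
  have h1 : HasDerivAt (fun t : ℝ => Real.log (t / (2 * Real.pi))) (1 / t) t := by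
    refine (((hasDerivAt_id t).div_const (2 * Real.pi)).log (by simp only [id]; positivity)).congr_deriv ?_
    simp only [id]
    field_simp
  refine (((hasDerivAt_id t).div_const 2).mul (h1.sub_const 1)).congr_deriv ?_
  simp only [id]
  field_simp
  ring

theorem exp_pi_mul_sq (n : ℕ) : Complex.exp ((-(Real.pi * (n : ℝ) ^ 2) : ℝ) * Complex.I) = (-1) ^ n := by
  have h1 := unitExp_half_sq_sub (n : ℤ)
  have h2 := unitExp_natCast_half n
  have h3 : unitExp (-((n : ℝ) ^ 2 / 2)) = (-1) ^ n := by
    push_cast at h1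
    rw [unitExp_neg, show (n : ℝ) ^ 2 / 2 = ((n : ℝ) ^ 2 / 2 - n / 2) + n / 2 by ring, unitExp_add, h1, h2]
    simp
  rw [← h3]
  unfold unitExp
  congr 3
  ring

/-- The phase `rsPhase t - t log n` is stationary at `t = 2πn²`. Scaling that point to `τ = 1`
leaves `π n² phaseFn τ - π n²`, and the constant is the sign `(-1)^n`. -/
theorem exp_rsPhase_sub_eq {n : ℕ} (hn : 1 ≤ n) {τ : ℝ} (hτ : 0 < τ) :
    Complex.exp (((rsPhase (2 * Real.pi * (n : ℝ) ^ 2 * τ) - 2 * Real.pi * (n : ℝ) ^ 2 * τ * Real.log n : ℝ) : ℂ) * Complex.I) =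
      (-1) ^ n * oscKernel (Real.pi * (n : ℝ) ^ 2) τ := by
  have hn0 : (0 : ℝ) < n := by exact_mod_cast hn
  have hpi := Real.pi_pos
  rw [← exp_pi_mul_sq]
  unfold oscKernel rsPhase phaseFn
  rw [← Complex.exp_add]
  congr 1
  rw [← add_mul, ← Complex.ofReal_add]
  congr 2
  rw [show 2 * Real.pi * (n : ℝ) ^ 2 * τ / (2 * Real.pi) = (n : ℝ) ^ 2 * τ by field_simp,
    Real.log_mul (by positivity) hτ.ne', Real.log_pow]
  push_cast
  ring

/-- Change of variable `t = 2πn²τ`. Extending the lower limit from `T₀ / (2πn²)` to `0` costs at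
most `T₀`, since the kernel has norm `1`. -/
theorem norm_integral_exp_rsPhase_sub_le {x T₀ : ℝ} (hT₀ : 0 < T₀) (hT : T₀ ≤ 2 * Real.pi * x ^ 2) {n : ℕ}
    (hn : 1 ≤ n) :
    ‖(∫ t in T₀..(2 * Real.pi * x ^ 2), Complex.exp (((rsPhase t - t * Real.log n : ℝ) : ℂ) * Complex.I)) -
      (2 * Real.pi * (n : ℝ) ^ 2 : ℝ) * ((-1) ^ n * oscIntegral x n)‖ ≤ T₀ := by
  have hn0 : (0 : ℝ) < n := by exact_mod_cast hn
  have hpi := Real.pi_pos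
  set c := 2 * Real.pi * (n : ℝ) ^ 2 with hc
  have hc0 : 0 < c := by positivity
  have hcc : (c : ℂ) ≠ 0 := by exact_mod_cast hc0.ne'
  have h1 := intervalIntegral.integral_comp_mul_left (a := T₀ / c) (b := (x / n) ^ 2)
    (fun t => Complex.exp (((rsPhase t - t * Real.log n : ℝ) : ℂ) * Complex.I)) hc0.ne'
  rw [mul_div_cancel₀ _ hc0.ne', show c * (x / n) ^ 2 = 2 * Real.pi * x ^ 2 by rw [hc]; field_simp] at h1
  have hle : T₀ / c ≤ (x / n) ^ 2 := by
    rw [div_le_iff₀ hc0, mul_comm, show c * (x / n) ^ 2 = 2 * Real.pi * x ^ 2 by rw [hc]; field_simp]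
    exact hT
  have h2 : (∫ τ in (T₀ / c)..(x / n) ^ 2, Complex.exp (((rsPhase (c * τ) - c * τ * Real.log n : ℝ) : ℂ) * Complex.I)) =
      (-1) ^ n * ∫ τ in (T₀ / c)..(x / n) ^ 2, oscKernel (Real.pi * (n : ℝ) ^ 2) τ := by
    rw [← intervalIntegral.integral_const_mul]
    refine intervalIntegral.integral_congr fun τ hτ => ?_
    rw [Set.uIcc_of_le hle] at hτ
    exact exp_rsPhase_sub_eq hn (lt_of_lt_of_le (by positivity) hτ.1)
  rw [h2] at h1
  have h3 : (∫ t in T₀..(2 * Real.pi * x ^ 2), Complex.exp (((rsPhase t - t * Real.log n : ℝ) : ℂ) * Complex.I)) =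
      c * ((-1) ^ n * ∫ τ in (T₀ / c)..(x / n) ^ 2, oscKernel (Real.pi * (n : ℝ) ^ 2) τ) := by
    rw [h1, Complex.real_smul, Complex.ofReal_inv, mul_inv_cancel_left₀ hcc]
  have h4 := intervalIntegral.integral_interval_sub_left
    (intervalIntegrable_oscKernel (Real.pi * (n : ℝ) ^ 2) 0 ((x / n) ^ 2))
    (intervalIntegrable_oscKernel (Real.pi * (n : ℝ) ^ 2) 0 (T₀ / c))
  rw [h3, ← h4]
  unfold oscIntegral
  rw [show ∀ A B : ℂ, (c : ℂ) * ((-1) ^ n * (A - B)) - c * ((-1) ^ n * A) = -(c * ((-1) ^ n * B)) by intro A B; ring,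
    norm_neg, norm_mul, norm_mul, Complex.norm_real, Real.norm_eq_abs, abs_of_pos hc0, norm_pow, norm_neg, norm_one,
    one_pow, one_mul]
  have h5 := norm_integral_oscKernel_le_length (Real.pi * (n : ℝ) ^ 2) 0 (T₀ / c)
  rw [sub_zero, abs_of_pos (by positivity)] at h5
  calc _ ≤ c * (T₀ / c) := by gcongr
    _ = T₀ := by field_simp

theorem natCast_cpow_mul_rsWeight {n : ℕ} (hn : 1 ≤ n) {t : ℝ} (ht : 0 < t) :
    (n : ℂ) ^ (-(1 / 2 + (t : ℂ) * Complex.I)) * rsWeight (1 / 2 + (t : ℂ) * Complex.I) =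
      ((1 / Real.sqrt n : ℝ) : ℂ) * (Complex.exp (((rsPhase t - t * Real.log n : ℝ) : ℂ) * Complex.I) *
        ((Real.log (t / (2 * Real.pi)) / 2 : ℝ) : ℂ)) := by
  have hn0 : (0 : ℝ) < n := by exact_mod_cast hn
  have hnne : (n : ℂ) ≠ 0 := by exact_mod_cast hn0.ne'
  unfold rsWeight
  rw [rsOmega_half t ht, rsLog_half t ht, neg_add, Complex.cpow_add _ _ hnne]
  have h1 : (n : ℂ) ^ (-(1 / 2) : ℂ) = ((1 / Real.sqrt n : ℝ) : ℂ) := by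
    rw [Real.sqrt_eq_rpow, one_div ((n : ℝ) ^ _), ← Real.rpow_neg hn0.le, Complex.ofReal_cpow hn0.le]
    push_cast
    rfl
  have h2 : (n : ℂ) ^ (-((t : ℂ) * Complex.I)) = Complex.exp ((-(t * Real.log n) : ℝ) * Complex.I) := by
    rw [Complex.cpow_def_of_ne_zero hnne, ← Complex.natCast_log]
    congr 1
    push_cast
    ring
  rw [h1, h2, sub_eq_add_neg, Complex.ofReal_add, add_mul, Complex.exp_add]
  push_cast
  ring

/-- The difference `rsPhase' - log n` is the derivative of the phase, so against the exponential it
integrates exactly to something of norm at most `2`. Hence `rsPhase'` may be replaced by the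
constant `log n`. -/
theorem integral_natCast_cpow_mul_rsWeight {T₀ T : ℝ} (hT₀ : 0 < T₀) (hT : T₀ ≤ T) {n : ℕ} (hn : 1 ≤ n) :
    ‖(∫ t in T₀..T, (n : ℂ) ^ (-(1 / 2 + (t : ℂ) * Complex.I)) * rsWeight (1 / 2 + (t : ℂ) * Complex.I)) -
      ((1 / Real.sqrt n * Real.log n : ℝ) : ℂ) *
        ∫ t in T₀..T, Complex.exp (((rsPhase t - t * Real.log n : ℝ) : ℂ) * Complex.I)‖ ≤ 2 / Real.sqrt n := by
  have hn0 : (0 : ℝ) < n := by exact_mod_cast hn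
  set f : ℝ → ℂ := fun t => Complex.exp (((rsPhase t - t * Real.log n : ℝ) : ℂ) * Complex.I) with hf
  have hd : ∀ t ∈ Set.uIcc T₀ T, HasDerivAt (fun t => f t * (-Complex.I))
      (f t * ((Real.log (t / (2 * Real.pi)) / 2 : ℝ) : ℂ) - Real.log n * f t) t := by
    intro t ht
    rw [Set.uIcc_of_le hT] at ht
    have h1 := (((hasDerivAt_rsPhase (hT₀.trans_le ht.1)).sub ((hasDerivAt_id t).mul_const (Real.log n))).ofReal_comp.mul_const
      Complex.I).cexp.mul_const (-Complex.I)
    refine h1.congr_deriv ?_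
    simp only [hf, id, Pi.sub_apply]
    push_cast
    ring_nf
    rw [Complex.I_sq]
    ring
  have hfc : ContinuousOn f (Set.uIcc T₀ T) := by
    rw [Set.uIcc_of_le hT]
    intro t ht
    exact (((hasDerivAt_rsPhase (hT₀.trans_le ht.1)).sub ((hasDerivAt_id t).mul_const (Real.log n))).ofReal_comp.mul_const
      Complex.I).cexp.continuousAt.continuousWithinAt
  have hlc : ContinuousOn (fun t : ℝ => ((Real.log (t / (2 * Real.pi)) / 2 : ℝ) : ℂ)) (Set.uIcc T₀ T) := by
    rw [Set.uIcc_of_le hT]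
    refine Complex.continuous_ofReal.comp_continuousOn (ContinuousOn.div_const (ContinuousOn.log (by fun_prop) ?_) 2)
    intro t ht
    have : 0 < t := hT₀.trans_le ht.1
    have := Real.pi_pos
    positivity
  have hcint : IntervalIntegrable (fun t : ℝ => f t * ((Real.log (t / (2 * Real.pi)) / 2 : ℝ) : ℂ))
    MeasureTheory.volume T₀ T := (hfc.mul hlc).intervalIntegrable
  have hcint2 : IntervalIntegrable (fun t : ℝ => (Real.log n : ℂ) * f t) MeasureTheory.volume T₀ T :=
    (continuousOn_const.mul hfc).intervalIntegrable
  have h1 := intervalIntegral.integral_eq_sub_of_hasDerivAt hd (hcint.sub hcint2)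
  rw [intervalIntegral.integral_sub hcint hcint2, intervalIntegral.integral_const_mul] at h1
  have h2 : (∫ t in T₀..T, (n : ℂ) ^ (-(1 / 2 + (t : ℂ) * Complex.I)) * rsWeight (1 / 2 + (t : ℂ) * Complex.I)) =
      ((1 / Real.sqrt n : ℝ) : ℂ) * ∫ t in T₀..T, f t * ((Real.log (t / (2 * Real.pi)) / 2 : ℝ) : ℂ) := by
    rw [← intervalIntegral.integral_const_mul]
    refine intervalIntegral.integral_congr fun t ht => ?_
    rw [Set.uIcc_of_le hT] at ht
    exact natCast_cpow_mul_rsWeight hn (hT₀.trans_le ht.1)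
  rw [h2, eq_add_of_sub_eq h1]
  have hs := Real.sqrt_pos.mpr hn0
  have e : ((1 / Real.sqrt n : ℝ) : ℂ) * (f T * -Complex.I - f T₀ * -Complex.I + (Real.log n : ℂ) * ∫ t in T₀..T, f t) -
      ((1 / Real.sqrt n * Real.log n : ℝ) : ℂ) * ∫ t in T₀..T, f t =
      ((1 / Real.sqrt n : ℝ) : ℂ) * (f T * -Complex.I - f T₀ * -Complex.I) := by
    push_cast; ring
  rw [e, norm_mul, Complex.norm_real, Real.norm_eq_abs, abs_of_pos (by positivity)]
  have nf : ∀ t, ‖f t * -Complex.I‖ = 1 := fun t => by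
    rw [norm_mul, norm_neg, Complex.norm_I, mul_one]
    exact Complex.norm_exp_ofReal_mul_I _
  have h3 := norm_sub_le (f T * -Complex.I) (f T₀ * -Complex.I)
  rw [nf, nf] at h3
  calc _ ≤ 1 / Real.sqrt n * (1 + 1) := by gcongr
    _ = _ := by ring

/-- Term `n` becomes `2πn² · n^{-1/2} log n` times its signed oscillatory integral, which is the
weight of `exists_norm_sum_oscIntegral_le`. The errors per term are `O(log x / √n)` and sum to `O(√x
log x)`. -/
theorem exists_norm_integral_zetaPoly_le {T₀ : ℝ} (hT₀ : 0 < T₀) : ∃ C : ℝ, 0 ≤ C ∧ ∀ x : ℝ, 64 ≤ x →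
    T₀ ≤ 2 * Real.pi * x ^ 2 →
    ‖∫ t in T₀..(2 * Real.pi * x ^ 2), zetaPoly ⌊2 * x⌋₊ (1 / 2 + (t : ℂ) * Complex.I) * rsWeight (1 / 2 + (t : ℂ) * Complex.I)‖ ≤
      C * (Real.sqrt x * Real.log x) := by
  obtain ⟨C, hC0, hC⟩ := exists_norm_sum_oscIntegral_le
  refine ⟨8 + 8 * T₀ + 7 * C, by positivity, fun x hx hT => ?_⟩
  have hx0 : 0 < x := by linarith
  have hlx := one_le_log_of_four_le (show 4 ≤ x by linarith)
  set Y := ⌊2 * x⌋₊ with hY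
  have hYx2 : (Y : ℝ) ≤ 2 * x := Nat.floor_le (by linarith)
  set T := 2 * Real.pi * x ^ 2 with hTdef
  set A := Real.sqrt x * Real.log x with hA
  have hAs : Real.sqrt x ≤ A := le_mul_of_one_le_right (by positivity) hlx
  have hwc : ContinuousOn (fun t : ℝ => rsWeight (1 / 2 + (t : ℂ) * Complex.I)) (Set.uIcc T₀ T) := by
    rw [Set.uIcc_of_le hT]
    have := continuousOn_rsWeight_line (σ := 1 / 2) (a := T₀) (b := T) hT₀
    push_cast at this
    exact this
  have hcpow : ∀ n ∈ Finset.Ico 1 (Y + 1), IntervalIntegrable (fun t : ℝ => (n : ℂ) ^ (-(1 / 2 + (t : ℂ) * Complex.I)) *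
      rsWeight (1 / 2 + (t : ℂ) * Complex.I)) MeasureTheory.volume T₀ T := by
    intro n hn
    rw [Finset.mem_Ico] at hn
    have : (n : ℂ) ≠ 0 := by exact_mod_cast (by omega : n ≠ 0)
    refine (ContinuousOn.mul (Continuous.continuousOn ?_) hwc).intervalIntegrable
    exact Continuous.const_cpow (by fun_prop) (Or.inl this)
  have hsplit : (∫ t in T₀..T, zetaPoly Y (1 / 2 + (t : ℂ) * Complex.I) * rsWeight (1 / 2 + (t : ℂ) * Complex.I)) =
      ∑ n ∈ Finset.Ico 1 (Y + 1), ∫ t in T₀..T, (n : ℂ) ^ (-(1 / 2 + (t : ℂ) * Complex.I)) * rsWeight (1 / 2 + (t : ℂ) * Complex.I) := by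
    rw [← intervalIntegral.integral_finsetSum hcpow]
    refine intervalIntegral.integral_congr fun t _ => ?_
    simp only [zetaPoly, Finset.sum_mul]
  have hlogn : ∀ n ∈ Finset.Ico 1 (Y + 1), 0 ≤ Real.log n ∧ Real.log n ≤ 2 * Real.log x := by
    intro n hn
    rw [Finset.mem_Ico] at hn
    have h1r : (1 : ℝ) ≤ n := by exact_mod_cast hn.1
    have h2r : (n : ℝ) ≤ Y := by exact_mod_cast (by omega : n ≤ Y)
    refine ⟨Real.log_nonneg h1r, ?_⟩
    have : Real.log n ≤ Real.log (x ^ 2) := Real.log_le_log (by linarith) (by nlinarith)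
    rw [Real.log_pow] at this
    exact_mod_cast this
  have hterm : ∀ n ∈ Finset.Ico 1 (Y + 1), ‖(∫ t in T₀..T, (n : ℂ) ^ (-(1 / 2 + (t : ℂ) * Complex.I)) * rsWeight (1 / 2 + (t : ℂ) * Complex.I)) -
      2 * Real.pi * (((n * Real.sqrt n * Real.log n : ℝ) : ℂ) * ((-1) ^ n * oscIntegral x n))‖ ≤
      (2 + 2 * T₀) * Real.log x * (1 / Real.sqrt n) := by
    intro n hn
    obtain ⟨l1, l2⟩ := hlogn n hn
    rw [Finset.mem_Ico] at hn
    have hn0 : (0 : ℝ) < n := by exact_mod_cast hn.1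
    have hs := Real.sqrt_pos.mpr hn0
    have hss := Real.mul_self_sqrt hn0.le
    have b1 := integral_natCast_cpow_mul_rsWeight hT₀ hT hn.1
    have b2 := norm_integral_exp_rsPhase_sub_le hT₀ hT hn.1
    set J := ∫ t in T₀..T, Complex.exp (((rsPhase t - t * Real.log n : ℝ) : ℂ) * Complex.I) with hJ
    have e : 2 * Real.pi * (((n * Real.sqrt n * Real.log n : ℝ) : ℂ) * ((-1) ^ n * oscIntegral x n)) =
        ((1 / Real.sqrt n * Real.log n : ℝ) : ℂ) * ((2 * Real.pi * (n : ℝ) ^ 2 : ℝ) * ((-1) ^ n * oscIntegral x n)) := by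
      have : n * Real.sqrt n * Real.log n = 1 / Real.sqrt n * Real.log n * (n : ℝ) ^ 2 := by
        generalize Real.sqrt n = s at *
        rw [← hss]
        field_simp
      rw [this]
      push_cast
      ring
    rw [e]
    have e2 : ∀ I₁ w j o : ℂ, I₁ - w * o = (I₁ - w * j) + w * (j - o) := by intros; ring
    rw [e2 _ _ J]
    refine (norm_add_le _ _).trans ((add_le_add b1 ?_).trans (?_ : 2 / Real.sqrt n + 1 / Real.sqrt n * (2 * Real.log x) * T₀ ≤ _))
    · rw [norm_mul, Complex.norm_real, Real.norm_eq_abs, abs_of_nonneg (by positivity)]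
      gcongr
    · have : 2 / Real.sqrt n ≤ 2 * Real.log x * (1 / Real.sqrt n) := by
        rw [div_eq_mul_one_div]
        gcongr
        linarith
      linarith
  have hC' := hC x hx
  rw [← hY, ← hA] at hC'
  have hsum : ‖∑ n ∈ Finset.Ico 1 (Y + 1), ((∫ t in T₀..T, (n : ℂ) ^ (-(1 / 2 + (t : ℂ) * Complex.I)) * rsWeight (1 / 2 + (t : ℂ) * Complex.I)) -
      2 * Real.pi * (((n * Real.sqrt n * Real.log n : ℝ) : ℂ) * ((-1) ^ n * oscIntegral x n)))‖ ≤ (8 + 8 * T₀) * A := by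
    refine (norm_sum_le _ _).trans ((Finset.sum_le_sum hterm).trans ?_)
    rw [← Finset.mul_sum]
    have h1 := sum_rpow_neg_half_le Y
    have h2 : ∑ n ∈ Finset.Ico 1 (Y + 1), 1 / Real.sqrt n ≤ 2 * Real.sqrt Y := by
      refine le_trans (le_of_eq (Finset.sum_congr rfl fun n _ => ?_)) h1
      rw [Real.rpow_neg (Nat.cast_nonneg _), ← Real.sqrt_eq_rpow, one_div]
    have h3 : Real.sqrt Y ≤ 2 * Real.sqrt x := by
      rw [Real.sqrt_le_left (by positivity), mul_pow, Real.sq_sqrt hx0.le]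
      linarith
    calc _ ≤ (2 + 2 * T₀) * Real.log x * (2 * (2 * Real.sqrt x)) := by
          gcongr
          linarith
      _ = _ := by rw [hA]; ring
  rw [Finset.sum_sub_distrib, ← Finset.mul_sum, ← hsplit] at hsum
  have hmain : ‖2 * (Real.pi : ℂ) * ∑ n ∈ Finset.Ico 1 (Y + 1), ((n * Real.sqrt n * Real.log n : ℝ) : ℂ) * ((-1) ^ n * oscIntegral x n)‖ ≤
      7 * (C * A) := by
    rw [norm_mul, norm_mul, Complex.norm_two, Complex.norm_real, Real.norm_eq_abs, abs_of_pos Real.pi_pos]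
    have : 2 * Real.pi ≤ 7 := by linarith [Real.pi_lt_d2]
    gcongr
  have := norm_le_norm_sub_add (∫ t in T₀..T, zetaPoly Y (1 / 2 + (t : ℂ) * Complex.I) * rsWeight (1 / 2 + (t : ℂ) * Complex.I))
    (2 * (Real.pi : ℂ) * ∑ n ∈ Finset.Ico 1 (Y + 1), ((n * Real.sqrt n * Real.log n : ℝ) : ℂ) * ((-1) ^ n * oscIntegral x n))
  linarith

/-- The mean value of `ζ(1/2 + it)` against `exp (i ϑ(t)) ϑ'(t)`. -/
theorem exists_norm_integral_zeta_mul_rsWeight_le {T₀ : ℝ} (hT₀ : 0 < T₀) : ∃ C : ℝ, 0 ≤ C ∧ ∀ x : ℝ, 64 ≤ x →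
    T₀ ≤ 2 * Real.pi * x ^ 2 →
    ‖∫ t in T₀..(2 * Real.pi * x ^ 2), riemannZeta (1 / 2 + (t : ℂ) * Complex.I) *
      (Complex.exp ((rsPhase t : ℂ) * Complex.I) * ((Real.log (t / (2 * Real.pi)) / 2 : ℝ) : ℂ))‖ ≤
      C * (Real.sqrt x * Real.log x) := by
  obtain ⟨C₁, hC₁0, hC₁⟩ := exists_norm_integral_bottom_le hT₀
  obtain ⟨C₂, hC₂0, hC₂⟩ := exists_norm_integral_zetaPoly_le hT₀
  refine ⟨C₁ + C₂ + 1800600, by positivity, fun x hx hT => ?_⟩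
  have hx0 : 0 < x := by linarith
  set Y := ⌊2 * x⌋₊ with hY
  set T := 2 * Real.pi * x ^ 2 with hTdef
  set A := Real.sqrt x * Real.log x with hA
  set F : ℂ → ℂ := fun s => (riemannZeta s - zetaPoly Y s) * rsWeight s with hF
  have hFd : DifferentiableOn ℂ F (Set.uIcc (1 / 2 : ℝ) 2 ×ℂ Set.uIcc T₀ T) := by
    intro s hs
    rw [Complex.mem_reProdIm, Set.uIcc_of_le hT] at hs
    have him : 0 < s.im := hT₀.trans_le hs.2.1
    refine (((differentiableAt_riemannZeta ?_).sub (differentiable_zetaPoly Y s)).mul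
      (differentiableAt_rsWeight him)).differentiableWithinAt
    rintro rfl
    simp at him
  have hrect := Complex.integral_boundary_rect_eq_zero_of_differentiableOn F ⟨1 / 2, T₀⟩ ⟨2, T⟩ hFd
  simp only at hrect
  have ht := norm_integral_top_le hx
  have hb := hC₁ x hx
  have hv := norm_integral_two_le hx hT₀ hT
  have hd := hC₂ x hx hT
  rw [← hY, ← hA] at ht hb hv hd
  have e0 : ((1 / 2 : ℝ) : ℂ) = 1 / 2 := by push_cast; rfl
  rw [e0] at hrect
  have hFc : IntervalIntegrable (fun t : ℝ => F (1 / 2 + (t : ℂ) * Complex.I)) MeasureTheory.volume T₀ T := by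
    refine ContinuousOn.intervalIntegrable ?_
    refine hFd.continuousOn.comp (Continuous.continuousOn (by fun_prop)) fun t ht => ?_
    rw [Complex.mem_reProdIm]
    simp only [Complex.add_re, Complex.add_im, Complex.mul_re, Complex.mul_im, Complex.ofReal_re, Complex.ofReal_im,
      Complex.I_re, Complex.I_im]
    norm_num
    exact ht
  have hDc : IntervalIntegrable (fun t : ℝ => zetaPoly Y (1 / 2 + (t : ℂ) * Complex.I) * rsWeight (1 / 2 + (t : ℂ) * Complex.I))
      MeasureTheory.volume T₀ T := by
    refine ContinuousOn.intervalIntegrable ?_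
    refine ContinuousOn.mul (Continuous.continuousOn ((differentiable_zetaPoly Y).continuous.comp (by fun_prop))) ?_
    rw [Set.uIcc_of_le hT]
    have := continuousOn_rsWeight_line (σ := 1 / 2) (a := T₀) (b := T) hT₀
    push_cast at this
    exact this
  have hsplit : (∫ t in T₀..T, riemannZeta (1 / 2 + (t : ℂ) * Complex.I) *
      (Complex.exp ((rsPhase t : ℂ) * Complex.I) * ((Real.log (t / (2 * Real.pi)) / 2 : ℝ) : ℂ))) =
      (∫ t in T₀..T, F (1 / 2 + (t : ℂ) * Complex.I)) +
      ∫ t in T₀..T, zetaPoly Y (1 / 2 + (t : ℂ) * Complex.I) * rsWeight (1 / 2 + (t : ℂ) * Complex.I) := by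
    rw [← intervalIntegral.integral_add hFc hDc]
    refine intervalIntegral.integral_congr fun t ht => ?_
    rw [Set.uIcc_of_le hT] at ht
    simp only [hF]
    unfold rsWeight
    rw [rsOmega_half t (hT₀.trans_le ht.1), rsLog_half t (hT₀.trans_le ht.1)]
    push_cast
    ring
  rw [hsplit]
  -- Cauchy's theorem expresses the critical line through the bottom, the top and the line `Re s =
  -- 2`.
  have hleft : Complex.I * (∫ t in T₀..T, F (1 / 2 + (t : ℂ) * Complex.I)) =
      (∫ σ in (1 / 2 : ℝ)..2, F ((σ : ℂ) + (T₀ : ℂ) * Complex.I)) - (∫ σ in (1 / 2 : ℝ)..2, F ((σ : ℂ) + (T : ℂ) * Complex.I)) +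
        Complex.I * ∫ t in T₀..T, F (((2 : ℝ) : ℂ) + (t : ℂ) * Complex.I) := by
    simp only [smul_eq_mul] at hrect
    linear_combination -hrect
  have hn : ‖∫ t in T₀..T, F (1 / 2 + (t : ℂ) * Complex.I)‖ ≤ C₁ * A + 1800000 * A + 600 * A := by
    have : ‖∫ t in T₀..T, F (1 / 2 + (t : ℂ) * Complex.I)‖ = ‖Complex.I * (∫ t in T₀..T, F (1 / 2 + (t : ℂ) * Complex.I))‖ := by
      rw [norm_mul, Complex.norm_I, one_mul]
    rw [this, hleft]
    refine (norm_add_le _ _).trans (add_le_add ((norm_sub_le _ _).trans (add_le_add hb ht)) ?_)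
    rw [norm_mul, Complex.norm_I, one_mul]
    exact hv
  refine (norm_add_le _ _).trans ((add_le_add hn hd).trans (le_of_eq ?_))
  ring

/-! ### Stirling's formula for the digamma function. -/

theorem digamma_ofReal {x : ℝ} (hx : 0 < x) :
    Complex.digamma x = ((deriv Real.Gamma x / Real.Gamma x : ℝ) : ℂ) := by
  have hne : ∀ m : ℕ, (x : ℂ) ≠ -m := fun m h => by
    have := congrArg Complex.re h
    simp at this
    linarith [(Nat.cast_nonneg m : (0 : ℝ) ≤ m)]
  have hneR : ∀ m : ℕ, x ≠ -m := fun m h => hne m (by rw [h]; push_cast; rfl)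
  have h1 := ((Complex.differentiableAt_Gamma _ hne).hasDerivAt).comp_ofReal
  have h2 := ((Real.differentiableAt_Gamma hneR).hasDerivAt).ofReal_comp
  have h3 : (fun y : ℝ => Complex.Gamma y) = fun y : ℝ => ((Real.Gamma y : ℝ) : ℂ) := by
    ext y; rw [Complex.Gamma_ofReal]
  rw [h3] at h1
  rw [Complex.digamma_def, logDeriv_apply, h1.unique h2, Complex.Gamma_ofReal]
  push_cast
  rfl

/-- Log-convexity of `Γ`: the derivative of `log Γ` at `x` lies between the slopes over `[x-1, x]`
and `[x, x+1]`, which the functional equation evaluates as `log (x-1)` and `log x`. -/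
theorem log_sub_one_le_logDeriv_Gamma {x : ℝ} (hx : 1 < x) :
    Real.log (x - 1) ≤ deriv Real.Gamma x / Real.Gamma x ∧ deriv Real.Gamma x / Real.Gamma x ≤ Real.log x := by
  have hd : HasDerivAt (Real.log ∘ Real.Gamma) (deriv Real.Gamma x / Real.Gamma x) x :=
    (Real.differentiableAt_Gamma fun m h => by linarith [(Nat.cast_nonneg m : (0 : ℝ) ≤ m)]).hasDerivAt.log
      (Real.Gamma_pos_of_pos (by linarith)).ne'
  have hf : ∀ y : ℝ, 0 < y → (Real.log ∘ Real.Gamma) (y + 1) = (Real.log ∘ Real.Gamma) y + Real.log y := by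
    intro y hy
    simp only [Function.comp]
    rw [Real.Gamma_add_one hy.ne', Real.log_mul hy.ne' (Real.Gamma_pos_of_pos hy).ne', add_comm]
  have h1 := Real.convexOn_log_Gamma.slope_le_of_hasDerivAt (x := x - 1) (y := x) (by simp; linarith) (by simp; linarith)
    (by linarith) hd
  have h2 := Real.convexOn_log_Gamma.le_slope_of_hasDerivAt (x := x) (y := x + 1) (by simp; linarith) (by simp; linarith)
    (by linarith) hd
  rw [slope_def_field] at h1 h2
  have e1 := hf (x - 1) (by linarith)
  rw [sub_add_cancel] at e1
  rw [e1] at h1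
  rw [hf x (by linarith)] at h2
  constructor
  · have : Real.log (x - 1) = ((Real.log ∘ Real.Gamma) (x - 1) + Real.log (x - 1) - (Real.log ∘ Real.Gamma) (x - 1)) / (x - (x - 1)) := by
      field_simp; ring
    rw [this]; exact h1
  · have : Real.log x = ((Real.log ∘ Real.Gamma) x + Real.log x - (Real.log ∘ Real.Gamma) x) / (x + 1 - x) := by
      field_simp; ring
    rw [this]; exact h2

/-- The increment of `digamma - log`. -/
noncomputable def logIncrement (z : ℂ) : ℂ := Complex.log (1 + 1 / z) - 1 / z

theorem norm_logIncrement_le {z : ℂ} (hz : 2 ≤ ‖z‖) : ‖logIncrement z‖ ≤ 1 / ‖z‖ ^ 2 := by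
  have hw : ‖1 / z‖ ≤ 1 / 2 := by
    rw [norm_div, norm_one]
    exact one_div_le_one_div_of_le (by norm_num) hz
  refine (Complex.norm_log_one_add_sub_self_le (by linarith)).trans ?_
  have h1 : (1 - ‖1 / z‖)⁻¹ ≤ 2 := by
    rw [inv_le_comm₀ (by linarith) (by norm_num)]
    linarith
  have h2 : ‖1 / z‖ ^ 2 = 1 / ‖z‖ ^ 2 := by rw [norm_div, norm_one, div_pow, one_pow]
  rw [h2]
  have : 0 ≤ 1 / ‖z‖ ^ 2 := by positivity
  nlinarith

theorem ne_neg_natCast_of_re_pos {z : ℂ} (hz : 0 < z.re) (m : ℕ) : z ≠ -m := fun h => by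
  rw [h] at hz
  simp at hz
  linarith [(Nat.cast_nonneg m : (0 : ℝ) ≤ m)]

theorem digamma_sub_log_eq {z : ℂ} (hz : 0 < z.re) :
    Complex.digamma z - Complex.log z = logIncrement z + (Complex.digamma (z + 1) - Complex.log (z + 1)) := by
  have hz0 : z ≠ 0 := by rintro rfl; simp at hz
  rw [Complex.digamma_apply_add_one z (ne_neg_natCast_of_re_pos hz)]
  have h1 : 0 < (1 + 1 / z).re := by
    rw [Complex.add_re, one_div, Complex.inv_re, Complex.one_re]
    have : 0 ≤ z.re / Complex.normSq z := div_nonneg hz.le (Complex.normSq_nonneg _)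
    linarith
  have h2 : Complex.log (z + 1) = Complex.log z + Complex.log (1 + 1 / z) := by
    have e : z + 1 = z * (1 + 1 / z) := by field_simp
    rw [e, Complex.log_mul hz0 (by intro h; rw [h] at h1; simp at h1)]
    -- Both factors have positive real part, so their arguments add up within `(-π, π)` and the
    -- logarithm of the product splits.
    have a1 := abs_lt.mp (Complex.abs_arg_lt_pi_div_two_iff.mpr (Or.inl hz))
    have a2 := abs_lt.mp (Complex.abs_arg_lt_pi_div_two_iff.mpr (Or.inl h1))
    constructor <;> linarith [a1.1, a1.2, a2.1, a2.2]
  rw [h2]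
  unfold logIncrement
  ring

theorem digamma_sub_log_eq_sum {z : ℂ} (hz : 0 < z.re) (N : ℕ) :
    Complex.digamma z - Complex.log z =
      ∑ n ∈ Finset.range N, logIncrement (z + n) + (Complex.digamma (z + N) - Complex.log (z + N)) := by
  induction N with
  | zero => simp
  | succ N ih =>
    rw [ih, Finset.sum_range_succ, digamma_sub_log_eq (z := z + N) (by simp; positivity)]
    push_cast
    ring_nf

theorem differentiableAt_digamma {z : ℂ} (hz : 0 < z.re ∨ z.im ≠ 0) : DifferentiableAt ℂ Complex.digamma z := by
  have hU : IsOpen {z : ℂ | 0 < z.re ∨ z.im ≠ 0} :=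
    (isOpen_lt continuous_const Complex.continuous_re).union (isOpen_ne_fun Complex.continuous_im continuous_const)
  have hne : ∀ w : ℂ, (0 < w.re ∨ w.im ≠ 0) → ∀ m : ℕ, w ≠ -m := by
    rintro w (h | h) m
    · exact ne_neg_natCast_of_re_pos h m
    · rintro rfl; simp at h
  have hd : DifferentiableOn ℂ Complex.Gamma {z : ℂ | 0 < z.re ∨ z.im ≠ 0} := fun w hw =>
    (Complex.differentiableAt_Gamma w (hne w hw)).differentiableWithinAt
  have h1 : DifferentiableAt ℂ (deriv Complex.Gamma) z := (hd.deriv hU).differentiableAt (hU.mem_nhds hz)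
  exact h1.div (Complex.differentiableAt_Gamma z (hne z hz)) (Complex.Gamma_ne_zero (hne z hz))

theorem tendsto_digamma_sub_log_ofReal {x : ℝ} (hx : 2 < x) :
    Tendsto (fun N : ℕ => Complex.digamma ((x : ℂ) + N) - Complex.log ((x : ℂ) + N)) atTop (nhds 0) := by
  have h1 : Tendsto (fun N : ℕ => 1 / (N : ℝ)) atTop (nhds 0) := tendsto_one_div_atTop_nhds_zero_nat
  refine squeeze_zero_norm' (Filter.eventually_atTop.mpr ⟨1, fun N hN => ?_⟩) h1
  have hN1 : (1 : ℝ) ≤ N := by exact_mod_cast hN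
  rw [← Complex.ofReal_natCast, ← Complex.ofReal_add, digamma_ofReal (by linarith), ← Complex.ofReal_log (by linarith),
    ← Complex.ofReal_sub, Complex.norm_real, Real.norm_eq_abs]
  obtain ⟨h2, h3⟩ := log_sub_one_le_logDeriv_Gamma (x := x + N) (by linarith)
  rw [abs_of_nonpos (by linarith)]
  have h4 : Real.log (x + N) - Real.log (x + N - 1) ≤ 1 / N := by
    rw [← Real.log_div (by linarith) (by linarith)]
    refine (Real.log_le_sub_one_of_pos (div_pos (by linarith) (by linarith))).trans ?_
    rw [div_sub_one (by linarith), div_le_div_iff₀ (by linarith) (by linarith)]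
    linarith
  linarith

theorem norm_add_natCast_ge {z : ℂ} (hz : 2 ≤ z.re) (n : ℕ) : (n : ℝ) + 2 ≤ ‖z + n‖ := by
  refine le_trans ?_ (Complex.re_le_norm _)
  simp; linarith

theorem summable_inv_add_two_sq : Summable fun n : ℕ => 1 / ((n : ℝ) + 2) ^ 2 := by
  have h := (Real.summable_one_div_nat_pow (p := 2)).mpr (by norm_num)
  have h2 := (summable_nat_add_iff (f := fun n : ℕ => 1 / (n : ℝ) ^ 2) 2).mpr h
  refine h2.congr fun n => ?_
  push_cast
  rfl

theorem norm_logIncrement_add_natCast_le {z : ℂ} (hz : 2 ≤ z.re) (n : ℕ) :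
    ‖logIncrement (z + n)‖ ≤ 1 / ((n : ℝ) + 2) ^ 2 := by
  have h := norm_add_natCast_ge hz n
  refine (norm_logIncrement_le (by linarith [(Nat.cast_nonneg n : (0 : ℝ) ≤ n)])).trans ?_
  gcongr

/-- On the real axis the remainder after `N` steps tends to `0` by convexity of `log Γ`. Both sides
are analytic for `Re z > 2`, so agreement at real points accumulating at `3` extends to the half
plane. -/
theorem digamma_sub_log_eq_tsum {z : ℂ} (hz : 2 < z.re) :
    Complex.digamma z - Complex.log z = ∑' n : ℕ, logIncrement (z + n) := by
  set U : Set ℂ := {z | 2 < z.re} with hU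
  have hUo : IsOpen U := isOpen_lt continuous_const Complex.continuous_re
  have hUc : IsPreconnected U := (convex_halfSpace_re_gt 2).isPreconnected
  have hf : DifferentiableOn ℂ (fun z => Complex.digamma z - Complex.log z) U := by
    intro w hw
    have hw2 : 0 < w.re := by rw [hU, Set.mem_ofPred_eq] at hw; linarith
    exact ((differentiableAt_digamma (Or.inl hw2)).sub (Complex.differentiableAt_log (Or.inl hw2))).differentiableWithinAt
  have hg : DifferentiableOn ℂ (fun z => ∑' n : ℕ, logIncrement (z + n)) U := by
    refine Complex.differentiableOn_tsum_of_summable_norm summable_inv_add_two_sq (fun n w hw => ?_) hUo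
      fun n w hw => norm_logIncrement_add_natCast_le (le_of_lt hw) n
    have h1 : 0 < (w + n).re := by
      rw [hU, Set.mem_ofPred_eq] at hw
      simp; linarith [(Nat.cast_nonneg n : (0 : ℝ) ≤ n)]
    have h0 : w + n ≠ 0 := by intro h; rw [h] at h1; simp at h1
    have h2 : 1 + 1 / (w + n) ∈ Complex.slitPlane := by
      left
      rw [Complex.add_re, one_div, Complex.inv_re, Complex.one_re]
      have : 0 ≤ (w + n).re / Complex.normSq (w + n) := div_nonneg h1.le (Complex.normSq_nonneg _)
      linarith
    have h3 : DifferentiableAt ℂ (fun w : ℂ => 1 / (w + n)) w :=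
      (differentiableAt_const _).div (differentiableAt_id.add_const _) h0
    exact (((h3.const_add 1).clog h2).sub h3).differentiableWithinAt
  have hreal : ∀ x : ℝ, 2 < x → Complex.digamma x - Complex.log x = ∑' n : ℕ, logIncrement ((x : ℂ) + n) := by
    intro x hx
    have hs : Summable fun n : ℕ => logIncrement ((x : ℂ) + n) :=
      Summable.of_norm_bounded summable_inv_add_two_sq fun n => norm_logIncrement_add_natCast_le (by simpa using hx.le) n
    have h1 := hs.hasSum.tendsto_sum_nat.add (tendsto_digamma_sub_log_ofReal hx)
    rw [add_zero] at h1
    refine tendsto_nhds_unique (tendsto_const_nhds.congr fun N => ?_) h1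
    exact digamma_sub_log_eq_sum (by simp; linarith) N
  refine (hf.analyticOnNhd hUo).eqOn_of_preconnected_of_frequently_eq (hg.analyticOnNhd hUo) hUc (z₀ := 3)
    (by rw [hU, Set.mem_ofPred_eq]; norm_num) ?_ hz
  have hseq : Tendsto (fun n : ℕ => ((3 + 1 / ((n : ℝ) + 1) : ℝ) : ℂ)) atTop (nhdsWithin 3 {3}ᶜ) := by
    refine tendsto_nhdsWithin_iff.mpr ⟨?_, Filter.Eventually.of_forall fun n => ?_⟩
    · have h1 : Tendsto (fun n : ℕ => (3 + 1 / ((n : ℝ) + 1) : ℝ)) atTop (nhds (3 + 0)) :=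
        tendsto_const_nhds.add tendsto_one_div_add_atTop_nhds_zero_nat
      have h2 := (Complex.continuous_ofReal.tendsto _).comp h1
      simpa [Function.comp_def] using h2
    · rw [Set.mem_compl_iff, Set.mem_singleton_iff]
      intro h
      have h1 : (3 + 1 / ((n : ℝ) + 1) : ℝ) = 3 := by exact_mod_cast h
      have : 0 < 1 / ((n : ℝ) + 1) := by positivity
      linarith
  refine hseq.frequently (Filter.Frequently.of_forall fun n => ?_)
  refine hreal _ ?_
  have : 0 < 1 / ((n : ℝ) + 1) := by positivity
  linarith

/-- A weak form of Stirling's formula for the digamma function. -/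
theorem norm_digamma_sub_log_le {z : ℂ} (hz : 0 < z.re) (hy : 2 ≤ |z.im|) :
    ‖Complex.digamma z - Complex.log z‖ ≤ 8 / |z.im| := by
  set y := |z.im| with hydef
  have hy0 : 0 < y := by linarith
  -- Since `Re z > 0`, `‖z + n‖² ≥ n² + y² ≥ (n + y)²/2`. The increments are therefore dominated by
  -- a telescoping sequence in `y + n`.
  have hn : ∀ n : ℕ, ((y + n) / 2) ^ 2 * 2 ≤ ‖z + n‖ ^ 2 := by
    intro n
    rw [← Complex.normSq_eq_norm_sq, Complex.normSq_apply]
    have h1 : (z + n).re = z.re + n := by simp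
    have h2 : (z + n).im = z.im := by simp
    have h3 : z.im * z.im = y ^ 2 := by rw [hydef, sq_abs, sq]
    rw [h1, h2, h3]
    have hn0 : (0 : ℝ) ≤ n := Nat.cast_nonneg n
    nlinarith [sq_nonneg (y - n), mul_nonneg hz.le hn0]
  have hterm : ∀ n : ℕ, ‖logIncrement (z + n)‖ ≤ 4 * (1 / (y + n - 1) - 1 / (y + n)) := by
    intro n
    have hn0 : (0 : ℝ) ≤ n := Nat.cast_nonneg n
    have h2 : y ≤ ‖z + n‖ := by
      have := Complex.abs_im_le_norm (z + n)
      simpa using this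
    refine (norm_logIncrement_le (by linarith)).trans ?_
    have h6 : 0 < y + n := by linarith
    have h7 : 0 < ‖z + n‖ := by linarith
    have h3 : 1 / ‖z + n‖ ^ 2 ≤ 2 / (y + n) ^ 2 := by
      rw [div_le_div_iff₀ (by positivity) (by positivity)]
      nlinarith [hn n]
    refine h3.trans ?_
    have h5 : 0 < y + n - 1 := by linarith
    rw [div_sub_div _ _ (by positivity) (by positivity), mul_div_assoc', div_le_div_iff₀ (by positivity) (by positivity)]
    nlinarith
  have hsum : ∀ N : ℕ, ‖∑ n ∈ Finset.range N, logIncrement (z + n)‖ ≤ 4 / (y - 1) := by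
    intro N
    refine (norm_sum_le _ _).trans ((Finset.sum_le_sum fun n _ => hterm n).trans ?_)
    rw [← Finset.mul_sum]
    have h1 := Finset.sum_range_sub' (fun n : ℕ => 1 / (y + n - 1)) N
    have h2 : ∀ n ∈ Finset.range N, 1 / (y + n - 1) - 1 / (y + n) = 1 / (y + n - 1) - 1 / (y + (n + 1 : ℕ) - 1) := by
      intro n _; push_cast; congr 2; ring
    rw [Finset.sum_congr rfl h2, h1]
    have : 0 ≤ 1 / (y + N - 1) := by
      have := (Nat.cast_nonneg N : (0 : ℝ) ≤ N)
      exact div_nonneg zero_le_one (by linarith)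
    rw [div_eq_mul_one_div 4 (y - 1)]
    have e : y + ((0 : ℕ) : ℝ) - 1 = y - 1 := by simp
    rw [e]
    linarith
  -- Two steps of the recursion move `z` into `Re z > 2`, where the series representation holds.
  have hlim : Tendsto (fun N : ℕ => ∑ n ∈ Finset.range N, logIncrement (z + n)) atTop
      (nhds (Complex.digamma z - Complex.log z)) := by
    have h3 : 2 < (z + (2 : ℕ)).re := by simp; linarith
    have h1 := digamma_sub_log_eq_tsum h3
    have hs : Summable fun n : ℕ => logIncrement (z + (2 : ℕ) + n) :=
      Summable.of_norm_bounded summable_inv_add_two_sq fun n => norm_logIncrement_add_natCast_le h3.le n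
    have h2 := hs.hasSum.tendsto_sum_nat.const_add (∑ n ∈ Finset.range 2, logIncrement (z + n))
    rw [← h1, ← digamma_sub_log_eq_sum hz 2] at h2
    rw [← tendsto_add_atTop_iff_nat 2]
    refine h2.congr fun N => ?_
    rw [add_comm N 2, Finset.sum_range_add]
    congr 1
    refine Finset.sum_congr rfl fun n _ => ?_
    push_cast
    rw [add_assoc]
  refine (le_of_tendsto hlim.norm (Filter.Eventually.of_forall hsum)).trans ?_
  rw [div_le_div_iff₀ (by linarith) hy0]
  linarith

theorem digamma_conj (z : ℂ) : Complex.digamma ((starRingEnd ℂ) z) = (starRingEnd ℂ) (Complex.digamma z) := by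
  have h : ((starRingEnd ℂ) ∘ Complex.Gamma ∘ (starRingEnd ℂ)) = Complex.Gamma := by
    ext w; simp [Complex.Gamma_conj]
  have h2 := congrFun (deriv_conj_conj (f := Complex.Gamma)) ((starRingEnd ℂ) z)
  rw [h] at h2
  simp only [Function.comp_apply, Complex.conj_conj] at h2
  rw [Complex.digamma_def, logDeriv_apply, logDeriv_apply, h2, Complex.Gamma_conj, map_div₀]

theorem norm_log_sub_log_le {y : ℝ} (hy : 0 < y) {z w : ℂ} (hz : y ≤ z.im) (hw : y ≤ w.im) :
    ‖Complex.log z - Complex.log w‖ ≤ ‖z - w‖ / y := by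
  have h := (convex_halfSpace_im_ge y).norm_image_sub_le_of_norm_hasDerivWithin_le (f := Complex.log)
    (f' := fun z => z⁻¹) (C := 1 / y) (fun x hx => (Complex.hasDerivAt_log (Or.inr (by
      rw [Set.mem_ofPred_eq] at hx; linarith))).hasDerivWithinAt) (fun x hx => by
      rw [Set.mem_ofPred_eq] at hx
      rw [norm_inv, one_div]
      exact inv_anti₀ hy (hx.trans ((le_abs_self _).trans (Complex.abs_im_le_norm x)))) hw hz
  rw [one_div_mul_eq_div] at h
  exact h

/-! ### Analytic continuation of `θ` and reality of Hardy's function. -/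

/-- The analytic continuation of the derivative of `rsTheta`. -/
noncomputable def rsDeriv (s : ℂ) : ℂ :=
  (Complex.digamma (s / 2) + Complex.digamma ((1 - s) / 2)) / 4 - (Real.log Real.pi / 2 : ℝ)

/-- Apply Stirling at `s/2` and at `(1-s)/2`. The latter may leave the right half plane and is
shifted by `1` to `(3-s)/2`. This point lies in the lower half plane, so its logarithm is compared
with the conjugate of `log (it/2)`, and the two terms `± iπ/2` cancel. -/
theorem norm_rsDeriv_sub_le {s : ℂ} (h1 : 1 / 2 ≤ s.re) (h2 : s.re ≤ 2) (ht : 8 ≤ s.im) :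
    ‖rsDeriv s - (Real.log (s.im / (2 * Real.pi)) / 2 : ℝ)‖ ≤ 10 / s.im := by
  set t := s.im with htdef
  have ht0 : 0 < t := by linarith
  have hpi := Real.pi_pos
  have re1 : (s / 2).re = s.re / 2 := by simp
  have im1 : (s / 2).im = t / 2 := by simp [htdef]
  have re2 : ((1 - s) / 2).re = (1 - s.re) / 2 := by simp
  have im2 : ((1 - s) / 2).im = -t / 2 := by simp [htdef]
  have e2 : (1 - s) / 2 + 1 = (3 - s) / 2 := by ring
  have re3 : ((3 - s) / 2).re = (3 - s.re) / 2 := by simp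
  have im3 : ((3 - s) / 2).im = -t / 2 := by simp [htdef]
  have b1 := norm_digamma_sub_log_le (z := s / 2) (by rw [re1]; linarith) (by rw [im1, abs_of_pos] <;> linarith)
  have b3 := norm_digamma_sub_log_le (z := (3 - s) / 2) (by rw [re3]; linarith)
    (by rw [im3, abs_of_neg] <;> linarith)
  rw [im1, abs_of_pos (by positivity)] at b1
  rw [im3, abs_of_neg (by linarith)] at b3
  have hrec := Complex.digamma_apply_add_one ((1 - s) / 2) (fun m h => by
    have := congrArg Complex.im h
    rw [im2] at this
    simp at this
    linarith)
  rw [e2] at hrec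
  set w : ℂ := ((t / 2 : ℝ) : ℂ) * Complex.I with hw
  have hwim : w.im = t / 2 := by rw [hw]; simp
  have c1 : ‖Complex.log (s / 2) - Complex.log w‖ ≤ 2 / t := by
    refine (norm_log_sub_log_le (y := t / 2) (by positivity) im1.ge hwim.ge).trans ?_
    have : s / 2 - w = ((s.re / 2 : ℝ) : ℂ) := by
      apply Complex.ext <;> simp [hw, htdef]
    rw [this, Complex.norm_real, Real.norm_eq_abs, abs_of_nonneg (by linarith), div_le_div_iff₀ (by positivity) ht0]
    nlinarith
  have hconj : Complex.log ((3 - s) / 2) = (starRingEnd ℂ) (Complex.log ((starRingEnd ℂ) ((3 - s) / 2))) := by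
    rw [← Complex.log_conj, Complex.conj_conj]
    intro h
    have := Complex.arg_eq_pi_iff.mp h
    rw [Complex.conj_im, im3] at this
    linarith [this.2]
  have c3 : ‖Complex.log ((starRingEnd ℂ) ((3 - s) / 2)) - Complex.log w‖ ≤ 3 / t := by
    refine (norm_log_sub_log_le (y := t / 2) (by positivity) (by rw [Complex.conj_im, im3]; linarith) hwim.ge).trans ?_
    have : (starRingEnd ℂ) ((3 - s) / 2) - w = (((3 - s.re) / 2 : ℝ) : ℂ) := by
      apply Complex.ext
      · rw [Complex.sub_re, Complex.conj_re, re3]; simp [hw]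
      · rw [Complex.sub_im, Complex.conj_im, im3, hwim]; simp; ring
    rw [this, Complex.norm_real, Real.norm_eq_abs, abs_of_nonneg (by linarith), div_le_div_iff₀ (by positivity) ht0]
    nlinarith
  have hlogw : Complex.log w = (Real.log (t / 2) : ℝ) + (Real.pi / 2 : ℝ) * Complex.I := by
    rw [hw, Complex.log_ofReal_mul (by positivity) Complex.I_ne_zero, Complex.log_I]
    push_cast; ring
  have hinv : ‖((1 - s) / 2)⁻¹‖ ≤ 2 / t := by
    rw [norm_inv, inv_le_comm₀ (norm_pos_iff.mpr fun h => by rw [h] at im2; simp at im2; linarith) (by positivity), inv_div]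
    have := Complex.abs_im_le_norm ((1 - s) / 2)
    rwa [im2, neg_div, abs_neg, abs_of_pos (by positivity)] at this
  have hlog : Real.log (t / (2 * Real.pi)) = Real.log (t / 2) - Real.log Real.pi := by
    rw [← Real.log_div (by positivity) hpi.ne', div_div]
  have e : rsDeriv s - (Real.log (t / (2 * Real.pi)) / 2 : ℝ) =
      ((Complex.digamma (s / 2) - Complex.log (s / 2)) + (Complex.log (s / 2) - Complex.log w) +
       (Complex.digamma ((3 - s) / 2) - Complex.log ((3 - s) / 2)) +
       (starRingEnd ℂ) (Complex.log ((starRingEnd ℂ) ((3 - s) / 2)) - Complex.log w) - ((1 - s) / 2)⁻¹) / 4 := by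
    have hcw : (starRingEnd ℂ) (Complex.log w) = (Real.log (t / 2) : ℝ) - (Real.pi / 2 : ℝ) * Complex.I := by
      rw [hlogw, map_add, map_mul, Complex.conj_ofReal, Complex.conj_ofReal, Complex.conj_I]; ring
    rw [map_sub, ← hconj, hcw, hlogw, hrec, hlog]
    unfold rsDeriv
    push_cast
    ring
  rw [e, norm_div, show ‖(4 : ℂ)‖ = 4 by simp]
  have hc : ‖(starRingEnd ℂ) (Complex.log ((starRingEnd ℂ) ((3 - s) / 2)) - Complex.log w)‖ ≤ 3 / t := by
    rw [Complex.norm_conj]; exact c3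
  -- The five errors are `16/t`, `2/t`, `16/t`, `3/t` and `2/t`, in total `39/t`, to be divided by
  -- `4`.
  have := (norm_sub_le _ _).trans (add_le_add ((norm_add_le _ _).trans (add_le_add ((norm_add_le _ _).trans
    (add_le_add ((norm_add_le _ _).trans (add_le_add b1 c1)) b3)) hc)) hinv)
  rw [div_le_iff₀ (by norm_num)]
  refine this.trans (le_of_eq_of_le ?_ (le_of_eq_of_le (show 39 / t = 39 / t from rfl) ?_))
  · field_simp; norm_num
  · rw [div_mul_eq_mul_div]; gcongr; norm_num

theorem differentiableAt_rsDeriv {s : ℂ} (hs : 0 < s.im) : DifferentiableAt ℂ rsDeriv s := by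
  unfold rsDeriv
  have h1 : DifferentiableAt ℂ (fun s : ℂ => Complex.digamma (s / 2)) s :=
    (differentiableAt_digamma (z := s / 2) (Or.inr (by simp; linarith))).comp s (f := fun s : ℂ => s / 2)
      (differentiableAt_id.div_const 2)
  have h2 : DifferentiableAt ℂ (fun s : ℂ => Complex.digamma ((1 - s) / 2)) s :=
    (differentiableAt_digamma (z := (1 - s) / 2) (Or.inr (by simp; linarith))).comp s (f := fun s : ℂ => (1 - s) / 2)
      ((differentiableAt_id.const_sub 1).div_const 2)
  exact ((h1.add h2).div_const 4).sub_const _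

theorem rsDeriv_half (t : ℝ) : rsDeriv (1 / 2 + (t : ℂ) * Complex.I) =
    (((Complex.digamma (1 / 4 + (t : ℂ) / 2 * Complex.I)).re / 2 - Real.log Real.pi / 2 : ℝ) : ℂ) := by
  unfold rsDeriv
  have e1 : (1 / 2 + (t : ℂ) * Complex.I) / 2 = 1 / 4 + (t : ℂ) / 2 * Complex.I := by ring
  have e2 : (1 - (1 / 2 + (t : ℂ) * Complex.I)) / 2 = (starRingEnd ℂ) (1 / 4 + (t : ℂ) / 2 * Complex.I) := by
    apply Complex.ext
    · rw [Complex.conj_re]; simp; norm_num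
    · rw [Complex.conj_im]; simp; ring
  rw [e1, e2, digamma_conj, Complex.add_conj]
  push_cast
  ring

theorem hasDerivAt_rsTheta (t : ℝ) : HasDerivAt rsTheta (rsDeriv (1 / 2 + (t : ℂ) * Complex.I)).re t := by
  have hc : Continuous fun u : ℝ => Complex.digamma (((1 / 4 : ℝ) : ℂ) + (u : ℂ) * Complex.I) := by
    refine continuous_iff_continuousAt.mpr fun u => ?_
    exact ContinuousAt.comp (f := fun v : ℝ => ((1 / 4 : ℝ) : ℂ) + (v : ℂ) * Complex.I)
      (differentiableAt_digamma (Or.inl (by simp))).continuousAt (by fun_prop)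
  have e : rsTheta = fun t : ℝ => (∫ u in (0 : ℝ)..(t / 2), Complex.digamma (((1 / 4 : ℝ) : ℂ) + (u : ℂ) * Complex.I)).re -
      t / 2 * Real.log Real.pi := by
    ext t
    unfold rsTheta logGamma
    have h1 : (1 / 4 + (t : ℂ) / 2 * Complex.I).re = 1 / 4 := by simp
    have h2 : (1 / 4 + (t : ℂ) / 2 * Complex.I).im = t / 2 := by simp
    rw [h1, h2, Complex.add_im, Complex.ofReal_im, Complex.I_mul_im, zero_add]
  have h1 := (hc.integral_hasStrictDerivAt 0 (t / 2)).hasDerivAt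
  have h2 := h1.scomp t ((hasDerivAt_id t).div_const 2)
  have h3 : HasDerivAt (fun t : ℝ => (∫ u in (0 : ℝ)..(t / 2), Complex.digamma (((1 / 4 : ℝ) : ℂ) + (u : ℂ) * Complex.I)).re)
      ((Complex.digamma (1 / 4 + (t : ℂ) / 2 * Complex.I)).re / 2) t := by
    have h4 := Complex.reCLM.hasFDerivAt.comp_hasDerivAt t h2
    refine h4.congr_deriv ?_
    have e5 : (((1 / 4 : ℝ) : ℂ) + ((t / 2 : ℝ) : ℂ) * Complex.I) = 1 / 4 + (t : ℂ) / 2 * Complex.I := by push_cast; ring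
    rw [e5, Complex.reCLM_apply, Complex.real_smul, Complex.re_ofReal_mul]
    ring
  rw [e, rsDeriv_half, Complex.ofReal_re]
  refine (h3.sub (((hasDerivAt_id t).div_const 2).mul_const (Real.log Real.pi))).congr_deriv ?_
  ring

/-- The analytic continuation of `i * rsTheta` to the right of the critical line. -/
noncomputable def rsW (s : ℂ) : ℂ :=
  (rsTheta s.im : ℂ) * Complex.I + ∫ u in (1 / 2 : ℝ)..s.re, rsDeriv ((u : ℂ) + (s.im : ℂ) * Complex.I)

/-- The hypothesis says that `s` lies in the disc about `1/2 + i Im s` of radius `Im s`, inside the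
upper half plane, where `rsDeriv` has a primitive `g`. The horizontal integral in `rsW` is an
increment of `g`, and on the critical line `iθ` and `g` have the same derivative, so `rsW - g` is
constant. -/
theorem hasDerivAt_rsW {s : ℂ} (hs : |s.re - 1 / 2| < s.im) : HasDerivAt rsW (rsDeriv s) s := by
  have him : 0 < s.im := (abs_nonneg _).trans_lt hs
  set c : ℂ := 1 / 2 + (s.im : ℂ) * Complex.I with hc
  set B := Metric.ball c s.im with hB
  have hBim : ∀ z ∈ B, 0 < z.im := by
    intro z hz
    rw [hB, Metric.mem_ball, dist_eq_norm] at hz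
    have h1 := (Complex.abs_im_le_norm (z - c)).trans_lt hz
    have h2 : (z - c).im = z.im - s.im := by simp [hc]
    rw [h2] at h1
    linarith [(abs_lt.mp h1).1]
  obtain ⟨g, hg⟩ := (show DifferentiableOn ℂ rsDeriv B from fun z hz =>
    (differentiableAt_rsDeriv (hBim z hz)).differentiableWithinAt).isExactOn_ball
  have hsB : s ∈ B := by
    rw [hB, Metric.mem_ball, dist_eq_norm]
    have : s - c = ((s.re - 1 / 2 : ℝ) : ℂ) := by apply Complex.ext <;> simp [hc]
    rw [this, Complex.norm_real]
    exact hs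
  have hconv : Convex ℝ B := convex_ball c s.im
  have hhalf : ∀ z ∈ B, ((1 / 2 : ℝ) : ℂ) + (z.im : ℂ) * Complex.I ∈ B := by
    intro z hz
    rw [hB, Metric.mem_ball, dist_eq_norm] at hz ⊢
    refine lt_of_le_of_lt ?_ hz
    have h1 : ((1 / 2 : ℝ) : ℂ) + (z.im : ℂ) * Complex.I - c = ((z.im - s.im : ℝ) : ℂ) * Complex.I := by rw [hc]; push_cast; ring
    rw [h1, norm_mul, Complex.norm_I, mul_one, Complex.norm_real]
    have h2 : z.im - s.im = (z - c).im := by simp [hc]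
    rw [h2]
    exact Complex.abs_im_le_norm _
  have hline : ∀ z ∈ B, ∀ u ∈ Set.uIcc (1 / 2 : ℝ) z.re, (u : ℂ) + (z.im : ℂ) * Complex.I ∈ B := by
    intro z hz u hu
    refine hconv.segment_subset (hhalf z hz) hz ?_
    rw [← segment_eq_uIcc] at hu
    obtain ⟨a, b, ha, hb, hab, rfl⟩ := hu
    refine ⟨a, b, ha, hb, hab, ?_⟩
    apply Complex.ext
    · simp
    · simp; rw [← add_mul, hab, one_mul]
  have hhor : ∀ z ∈ B, (∫ u in (1 / 2 : ℝ)..z.re, rsDeriv ((u : ℂ) + (z.im : ℂ) * Complex.I)) =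
      g z - g (((1 / 2 : ℝ) : ℂ) + (z.im : ℂ) * Complex.I) := by
    intro z hz
    have hd : ∀ u ∈ Set.uIcc (1 / 2 : ℝ) z.re, HasDerivAt (fun u : ℝ => g ((u : ℂ) + (z.im : ℂ) * Complex.I))
        (rsDeriv ((u : ℂ) + (z.im : ℂ) * Complex.I)) u := by
      intro u hu
      have h1 := (hg _ (hline z hz u hu)).scomp u ((Complex.ofRealCLM.hasDerivAt (x := u)).add_const ((z.im : ℂ) * Complex.I))
      simpa [Function.comp_def] using h1
    have hcont : ContinuousOn (fun u : ℝ => rsDeriv ((u : ℂ) + (z.im : ℂ) * Complex.I)) (Set.uIcc (1 / 2 : ℝ) z.re) := by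
      intro u hu
      exact (ContinuousAt.comp (f := fun u : ℝ => (u : ℂ) + (z.im : ℂ) * Complex.I)
        (differentiableAt_rsDeriv (hBim _ (hline z hz u hu))).continuousAt (by fun_prop)).continuousWithinAt
    rw [intervalIntegral.integral_eq_sub_of_hasDerivAt hd hcont.intervalIntegrable, Complex.re_add_im]
  have hver : ∀ z ∈ B, (rsTheta z.im : ℂ) * Complex.I - g (((1 / 2 : ℝ) : ℂ) + (z.im : ℂ) * Complex.I) =
      (rsTheta s.im : ℂ) * Complex.I - g (((1 / 2 : ℝ) : ℂ) + (s.im : ℂ) * Complex.I) := by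
    intro z hz
    have hseg : ∀ v ∈ Set.uIcc s.im z.im, ((1 / 2 : ℝ) : ℂ) + (v : ℂ) * Complex.I ∈ B := by
      intro v hv
      refine hconv.segment_subset (hhalf s hsB) (hhalf z hz) ?_
      rw [← segment_eq_uIcc] at hv
      obtain ⟨a, b, ha, hb, hab, rfl⟩ := hv
      refine ⟨a, b, ha, hb, hab, ?_⟩
      apply Complex.ext
      · simp; rw [← add_mul, hab, one_mul]
      · simp
    have hd : ∀ v ∈ Set.uIcc s.im z.im, HasDerivAt (fun v : ℝ => (rsTheta v : ℂ) * Complex.I -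
        g (((1 / 2 : ℝ) : ℂ) + (v : ℂ) * Complex.I)) 0 v := by
      intro v hv
      have h1 := (hg _ (hseg v hv)).comp v (((Complex.ofRealCLM.hasDerivAt (x := v)).mul_const Complex.I).const_add ((1 / 2 : ℝ) : ℂ))
      have h2 := ((hasDerivAt_rsTheta v).ofReal_comp.mul_const Complex.I).sub h1
      refine h2.congr_deriv ?_
      have e1 : ((1 / 2 : ℝ) : ℂ) + (v : ℂ) * Complex.I = 1 / 2 + (v : ℂ) * Complex.I := by
        push_cast; ring
      rw [e1, rsDeriv_half, Complex.ofReal_re]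
      simp
    have h3 := intervalIntegral.integral_eq_sub_of_hasDerivAt hd (by simp)
    simp only [intervalIntegral.integral_zero] at h3
    exact (sub_eq_zero.mp h3.symm)
  have heq : ∀ z ∈ B, rsW z = g z + ((rsTheta s.im : ℂ) * Complex.I - g (((1 / 2 : ℝ) : ℂ) + (s.im : ℂ) * Complex.I)) := by
    intro z hz
    rw [← hver z hz]
    unfold rsW
    rw [hhor z hz]
    ring
  exact ((hg s hsB).add_const _).congr_of_eventuallyEq
    (Filter.eventually_of_mem (Metric.isOpen_ball.mem_nhds hsB) heq)

theorem rsW_half (t : ℝ) : rsW (1 / 2 + (t : ℂ) * Complex.I) = (rsTheta t : ℂ) * Complex.I := by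
  unfold rsW
  simp

/-- Hardy's function is real-valued. -/
theorem im_hardyZ (t : ℝ) : (hardyZ t).im = 0 := by
  set s : ℂ := 1 / 2 + (t : ℂ) * Complex.I with hs
  set z : ℂ := 1 / 4 + (t : ℂ) / 2 * Complex.I with hz
  have hsre : 0 < s.re := by simp [hs]
  have hs0 : s ≠ 0 := by intro h; rw [h] at hsre; simp at hsre
  have hGs : Complex.Gammaℝ s ≠ 0 := Complex.Gammaℝ_ne_zero_of_re_pos hsre
  have hL : completedRiemannZeta s = Complex.Gammaℝ s * riemannZeta s := by
    rw [riemannZeta_def_of_ne_zero hs0, mul_div_cancel₀ _ hGs]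
  have hcs : (starRingEnd ℂ) s = 1 - s := by
    apply Complex.ext <;> simp [hs]; norm_num
  have hcs0 : (1 - s) ≠ 0 := by rw [← hcs]; simpa using hs0
  have hGc : Complex.Gammaℝ ((starRingEnd ℂ) s) = (starRingEnd ℂ) (Complex.Gammaℝ s) := by
    rw [Complex.Gammaℝ_def, Complex.Gammaℝ_def, map_mul, ← Complex.Gamma_conj]
    have h1 : (starRingEnd ℂ) (s / 2) = (starRingEnd ℂ) s / 2 := by rw [map_div₀, Complex.conj_ofNat]
    have h2 : -(starRingEnd ℂ) s / 2 = (starRingEnd ℂ) (-s / 2) := by rw [map_div₀, map_neg, Complex.conj_ofNat]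
    rw [h1, h2, Complex.cpow_conj _ _ (by rw [Complex.arg_ofReal_of_nonneg Real.pi_pos.le]; exact Real.pi_pos.ne),
      Complex.conj_ofReal]
  -- On the critical line conjugation is `s ↦ 1 - s`, so the functional equation makes the completed
  -- zeta function real there.
  have hreal : (starRingEnd ℂ) (completedRiemannZeta s) = completedRiemannZeta s := by
    refine Eq.trans ?_ (completedRiemannZeta_one_sub s)
    rw [hL, map_mul, ← riemannZeta_conj, ← hGc, hcs,
      riemannZeta_def_of_ne_zero hcs0, mul_div_cancel₀]
    rw [← hcs, hGc]
    simpa using hGs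
  -- The archimedean factor is a positive number times `e^{iθ}`; hence the completed zeta function
  -- is a positive multiple of `Z`.
  have hG : Complex.Gammaℝ s = (Real.exp ((logGamma z).re - Real.log Real.pi / 4) : ℝ) * Complex.exp ((rsTheta t : ℂ) * Complex.I) := by
    have e1 : s / 2 = z := by rw [hs, hz]; ring
    have hpi : (Real.pi : ℂ) ≠ 0 := by exact_mod_cast Real.pi_ne_zero
    rw [Complex.Gammaℝ_def, e1, ← exp_logGamma (show 0 < z.re by simp [hz]), Complex.cpow_def_of_ne_zero hpi, ← Complex.exp_add,
      Complex.ofReal_exp, ← Complex.exp_add, ← Complex.ofReal_log Real.pi_pos.le]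
    congr 1
    have e2 := Complex.re_add_im (logGamma z)
    have e3 : (rsTheta t : ℂ) = (logGamma z).im - t / 2 * Real.log Real.pi := by
      unfold rsTheta; push_cast; rfl
    rw [e3]
    push_cast
    linear_combination (-1 : ℂ) * e2 + (-(Real.log Real.pi : ℂ) / 2) * hs
  have hZ : completedRiemannZeta s = (Real.exp ((logGamma z).re - Real.log Real.pi / 4) : ℝ) * hardyZ t := by
    rw [hL, hG]; unfold hardyZ; rw [← hs]; ring
  have him : (completedRiemannZeta s).im = 0 := Complex.conj_eq_iff_im.mp hreal
  rw [hZ, Complex.im_ofReal_mul] at him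
  exact (mul_eq_zero.mp him).resolve_left (Real.exp_pos _).ne'

/-! ### The mean value of `Z θ'`. -/

theorem sqrt_sqrt_le_rpow {x : ℝ} (hx : 0 ≤ x) : √x ≤ (2 * Real.pi * x ^ 2) ^ (1 / 4 : ℝ) := by
  have h1 : √x = (x ^ 2) ^ (1 / 4 : ℝ) := by
    rw [Real.sqrt_eq_rpow, ← Real.rpow_natCast, ← Real.rpow_mul hx]; norm_num
  rw [h1]
  have := Real.pi_gt_three
  exact Real.rpow_le_rpow (by positivity) (by nlinarith [sq_nonneg x]) (by norm_num)

theorem exists_eq_two_pi_mul_sq {a t : ℝ} (ha : 0 ≤ a) (ht : 2 * Real.pi * a ^ 2 ≤ t) : ∃ x, a ≤ x ∧ t = 2 * Real.pi * x ^ 2 := by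
  have hpi := Real.pi_pos
  refine ⟨√(t / (2 * Real.pi)), ?_, ?_⟩
  · refine Real.le_sqrt_of_sq_le ?_
    rw [le_div_iff₀ (by positivity)]; linarith
  · rw [Real.sq_sqrt (div_nonneg (le_trans (by positivity) ht) (by positivity))]; field_simp

theorem norm_riemannZeta_le_rpow {σ t : ℝ} (h1 : 1 / 2 ≤ σ) (h2 : σ ≤ 2) (ht : 2 * Real.pi * 64 ^ 2 ≤ t) :
    ‖riemannZeta ((σ : ℂ) + (t : ℂ) * Complex.I)‖ ≤ 200004 * t ^ (1 / 4 : ℝ) := by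
  obtain ⟨x, hx, rfl⟩ := exists_eq_two_pi_mul_sq (by norm_num) ht
  refine (norm_riemannZeta_le_sqrt (by linarith) h1 h2).trans ?_
  gcongr
  exact sqrt_sqrt_le_rpow (by linarith)

theorem norm_integral_le_of_norm_le_rpow {E : Type*} [NormedAddCommGroup E] [NormedSpace ℝ E] {f : ℝ → E} {a b M : ℝ}
    (ha : 0 < a) (hab : a ≤ b) (hM : 0 ≤ M)
    (hf : ∀ t, a ≤ t → t ≤ b → ‖f t‖ ≤ M * t ^ (-3 / 4 : ℝ)) : ‖∫ t in a..b, f t‖ ≤ 4 * M * b ^ (1 / 4 : ℝ) := by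
  have hint : IntervalIntegrable (fun t : ℝ => t ^ (-3 / 4 : ℝ)) MeasureTheory.volume a b :=
    intervalIntegral.intervalIntegrable_rpow' (by norm_num)
  have h1 := intervalIntegral.norm_integral_le_of_norm_le (μ := MeasureTheory.volume) hab (f := f) (g := fun t => M * t ^ (-3 / 4 : ℝ))
    (Filter.Eventually.of_forall fun t ht => hf t ht.1.le ht.2) (hint.const_mul M)
  refine h1.trans ?_
  rw [intervalIntegral.integral_const_mul, integral_rpow (Or.inl (by norm_num))]
  have h2 : (-3 / 4 + 1 : ℝ) = 1 / 4 := by norm_num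
  rw [h2]
  have h3 : 0 ≤ a ^ (1 / 4 : ℝ) := by positivity
  nlinarith

theorem rpow_quarter_mul_inv {t : ℝ} (ht : 0 < t) : t ^ (1 / 4 : ℝ) * t⁻¹ = t ^ (-3 / 4 : ℝ) := by
  rw [← Real.rpow_neg_one, ← Real.rpow_add ht]; norm_num

theorem continuousAt_rsDeriv_line (σ : ℝ) {t : ℝ} (ht : 0 < t) :
    ContinuousAt (fun t : ℝ => rsDeriv ((σ : ℂ) + (t : ℂ) * Complex.I)) t :=
  ContinuousAt.comp (f := fun t : ℝ => (σ : ℂ) + (t : ℂ) * Complex.I)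
    (differentiableAt_rsDeriv (by simpa using ht)).continuousAt (by fun_prop)

theorem continuousAt_riemannZeta_line (σ : ℝ) {t : ℝ} (ht : 0 < t) :
    ContinuousAt (fun t : ℝ => riemannZeta ((σ : ℂ) + (t : ℂ) * Complex.I)) t :=
  ContinuousAt.comp (f := fun t : ℝ => (σ : ℂ) + (t : ℂ) * Complex.I)
    (differentiableAt_riemannZeta (fun h => by
      have := congrArg Complex.im h
      simp at this
      exact ht.ne' this)).continuousAt (by fun_prop)

theorem norm_hardyZ (t : ℝ) : ‖hardyZ t‖ = ‖riemannZeta (((1 / 2 : ℝ) : ℂ) + (t : ℂ) * Complex.I)‖ := by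
  unfold hardyZ
  rw [norm_mul, Complex.norm_exp_ofReal_mul_I, one_mul]
  norm_num

theorem continuous_rsTheta : Continuous rsTheta :=
  continuous_iff_continuousAt.mpr fun t => (hasDerivAt_rsTheta t).continuousAt

theorem continuousAt_hardyZ {t : ℝ} (ht : 0 < t) : ContinuousAt hardyZ t := by
  have h := continuousAt_riemannZeta_line (1 / 2) ht
  have e : (((1 / 2 : ℝ) : ℂ)) = 1 / 2 := by norm_num
  rw [e] at h
  have h2 := continuous_rsTheta
  exact (show ContinuousAt (fun t : ℝ => Complex.exp ((rsTheta t : ℂ) * Complex.I)) t by fun_prop).mul h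

set_option maxHeartbeats 1000000 in
-- Write `Z θ' = E f + Z g'`, where `f` is the integrand with `rsPhase` in place of `θ`, `E = e^{i(θ
-- - rsPhase)}` and `g' = θ' - rsPhase' = O(1/t)`. Integrating `E f` by parts against the primitive
-- `K` of `f` uses `K = O(t^{1/4} log t)` and `E' = O(1/t)`. For `Z g'` the convexity bound is
-- enough.
theorem exists_norm_integral_hardyZ_mul_rsDeriv_le {T₀ : ℝ} (hT₀ : 2 * Real.pi * 64 ^ 2 ≤ T₀) :
    ∃ C, 0 ≤ C ∧ ∀ T, T₀ ≤ T → ‖∫ t in T₀..T, hardyZ t * rsDeriv (1 / 2 + (t : ℂ) * Complex.I)‖ ≤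
      C * (T ^ (1 / 4 : ℝ) * Real.log T) := by
  have hpi := Real.pi_gt_three
  have hT0 : 8 ≤ T₀ := by linarith
  have hpos : 0 < T₀ := by linarith
  obtain ⟨C, hC, hK⟩ := exists_norm_integral_zeta_mul_rsWeight_le hpos
  set f : ℝ → ℂ := fun t => riemannZeta (1 / 2 + (t : ℂ) * Complex.I) *
    (Complex.exp ((rsPhase t : ℂ) * Complex.I) * ((Real.log (t / (2 * Real.pi)) / 2 : ℝ) : ℂ)) with hf
  set K : ℝ → ℂ := fun T => ∫ t in T₀..T, f t with hKdef
  have hKle : ∀ t, T₀ ≤ t → ‖K t‖ ≤ C * (t ^ (1 / 4 : ℝ) * Real.log t) := by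
    intro t ht
    obtain ⟨x, hx, rfl⟩ := exists_eq_two_pi_mul_sq (by norm_num) (hT₀.trans ht)
    refine (hK x hx ht).trans ?_
    have h1 := sqrt_sqrt_le_rpow (x := x) (by linarith)
    have h2 : Real.log x ≤ Real.log (2 * Real.pi * x ^ 2) := Real.log_le_log (by linarith) (by nlinarith)
    have h3 : 0 ≤ Real.log x := Real.log_nonneg (by linarith)
    gcongr
  have eh : (((1 / 2 : ℝ) : ℂ)) = 1 / 2 := by norm_num
  have hLc : ∀ t : ℝ, 0 < t → ContinuousAt (fun t : ℝ => Real.log (t / (2 * Real.pi)) / 2) t := fun t ht =>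
    ((continuousAt_id.div_const _).log (div_pos ht (by positivity)).ne').div_const _
  have hfc : ∀ t : ℝ, 0 < t → ContinuousAt f t := by
    intro t ht
    have h1 := continuousAt_riemannZeta_line (1 / 2) ht
    rw [eh] at h1
    have h2 := (hasDerivAt_rsPhase ht).continuousAt
    have h3 := hLc t ht
    exact h1.mul ((show ContinuousAt (fun t : ℝ => Complex.exp ((rsPhase t : ℂ) * Complex.I)) t from
      ((Complex.continuous_ofReal.continuousAt.comp h2).mul continuousAt_const).cexp).mul
      (Complex.continuous_ofReal.continuousAt.comp h3))
  have hsub : ∀ T, T₀ ≤ T → ∀ t ∈ Set.uIcc T₀ T, T₀ ≤ t ∧ t ≤ T := by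
    intro T hT t ht
    rw [Set.uIcc_of_le hT] at ht
    exact ht
  have hfi : ∀ T, T₀ ≤ T → IntervalIntegrable f MeasureTheory.volume T₀ T := fun T hT =>
    ContinuousOn.intervalIntegrable fun t ht => (hfc t (by linarith [(hsub T hT t ht).1])).continuousWithinAt
  have hKd : ∀ t, T₀ ≤ t → HasDerivAt K (f t) t := fun t ht =>
    intervalIntegral.integral_hasDerivAt_right (hfi t ht)
      (ContinuousAt.stronglyMeasurableAtFilter isOpen_Ioi (s := Set.Ioi 0) (fun u hu => hfc u hu) t (hpos.trans_le ht))
      (hfc t (hpos.trans_le ht))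
  set g' : ℝ → ℝ := fun t => (rsDeriv (1 / 2 + (t : ℂ) * Complex.I)).re - Real.log (t / (2 * Real.pi)) / 2 with hg'
  set E : ℝ → ℂ := fun t => Complex.exp (((rsTheta t - rsPhase t : ℝ) : ℂ) * Complex.I) with hE
  have hEd : ∀ t : ℝ, 0 < t → HasDerivAt E (E t * ((g' t : ℂ) * Complex.I)) t := fun t ht =>
    (((hasDerivAt_rsTheta t).sub (hasDerivAt_rsPhase ht)).ofReal_comp.mul_const Complex.I).cexp
  have hDc : ∀ t : ℝ, 0 < t → ContinuousAt (fun t : ℝ => rsDeriv (1 / 2 + (t : ℂ) * Complex.I)) t := by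
    intro t ht
    have h1 := continuousAt_rsDeriv_line (1 / 2) ht
    rwa [eh] at h1
  have hg'c : ∀ t : ℝ, 0 < t → ContinuousAt g' t := fun t ht =>
    (Complex.continuous_re.continuousAt.comp (hDc t ht)).sub (hLc t ht)
  have hre : ∀ t : ℝ, rsDeriv (1 / 2 + (t : ℂ) * Complex.I) = (g' t : ℂ) + ((Real.log (t / (2 * Real.pi)) / 2 : ℝ) : ℂ) := by
    intro t
    rw [← Complex.ofReal_add, hg']
    simp only [sub_add_cancel]
    rw [rsDeriv_half, Complex.ofReal_re]
  have hg'le : ∀ t, T₀ ≤ t → |g' t| ≤ 10 * t⁻¹ := by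
    intro t ht
    have h := norm_rsDeriv_sub_le (s := 1 / 2 + (t : ℂ) * Complex.I) (by simp) (by simp; norm_num) (by simp; linarith)
    have him : (1 / 2 + (t : ℂ) * Complex.I).im = t := by simp
    rw [him, hre, add_sub_cancel_right, Complex.norm_real, div_eq_mul_inv] at h
    exact h
  have hEn : ∀ t, ‖E t‖ = 1 := fun t => Complex.norm_exp_ofReal_mul_I _
  have hEc : ∀ t : ℝ, 0 < t → ContinuousAt (fun t => E t * ((g' t : ℂ) * Complex.I)) t := fun t ht =>
    (hEd t ht).continuousAt.mul ((Complex.continuous_ofReal.continuousAt.comp (hg'c t ht)).mul continuousAt_const)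
  refine ⟨41 * C + 8000160, by positivity, fun T hT => ?_⟩
  have hTpos : 0 < T := hpos.trans_le hT
  have hlogT : 1 ≤ Real.log T := by
    rw [Real.le_log_iff_exp_le hTpos]
    linarith [Real.exp_one_lt_d9]
  have hR : 0 ≤ T ^ (1 / 4 : ℝ) := by positivity
  have hparts := intervalIntegral.integral_mul_deriv_eq_deriv_mul (u := E) (v := K) (u' := fun t => E t * ((g' t : ℂ) * Complex.I)) (v' := f)
    (a := T₀) (b := T) (fun t ht => hEd t (by linarith [(hsub T hT t ht).1])) (fun t ht => hKd t (hsub T hT t ht).1)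
    (ContinuousOn.intervalIntegrable fun t ht => (hEc t (by linarith [(hsub T hT t ht).1])).continuousWithinAt) (hfi T hT)
  have hK0 : K T₀ = 0 := by simp [hKdef]
  rw [hK0, mul_zero, sub_zero] at hparts
  have hsplit : (∫ t in T₀..T, hardyZ t * rsDeriv (1 / 2 + (t : ℂ) * Complex.I)) =
      (∫ t in T₀..T, E t * f t) + ∫ t in T₀..T, hardyZ t * (g' t : ℂ) := by
    rw [← intervalIntegral.integral_add]
    · refine intervalIntegral.integral_congr fun t _ => ?_
      simp only [hre, hf, hE]
      have : Complex.exp (((rsTheta t - rsPhase t : ℝ) : ℂ) * Complex.I) * Complex.exp ((rsPhase t : ℂ) * Complex.I) =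
          Complex.exp ((rsTheta t : ℂ) * Complex.I) := by
        rw [← Complex.exp_add]; push_cast; ring_nf
      unfold hardyZ
      rw [← this]
      ring
    · exact ContinuousOn.intervalIntegrable fun t ht =>
        ((hEd t (by linarith [(hsub T hT t ht).1])).continuousAt.mul (hfc t (by linarith [(hsub T hT t ht).1]))).continuousWithinAt
    · exact ContinuousOn.intervalIntegrable fun t ht =>
        ((continuousAt_hardyZ (by linarith [(hsub T hT t ht).1])).mul (Complex.continuous_ofReal.continuousAt.comp
          (hg'c t (by linarith [(hsub T hT t ht).1])))).continuousWithinAt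
  have hI1 : ‖∫ t in T₀..T, E t * ((g' t : ℂ) * Complex.I) * K t‖ ≤ 4 * (10 * C * Real.log T) * T ^ (1 / 4 : ℝ) := by
    refine norm_integral_le_of_norm_le_rpow hpos hT (by positivity) fun t h1 h2 => ?_
    have ht : 0 < t := by linarith
    rw [norm_mul, norm_mul, norm_mul, hEn, one_mul, Complex.norm_I, mul_one, Complex.norm_real, Real.norm_eq_abs,
      ← rpow_quarter_mul_inv ht]
    have hl : Real.log t ≤ Real.log T := Real.log_le_log ht h2
    calc |g' t| * ‖K t‖ ≤ (10 * t⁻¹) * (C * (t ^ (1 / 4 : ℝ) * Real.log T)) := by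
          gcongr
          · exact hg'le t h1
          · exact (hKle t h1).trans (by gcongr)
      _ = _ := by ring
  have hI2 : ‖∫ t in T₀..T, hardyZ t * (g' t : ℂ)‖ ≤ 4 * 2000040 * T ^ (1 / 4 : ℝ) := by
    refine norm_integral_le_of_norm_le_rpow hpos hT (by positivity) fun t h1 h2 => ?_
    have ht : 0 < t := by linarith
    rw [norm_mul, norm_hardyZ, Complex.norm_real, Real.norm_eq_abs, ← rpow_quarter_mul_inv ht]
    calc _ ≤ (200004 * t ^ (1 / 4 : ℝ)) * (10 * t⁻¹) :=
          mul_le_mul (norm_riemannZeta_le_rpow le_rfl (by norm_num) (hT₀.trans h1)) (hg'le t h1) (abs_nonneg _) (by positivity)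
      _ = _ := by ring
  rw [hsplit, hparts]
  refine (norm_add_le _ _).trans ((add_le_add (norm_sub_le _ _) hI2).trans ?_)
  rw [norm_mul, hEn, one_mul]
  have h5 := hKle T hT
  nlinarith [mul_le_mul_of_nonneg_left hlogT hR]

/-! ### Half residues at Gram points. -/

theorem integral_inv_horizontal {c : ℂ} {y p q : ℝ} (hne : ∀ u ∈ Set.uIcc p q, (u : ℂ) + (y : ℂ) * Complex.I - c ∈ Complex.slitPlane) :
    (∫ u in p..q, ((u : ℂ) + (y : ℂ) * Complex.I - c)⁻¹) =
      Complex.log ((q : ℂ) + (y : ℂ) * Complex.I - c) - Complex.log ((p : ℂ) + (y : ℂ) * Complex.I - c) := by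
  refine intervalIntegral.integral_eq_sub_of_hasDerivAt (f := fun u : ℝ => Complex.log ((u : ℂ) + (y : ℂ) * Complex.I - c)) (fun u hu => ?_) ?_
  · have h := (((Complex.ofRealCLM.hasDerivAt (x := u)).add_const ((y : ℂ) * Complex.I)).sub_const c).clog_real (hne u hu)
    simpa using h
  · refine ContinuousOn.intervalIntegrable fun u hu => ContinuousAt.continuousWithinAt ?_
    exact ContinuousAt.inv₀ (by fun_prop) (Complex.slitPlane_ne_zero (hne u hu))

theorem integral_inv_vertical {c : ℂ} {x p q : ℝ} (hne : ∀ u ∈ Set.uIcc p q, (x : ℂ) + (u : ℂ) * Complex.I - c ∈ Complex.slitPlane) :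
    Complex.I * (∫ u in p..q, ((x : ℂ) + (u : ℂ) * Complex.I - c)⁻¹) =
      Complex.log ((x : ℂ) + (q : ℂ) * Complex.I - c) - Complex.log ((x : ℂ) + (p : ℂ) * Complex.I - c) := by
  rw [← intervalIntegral.integral_const_mul]
  refine intervalIntegral.integral_eq_sub_of_hasDerivAt (f := fun u : ℝ => Complex.log ((x : ℂ) + (u : ℂ) * Complex.I - c)) (fun u hu => ?_) ?_
  · have h := ((hasDerivAt_vertical x u).sub_const c).clog_real (hne u hu)
    simpa [div_eq_mul_inv] using h
  · refine ContinuousOn.intervalIntegrable fun u hu => ContinuousAt.continuousWithinAt ?_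
    exact continuousAt_const.mul (ContinuousAt.inv₀ (by fun_prop) (Complex.slitPlane_ne_zero (hne u hu)))

theorem intervalIntegral_re {f : ℝ → ℂ} {a b : ℝ} (hf : IntervalIntegrable f MeasureTheory.volume a b) :
    (∫ t in a..b, f t).re = ∫ t in a..b, (f t).re :=
  (Complex.reCLM.intervalIntegral_comp_comm hf).symm

set_option maxHeartbeats 1000000 in
/-- The residue theorem for a rectangle with a simple pole on its left side, with a real residue. -/
theorem boundary_rect_of_pole_on_left {A G : ℂ → ℂ} {Ω : Set ℂ} (hΩ : IsOpen Ω) {a b ρ r p q : ℝ} (hpq : p < q) (ha : a < ρ) (hb : ρ < b)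
    (hA : DifferentiableOn ℂ A Ω)
    (hR : ∀ σ t : ℝ, p ≤ σ → σ ≤ q → a ≤ t → t ≤ b → (σ : ℂ) + (t : ℂ) * Complex.I ∈ Ω)
    (hr : A ((p : ℂ) + (ρ : ℂ) * Complex.I) = (r : ℂ))
    (hG : ∀ s ∈ Ω, s ≠ (p : ℂ) + (ρ : ℂ) * Complex.I → G s = A s / (s - ((p : ℂ) + (ρ : ℂ) * Complex.I)))
    {k : ℝ → ℝ} (hk : ∀ t, a ≤ t → t ≤ b → t ≠ ρ → (G ((p : ℂ) + (t : ℂ) * Complex.I)).re = k t) :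
    (∫ σ in p..q, G ((σ : ℂ) + (a : ℂ) * Complex.I)).im - (∫ σ in p..q, G ((σ : ℂ) + (b : ℂ) * Complex.I)).im +
      (∫ t in a..b, G ((q : ℂ) + (t : ℂ) * Complex.I)).re - ∫ t in a..b, k t = Real.pi * r := by
  set ρ₀ : ℂ := (p : ℂ) + (ρ : ℂ) * Complex.I with hρ₀
  have hρre : ρ₀.re = p := by simp [hρ₀]
  have hρim : ρ₀.im = ρ := by simp [hρ₀]
  have hρΩ : ρ₀ ∈ Ω := hR p ρ le_rfl hpq.le ha.le hb.le
  -- The divided difference of `A` is analytic, so `G` is `r / (s - ρ₀)` plus a function to which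
  -- Cauchy's theorem applies.
  set B := dslope A ρ₀ with hBdef
  have hB : DifferentiableOn ℂ B Ω := (Complex.differentiableOn_dslope (hΩ.mem_nhds hρΩ)).mpr hA
  have hGB : ∀ s ∈ Ω, s ≠ ρ₀ → G s = r * (s - ρ₀)⁻¹ + B s := by
    intro s hs hne
    have h0 : s - ρ₀ ≠ 0 := sub_ne_zero.mpr hne
    rw [hG s hs hne, hBdef, dslope_of_ne _ hne, slope_def_field, hr]
    field_simp
    ring
  have hBh : ∀ y, a ≤ y → y ≤ b → IntervalIntegrable (fun σ : ℝ => B ((σ : ℂ) + (y : ℂ) * Complex.I)) MeasureTheory.volume p q := by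
    intro y h1 h2
    refine ContinuousOn.intervalIntegrable fun σ hσ => ?_
    rw [Set.uIcc_of_le hpq.le] at hσ
    exact (ContinuousAt.comp (f := fun σ : ℝ => (σ : ℂ) + (y : ℂ) * Complex.I)
      (hB.differentiableAt (hΩ.mem_nhds (hR σ y hσ.1 hσ.2 h1 h2))).continuousAt (by fun_prop)).continuousWithinAt
  have hab : a ≤ b := (ha.trans hb).le
  have hBv : ∀ x, p ≤ x → x ≤ q → IntervalIntegrable (fun t : ℝ => B ((x : ℂ) + (t : ℂ) * Complex.I)) MeasureTheory.volume a b := by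
    intro x h1 h2
    refine ContinuousOn.intervalIntegrable fun t ht => ?_
    rw [Set.uIcc_of_le hab] at ht
    exact (ContinuousAt.comp (f := fun t : ℝ => (x : ℂ) + (t : ℂ) * Complex.I)
      (hB.differentiableAt (hΩ.mem_nhds (hR x t h1 h2 ht.1 ht.2))).continuousAt (by fun_prop)).continuousWithinAt
  have hslh : ∀ y, y ≠ ρ → ∀ u ∈ Set.uIcc p q, (u : ℂ) + (y : ℂ) * Complex.I - ρ₀ ∈ Complex.slitPlane := by
    intro y hy u _
    right
    rw [Complex.sub_im, hρim]
    simpa using sub_ne_zero.mpr hy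
  have hslv : ∀ t ∈ Set.uIcc a b, (q : ℂ) + (t : ℂ) * Complex.I - ρ₀ ∈ Complex.slitPlane := by
    intro t _
    left
    rw [Complex.sub_re, hρre]
    simpa using hpq
  have hH : ∀ y, a ≤ y → y ≤ b → y ≠ ρ → (∫ σ in p..q, G ((σ : ℂ) + (y : ℂ) * Complex.I)) =
      r * (Complex.log ((q : ℂ) + (y : ℂ) * Complex.I - ρ₀) - Complex.log ((p : ℂ) + (y : ℂ) * Complex.I - ρ₀)) +
      ∫ σ in p..q, B ((σ : ℂ) + (y : ℂ) * Complex.I) := by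
    intro y h1 h2 hy
    rw [← integral_inv_horizontal (hslh y hy), ← intervalIntegral.integral_const_mul, ← intervalIntegral.integral_add _ (hBh y h1 h2)]
    · refine intervalIntegral.integral_congr fun σ hσ => ?_
      rw [Set.uIcc_of_le hpq.le] at hσ
      exact hGB _ (hR σ y hσ.1 hσ.2 h1 h2) (fun h => hy (by simpa [hρim] using congrArg Complex.im h))
    · refine ContinuousOn.intervalIntegrable fun u hu => ContinuousAt.continuousWithinAt ?_
      exact continuousAt_const.mul (ContinuousAt.inv₀ (by fun_prop) (Complex.slitPlane_ne_zero (hslh y hy u hu)))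
  have hV : Complex.I * (∫ t in a..b, G ((q : ℂ) + (t : ℂ) * Complex.I)) =
      r * (Complex.log ((q : ℂ) + (b : ℂ) * Complex.I - ρ₀) - Complex.log ((q : ℂ) + (a : ℂ) * Complex.I - ρ₀)) +
      Complex.I * ∫ t in a..b, B ((q : ℂ) + (t : ℂ) * Complex.I) := by
    rw [← integral_inv_vertical hslv, mul_left_comm, ← mul_add, ← intervalIntegral.integral_const_mul (r : ℂ),
      ← intervalIntegral.integral_add _ (hBv q hpq.le le_rfl)]
    · congr 1
      refine intervalIntegral.integral_congr fun t ht => ?_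
      rw [Set.uIcc_of_le hab] at ht
      exact hGB _ (hR q t hpq.le le_rfl ht.1 ht.2) (fun h => hpq.ne' (by simpa [hρre] using congrArg Complex.re h))
    · refine ContinuousOn.intervalIntegrable fun u hu => ContinuousAt.continuousWithinAt ?_
      exact continuousAt_const.mul (ContinuousAt.inv₀ (by fun_prop) (Complex.slitPlane_ne_zero (hslv u hu)))
  have hCauchy := Complex.integral_boundary_rect_eq_zero_of_differentiableOn B ((p : ℂ) + (a : ℂ) * Complex.I)
    ((q : ℂ) + (b : ℂ) * Complex.I) (hB.mono fun s hs => by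
      rw [Complex.mem_reProdIm] at hs
      simp only [re_ofReal_add_ofReal_mul_I, im_ofReal_add_ofReal_mul_I, Set.uIcc_of_le hpq.le, Set.uIcc_of_le hab] at hs
      have := hR s.re s.im hs.1.1 hs.1.2 hs.2.1 hs.2.2
      rwa [Complex.re_add_im] at this)
  simp only [re_ofReal_add_ofReal_mul_I, im_ofReal_add_ofReal_mul_I, smul_eq_mul] at hCauchy
  -- On the left side `r / (s - ρ₀)` is purely imaginary because `r` is real, so `B` and `G` have
  -- the same real part there, except at the single point `ρ`.
  have hL : (∫ t in a..b, B ((p : ℂ) + (t : ℂ) * Complex.I)).re = ∫ t in a..b, k t := by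
    rw [intervalIntegral_re (hBv p le_rfl hpq.le)]
    refine intervalIntegral.integral_congr_ae ?_
    have h0 : ∀ᵐ t : ℝ, t ≠ ρ := by
      rw [MeasureTheory.ae_iff]
      simp
    filter_upwards [h0] with t ht hmem
    rw [Set.uIoc_of_le hab] at hmem
    have h1 := hGB ((p : ℂ) + (t : ℂ) * Complex.I) (hR p t le_rfl hpq.le hmem.1.le hmem.2)
      (fun h => ht (by simpa [hρim] using congrArg Complex.im h))
    have h2 := hk t hmem.1.le hmem.2 ht
    have h3 : (p : ℂ) + (t : ℂ) * Complex.I - ρ₀ = ((t - ρ : ℝ) : ℂ) * Complex.I := by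
      rw [hρ₀]; push_cast; ring
    rw [h1, h3, Complex.add_re, Complex.re_ofReal_mul] at h2
    rw [← h2]
    simp
  have e1 : (p : ℂ) + (b : ℂ) * Complex.I - ρ₀ = ((b - ρ : ℝ) : ℂ) * Complex.I := by
    rw [hρ₀]; push_cast; ring
  have e2 : (p : ℂ) + (a : ℂ) * Complex.I - ρ₀ = ((ρ - a : ℝ) : ℂ) * -Complex.I := by
    rw [hρ₀]; push_cast; ring
  -- Along the bottom, right and top sides `r / (s - ρ₀)` integrates to `r` times a difference of
  -- logarithms at the two left corners, whose arguments are `π/2` and `-π/2`. This is half of a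
  -- full turn.
  have l1 : (Complex.log ((p : ℂ) + (b : ℂ) * Complex.I - ρ₀)).im = Real.pi / 2 := by
    rw [e1, Complex.log_ofReal_mul (by linarith) Complex.I_ne_zero, Complex.log_I]
    simp
  have l2 : (Complex.log ((p : ℂ) + (a : ℂ) * Complex.I - ρ₀)).im = -(Real.pi / 2) := by
    rw [e2, Complex.log_ofReal_mul (by linarith) (neg_ne_zero.mpr Complex.I_ne_zero), Complex.log_neg_I]
    simp
  have key : (∫ σ in p..q, G ((σ : ℂ) + (a : ℂ) * Complex.I)) - (∫ σ in p..q, G ((σ : ℂ) + (b : ℂ) * Complex.I)) +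
      Complex.I * (∫ t in a..b, G ((q : ℂ) + (t : ℂ) * Complex.I)) =
      r * (Complex.log ((p : ℂ) + (b : ℂ) * Complex.I - ρ₀) - Complex.log ((p : ℂ) + (a : ℂ) * Complex.I - ρ₀)) +
      Complex.I * ∫ t in a..b, B ((p : ℂ) + (t : ℂ) * Complex.I) := by
    rw [hH a le_rfl hab ha.ne, hH b hab le_rfl hb.ne', hV]
    linear_combination hCauchy
  have him := congrArg Complex.im key
  rw [Complex.add_im, Complex.sub_im, Complex.I_mul_im, Complex.add_im, Complex.I_mul_im, Complex.im_ofReal_mul, Complex.sub_im,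
    l1, l2, hL] at him
  linarith

theorem two_le_log_div_sub {t : ℝ} (ht : 2 * Real.pi * 64 ^ 2 ≤ t) : 2 ≤ Real.log (t / (2 * Real.pi)) / 2 - 10 / t := by
  have hpi := Real.pi_gt_three
  have h1 : 10 / t ≤ 1 := by rw [div_le_one (by nlinarith)]; nlinarith
  have h2 : 6 ≤ Real.log (t / (2 * Real.pi)) := by
    rw [Real.le_log_iff_exp_le (div_pos (by nlinarith) (by positivity))]
    have h3 : Real.exp 6 ≤ 64 ^ 2 := by
      have : Real.exp 6 = Real.exp 1 ^ 6 := by rw [← Real.exp_nat_mul]; norm_num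
      rw [this]
      calc Real.exp 1 ^ 6 ≤ 4 ^ 6 := by gcongr; linarith [Real.exp_one_lt_d9]
        _ = _ := by norm_num
    refine h3.trans ?_
    rw [le_div_iff₀ (by positivity)]; linarith
  linarith

theorem le_re_rsDeriv {σ t : ℝ} (h1 : 1 / 2 ≤ σ) (h2 : σ ≤ 2) (ht : 2 * Real.pi * 64 ^ 2 ≤ t) :
    Real.log (t / (2 * Real.pi)) / 2 - 10 / t ≤ (rsDeriv ((σ : ℂ) + (t : ℂ) * Complex.I)).re := by
  have hpi := Real.pi_gt_three
  have h := norm_rsDeriv_sub_le (s := (σ : ℂ) + (t : ℂ) * Complex.I) (by simpa using h1) (by simpa using h2)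
    (by rw [im_ofReal_add_ofReal_mul_I]; nlinarith)
  rw [im_ofReal_add_ofReal_mul_I] at h
  have h3 := (Complex.abs_re_le_norm _).trans h
  rw [Complex.sub_re, Complex.ofReal_re] at h3
  linarith [(abs_le.mp h3).1]

/-- Integrate the lower bound for `Re rsDeriv` horizontally. In particular `‖exp (rsW s)‖ > 1`
strictly to the right of the critical line, so `gramKernel` has no poles in that part of the strip.
-/
theorem le_re_rsW {σ t : ℝ} (h1 : 1 / 2 ≤ σ) (h2 : σ ≤ 2) (ht : 2 * Real.pi * 64 ^ 2 ≤ t) :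
    (σ - 1 / 2) * (Real.log (t / (2 * Real.pi)) / 2 - 10 / t) ≤ (rsW ((σ : ℂ) + (t : ℂ) * Complex.I)).re := by
  have hpi := Real.pi_gt_three
  have hi : IntervalIntegrable (fun u : ℝ => rsDeriv ((u : ℂ) + (t : ℂ) * Complex.I)) MeasureTheory.volume (1 / 2) σ :=
    ContinuousOn.intervalIntegrable fun u _ => (ContinuousAt.comp (f := fun u : ℝ => (u : ℂ) + (t : ℂ) * Complex.I)
      (differentiableAt_rsDeriv (by rw [im_ofReal_add_ofReal_mul_I]; nlinarith)).continuousAt (by fun_prop)).continuousWithinAt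
  unfold rsW
  rw [re_ofReal_add_ofReal_mul_I, im_ofReal_add_ofReal_mul_I, Complex.add_re, Complex.re_ofReal_mul, Complex.I_re, mul_zero, zero_add,
    intervalIntegral_re hi]
  have h := intervalIntegral.integral_mono_on (μ := MeasureTheory.volume) (f := fun _ => Real.log (t / (2 * Real.pi)) / 2 - 10 / t) h1
    (by simp) (show IntervalIntegrable (fun u : ℝ => (rsDeriv ((u : ℂ) + (t : ℂ) * Complex.I)).re) MeasureTheory.volume (1 / 2) σ from
      ⟨hi.1.re, hi.2.re⟩)
    (fun u hu => le_re_rsDeriv hu.1 (hu.2.trans h2) ht)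
  rwa [intervalIntegral.integral_const, smul_eq_mul] at h

theorem rsTheta_strictMonoOn : StrictMonoOn rsTheta (Set.Ici (2 * Real.pi * 64 ^ 2)) := by
  refine strictMonoOn_of_deriv_pos (convex_Ici _) continuous_rsTheta.continuousOn fun t ht => ?_
  rw [interior_Ici] at ht
  have h := le_re_rsDeriv (σ := 1 / 2) (t := t) le_rfl (by norm_num) (le_of_lt ht)
  have e : (((1 / 2 : ℝ) : ℂ)) = 1 / 2 := by norm_num
  rw [e] at h
  rw [(hasDerivAt_rsTheta t).deriv]
  linarith [two_le_log_div_sub (le_of_lt ht)]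

/-- The meromorphic function whose poles on the critical line are the Gram points of a given parity. -/
noncomputable def gramKernel (ε : ℝ) (s : ℂ) : ℂ :=
  riemannZeta s * rsDeriv s * (Complex.exp (rsW s) / (Complex.exp (rsW s) - ε))

/-- The map `w ↦ 1/(w - ε)` sends the unit circle, which passes through its pole `ε`, to a vertical
line. -/
theorem re_inv_exp_sub {ε : ℝ} (hε : ε = 1 ∨ ε = -1) {x : ℝ} (h : Complex.exp ((x : ℂ) * Complex.I) ≠ ε) :
    (Complex.exp ((x : ℂ) * Complex.I) - ε)⁻¹.re = -ε / 2 := by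
  have h1 : Complex.exp ((x : ℂ) * Complex.I) = ⟨Real.cos x, Real.sin x⟩ := by
    apply Complex.ext
    · rw [Complex.exp_ofReal_mul_I_re]
    · rw [Complex.exp_ofReal_mul_I_im]
  have hne := Complex.normSq_pos.mpr (sub_ne_zero.mpr h)
  rw [Complex.inv_re, div_eq_iff hne.ne', h1, Complex.normSq_apply]
  simp only [Complex.sub_re, Complex.sub_im, Complex.ofReal_re, Complex.ofReal_im]
  have := Real.sin_sq_add_cos_sq x
  rcases hε with rfl | rfl
  · linear_combination (1 / 2) * this
  · linear_combination (-1 / 2) * this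

set_option maxHeartbeats 1000000 in
-- Write `w - ε = D · (s - ρ₀)` with `D` the divided difference of `w = exp ∘ rsW`. Then `D ρ₀ =
-- w'(ρ₀) = ε rsDeriv ρ₀`, so the numerator `ζ · rsDeriv · w / D` takes the value `ζ(ρ₀) = ε Z(ρ)`,
-- a real residue.
theorem gramKernel_cell {ε : ℝ} (hε : ε = 1 ∨ ε = -1) {a b ρ : ℝ} (hT : 2 * Real.pi * 64 ^ 2 ≤ a) (ha : a < ρ) (hb : ρ < b)
    (hρ : Complex.exp ((rsTheta ρ : ℂ) * Complex.I) = ε)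
    (hne : ∀ t, a ≤ t → t ≤ b → t ≠ ρ → Complex.exp ((rsTheta t : ℂ) * Complex.I) ≠ ε) :
    (∫ σ in (1 / 2 : ℝ)..2, gramKernel ε ((σ : ℂ) + (a : ℂ) * Complex.I)).im -
      (∫ σ in (1 / 2 : ℝ)..2, gramKernel ε ((σ : ℂ) + (b : ℂ) * Complex.I)).im +
      (∫ t in a..b, gramKernel ε (((2 : ℝ) : ℂ) + (t : ℂ) * Complex.I)).re +
      ε / 2 * (∫ t in a..b, (hardyZ t * rsDeriv (1 / 2 + (t : ℂ) * Complex.I)).re) = Real.pi * (ε * (hardyZ ρ).re) := by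
  have hpi := Real.pi_gt_three
  have ha4 : 4 ≤ a := by nlinarith
  have eh : (((1 / 2 : ℝ) : ℂ)) = 1 / 2 := by norm_num
  have hεsq : (ε : ℂ) * ε = 1 := by rcases hε with rfl | rfl <;> norm_num
  have hε0 : (ε : ℂ) ≠ 0 := left_ne_zero_of_mul_eq_one hεsq
  have hεn : ‖(ε : ℂ)‖ = 1 := by rcases hε with rfl | rfl <;> simp
  set ρ₀ : ℂ := ((1 / 2 : ℝ) : ℂ) + (ρ : ℂ) * Complex.I with hρ₀
  set U : Set ℂ := {s | |s.re - 1 / 2| < s.im} with hU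
  have hUo : IsOpen U := isOpen_lt (by fun_prop) Complex.continuous_im
  set w : ℂ → ℂ := fun s => Complex.exp (rsW s) with hw
  have hwd : ∀ s ∈ U, HasDerivAt w (w s * rsDeriv s) s := fun s hs => (hasDerivAt_rsW hs).cexp
  have him : ∀ s ∈ U, 0 < s.im := fun s hs => (abs_nonneg _).trans_lt hs
  have hRU : ∀ σ t : ℝ, 1 / 2 ≤ σ → σ ≤ 2 → a ≤ t → t ≤ b → (σ : ℂ) + (t : ℂ) * Complex.I ∈ U := by
    intro σ t h1 h2 h3 _
    rw [hU, Set.mem_ofPred_eq, re_ofReal_add_ofReal_mul_I, im_ofReal_add_ofReal_mul_I, abs_of_nonneg (by linarith)]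
    linarith
  have hρU : ρ₀ ∈ U := hRU _ _ le_rfl (by norm_num) ha.le hb.le
  have hwρ : w ρ₀ = ε := by rw [hw, hρ₀, eh]; simp only [rsW_half]; exact hρ
  set D := dslope w ρ₀ with hD
  have hDd : DifferentiableOn ℂ D U := (Complex.differentiableOn_dslope (hUo.mem_nhds hρU)).mpr
    fun s hs => (hwd s hs).differentiableAt.differentiableWithinAt
  set Ω : Set ℂ := U ∩ D ⁻¹' {0}ᶜ with hΩdef
  have hΩ : IsOpen Ω := hDd.continuousOn.isOpen_inter_preimage hUo isOpen_compl_singleton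
  have hDρ : D ρ₀ = ε * rsDeriv ρ₀ := by
    rw [hD, dslope_same, (hwd ρ₀ hρU).deriv, hwρ]
  have hDne : ∀ s, s ≠ ρ₀ → D s * (s - ρ₀) = w s - ε := by
    intro s hs
    have h0 : s - ρ₀ ≠ 0 := sub_ne_zero.mpr hs
    rw [hD, dslope_of_ne _ hs, slope_def_field, hwρ]
    field_simp
  have hre0 : rsDeriv ρ₀ ≠ 0 := by
    intro h
    have h1 := le_re_rsDeriv (σ := 1 / 2) (t := ρ) le_rfl (by norm_num) (hT.trans ha.le)
    rw [← hρ₀, h] at h1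
    have := two_le_log_div_sub (hT.trans ha.le)
    simp only [Complex.zero_re] at h1
    linarith
  -- A zero of `D` in the closed rectangle would be another solution of `w = ε`. On the critical
  -- line the hypothesis excludes it, to the right `‖w‖ > 1` does, and at `ρ₀` itself `rsDeriv` is
  -- nonzero.
  have hRΩ : ∀ σ t : ℝ, 1 / 2 ≤ σ → σ ≤ 2 → a ≤ t → t ≤ b → (σ : ℂ) + (t : ℂ) * Complex.I ∈ Ω := by
    intro σ t h1 h2 h3 h4
    refine ⟨hRU σ t h1 h2 h3 h4, fun h0 => ?_⟩
    rw [Set.mem_singleton_iff] at h0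
    by_cases hs : (σ : ℂ) + (t : ℂ) * Complex.I = ρ₀
    · rw [hs, hDρ] at h0
      exact mul_ne_zero hε0 hre0 h0
    · have h5 := hDne _ hs
      rw [h0, zero_mul, eq_comm, sub_eq_zero] at h5
      rcases h1.eq_or_lt with rfl | h1
      · rw [hw, eh] at h5
        simp only [rsW_half] at h5
        exact hne t h3 h4 (fun h => hs (by rw [h])) h5
      · have h6 := congrArg norm h5
        rw [hεn, hw] at h6
        simp only [Complex.norm_exp, Real.exp_eq_one_iff] at h6
        have h7 := le_re_rsW h1.le h2 (hT.trans h3)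
        have h8 := two_le_log_div_sub (hT.trans h3)
        rw [h6] at h7
        nlinarith
  have hζρ : riemannZeta ρ₀ = ((ε * (hardyZ ρ).re : ℝ) : ℂ) := by
    have h1 : ((hardyZ ρ).re : ℂ) = hardyZ ρ := Complex.ext (by simp) (by simp [im_hardyZ])
    rw [Complex.ofReal_mul, h1, hρ₀, eh]
    unfold hardyZ
    rw [hρ, ← mul_assoc, hεsq, one_mul]
  have h := boundary_rect_of_pole_on_left (A := fun s => riemannZeta s * rsDeriv s * w s / D s) (G := gramKernel ε) hΩ
    (p := 1 / 2) (q := 2) (r := ε * (hardyZ ρ).re) (by norm_num) ha hb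
    (fun s hs => ((((differentiableAt_riemannZeta (fun h => (him s hs.1).ne' (by rw [h]; simp))).mul
      (differentiableAt_rsDeriv (him s hs.1))).mul (hwd s hs.1).differentiableAt).div
      (hDd.differentiableAt (hUo.mem_nhds hs.1)) hs.2).differentiableWithinAt)
    hRΩ (by
      rw [← hρ₀, hDρ, hwρ, hζρ]
      field_simp)
    (fun s hs hsne => by
      rw [← hρ₀] at hsne ⊢
      rw [div_div, hDne s hsne, mul_div_assoc]
      rfl)
    (k := fun t => -ε / 2 * (hardyZ t * rsDeriv (1 / 2 + (t : ℂ) * Complex.I)).re)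
    (fun t h1 h2 h3 => by
      have h4 := re_inv_exp_sub hε (hne t h1 h2 h3)
      have h5 : ((hardyZ t * rsDeriv (1 / 2 + (t : ℂ) * Complex.I)).re : ℂ) = hardyZ t * rsDeriv (1 / 2 + (t : ℂ) * Complex.I) := by
        rw [rsDeriv_half]
        exact Complex.ext (by simp) (by simp [im_hardyZ])
      have h6 : gramKernel ε (((1 / 2 : ℝ) : ℂ) + (t : ℂ) * Complex.I) =
          ((hardyZ t * rsDeriv (1 / 2 + (t : ℂ) * Complex.I)).re : ℂ) * (Complex.exp ((rsTheta t : ℂ) * Complex.I) - ε)⁻¹ := by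
        rw [h5, eh]
        unfold gramKernel hardyZ
        rw [rsW_half]
        ring
      rw [h6, Complex.re_ofReal_mul, h4]
      ring)
  rw [intervalIntegral.integral_const_mul] at h
  linarith

/-! ### The kernel on the line `Re s = 2`. -/

/-- Integrating `∑_{n ≥ 2} n^{-2-it}` termwise gives `∑ i n^{-2-it} / log n`, which is bounded
because `log n ≥ log 2`. The constant term of `ζ`, removed here, is what produces the main term. -/
theorem exists_antideriv_riemannZeta_sub_one : ∃ (P : ℝ → ℂ) (M : ℝ), 0 ≤ M ∧ ∀ t : ℝ,
    HasDerivAt P (riemannZeta (((2 : ℝ) : ℂ) + (t : ℂ) * Complex.I) - 1) t ∧ ‖P t‖ ≤ M ∧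
    ‖riemannZeta (((2 : ℝ) : ℂ) + (t : ℂ) * Complex.I) - 1‖ ≤ M := by
  set u : ℕ → ℝ := fun k => ((k + (1 + 1) : ℕ) : ℝ) ^ (-2 : ℝ) with hu
  have hus : Summable u := (summable_nat_add_iff (f := fun k : ℕ => (k : ℝ) ^ (-2 : ℝ)) (1 + 1)).mpr
    (Real.summable_nat_rpow.mpr (by norm_num))
  have hu0 : ∀ k, 0 ≤ u k := fun k => by rw [hu]; positivity
  set g' : ℕ → ℝ → ℂ := fun k t => ((k + (1 + 1) : ℕ) : ℂ) ^ (-(((2 : ℝ) : ℂ) + (t : ℂ) * Complex.I)) with hg'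
  set g : ℕ → ℝ → ℂ := fun k t => g' k t * (Complex.I / (Real.log ((k + (1 + 1) : ℕ) : ℝ) : ℝ)) with hg
  have hn' : ∀ k t, ‖g' k t‖ = u k := fun k t => by
    rw [hg', hu]
    simp only
    rw [norm_natCast_cpow_neg (by omega), re_ofReal_add_ofReal_mul_I]
  have hlog : ∀ k : ℕ, 1 / 2 ≤ Real.log ((k + (1 + 1) : ℕ) : ℝ) := fun k => by
    have h1 : Real.log 2 ≤ Real.log ((k + (1 + 1) : ℕ) : ℝ) := Real.log_le_log (by norm_num) (by push_cast; linarith [(Nat.cast_nonneg k : (0 : ℝ) ≤ k)])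
    linarith [Real.log_two_gt_d9]
  have hn : ∀ k t, ‖g k t‖ ≤ 2 * u k := fun k t => by
    rw [hg]
    simp only
    rw [norm_mul, hn', norm_div, Complex.norm_I, Complex.norm_real, Real.norm_eq_abs, abs_of_pos (by linarith [hlog k]), mul_comm]
    refine mul_le_mul_of_nonneg_right ?_ (hu0 k)
    rw [div_le_iff₀ (by linarith [hlog k])]
    linarith [hlog k]
  have hd : ∀ k t, HasDerivAt (g k) (g' k t) t := fun k t => by
    have hk : ((k + (1 + 1) : ℕ) : ℂ) ≠ 0 := by exact_mod_cast (by omega : k + (1 + 1) ≠ 0)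
    have h1 := (((hasDerivAt_id (((2 : ℝ) : ℂ) + (t : ℂ) * Complex.I)).neg).const_cpow (c := ((k + (1 + 1) : ℕ) : ℂ)) (Or.inl hk)).comp t
      (hasDerivAt_vertical 2 t)
    have h2 := h1.mul_const (Complex.I / (Real.log ((k + (1 + 1) : ℕ) : ℝ) : ℝ))
    refine h2.congr_deriv ?_
    have hl : ((Real.log ((k + (1 + 1) : ℕ) : ℝ) : ℝ) : ℂ) ≠ 0 := by
      exact_mod_cast (by linarith [hlog k] : Real.log ((k + (1 + 1) : ℕ) : ℝ) ≠ 0)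
    have hl2 : Complex.log ((k + (1 + 1) : ℕ) : ℂ) = ((Real.log ((k + (1 + 1) : ℕ) : ℝ) : ℝ) : ℂ) := Complex.natCast_log.symm
    rw [hl2, hg']
    simp only [id, Pi.neg_apply]
    field_simp
    rw [Complex.I_sq]
    ring
  have hsum : ∀ t : ℝ, HasSum (fun k => g' k t) (riemannZeta (((2 : ℝ) : ℂ) + (t : ℂ) * Complex.I) - 1) := fun t => by
    have h := hasSum_zeta_sub_zetaPoly 1 (s := ((2 : ℝ) : ℂ) + (t : ℂ) * Complex.I) (by rw [re_ofReal_add_ofReal_mul_I]; norm_num)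
    have e : zetaPoly 1 (((2 : ℝ) : ℂ) + (t : ℂ) * Complex.I) = 1 := by simp [zetaPoly]
    rwa [e] at h
  have hgs : ∀ t, Summable fun k => g k t := fun t => Summable.of_norm_bounded (hus.mul_left 2) fun k => hn k t
  refine ⟨fun t => ∑' k, g k t, ∑' k, 2 * u k, tsum_nonneg fun k => by linarith [hu0 k], fun t => ⟨?_, ?_, ?_⟩⟩
  · rw [← (hsum t).tsum_eq]
    exact hasDerivAt_tsum hus hd (fun k t => (hn' k t).le) (hgs 0) t
  · exact tsum_of_norm_bounded (hus.mul_left 2).hasSum fun k => hn k t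
  · rw [← (hsum t).tsum_eq]
    exact tsum_of_norm_bounded (hus.mul_left 2).hasSum fun k => (hn' k t).le.trans (by linarith [hu0 k])

/-- Integrate by parts against the bounded primitive; the logarithm has derivative `1/t`. The result
is stated in the weaker shape common to all the error terms. -/
theorem exists_norm_integral_riemannZeta_sub_one_mul_log_le {T₀ : ℝ} (hT₀ : 2 * Real.pi * 64 ^ 2 ≤ T₀) :
    ∃ C, 0 ≤ C ∧ ∀ T, T₀ ≤ T → ‖∫ t in T₀..T, (riemannZeta (((2 : ℝ) : ℂ) + (t : ℂ) * Complex.I) - 1) *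
      ((Real.log (t / (2 * Real.pi)) / 2 : ℝ) : ℂ)‖ ≤ C * (T ^ (1 / 4 : ℝ) * Real.log T) := by
  obtain ⟨P, M, hM, hP⟩ := exists_antideriv_riemannZeta_sub_one
  have hpi := Real.pi_gt_three
  have hpos : 1 ≤ T₀ := by nlinarith
  set l : ℝ → ℂ := fun t => ((Real.log (t / (2 * Real.pi)) / 2 : ℝ) : ℂ) with hl
  have hld : ∀ t : ℝ, 0 < t → HasDerivAt l ((t⁻¹ / 2 : ℝ) : ℂ) t := fun t ht => by
    have h := (((hasDerivAt_id t).div_const (2 * Real.pi)).log (div_pos ht (by positivity)).ne').div_const 2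
    refine h.ofReal_comp.congr_deriv ?_
    congr 1
    simp only [id]
    field_simp
  have hsub : ∀ T, T₀ ≤ T → ∀ t ∈ Set.uIcc T₀ T, 0 < t := by
    intro T hT t ht
    rw [Set.uIcc_of_le hT] at ht
    linarith [ht.1]
  refine ⟨10 * M, by positivity, fun T hT => ?_⟩
  have hT1 : 1 ≤ T := hpos.trans hT
  have hlog : ∀ t, T₀ ≤ t → t ≤ T → ‖l t‖ ≤ Real.log T := by
    intro t h1 h2
    have h3 := two_le_log_div_sub (hT₀.trans h1)
    have h4 : 0 < 10 / t := by have : 0 < t := by linarith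
                               positivity
    rw [hl]
    simp only
    rw [Complex.norm_real, Real.norm_eq_abs, abs_of_nonneg (by linarith)]
    have h5 : Real.log (t / (2 * Real.pi)) ≤ Real.log T := by
      refine Real.log_le_log (div_pos (by linarith) (by positivity)) ?_
      rw [div_le_iff₀ (by positivity)]
      nlinarith
    linarith
  have hlT : 1 ≤ Real.log T := one_le_log_of_four_le (by nlinarith)
  have hparts := intervalIntegral.integral_mul_deriv_eq_deriv_mul (u := l) (v := P) (a := T₀) (b := T)
    (fun t ht => hld t (hsub T hT t ht)) (fun t _ => (hP t).1)
    (ContinuousOn.intervalIntegrable fun t ht => ((Complex.continuous_ofReal.continuousAt.comp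
      ((continuousAt_inv₀ (hsub T hT t ht).ne').div_const 2))).continuousWithinAt)
    (ContinuousOn.intervalIntegrable fun t ht =>
      ((continuousAt_riemannZeta_line 2 (hsub T hT t ht)).sub continuousAt_const).continuousWithinAt)
  have hI : ‖∫ t in T₀..T, ((t⁻¹ / 2 : ℝ) : ℂ) * P t‖ ≤ 4 * M * T ^ (1 / 4 : ℝ) := by
    refine norm_integral_le_of_norm_le_rpow (by linarith) hT hM fun t h1 h2 => ?_
    have ht : 0 < t := by linarith
    rw [norm_mul, Complex.norm_real, Real.norm_eq_abs, abs_of_pos (by positivity), ← rpow_quarter_mul_inv ht]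
    have h3 : 1 ≤ t ^ (1 / 4 : ℝ) := Real.one_le_rpow (by linarith) (by norm_num)
    calc t⁻¹ / 2 * ‖P t‖ ≤ t⁻¹ * M := mul_le_mul (by linarith [inv_pos.mpr ht]) (hP t).2.1 (norm_nonneg _) (by positivity)
      _ ≤ M * (t ^ (1 / 4 : ℝ) * t⁻¹) := by
        have : 0 ≤ t⁻¹ * M := by positivity
        nlinarith
  have hR : 1 ≤ T ^ (1 / 4 : ℝ) := Real.one_le_rpow hT1 (by norm_num)
  have e : (∫ t in T₀..T, (riemannZeta (((2 : ℝ) : ℂ) + (t : ℂ) * Complex.I) - 1) * l t) =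
      ∫ t in T₀..T, l t * (riemannZeta (((2 : ℝ) : ℂ) + (t : ℂ) * Complex.I) - 1) :=
    intervalIntegral.integral_congr fun t _ => mul_comm _ _
  have hb : ∀ t, T₀ ≤ t → t ≤ T → ‖l t * P t‖ ≤ M * (T ^ (1 / 4 : ℝ) * Real.log T) := by
    intro t h1 h2
    rw [norm_mul]
    calc ‖l t‖ * ‖P t‖ ≤ Real.log T * M := mul_le_mul (hlog t h1 h2) (hP t).2.1 (norm_nonneg _) (by linarith)
      _ ≤ _ := by
        have : 0 ≤ Real.log T * M := by positivity
        nlinarith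
  rw [e, hparts]
  refine (norm_sub_le _ _).trans ((add_le_add ((norm_sub_le _ _).trans (add_le_add (hb T hT le_rfl) (hb T₀ le_rfl hT))) hI).trans ?_)
  have h6 : M * T ^ (1 / 4 : ℝ) ≤ M * (T ^ (1 / 4 : ℝ) * Real.log T) := by
    refine mul_le_mul_of_nonneg_left ?_ hM
    nlinarith
  have h7 : 0 ≤ M * (T ^ (1 / 4 : ℝ) * Real.log T) := by positivity
  linarith

theorem norm_rsDeriv_le_log {σ t : ℝ} (h1 : 1 / 2 ≤ σ) (h2 : σ ≤ 2) (ht : 2 * Real.pi * 64 ^ 2 ≤ t) :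
    ‖rsDeriv ((σ : ℂ) + (t : ℂ) * Complex.I)‖ ≤ Real.log t := by
  have hpi := Real.pi_gt_three
  have ht0 : 0 < t := by nlinarith
  have h := norm_rsDeriv_sub_le (s := (σ : ℂ) + (t : ℂ) * Complex.I) (by simpa using h1) (by simpa using h2)
    (by rw [im_ofReal_add_ofReal_mul_I]; nlinarith)
  rw [im_ofReal_add_ofReal_mul_I] at h
  have h3 := two_le_log_div_sub ht
  have h4 : 0 < 10 / t := by positivity
  have h5 := norm_le_norm_sub_add (rsDeriv ((σ : ℂ) + (t : ℂ) * Complex.I)) ((Real.log (t / (2 * Real.pi)) / 2 : ℝ) : ℂ)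
  rw [Complex.norm_real, Real.norm_eq_abs, abs_of_nonneg (by linarith)] at h5
  have h6 : Real.log (t / (2 * Real.pi)) ≤ Real.log t := by
    refine Real.log_le_log (by positivity) ?_
    rw [div_le_iff₀ (by positivity)]
    nlinarith
  linarith

/-- At `σ = 2` the real part of `rsW` is at least `(3/4) log (t/2π) - 1`, and `(2π)^{3/4} e ≤ 21`.
Since `‖w‖ ≥ 2`, subtracting `ε` at most halves the norm. -/
theorem rpow_le_norm_exp_rsW_sub {ε : ℝ} (hε : ε = 1 ∨ ε = -1) {t : ℝ} (ht : 2 * Real.pi * 64 ^ 2 ≤ t) :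
    t ^ (3 / 4 : ℝ) / 42 ≤ ‖Complex.exp (rsW (((2 : ℝ) : ℂ) + (t : ℂ) * Complex.I)) - ε‖ := by
  have hpi := Real.pi_gt_three
  have ht0 : 0 < t := by nlinarith
  have h1 := le_re_rsW (σ := 2) (by norm_num) le_rfl ht
  have h2 := two_le_log_div_sub ht
  have h3 : 10 / t ≤ 1 / 10 := by rw [div_le_div_iff₀ ht0 (by norm_num)]; nlinarith
  set w := Complex.exp (rsW (((2 : ℝ) : ℂ) + (t : ℂ) * Complex.I)) with hw
  have hn : ‖w‖ = Real.exp (rsW (((2 : ℝ) : ℂ) + (t : ℂ) * Complex.I)).re := Complex.norm_exp _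
  have h4 : 2 ≤ ‖w‖ := by
    rw [hn]
    linarith [Real.add_one_le_exp (rsW (((2 : ℝ) : ℂ) + (t : ℂ) * Complex.I)).re]
  have hεn : ‖(ε : ℂ)‖ = 1 := by rcases hε with rfl | rfl <;> simp
  have h5 := norm_sub_norm_le w ε
  rw [hεn] at h5
  have h6 : t ^ (3 / 4 : ℝ) / 21 ≤ ‖w‖ := by
    have h7 : Real.exp (Real.log (t / (2 * Real.pi)) * (3 / 4) - 1) ≤ ‖w‖ := by
      rw [hn]
      exact Real.exp_le_exp.mpr (by linarith)
    refine le_trans ?_ h7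
    rw [Real.exp_sub, ← Real.rpow_def_of_pos (by positivity), Real.div_rpow ht0.le (by positivity), div_div]
    refine div_le_div_of_nonneg_left (by positivity) (by positivity) ?_
    have h8 : (2 * Real.pi) ^ (3 / 4 : ℝ) ≤ 2 * Real.pi := by
      conv_rhs => rw [← Real.rpow_one (2 * Real.pi)]
      exact Real.rpow_le_rpow_of_exponent_le (by linarith) (by norm_num)
    calc (2 * Real.pi) ^ (3 / 4 : ℝ) * Real.exp 1 ≤ 7 * 3 := by
          gcongr
          · linarith [Real.pi_lt_d2]
          · linarith [Real.exp_one_lt_d9]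
      _ = 21 := by norm_num
  linarith

theorem hasDerivAt_rsW_line (σ : ℝ) (h1 : 1 / 2 ≤ σ) (h2 : σ ≤ 2) {t : ℝ} (ht : 2 ≤ t) :
    HasDerivAt rsW (rsDeriv ((σ : ℂ) + (t : ℂ) * Complex.I)) ((σ : ℂ) + (t : ℂ) * Complex.I) :=
  hasDerivAt_rsW (by
    rw [re_ofReal_add_ofReal_mul_I, im_ofReal_add_ofReal_mul_I, abs_of_nonneg (by linarith)]
    linarith)

theorem continuousAt_gramKernel_line {ε : ℝ} (hε : ε = 1 ∨ ε = -1) {t : ℝ} (ht : 2 * Real.pi * 64 ^ 2 ≤ t) :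
    ContinuousAt (fun t : ℝ => gramKernel ε (((2 : ℝ) : ℂ) + (t : ℂ) * Complex.I)) t := by
  have hpi := Real.pi_gt_three
  have ht0 : 2 ≤ t := by nlinarith
  have h := rpow_le_norm_exp_rsW_sub hε ht
  have hw : ContinuousAt (fun t : ℝ => Complex.exp (rsW (((2 : ℝ) : ℂ) + (t : ℂ) * Complex.I))) t :=
    (ContinuousAt.comp (f := fun t : ℝ => ((2 : ℝ) : ℂ) + (t : ℂ) * Complex.I)
      (hasDerivAt_rsW_line 2 (by norm_num) le_rfl ht0).continuousAt (by fun_prop)).cexp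
  refine ((continuousAt_riemannZeta_line 2 (by linarith)).mul (continuousAt_rsDeriv_line 2 (by linarith))).mul
    (hw.div (hw.sub continuousAt_const) (norm_pos_iff.mp (lt_of_lt_of_le ?_ h)))
  have : 0 < t := by linarith
  positivity

set_option maxHeartbeats 1000000 in
-- Because `w / (w - ε) = 1 + ε / (w - ε)`, the kernel is `ζ · rsDeriv` up to `O(t^{-3/4} log t)`.
-- Moving `rsDeriv` to the critical line costs `O(1/t)`, which leaves `θ' + (ζ - 1) · log(t/2π)/2`.
-- The first term integrates to the increment of `θ`.
theorem exists_abs_re_integral_gramKernel_sub_le {ε : ℝ} (hε : ε = 1 ∨ ε = -1) {T₀ : ℝ} (hT₀ : 2 * Real.pi * 64 ^ 2 ≤ T₀) :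
    ∃ C, 0 ≤ C ∧ ∀ T, T₀ ≤ T →
      |(∫ t in T₀..T, gramKernel ε (((2 : ℝ) : ℂ) + (t : ℂ) * Complex.I)).re - (rsTheta T - rsTheta T₀)| ≤
        C * (T ^ (1 / 4 : ℝ) * Real.log T) := by
  obtain ⟨C, hC, hCle⟩ := exists_norm_integral_riemannZeta_sub_one_mul_log_le hT₀
  obtain ⟨P, M, hM, hP⟩ := exists_antideriv_riemannZeta_sub_one
  have hpi := Real.pi_gt_three
  have hpos : 8 ≤ T₀ := by nlinarith
  have eh : (((1 / 2 : ℝ) : ℂ)) = 1 / 2 := by norm_num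
  set Z : ℝ → ℂ := fun t => riemannZeta (((2 : ℝ) : ℂ) + (t : ℂ) * Complex.I) with hZ
  set l : ℝ → ℂ := fun t => ((Real.log (t / (2 * Real.pi)) / 2 : ℝ) : ℂ) with hl
  set G : ℝ → ℂ := fun t => gramKernel ε (((2 : ℝ) : ℂ) + (t : ℂ) * Complex.I) with hG
  set d₁ : ℝ → ℂ := fun t => rsDeriv (1 / 2 + (t : ℂ) * Complex.I) with hd₁
  set d₂ : ℝ → ℂ := fun t => rsDeriv (((2 : ℝ) : ℂ) + (t : ℂ) * Complex.I) with hd₂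
  set v : ℝ → ℂ := fun t => Complex.exp (rsW (((2 : ℝ) : ℂ) + (t : ℂ) * Complex.I)) - ε with hv
  have hvle : ∀ t, T₀ ≤ t → t ^ (3 / 4 : ℝ) / 42 ≤ ‖v t‖ := fun t ht => rpow_le_norm_exp_rsW_sub hε (hT₀.trans ht)
  set R : ℝ → ℂ := fun t => G t - (d₁ t + (Z t - 1) * l t) with hR
  have hb1 : ∀ t, T₀ ≤ t → ‖d₁ t - l t‖ ≤ 10 * t⁻¹ := by
    intro t ht
    have h := norm_rsDeriv_sub_le (s := 1 / 2 + (t : ℂ) * Complex.I) (by simp) (by simp; norm_num) (by simp; linarith)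
    have him : (1 / 2 + (t : ℂ) * Complex.I).im = t := by simp
    rw [him, div_eq_mul_inv 10] at h
    exact h
  have hb2 : ∀ t, T₀ ≤ t → ‖d₂ t - l t‖ ≤ 10 * t⁻¹ := by
    intro t ht
    have h := norm_rsDeriv_sub_le (s := ((2 : ℝ) : ℂ) + (t : ℂ) * Complex.I) (by rw [re_ofReal_add_ofReal_mul_I]; norm_num)
      (by rw [re_ofReal_add_ofReal_mul_I]) (by rw [im_ofReal_add_ofReal_mul_I]; linarith)
    rw [im_ofReal_add_ofReal_mul_I, div_eq_mul_inv 10] at h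
    exact h
  refine ⟨C + 4 * (20 + 10 * M + (1 + M) * 42), by positivity, fun T hT => ?_⟩
  have hlT : 1 ≤ Real.log T := one_le_log_of_four_le (by linarith)
  have hsub : ∀ t ∈ Set.uIcc T₀ T, T₀ ≤ t := by
    intro t ht
    rw [Set.uIcc_of_le hT] at ht
    exact ht.1
  have hid₁ : IntervalIntegrable d₁ MeasureTheory.volume T₀ T := ContinuousOn.intervalIntegrable fun t ht => by
    have h := continuousAt_rsDeriv_line (1 / 2) (t := t) (by linarith [hsub t ht])
    rw [eh] at h
    exact h.continuousWithinAt
  have hiG : IntervalIntegrable G MeasureTheory.volume T₀ T := ContinuousOn.intervalIntegrable fun t ht =>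
    (continuousAt_gramKernel_line hε (hT₀.trans (hsub t ht))).continuousWithinAt
  have hiZ : IntervalIntegrable (fun t => (Z t - 1) * l t) MeasureTheory.volume T₀ T := ContinuousOn.intervalIntegrable fun t ht =>
    (((continuousAt_riemannZeta_line 2 (by linarith [hsub t ht])).sub continuousAt_const).mul
      (Complex.continuous_ofReal.continuousAt.comp (((continuousAt_id.div_const _).log
        (div_pos (by linarith [hsub t ht] : 0 < t) (by positivity)).ne').div_const _))).continuousWithinAt
  have hsplit : (∫ t in T₀..T, G t) = (∫ t in T₀..T, d₁ t) + (∫ t in T₀..T, (Z t - 1) * l t) + ∫ t in T₀..T, R t := by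
    rw [← intervalIntegral.integral_add hid₁ hiZ, ← intervalIntegral.integral_add (hid₁.add hiZ) (hiG.sub (hid₁.add hiZ))]
    refine intervalIntegral.integral_congr fun t _ => ?_
    change G t = d₁ t + (Z t - 1) * l t + (G t - (d₁ t + (Z t - 1) * l t))
    ring
  have hθ : (∫ t in T₀..T, d₁ t).re = rsTheta T - rsTheta T₀ := by
    rw [intervalIntegral_re hid₁]
    exact intervalIntegral.integral_eq_sub_of_hasDerivAt (fun t _ => hasDerivAt_rsTheta t) ⟨hid₁.1.re, hid₁.2.re⟩
  have hRle : ‖∫ t in T₀..T, R t‖ ≤ 4 * ((20 + 10 * M + (1 + M) * 42) * Real.log T) * T ^ (1 / 4 : ℝ) := by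
    refine norm_integral_le_of_norm_le_rpow (by linarith) hT (by positivity) fun t h1 h2 => ?_
    have ht : 0 < t := by linarith
    have hv0 : v t ≠ 0 := norm_pos_iff.mp (lt_of_lt_of_le (by positivity) (hvle t h1))
    have e : R t = (d₂ t - l t) - (d₁ t - l t) + (Z t - 1) * (d₂ t - l t) + Z t * d₂ t * (ε * (v t)⁻¹) := by
      have e2 : G t = Z t * d₂ t * ((v t + ε) / v t) := by
        simp only [hG, hv, hZ, hd₂, sub_add_cancel]
        rfl
      simp only [hR]
      rw [e2]
      field_simp
      ring
    have hεn : ‖(ε : ℂ)‖ = 1 := by rcases hε with rfl | rfl <;> simp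
    have hZn : ‖Z t‖ ≤ 1 + M := by
      have := norm_le_norm_sub_add (Z t) 1
      rw [norm_one] at this
      linarith [(hP t).2.2]
    have hvi : ‖(v t)⁻¹‖ ≤ 42 * t ^ (-3 / 4 : ℝ) := by
      rw [norm_inv, inv_le_comm₀ (norm_pos_iff.mpr hv0) (by positivity), mul_inv, neg_div, Real.rpow_neg ht.le, inv_inv]
      linarith [hvle t h1]
    have hinv : t⁻¹ ≤ t ^ (-3 / 4 : ℝ) := by
      rw [← Real.rpow_neg_one]
      exact Real.rpow_le_rpow_of_exponent_le (by linarith) (by norm_num)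
    have hd : ‖d₂ t‖ ≤ Real.log T := (norm_rsDeriv_le_log (by norm_num) le_rfl (hT₀.trans h1)).trans (Real.log_le_log ht h2)
    rw [e]
    have b1 : ‖(d₂ t - l t) - (d₁ t - l t)‖ ≤ 20 * t⁻¹ := (norm_sub_le _ _).trans (by linarith [hb1 t h1, hb2 t h1])
    have b2 : ‖(Z t - 1) * (d₂ t - l t)‖ ≤ M * (10 * t⁻¹) := by
      rw [norm_mul]
      exact mul_le_mul (hP t).2.2 (hb2 t h1) (norm_nonneg _) hM
    have b3 : ‖Z t * d₂ t * (ε * (v t)⁻¹)‖ ≤ (1 + M) * Real.log T * (42 * t ^ (-3 / 4 : ℝ)) := by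
      rw [norm_mul, norm_mul, norm_mul, hεn, one_mul]
      gcongr
    refine (norm_add_le _ _).trans ((add_le_add ((norm_add_le _ _).trans (add_le_add b1 b2)) b3).trans ?_)
    set q := t ^ (-3 / 4 : ℝ) with hq
    have hq0 : 0 ≤ q := by positivity
    have c1 : (20 + 10 * M) * t⁻¹ ≤ (20 + 10 * M) * (q * Real.log T) :=
      mul_le_mul_of_nonneg_left (hinv.trans (by nlinarith)) (by positivity)
    linarith
  rw [hsplit, Complex.add_re, Complex.add_re, hθ]
  have a1 := (Complex.abs_re_le_norm _).trans (hCle T hT)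
  have a2 := (Complex.abs_re_le_norm _).trans hRle
  have e3 : rsTheta T - rsTheta T₀ + (∫ t in T₀..T, (Z t - 1) * l t).re + (∫ t in T₀..T, R t).re - (rsTheta T - rsTheta T₀) =
      (∫ t in T₀..T, (Z t - 1) * l t).re + (∫ t in T₀..T, R t).re := by ring
  rw [e3]
  refine (abs_add_le _ _).trans ?_
  linarith

/-! ### The horizontal sides. -/

/-- At a height with `e^{iθ} = -ε` one has `w = -ε e^J`, where `J` is the horizontal integral of
`rsDeriv` and is almost real. Then `w / (w - ε) = 1 / (1 + e^{-J})`, and `|Im J| ≤ 1` makes `Re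
e^{-J}` nonnegative. This is why the cells end at Gram points of the opposite parity. -/
theorem norm_exp_rsW_div_le_one {ε : ℝ} (hε : ε = 1 ∨ ε = -1) {σ T : ℝ} (h1 : 1 / 2 ≤ σ) (h2 : σ ≤ 2) (hT : 2 * Real.pi * 64 ^ 2 ≤ T)
    (hθ : Complex.exp ((rsTheta T : ℂ) * Complex.I) = -ε) :
    ‖Complex.exp (rsW ((σ : ℂ) + (T : ℂ) * Complex.I)) / (Complex.exp (rsW ((σ : ℂ) + (T : ℂ) * Complex.I)) - ε)‖ ≤ 1 := by
  have hpi := Real.pi_gt_three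
  have hT0 : 100 ≤ T := by nlinarith
  set J : ℂ := ∫ u in (1 / 2 : ℝ)..σ, rsDeriv ((u : ℂ) + (T : ℂ) * Complex.I) with hJ
  have hi : IntervalIntegrable (fun u : ℝ => rsDeriv ((u : ℂ) + (T : ℂ) * Complex.I)) MeasureTheory.volume (1 / 2) σ :=
    ContinuousOn.intervalIntegrable fun u _ => (ContinuousAt.comp (f := fun u : ℝ => (u : ℂ) + (T : ℂ) * Complex.I)
      (differentiableAt_rsDeriv (by rw [im_ofReal_add_ofReal_mul_I]; linarith)).continuousAt (by fun_prop)).continuousWithinAt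
  have hJim : |J.im| ≤ 1 := by
    have e : J = (∫ u in (1 / 2 : ℝ)..σ, (rsDeriv ((u : ℂ) + (T : ℂ) * Complex.I) - ((Real.log (T / (2 * Real.pi)) / 2 : ℝ) : ℂ))) +
        (((σ - 1 / 2) * (Real.log (T / (2 * Real.pi)) / 2) : ℝ) : ℂ) := by
      rw [intervalIntegral.integral_sub hi (by simp), intervalIntegral.integral_const, hJ]
      rw [Complex.real_smul]
      push_cast
      ring
    rw [e, Complex.add_im, Complex.ofReal_im, add_zero]
    refine (Complex.abs_im_le_norm _).trans ?_
    have h := intervalIntegral.norm_integral_le_of_norm_le_const (a := 1 / 2) (b := σ) (C := 1 / 10)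
      (f := fun u : ℝ => rsDeriv ((u : ℂ) + (T : ℂ) * Complex.I) - ((Real.log (T / (2 * Real.pi)) / 2 : ℝ) : ℂ)) (fun u hu => by
        rw [Set.uIoc_of_le h1] at hu
        have h := norm_rsDeriv_sub_le (s := (u : ℂ) + (T : ℂ) * Complex.I) (by rw [re_ofReal_add_ofReal_mul_I]; exact hu.1.le)
          (by rw [re_ofReal_add_ofReal_mul_I]; exact hu.2.trans h2) (by rw [im_ofReal_add_ofReal_mul_I]; linarith)
        rw [im_ofReal_add_ofReal_mul_I] at h
        refine h.trans ?_
        rw [div_le_div_iff₀ (by linarith) (by norm_num)]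
        linarith)
    rw [abs_of_nonneg (by linarith)] at h
    refine h.trans ?_
    linarith
  have hw : Complex.exp (rsW ((σ : ℂ) + (T : ℂ) * Complex.I)) = -ε * Complex.exp J := by
    unfold rsW
    rw [re_ofReal_add_ofReal_mul_I, im_ofReal_add_ofReal_mul_I, Complex.exp_add, hθ]
  have hεsq : (ε : ℂ) * ε = 1 := by rcases hε with rfl | rfl <;> norm_num
  have e2 : Complex.exp (rsW ((σ : ℂ) + (T : ℂ) * Complex.I)) / (Complex.exp (rsW ((σ : ℂ) + (T : ℂ) * Complex.I)) - ε) =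
      (1 + Complex.exp (-J))⁻¹ := by
    have hJ0 := Complex.exp_ne_zero J
    have hε0 : (ε : ℂ) ≠ 0 := left_ne_zero_of_mul_eq_one hεsq
    rw [hw, Complex.exp_neg, show -(ε : ℂ) * Complex.exp J - ε = -ε * (Complex.exp J + 1) by ring,
      mul_div_mul_left _ _ (neg_ne_zero.mpr hε0), show 1 + (Complex.exp J)⁻¹ = (Complex.exp J + 1) / Complex.exp J by field_simp, inv_div]
  rw [e2, norm_inv]
  refine inv_le_one_of_one_le₀ ?_
  refine le_trans ?_ (Complex.re_le_norm _)
  rw [Complex.add_re, Complex.one_re, Complex.exp_re]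
  have := Real.cos_nonneg_of_neg_pi_div_two_le_of_le (x := (-J).im) (by rw [Complex.neg_im]; linarith [(abs_le.mp hJim).2])
    (by rw [Complex.neg_im]; linarith [(abs_le.mp hJim).1])
  have := mul_nonneg (Real.exp_pos (-J).re).le this
  linarith

theorem norm_integral_gramKernel_horizontal_le {ε : ℝ} (hε : ε = 1 ∨ ε = -1) {T : ℝ} (hT : 2 * Real.pi * 64 ^ 2 ≤ T)
    (hθ : Complex.exp ((rsTheta T : ℂ) * Complex.I) = -ε) :
    ‖∫ σ in (1 / 2 : ℝ)..2, gramKernel ε ((σ : ℂ) + (T : ℂ) * Complex.I)‖ ≤ 300006 * (T ^ (1 / 4 : ℝ) * Real.log T) := by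
  have hpi := Real.pi_gt_three
  have hT0 : 4 ≤ T := by nlinarith
  have hl := one_le_log_of_four_le hT0
  have h := intervalIntegral.norm_integral_le_of_norm_le_const (a := 1 / 2) (b := 2) (C := 200004 * T ^ (1 / 4 : ℝ) * Real.log T * 1)
    (f := fun u : ℝ => gramKernel ε ((u : ℂ) + (T : ℂ) * Complex.I)) (fun u hu => by
      rw [Set.uIoc_of_le (by norm_num)] at hu
      unfold gramKernel
      rw [norm_mul, norm_mul]
      exact mul_le_mul (mul_le_mul (norm_riemannZeta_le_rpow hu.1.le hu.2 hT) (norm_rsDeriv_le_log hu.1.le hu.2 hT) (norm_nonneg _)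
        (by positivity)) (norm_exp_rsW_div_le_one hε hu.1.le hu.2 hT hθ) (norm_nonneg _) (by positivity))
  refine h.trans (le_of_eq ?_)
  rw [abs_of_pos (by norm_num)]
  ring

/-! ### Growth of `θ` and the Gram points. -/

/-- Compare derivatives: `θ'` is about `(1/2) log t`, well above the derivative `(log t + 1)/8`.
Only the order of magnitude matters, so the constant `1/8` is deliberately crude. -/
theorem exists_mul_log_le_rsTheta : ∃ c : ℝ, ∀ T, 2 * Real.pi * 64 ^ 2 ≤ T → T * Real.log T / 8 - c ≤ rsTheta T := by
  have hpi := Real.pi_gt_three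
  set T₀ := 2 * Real.pi * 64 ^ 2 with hT₀
  have hT0 : 1000 ≤ T₀ := by nlinarith
  have hd : ∀ t, T₀ ≤ t → HasDerivAt (fun t => rsTheta t - t * Real.log t / 8)
      ((rsDeriv (1 / 2 + (t : ℂ) * Complex.I)).re - (1 * Real.log t + t * t⁻¹) / 8) t := fun t ht =>
    (hasDerivAt_rsTheta t).sub (((hasDerivAt_id t).mul (Real.hasDerivAt_log (by linarith))).div_const 8)
  have hm : MonotoneOn (fun t => rsTheta t - t * Real.log t / 8) (Set.Ici T₀) := by
    refine monotoneOn_of_deriv_nonneg (convex_Ici _) (fun t ht => (hd t ht).continuousAt.continuousWithinAt)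
      (fun t ht => (hd t (interior_subset ht)).differentiableAt.differentiableWithinAt) fun t ht => ?_
    have ht' : T₀ ≤ t := interior_subset ht
    have ht0 : 0 < t := by linarith
    rw [(hd t ht').deriv, mul_inv_cancel₀ ht0.ne']
    have h := le_re_rsDeriv (σ := 1 / 2) (t := t) le_rfl (by norm_num) ht'
    have e : (((1 / 2 : ℝ) : ℂ)) = 1 / 2 := by norm_num
    rw [e, Real.log_div ht0.ne' (by positivity)] at h
    have h1 : 10 / t ≤ 1 := by rw [div_le_one ht0]; linarith
    have h2 : Real.log (2 * Real.pi) ≤ 2 := by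
      rw [Real.log_le_iff_le_exp (by positivity)]
      have : Real.exp 2 = Real.exp 1 * Real.exp 1 := by rw [← Real.exp_add]; norm_num
      rw [this]
      nlinarith [Real.exp_one_gt_d9, Real.pi_lt_d2]
    have h3 : 6 ≤ Real.log t := by
      have h4 : 6 ≤ Real.log (2 ^ 9) := by
        rw [Real.log_pow]; push_cast; linarith [Real.log_two_gt_d9]
      exact h4.trans (Real.log_le_log (by norm_num) (by norm_num; linarith))
    linarith
  refine ⟨-(rsTheta T₀ - T₀ * Real.log T₀ / 8), fun T hT => ?_⟩
  have := hm (Set.mem_Ici.mpr le_rfl) (Set.mem_Ici.mpr hT) hT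
  simp only at this
  linarith

/-- Once `πm` exceeds the maximum of `θ` on `[7, T₀]`, every solution above `7` lies beyond `T₀`,
where `θ` is strictly increasing, so the choice in the definition is harmless. Existence follows
from the intermediate value theorem and the growth of `θ`. The finitely many smaller indices only
affect a bounded term. -/
theorem exists_gramPoint_spec : ∃ m₀ : ℕ, ∀ m : ℤ, (m₀ : ℤ) ≤ m →
    2 * Real.pi * 64 ^ 2 ≤ gramPoint m ∧ rsTheta (gramPoint m) = Real.pi * m := by
  have hpi := Real.pi_gt_three
  obtain ⟨c, hc⟩ := exists_mul_log_le_rsTheta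
  set T₀ := 2 * Real.pi * 64 ^ 2 with hT₀
  have hT0 : 1000 ≤ T₀ := by nlinarith
  obtain ⟨M, hM⟩ := (isCompact_Icc (a := 7) (b := T₀)).bddAbove_image continuous_rsTheta.continuousOn
  have hM' : ∀ t, 7 ≤ t → t ≤ T₀ → rsTheta t ≤ M := fun t h1 h2 => hM ⟨t, ⟨h1, h2⟩, rfl⟩
  obtain ⟨m₀, hm₀⟩ := exists_nat_gt M
  refine ⟨m₀, fun m hm => ?_⟩
  have hmM : M < Real.pi * m := by
    have h1 : (m₀ : ℝ) ≤ m := by exact_mod_cast hm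
    have h2 : (0 : ℝ) ≤ m₀ := Nat.cast_nonneg _
    nlinarith
  have hex : ∃ t : ℝ, 7 < t ∧ rsTheta t = Real.pi * m := by
    set T := max T₀ (8 * (Real.pi * m + c)) with hT
    have hTT : T₀ ≤ T := le_max_left _ _
    have h1 : Real.pi * m ≤ rsTheta T := by
      have h2 := hc T hTT
      have h3 := one_le_log_of_four_le (x := T) (by linarith)
      have h4 : 8 * (Real.pi * m + c) ≤ T := le_max_right _ _
      nlinarith
    obtain ⟨t, ht, he⟩ := intermediate_value_Icc hTT continuous_rsTheta.continuousOn
      ⟨(hM' T₀ (by linarith) le_rfl).trans hmM.le, h1⟩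
    exact ⟨t, by linarith [ht.1], he⟩
  obtain ⟨h7, he⟩ := Classical.epsilon_spec hex
  change 7 < gramPoint m at h7
  change rsTheta (gramPoint m) = _ at he
  refine ⟨le_of_not_gt fun hlt => ?_, he⟩
  have := hM' _ h7.le hlt.le
  linarith

/-- From index `m - 1` to `m + 1` the strictly increasing `θ` gains `2π`, with `ρ` at the middle
value. Another solution of `e^{iθ} = ε` would differ from `πm` by a nonzero multiple of `2π`, which
does not fit. -/
theorem gramPoint_cell {ε : ℝ} (hε : ε = 1 ∨ ε = -1) {m : ℤ} (hm : Complex.exp ((Real.pi * m : ℝ) * Complex.I) = ε)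
    {a b ρ : ℝ} (ha : 2 * Real.pi * 64 ^ 2 ≤ a) (hρ : 2 * Real.pi * 64 ^ 2 ≤ ρ) (hb : 2 * Real.pi * 64 ^ 2 ≤ b)
    (hθa : rsTheta a = Real.pi * (m - 1 : ℤ)) (hθρ : rsTheta ρ = Real.pi * m) (hθb : rsTheta b = Real.pi * (m + 1 : ℤ)) :
    a < b ∧ (∫ σ in (1 / 2 : ℝ)..2, gramKernel ε ((σ : ℂ) + (a : ℂ) * Complex.I)).im -
      (∫ σ in (1 / 2 : ℝ)..2, gramKernel ε ((σ : ℂ) + (b : ℂ) * Complex.I)).im +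
      (∫ t in a..b, gramKernel ε (((2 : ℝ) : ℂ) + (t : ℂ) * Complex.I)).re +
      ε / 2 * (∫ t in a..b, (hardyZ t * rsDeriv (1 / 2 + (t : ℂ) * Complex.I)).re) = Real.pi * (ε * (hardyZ ρ).re) := by
  have hpi := Real.pi_pos
  push_cast at hθa hθb
  have haρ : a < ρ := (rsTheta_strictMonoOn.lt_iff_lt ha hρ).mp (by rw [hθa, hθρ]; linarith)
  have hρb : ρ < b := (rsTheta_strictMonoOn.lt_iff_lt hρ hb).mp (by rw [hθb, hθρ]; linarith)
  refine ⟨haρ.trans hρb, gramKernel_cell hε ha haρ hρb (by rw [hθρ]; exact hm) fun t h1 h2 hne h => hne ?_⟩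
  have htT : 2 * Real.pi * 64 ^ 2 ≤ t := ha.trans h1
  rw [← hm, Complex.exp_eq_exp_iff_exists_int] at h
  obtain ⟨k, hk⟩ := h
  have hk' : rsTheta t = Real.pi * m + k * (2 * Real.pi) := by
    have := congrArg Complex.im hk
    simpa using this
  have m1 := rsTheta_strictMonoOn.monotoneOn ha htT h1
  have m2 := rsTheta_strictMonoOn.monotoneOn htT hb h2
  rw [hθa, hk'] at m1
  rw [hθb, hk'] at m2
  have k1 : -1 ≤ (2 * k : ℝ) := by
    by_contra! h; nlinarith
  have k2 : (2 * k : ℝ) ≤ 1 := by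
    by_contra! h; nlinarith
  have k3 : -1 ≤ 2 * k := by exact_mod_cast k1
  have k4 : 2 * k ≤ 1 := by exact_mod_cast k2
  have k0 : k = 0 := by omega
  rw [k0, Int.cast_zero, zero_mul, add_zero, ← hθρ] at hk'
  exact rsTheta_strictMonoOn.injOn htT hρ hk'

/-! ### Telescoping over the cells and conclusion. -/

/-- The primitive whose increment over a Gram cell is `π ε Z` at the interior Gram point. -/
noncomputable def gramPrimitive (ε T : ℝ) : ℝ :=
  -(∫ σ in (1 / 2 : ℝ)..2, gramKernel ε ((σ : ℂ) + (T : ℂ) * Complex.I)).im +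
    (∫ t in (2 * Real.pi * 64 ^ 2)..T, gramKernel ε (((2 : ℝ) : ℂ) + (t : ℂ) * Complex.I)).re +
    ε / 2 * (∫ t in (2 * Real.pi * 64 ^ 2)..T, (hardyZ t * rsDeriv (1 / 2 + (t : ℂ) * Complex.I)).re)

theorem intervalIntegrable_hardyZ_mul_rsDeriv {a b : ℝ} (ha : 0 < a) (hab : a ≤ b) :
    IntervalIntegrable (fun t : ℝ => hardyZ t * rsDeriv (1 / 2 + (t : ℂ) * Complex.I)) MeasureTheory.volume a b :=
  ContinuousOn.intervalIntegrable fun t ht => by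
    rw [Set.uIcc_of_le hab] at ht
    have h := continuousAt_rsDeriv_line (1 / 2) (t := t) (by linarith [ht.1])
    have e : (((1 / 2 : ℝ) : ℂ)) = 1 / 2 := by norm_num
    rw [e] at h
    exact ((continuousAt_hardyZ (by linarith [ht.1])).mul h).continuousWithinAt

theorem intervalIntegrable_gramKernel {ε : ℝ} (hε : ε = 1 ∨ ε = -1) {a b : ℝ} (ha : 2 * Real.pi * 64 ^ 2 ≤ a) (hab : a ≤ b) :
    IntervalIntegrable (fun t : ℝ => gramKernel ε (((2 : ℝ) : ℂ) + (t : ℂ) * Complex.I)) MeasureTheory.volume a b :=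
  ContinuousOn.intervalIntegrable fun t ht => by
    rw [Set.uIcc_of_le hab] at ht
    exact (continuousAt_gramKernel_line hε (ha.trans ht.1)).continuousWithinAt

theorem gramPrimitive_sub {ε : ℝ} (hε : ε = 1 ∨ ε = -1) {a b : ℝ} (ha : 2 * Real.pi * 64 ^ 2 ≤ a) (hab : a ≤ b) :
    gramPrimitive ε b - gramPrimitive ε a = (∫ σ in (1 / 2 : ℝ)..2, gramKernel ε ((σ : ℂ) + (a : ℂ) * Complex.I)).im -
      (∫ σ in (1 / 2 : ℝ)..2, gramKernel ε ((σ : ℂ) + (b : ℂ) * Complex.I)).im +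
      (∫ t in a..b, gramKernel ε (((2 : ℝ) : ℂ) + (t : ℂ) * Complex.I)).re +
      ε / 2 * (∫ t in a..b, (hardyZ t * rsDeriv (1 / 2 + (t : ℂ) * Complex.I)).re) := by
  have hpi := Real.pi_pos
  have h1 := intervalIntegral.integral_add_adjacent_intervals (intervalIntegrable_gramKernel hε le_rfl ha) (intervalIntegrable_gramKernel hε ha hab)
  have i1 := intervalIntegrable_hardyZ_mul_rsDeriv (by positivity) ha
  have i2 := intervalIntegrable_hardyZ_mul_rsDeriv (lt_of_lt_of_le (by positivity) ha) hab
  have h2 := intervalIntegral.integral_add_adjacent_intervals (show IntervalIntegrable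
    (fun t : ℝ => (hardyZ t * rsDeriv (1 / 2 + (t : ℂ) * Complex.I)).re) MeasureTheory.volume _ a from ⟨i1.1.re, i1.2.re⟩)
    (show IntervalIntegrable (fun t : ℝ => (hardyZ t * rsDeriv (1 / 2 + (t : ℂ) * Complex.I)).re) MeasureTheory.volume a b from ⟨i2.1.re, i2.2.re⟩)
  unfold gramPrimitive
  rw [← h1, ← h2, Complex.add_re]
  ring

theorem exists_abs_gramPrimitive_sub_le {ε : ℝ} (hε : ε = 1 ∨ ε = -1) :
    ∃ C, 0 ≤ C ∧ ∀ T, 2 * Real.pi * 64 ^ 2 ≤ T → Complex.exp ((rsTheta T : ℂ) * Complex.I) = -ε →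
      |gramPrimitive ε T - rsTheta T| ≤ C * (T ^ (1 / 4 : ℝ) * Real.log T) := by
  have hpi := Real.pi_gt_three
  obtain ⟨C₁, hC₁, h1⟩ := exists_abs_re_integral_gramKernel_sub_le hε le_rfl
  obtain ⟨C₂, hC₂, h2⟩ := exists_norm_integral_hardyZ_mul_rsDeriv_le le_rfl
  refine ⟨300006 + C₁ + C₂ + |rsTheta (2 * Real.pi * 64 ^ 2)|, by positivity, fun T hT hθ => ?_⟩
  have a1 := (Complex.abs_im_le_norm _).trans (norm_integral_gramKernel_horizontal_le hε hT hθ)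
  have a2 := h1 T hT
  have a3 := (Complex.abs_re_le_norm _).trans (h2 T hT)
  rw [intervalIntegral_re (intervalIntegrable_hardyZ_mul_rsDeriv (by positivity) hT)] at a3
  have hB : 1 ≤ T ^ (1 / 4 : ℝ) * Real.log T :=
    one_le_mul_of_one_le_of_one_le (Real.one_le_rpow (by nlinarith) (by norm_num)) (one_le_log_of_four_le (by nlinarith))
  set B := T ^ (1 / 4 : ℝ) * Real.log T with hBdef
  unfold gramPrimitive
  set x := (∫ σ in (1 / 2 : ℝ)..2, gramKernel ε ((σ : ℂ) + (T : ℂ) * Complex.I)).im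
  set y := (∫ t in (2 * Real.pi * 64 ^ 2)..T, gramKernel ε (((2 : ℝ) : ℂ) + (t : ℂ) * Complex.I)).re
  set z := ∫ t in (2 * Real.pi * 64 ^ 2)..T, (hardyZ t * rsDeriv (1 / 2 + (t : ℂ) * Complex.I)).re
  set q := rsTheta (2 * Real.pi * 64 ^ 2)
  have e : -x + y + ε / 2 * z - rsTheta T = -x + (y - (rsTheta T - q)) + ε / 2 * z - q := by ring
  have a4 : |ε / 2 * z| ≤ C₂ * B := by
    have : |ε / 2| = 1 / 2 := by rcases hε with rfl | rfl <;> norm_num [abs_div]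
    rw [abs_mul, this]
    linarith [abs_nonneg z]
  have a5 : |q| ≤ |q| * B := by nlinarith [abs_nonneg q]
  rw [e]
  refine (abs_sub _ _).trans ((add_le_add ((abs_add_le _ _).trans (add_le_add (abs_add_le _ _) le_rfl)) le_rfl).trans ?_)
  rw [abs_neg]
  linarith

/-- The lower bound for `θ` gives `T log T = O(N)`. Then `T^{1/4} log T = (T log T)^{1/4} (log
T)^{3/4}` has the required size, and the factor `log log N`, eventually at least `1`, is simply
inserted. -/
theorem exists_rpow_mul_log_le_of_rsTheta_le : ∃ K : ℝ, 0 ≤ K ∧ ∀ᶠ N : ℕ in atTop, ∀ T : ℝ, 2 * Real.pi * 64 ^ 2 ≤ T →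
    rsTheta T ≤ Real.pi * (2 * N + 2) → T ^ (1 / 4 : ℝ) * Real.log T ≤
      K * ((N : ℝ) ^ (1 / 4 : ℝ) * Real.log N ^ (3 / 4 : ℝ) * Real.log (Real.log N)) := by
  have hpi := Real.pi_gt_three
  obtain ⟨c, hc⟩ := exists_mul_log_le_rsTheta
  set C₁ : ℝ := 8 * (4 * Real.pi + |c|) with hC₁
  have hC1 : 1 ≤ C₁ := by rw [hC₁]; linarith [abs_nonneg c]
  set C₂ : ℝ := Real.log C₁ + 1 with hC₂
  have hlogC : 0 ≤ Real.log C₁ := Real.log_nonneg hC1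
  have hC2 : 0 ≤ C₂ := by linarith
  have hll : ∀ᶠ N : ℕ in atTop, 1 ≤ Real.log (Real.log (N : ℝ)) :=
    (Real.tendsto_log_atTop.comp (Real.tendsto_log_atTop.comp tendsto_natCast_atTop_atTop)).eventually_ge_atTop 1
  refine ⟨C₁ ^ (1 / 4 : ℝ) * C₂ ^ (3 / 4 : ℝ), by positivity, ?_⟩
  filter_upwards [hll, eventually_ge_atTop 4] with N hN hN4 T hT hθ
  have hN4' : (4 : ℝ) ≤ N := by exact_mod_cast hN4
  have hNl := one_le_log_of_four_le hN4'
  have hT4 : 4 ≤ T := by nlinarith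
  have hTl := one_le_log_of_four_le hT4
  have h1 : T * Real.log T ≤ C₁ * N := by
    have := hc T hT
    have h2 : |c| ≤ |c| * N := by nlinarith [abs_nonneg c]
    rw [hC₁]
    nlinarith [le_abs_self c]
  have h2 : Real.log T ≤ C₂ * Real.log N := by
    have h3 : Real.log T ≤ Real.log (C₁ * N) := Real.log_le_log (by linarith) (by nlinarith)
    rw [Real.log_mul (by linarith) (by linarith)] at h3
    rw [hC₂]
    nlinarith
  have e : T ^ (1 / 4 : ℝ) * Real.log T = (T * Real.log T) ^ (1 / 4 : ℝ) * Real.log T ^ (3 / 4 : ℝ) := by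
    rw [Real.mul_rpow (by linarith) (by linarith), mul_assoc, ← Real.rpow_add (by linarith)]
    norm_num
  rw [e]
  calc _ ≤ (C₁ * N) ^ (1 / 4 : ℝ) * (C₂ * Real.log N) ^ (3 / 4 : ℝ) := by gcongr
    _ = C₁ ^ (1 / 4 : ℝ) * C₂ ^ (3 / 4 : ℝ) * ((N : ℝ) ^ (1 / 4 : ℝ) * Real.log N ^ (3 / 4 : ℝ)) := by
      rw [Real.mul_rpow (by linarith) (by linarith), Real.mul_rpow hC2 (by linarith)]
      ring
    _ ≤ _ := by
      refine mul_le_mul_of_nonneg_left ?_ (by positivity)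
      exact le_mul_of_one_le_right (by positivity) hN

theorem sum_hardyZ_gramPoint_isBigO {ε : ℝ} (hε : ε = 1 ∨ ε = -1) {j : ℤ} (hj : j = 0 ∨ j = 1)
    (hεj : Complex.exp ((Real.pi * j : ℝ) * Complex.I) = ε) :
    (fun N : ℕ => (∑ n ∈ Finset.range (N + 1), hardyZ (gramPoint (2 * (n : ℤ) + j))) - 2 * ε * (N : ℂ)) =O[atTop]
      (fun N : ℕ => (N : ℝ) ^ (1 / 4 : ℝ) * Real.log N ^ (3 / 4 : ℝ) * Real.log (Real.log N)) := by
  have hpi := Real.pi_gt_three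
  obtain ⟨m₀, hm₀⟩ := exists_gramPoint_spec
  obtain ⟨C, hC, hF⟩ := exists_abs_gramPrimitive_sub_le hε
  obtain ⟨K, hK, hgrow⟩ := exists_rpow_mul_log_le_of_rsTheta_le
  have hεsq : ε * ε = 1 := by rcases hε with rfl | rfl <;> norm_num
  have hexp : ∀ n : ℤ, Complex.exp ((Real.pi * (2 * n + j : ℤ) : ℝ) * Complex.I) = ε := by
    intro n
    rw [← hεj, Complex.exp_eq_exp_iff_exists_int]
    exact ⟨n, by push_cast; ring⟩
  have hexp' : ∀ n : ℤ, Complex.exp ((Real.pi * (2 * n + j - 1 : ℤ) : ℝ) * Complex.I) = -ε := by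
    intro n
    rw [← hexp n, ← Complex.exp_sub_pi_mul_I]
    congr 1
    push_cast; ring
  set P : ℕ → ℝ := fun n => gramPoint (2 * (n : ℤ) + j - 1) with hP
  set n₀ := m₀ + 1 with hn₀
  have hspec : ∀ n, n₀ ≤ n → 2 * Real.pi * 64 ^ 2 ≤ P n ∧ rsTheta (P n) = Real.pi * (2 * (n : ℤ) + j - 1 : ℤ) := fun n hn =>
    hm₀ _ (by omega)
  have htel : ∀ N, n₀ ≤ N → ∑ n ∈ Finset.Ico n₀ N, Real.pi * (ε * (hardyZ (gramPoint (2 * (n : ℤ) + j))).re) =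
      gramPrimitive ε (P N) - gramPrimitive ε (P n₀) := by
    intro N hN
    induction N, hN using Nat.le_induction with
    | base => simp
    | succ n hn ih =>
      have s1 := hspec n hn
      have s2 := hspec (n + 1) (by omega)
      have s3 := hm₀ (2 * (n : ℤ) + j) (by omega)
      have e : (2 * ((n + 1 : ℕ) : ℤ) + j - 1 : ℤ) = 2 * (n : ℤ) + j + 1 := by push_cast; ring
      rw [e] at s2
      have hcell := gramPoint_cell hε (hexp n) s1.1 s3.1 s2.1 s1.2 s3.2 s2.2
      rw [Finset.sum_Ico_succ_top hn, ih, ← hcell.2, ← gramPrimitive_sub hε s1.1 hcell.1.le]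
      ring
  -- The finitely many terms below `n₀`, about which nothing is needed, enter only through a
  -- constant.
  set S₀ : ℂ := ∑ n ∈ Finset.range n₀, hardyZ (gramPoint (2 * (n : ℤ) + j)) with hS₀
  refine IsBigO.of_bound ((‖S₀‖ + |gramPrimitive ε (P n₀)| + 2 + C) * K) ?_
  filter_upwards [hgrow, eventually_ge_atTop n₀] with N hN hNn
  have sN := hspec (N + 1) (by omega)
  set T := P (N + 1) with hTdef
  have hjle : (j : ℝ) ≤ 1 := by rcases hj with rfl | rfl <;> norm_num
  have hj0 : (0 : ℝ) ≤ j := by rcases hj with rfl | rfl <;> norm_num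
  have hθT : rsTheta T = Real.pi * (2 * N + 1 + j) := by rw [sN.2]; push_cast; ring
  have hB := hN T sN.1 (by rw [hθT]; exact mul_le_mul_of_nonneg_left (by linarith) (by linarith))
  have hFT := hF T sN.1 (by rw [sN.2]; exact hexp' _)
  have hB1 : 1 ≤ T ^ (1 / 4 : ℝ) * Real.log T :=
    one_le_mul_of_one_le_of_one_le (Real.one_le_rpow (by nlinarith [sN.1]) (by norm_num)) (one_le_log_of_four_le (by nlinarith [sN.1]))
  set B := T ^ (1 / 4 : ℝ) * Real.log T with hBdef
  have hre : ∀ t, hardyZ t = ((hardyZ t).re : ℂ) := fun t => Complex.ext (by simp) (by simp [im_hardyZ])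
  have hsum : ∑ n ∈ Finset.Ico n₀ (N + 1), hardyZ (gramPoint (2 * (n : ℤ) + j)) =
      ((ε / Real.pi * (gramPrimitive ε T - gramPrimitive ε (P n₀)) : ℝ) : ℂ) := by
    rw [← htel (N + 1) (by omega), Finset.mul_sum, Complex.ofReal_sum]
    refine Finset.sum_congr rfl fun n _ => ?_
    rw [hre]
    congr 1
    rw [Complex.ofReal_re]
    field_simp
    linear_combination (-(hardyZ (gramPoint (2 * (n : ℤ) + j))).re) * hεsq
  -- At the last edge `θ(T) = π (2N + 1 + j)`, so `(ε/π) θ(T)` is `2εN` plus the bounded term `ε (1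
  -- + j)`.
  have htot : (∑ n ∈ Finset.range (N + 1), hardyZ (gramPoint (2 * (n : ℤ) + j))) - 2 * ε * (N : ℂ) =
      S₀ + ((ε / Real.pi * ((gramPrimitive ε T - rsTheta T) - gramPrimitive ε (P n₀)) + ε * (1 + j) : ℝ) : ℂ) := by
    rw [← Finset.sum_range_add_sum_Ico _ (by omega : n₀ ≤ N + 1), hsum, hθT, ← hS₀]
    have : (Real.pi : ℂ) ≠ 0 := by exact_mod_cast Real.pi_ne_zero
    push_cast
    field_simp
    ring
  rw [htot]
  have hεa : |ε| = 1 := by rcases hε with rfl | rfl <;> norm_num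
  have hεπ : |ε / Real.pi| ≤ 1 := by
    rw [abs_div, hεa, abs_of_pos Real.pi_pos, div_le_one Real.pi_pos]; linarith
  have hb : ‖((ε / Real.pi * ((gramPrimitive ε T - rsTheta T) - gramPrimitive ε (P n₀)) + ε * (1 + j) : ℝ) : ℂ)‖ ≤
      C * B + |gramPrimitive ε (P n₀)| + 2 := by
    rw [Complex.norm_real, Real.norm_eq_abs]
    refine (abs_add_le _ _).trans (add_le_add ?_ ?_)
    · rw [abs_mul]
      refine (mul_le_of_le_one_left (abs_nonneg _) hεπ).trans ((abs_sub _ _).trans ?_)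
      linarith
    · rw [abs_mul, hεa, one_mul, abs_of_nonneg] <;> linarith
  refine (norm_add_le _ _).trans ((add_le_add le_rfl hb).trans ?_)
  have hA : 0 ≤ ‖S₀‖ + |gramPrimitive ε (P n₀)| + 2 := by positivity
  calc ‖S₀‖ + (C * B + |gramPrimitive ε (P n₀)| + 2) ≤ (‖S₀‖ + |gramPrimitive ε (P n₀)| + 2 + C) * B := by nlinarith
    _ ≤ (‖S₀‖ + |gramPrimitive ε (P n₀)| + 2 + C) * (K * ((N : ℝ) ^ (1 / 4 : ℝ) * Real.log N ^ (3 / 4 : ℝ) * Real.log (Real.log N))) :=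
      mul_le_mul_of_nonneg_left hB (by positivity)
    _ ≤ _ := by
      rw [mul_assoc (‖S₀‖ + |gramPrimitive ε (P n₀)| + 2 + C)]
      exact mul_le_mul_of_nonneg_left (mul_le_mul_of_nonneg_left (le_abs_self _) hK) (by positivity)

theorem theorem1 :
    (fun N : ℕ => (∑ n ∈ Finset.range (N + 1), hardyZ (gramPoint (2 * (n : ℤ)))) - 2 * (N : ℂ))
        =O[atTop] (fun N : ℕ => (N : ℝ) ^ (1 / 4 : ℝ) * Real.log N ^ (3 / 4 : ℝ) *
          Real.log (Real.log N)) ∧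
      (fun N : ℕ =>
          (∑ n ∈ Finset.range (N + 1), hardyZ (gramPoint (2 * (n : ℤ) + 1))) + 2 * (N : ℂ))
        =O[atTop] (fun N : ℕ => (N : ℝ) ^ (1 / 4 : ℝ) * Real.log N ^ (3 / 4 : ℝ) *
          Real.log (Real.log N)) := by
  constructor
  · simpa using sum_hardyZ_gramPoint_isBigO (ε := 1) (Or.inl rfl) (j := 0) (Or.inl rfl) (by simp)
  · simpa using sum_hardyZ_gramPoint_isBigO (ε := -1) (Or.inr rfl) (j := 1) (Or.inr rfl) (by simp)
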